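/- Let $B_3=\langle g_1,g_2\mid g_1g_2g_1=g_2g_1g_2\rangle$ be the braid group on three strings, let $0\le n\le 5$, and let $X=\{x_1,\dots,x_n\}$ be a set of $n$ pairwise distinct nonzero complex numbers. Put $P_X(t)=\prod_{i=1}^n(t-x_i)$ and let $Q_X=\mathbb C[B_3]/\langle P_X(g_1),P_X(g_2)\rangle$ be the quotient of the group algebra by the two-sided ideal generated by $P_X(g_1)$ and $P_X(g_2)$. Write $e_k(Y)$ for the $k$-th elementary symmetric polynomial in a finite set $Y$ of numbers, $Y^{\setminus i}:=Y\setminus\{x_i\}$, and $\Delta_i(Y):=\prod_{x_j\in Y,\,j\ne i}(x_j-x_i)$. **(A) Criterion.** Put $$I^{(2)}_{ij}=x_i^2-x_ix_j+x_j^2,\quad I^{(3)}_{ijk}=x_i^2+x_jx_k,\quad I^{(4)}_{h,i}=x_i^2-h,\quad J^{(4)}_{h,ijkl}=x_ix_j+x_kx_l-h,$$ $$I^{(5)}_{f,i}=x_i^2+x_if+f^2,\quad J^{(5)}_{f,ij}=x_ix_j+f^2,\quad I^{(6)}_i=e_5(X)+x_i^5,\quad J^{(6)}_{ij}=e_5(X)-x_i^3x_j^2,\quad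 K^{(6)}_{i,jklm}=x_jx_k+x_lx_m .$$ Then $Q_X$ is semisimple if and only if the following quantities are nonzero for all pairwise distinct indices $i,j,k,l,m\in\{1,\dots,n\}$: - $n\le 1$: no condition; - $n=2$: $I^{(2)}_{12}$; - $n=3$: $I^{(2)}_{ij}$ and $I^{(3)}_{ijk}$; - $n=4$: $I^{(2)}_{ij}$, $I^{(3)}_{ijk}$, and $I^{(4)}_{h,i}$, $J^{(4)}_{h,ijkl}$ for every $h$ with $h^2=e_4(X)$; - $n=5$: $I^{(2)}_{ij}$, $I^{(3)}_{ijk}$; for every four-element subset $Y\subset X$ and every $h$ with $h^2=e_4(Y)$, all $I^{(4)}_{h,i}$ and $J^{(4)}_{h,ijkl}$ with $\{x_i,x_j,x_k,x_l\}=Y$; $I^{(5)}_{f,i}$ and $J^{(5)}_{f,ij}$ for every $f$ with $f^5=e_5(X)$; and $I^{(6)}_i$, $J^{(6)}_{ij}$, $K^{(6)}_{i,jklm}$. **(B) Irreducible representations.** If $Q_X$ is semisimple, then the following representations of $Q_X$ exist, are irreducible and pairwise inequivalent, and every irreducible representation of $Q_X$ over $\mathbb C$ is equivalent to one of them: $\rho^{(d)}_Y$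 for $Y\subset X$ with $|Y|=d\in\{1,2,3\}$; $\rho^{(4)}_{h,Y}$ for $Y\subset X$ with $|Y|=4$ and $h^2=e_4(Y)$; and, if $n=5$, $\rho^{(5)}_{f,X}$ for $f^5=e_5(X)$ and $\rho^{(6)}_{s,X}$ for $1\le s\le5$. Here $Y$ is listed in the order of the indices, and in the formulas its elements are renamed $x_1,\dots,x_d$. In dimensions $d\le5$ the matrix of $g_1$ is $\operatorname{diag}(x_1,\dots,x_d)$, and the matrix of $g_2$ is as follows, with $\Delta_i=\Delta_i(Y)$. - $d=1$: $g_2\mapsto x_1$. - $d=2$: $\displaystyle g_2\mapsto\frac1{x_1-x_2}\begin{pmatrix}-x_2^2&-x_1x_2\\x_1^2-x_1x_2+x_2^2&x_1^2\end{pmatrix}$. - $d=3$: the $(i,i)$ entry is $x_jx_k(x_j+x_k)/\Delta_i$ and the $(i,j)$ entry, $i\ne j$, is $x_k(x_i^2+x_jx_k)/\Delta_i$, where $\{i,j,k\}=\{1,2,3\}$. - $d=4$: with $\alpha_i=e_3(Y^{\setminus i})e_1(Y^{\setminus i})-h\,e_2(Y^{\setminus i})$, $\beta_i=e_4(Y)/x_i^2-h$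 and $\gamma_a=x_1x_a+x_bx_c-h$ for $\{a,b,c\}=\{2,3,4\}$: the $(i,i)$ entry is $\alpha_i/\Delta_i$, the $(1,a)$ entry is $\beta_1\gamma_b\gamma_c/\Delta_1$, the $(a,1)$ entry is $\beta_a/\Delta_a$, and the $(a,b)$ entry is $\beta_a\gamma_a/\Delta_a$ for distinct $a,b\in\{2,3,4\}$. - $d=5$: the $(i,i)$ entry is $\bigl(e_4(X^{\setminus i})e_1(X^{\setminus i})+f x_i e_3(X^{\setminus i})+f\prod_{k\ne i}(f+x_k)\bigr)/\Delta_i$ and, for $i\neq j$, the $(i,j)$ entry is $(x_i^2+fx_i+f^2)\prod_{k\ne i,j}(f^2+x_ix_k)/(f x_ix_j\Delta_i)$. - $d=6$: $\rho^{(6)}_{s,X}$ is obtained from $\rho^{(6)}_{5,X}$ by exchanging $x_s$ and $x_5$ in both matrices. In $\rho^{(6)}_{5,X}$, $g_1\mapsto\operatorname{diag}(x_1,x_2,x_3,x_4,x_5,x_5)$ and $g_2\mapsto(g_{ij})$. Put $q_a=x_1x_a+x_bx_c$ for $\{a,b,c\}=\{2,3,4\}$, $p_i=e_5(X)-x_i^3x_5^2$,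 $(\sigma_{ij}\circ F)(\dots x_i\dots x_j\dots)=F(\dots x_j\dots x_i\dots)$, $\Delta_i=\Delta_i(X)$, and let $a,b,c$ be pairwise distinct in $\{2,3,4\}$. Then $$g_{ii}=\frac{e_4(X^{\setminus i})e_1(X^{\setminus i})-x_ix_5e_3(X^{\setminus i})}{\Delta_i}\ (i\le4),\quad g_{1a}=\frac{p_aq_bq_c}{x_1^2\Delta_a},\quad g_{a1}=\frac{p_1}{x_a^2\Delta_1},\quad g_{ab}=\frac{q_ap_b}{x_a^2\Delta_b},$$ $$\begin{pmatrix}g_{51}&g_{52}\\g_{61}&g_{62}\end{pmatrix}=\begin{pmatrix}1/\Delta_1&0\\0&1/\Delta_2\end{pmatrix},\quad \begin{pmatrix}g_{53}&g_{54}\\g_{63}&g_{64}\end{pmatrix}=\begin{pmatrix}q_4\,r&q_3\,(\sigma_{34}\circ r)\\ \sigma_{12}\circ r&\sigma_{12}\sigma_{34}\circ r\end{pmatrix},\quad \begin{pmatrix}g_{55}&g_{56}\\g_{65}&g_{66}\end{pmatrix}=\begin{pmatrix}u&q_3q_4\,v\\ \sigma_{12}\circ v&\sigma_{12}\circ u\end{pmatrix},$$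 $$\begin{pmatrix}g_{35}&g_{36}\\g_{45}&g_{46}\end{pmatrix}=\frac1{x_5\Delta_5}\begin{pmatrix}w/x_3^2&q_3(\sigma_{12}\circ w)/x_3^2\\ (\sigma_{34}\circ w)/x_4^2&q_4(\sigma_{12}\sigma_{34}\circ w)/x_4^2\end{pmatrix},$$ $$\begin{pmatrix}g_{15}&g_{16}\\g_{25}&g_{26}\end{pmatrix}=\frac1{\Delta_5}\begin{pmatrix}z/x_1&q_3q_4(\sigma_{12}\circ(\sigma_{23}\circ w))/(x_1^2x_5)\\ (\sigma_{23}\circ w)/(x_2^2x_5)&(\sigma_{12}\circ z)/x_2\end{pmatrix},$$ where $$r=\frac{x_3}{x_1(x_2-x_1)\Delta_3(X^{\setminus2})},\quad v=\frac{p_2}{x_1x_5(x_2-x_1)\Delta_5(X^{\setminus2})},$$ $$u=\frac{x_1x_2(x_3+x_4)(x_3x_4-x_1x_5)+x_3x_4(x_2-x_1)(x_1^2+x_2x_5)}{(x_2-x_1)\Delta_5(X^{\setminus2})},$$ $$w=p_1\bigl(x_1x_2x_3x_4\{x_1x_3+x_5(x_2+x_4)\}-x_5^3\{x_1x_3(x_2+x_4)+x_5x_2x_4\}\bigr),$$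 and, with $e_1,e_2,e_3$ the elementary symmetric polynomials in $x_2,x_3,x_4$, $$z=(e_1e_3-x_1^2e_2)(x_1e_1e_3-e_2x_5^3)x_1x_5+e_3(x_1-x_5)\bigl(x_1^2(e_1-x_1)\{e_3(x_1-x_5)-e_1x_5^3\}+(x_1e_2-e_3)\{x_1e_2+(x_1-x_5)x_5^2\}x_5\bigr).$$ -/

import Mathlib

namespace BraidQuotient

/-! ### The braid group on three strings and the quotients of its group algebra -/

/-- The defining relation `g₁ g₂ g₁ = g₂ g₁ g₂` of the three string braid group;
`g₁` and `g₂` are the generators with index `0` and `1`. -/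
def braidRels : Set (FreeGroup (Fin 2)) :=
  {FreeGroup.of 0 * FreeGroup.of 1 * FreeGroup.of 0 *
    (FreeGroup.of 1 * FreeGroup.of 0 * FreeGroup.of 1)⁻¹}

/-- The three string braid group `B₃`. -/
abbrev B3 : Type := PresentedGroup braidRels

/-- The elementary braids `g₁`, `g₂` as elements of the group algebra `ℂ[B₃]`. -/
noncomputable def elemBraid (s : Fin 2) : MonoidAlgebra ℂ B3 :=
  MonoidAlgebra.of ℂ B3 (PresentedGroup.of s)

/-- The polynomial `P_X(t) = ∏ᵢ (t - xᵢ)`. -/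
noncomputable def polyP {n : ℕ} (x : Fin n → ℂ) : Polynomial ℂ :=
  ∏ i, (Polynomial.X - Polynomial.C (x i))

/-- The relations `P_X(g₁) = 0` and `P_X(g₂) = 0`. -/
def quotRel {n : ℕ} (x : Fin n → ℂ) (a b : MonoidAlgebra ℂ B3) : Prop :=
  ∃ s : Fin 2, a = Polynomial.aeval (elemBraid s) (polyP x) ∧ b = 0

/-- The algebra `Q_X = ℂ[B₃] / ⟨P_X(g)⟩`: the quotient of the group algebra by the two-sided
ideal generated by `P_X(g₁)` and `P_X(g₂)`. -/
abbrev Q {n : ℕ} (x : Fin n → ℂ) : Type := RingQuot (quotRel x)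

/-- The images of the elementary braids in `Q_X`. -/
noncomputable def gen {n : ℕ} (x : Fin n → ℂ) (s : Fin 2) : Q x :=
  RingQuot.mkAlgHom ℂ (quotRel x) (elemBraid s)

/-- Irreducibility of a representation of an algebra on a complex vector space. -/
def IsIrreducible {A V : Type*} [Ring A] [Algebra ℂ A] [AddCommGroup V] [Module ℂ V]
    (ρ : A →ₐ[ℂ] Module.End ℂ V) : Prop :=
  Nontrivial V ∧
    ∀ W : Submodule ℂ V, (∀ a : A, ∀ v ∈ W, ρ a v ∈ W) → W = ⊥ ∨ W = ⊤

/-! ### The polynomial conditions -/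

section conditions

variable {n : ℕ} (x : Fin n → ℂ)

def I2 (i j : Fin n) : ℂ := x i ^ 2 - x i * x j + x j ^ 2

def I3 (i j k : Fin n) : ℂ := x i ^ 2 + x j * x k

def I4 (h : ℂ) (i : Fin n) : ℂ := x i ^ 2 - h

def J4 (h : ℂ) (i j k l : Fin n) : ℂ := x i * x j + x k * x l - h

def I5 (f : ℂ) (i : Fin n) : ℂ := x i ^ 2 + x i * f + f ^ 2

def J5 (f : ℂ) (i j : Fin n) : ℂ := x i * x j + f ^ 2

def I6 (i : Fin n) : ℂ := (∏ m, x m) + x i ^ 5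

def J6 (i j : Fin n) : ℂ := (∏ m, x m) - x i ^ 3 * x j ^ 2

def K6 (j k l m : Fin n) : ℂ := x j * x k + x l * x m

/-- The semisimplicity conditions for `|X| = n ≤ 5`. In the third line `h` is any square root of
`e₄` of the four variables with the indices `i, j, k, l`, that is of `e₄(X)` if `n = 4` and of
`e₄(X ∖ {x_m})` for the remaining index `m` if `n = 5`. A line that asks for more distinct indices
than there are is void. -/
def SemisimplicityConditions : Prop :=
  (∀ i j : Fin n, [i, j].Nodup → I2 x i j ≠ 0) ∧
  (∀ i j k : Fin n, [i, j, k].Nodup → I3 x i j k ≠ 0) ∧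
  (∀ i j k l : Fin n, [i, j, k, l].Nodup → ∀ h : ℂ, h ^ 2 = x i * x j * x k * x l →
    I4 x h i ≠ 0 ∧ J4 x h i j k l ≠ 0) ∧
  (n = 5 →
    (∀ f : ℂ, f ^ 5 = ∏ m, x m →
      (∀ i : Fin n, I5 x f i ≠ 0) ∧ (∀ i j : Fin n, [i, j].Nodup → J5 x f i j ≠ 0)) ∧
    (∀ i : Fin n, I6 x i ≠ 0) ∧
    (∀ i j : Fin n, [i, j].Nodup → J6 x i j ≠ 0) ∧
    (∀ j k l m : Fin n, [j, k, l, m].Nodup → K6 x j k l m ≠ 0))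

end conditions

/-! ### The matrices of the representations

In each dimension `d` the matrix of `g₁` is diagonal, and the matrix of `g₂` is given below.
The variables `x₁, x₂, …` are `x 0, x 1, …`. -/

/-- The `k`-th elementary symmetric polynomial in the variables with index in `S`. -/
noncomputable def esym {d : ℕ} (x : Fin d → ℂ) (S : Finset (Fin d)) (k : ℕ) : ℂ :=
  (S.val.map x).esymm k

/-- `Δᵢ`, the product of `xⱼ - xᵢ` over the indices `j ≠ i` in `S`. -/
noncomputable def Delta {d : ℕ} (x : Fin d → ℂ) (S : Finset (Fin d)) (i : Fin d) : ℂ :=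
  ∏ j ∈ S.erase i, (x j - x i)

noncomputable def mat2 (x : Fin 2 → ℂ) : Matrix (Fin 2) (Fin 2) ℂ :=
  (1 / (x 0 - x 1)) •
    !![-x 1 ^ 2, -(x 0 * x 1);
       x 0 ^ 2 - x 0 * x 1 + x 1 ^ 2, x 0 ^ 2]

noncomputable def mat3 (x : Fin 3 → ℂ) : Matrix (Fin 3) (Fin 3) ℂ :=
  let D := Delta x Finset.univ
  !![x 1 * x 2 * (x 1 + x 2) / D 0, x 2 * (x 0 ^ 2 + x 1 * x 2) / D 0,
      x 1 * (x 0 ^ 2 + x 1 * x 2) / D 0;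
     x 2 * (x 1 ^ 2 + x 0 * x 2) / D 1, x 0 * x 2 * (x 0 + x 2) / D 1,
      x 0 * (x 1 ^ 2 + x 0 * x 2) / D 1;
     x 1 * (x 2 ^ 2 + x 0 * x 1) / D 2, x 0 * (x 2 ^ 2 + x 0 * x 1) / D 2,
      x 0 * x 1 * (x 0 + x 1) / D 2]

noncomputable def mat4 (h : ℂ) (x : Fin 4 → ℂ) : Matrix (Fin 4) (Fin 4) ℂ :=
  let D := Delta x Finset.univ
  let α : Fin 4 → ℂ := fun i =>
    esym x (Finset.univ.erase i) 3 * esym x (Finset.univ.erase i) 1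
      - h * esym x (Finset.univ.erase i) 2
  let β : Fin 4 → ℂ := fun i => (∏ m, x m) / x i ^ 2 - h
  let γ₂ := x 0 * x 1 + x 2 * x 3 - h
  let γ₃ := x 0 * x 2 + x 1 * x 3 - h
  let γ₄ := x 0 * x 3 + x 1 * x 2 - h
  !![α 0 / D 0, β 0 * γ₃ * γ₄ / D 0, β 0 * γ₂ * γ₄ / D 0, β 0 * γ₂ * γ₃ / D 0;
     β 1 / D 1, α 1 / D 1, β 1 * γ₂ / D 1, β 1 * γ₂ / D 1;
     β 2 / D 2, β 2 * γ₃ / D 2, α 2 / D 2, β 2 * γ₃ / D 2;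
     β 3 / D 3, β 3 * γ₄ / D 3, β 3 * γ₄ / D 3, α 3 / D 3]

noncomputable def mat5 (f : ℂ) (x : Fin 5 → ℂ) : Matrix (Fin 5) (Fin 5) ℂ :=
  Matrix.of fun i j =>
    if i = j then
      (esym x (Finset.univ.erase i) 4 * esym x (Finset.univ.erase i) 1
        + f * x i * esym x (Finset.univ.erase i) 3
        + f * ∏ k ∈ Finset.univ.erase i, (f + x k)) / Delta x Finset.univ i
    else
      (x i ^ 2 + f * x i + f ^ 2) * (∏ k ∈ (Finset.univ.erase i).erase j, (f ^ 2 + x i * x k))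
        / (f * x i * x j * Delta x Finset.univ i)

/-- `(σ_{ij} ∘ F)(… xᵢ … xⱼ …) = F(… xⱼ … xᵢ …)`. -/
def sigma (i j : Fin 5) (F : (Fin 5 → ℂ) → ℂ) : (Fin 5 → ℂ) → ℂ :=
  fun x => F (x ∘ Equiv.swap i j)

def p6 (i : Fin 5) (x : Fin 5 → ℂ) : ℂ := (∏ m, x m) - x i ^ 3 * x 4 ^ 2

noncomputable def r6 (x : Fin 5 → ℂ) : ℂ :=
  x 2 / (x 0 * (x 1 - x 0) * Delta x (Finset.univ.erase 1) 2)

noncomputable def v6 (x : Fin 5 → ℂ) : ℂ :=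
  p6 1 x / (x 0 * x 4 * (x 1 - x 0) * Delta x (Finset.univ.erase 1) 4)

noncomputable def u6 (x : Fin 5 → ℂ) : ℂ :=
  (x 0 * x 1 * (x 2 + x 3) * (x 2 * x 3 - x 0 * x 4)
      + x 2 * x 3 * (x 1 - x 0) * (x 0 ^ 2 + x 1 * x 4))
    / ((x 1 - x 0) * Delta x (Finset.univ.erase 1) 4)

def w6 (x : Fin 5 → ℂ) : ℂ :=
  p6 0 x * (x 0 * x 1 * x 2 * x 3 * (x 0 * x 2 + x 4 * (x 1 + x 3))
    - x 4 ^ 3 * (x 0 * x 2 * (x 1 + x 3) + x 4 * x 1 * x 3))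

/-- Here `e₁, e₂, e₃` are the elementary symmetric polynomials in `x₂, x₃, x₄`. -/
noncomputable def z6 (x : Fin 5 → ℂ) : ℂ :=
  let e := esym x {1, 2, 3}
  (e 1 * e 3 - x 0 ^ 2 * e 2) * (x 0 * e 1 * e 3 - e 2 * x 4 ^ 3) * x 0 * x 4
    + e 3 * (x 0 - x 4) *
      (x 0 ^ 2 * (e 1 - x 0) * (e 3 * (x 0 - x 4) - e 1 * x 4 ^ 3)
        + (x 0 * e 2 - e 3) * (x 0 * e 2 + (x 0 - x 4) * x 4 ^ 2) * x 4)

/-- The matrix of `g₂` in the six-dimensional representation in which the eigenvalue `x₅`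
is the double one. -/
noncomputable def mat6 (x : Fin 5 → ℂ) : Matrix (Fin 6) (Fin 6) ℂ :=
  let D := Delta x Finset.univ
  let p : Fin 5 → ℂ := fun i => p6 i x
  let q₂ := x 0 * x 1 + x 2 * x 3
  let q₃ := x 0 * x 2 + x 1 * x 3
  let q₄ := x 0 * x 3 + x 1 * x 2
  let G : Fin 5 → ℂ := fun i =>
    (esym x (Finset.univ.erase i) 4 * esym x (Finset.univ.erase i) 1
      - x i * x 4 * esym x (Finset.univ.erase i) 3) / D i
  !![G 0, p 1 * q₃ * q₄ / (x 0 ^ 2 * D 1), p 2 * q₂ * q₄ / (x 0 ^ 2 * D 2),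
        p 3 * q₂ * q₃ / (x 0 ^ 2 * D 3),
        z6 x / (x 0 * D 4), q₃ * q₄ * sigma 0 1 (sigma 1 2 w6) x / (x 0 ^ 2 * x 4 * D 4);
     p 0 / (x 1 ^ 2 * D 0), G 1, q₂ * p 2 / (x 1 ^ 2 * D 2), q₂ * p 3 / (x 1 ^ 2 * D 3),
        sigma 1 2 w6 x / (x 1 ^ 2 * x 4 * D 4), sigma 0 1 z6 x / (x 1 * D 4);
     p 0 / (x 2 ^ 2 * D 0), q₃ * p 1 / (x 2 ^ 2 * D 1), G 2, q₃ * p 3 / (x 2 ^ 2 * D 3),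
        w6 x / (x 2 ^ 2 * x 4 * D 4), q₃ * sigma 0 1 w6 x / (x 2 ^ 2 * x 4 * D 4);
     p 0 / (x 3 ^ 2 * D 0), q₄ * p 1 / (x 3 ^ 2 * D 1), q₄ * p 2 / (x 3 ^ 2 * D 2), G 3,
        sigma 2 3 w6 x / (x 3 ^ 2 * x 4 * D 4),
        q₄ * sigma 0 1 (sigma 2 3 w6) x / (x 3 ^ 2 * x 4 * D 4);
     1 / D 0, 0, q₄ * r6 x, q₃ * sigma 2 3 r6 x, u6 x, q₃ * q₄ * v6 x;
     0, 1 / D 1, sigma 0 1 r6 x, sigma 0 1 (sigma 2 3 r6) x, sigma 0 1 v6 x, sigma 0 1 u6 x]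

/-! ### The list of representations -/

/-- The labels of the representations of `Q_X`. A representation attached to a subset of `X`
(given by a set `Y` of indices) is also a representation of `Q_X`. In dimension 4 it also depends
on a square root `h` of `e₄`, in dimension 5 on a fifth root `f` of `e₅`, and in dimension 6 on
the choice `s` of the double eigenvalue. -/
inductive Label {n : ℕ} (x : Fin n → ℂ) : Type
  | rho1 (Y : Finset (Fin n)) (hY : Y.card = 1)
  | rho2 (Y : Finset (Fin n)) (hY : Y.card = 2)
  | rho3 (Y : Finset (Fin n)) (hY : Y.card = 3)
  | rho4 (Y : Finset (Fin n)) (hY : Y.card = 4) (h : ℂ) (hh : h ^ 2 = ∏ i ∈ Y, x i)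
  | rho5 (Y : Finset (Fin n)) (hY : Y.card = 5) (f : ℂ) (hf : f ^ 5 = ∏ i ∈ Y, x i)
  | rho6 (Y : Finset (Fin n)) (hY : Y.card = 5) (s : Fin 5)

/-- The variables with index in `Y`, in their given order. -/
noncomputable def sub {n d : ℕ} (x : Fin n → ℂ) (Y : Finset (Fin n)) (hY : Y.card = d) :
    Fin d → ℂ :=
  fun i => x (Y.orderEmbOfFin hY i)

namespace Label

variable {n : ℕ} {x : Fin n → ℂ}

/-- The dimension of the representation. -/
def dim : Label x → ℕ
  | rho1 _ _ => 1
  | rho2 _ _ => 2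
  | rho3 _ _ => 3
  | rho4 _ _ _ _ => 4
  | rho5 _ _ _ _ => 5
  | rho6 _ _ _ => 6

/-- The matrix of `g₁`. In the representation `rho6 Y hY s` the roles of `x₅` and of the
variable number `s` are exchanged. -/
noncomputable def mat_g1 : (L : Label x) → Matrix (Fin L.dim) (Fin L.dim) ℂ
  | rho1 Y hY => Matrix.diagonal (sub x Y hY)
  | rho2 Y hY => Matrix.diagonal (sub x Y hY)
  | rho3 Y hY => Matrix.diagonal (sub x Y hY)
  | rho4 Y hY _ _ => Matrix.diagonal (sub x Y hY)
  | rho5 Y hY _ _ => Matrix.diagonal (sub x Y hY)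
  | rho6 Y hY s =>
      let y := sub x Y hY ∘ Equiv.swap s 4
      Matrix.diagonal ![y 0, y 1, y 2, y 3, y 4, y 4]

/-- The matrix of `g₂`. -/
noncomputable def mat_g2 : (L : Label x) → Matrix (Fin L.dim) (Fin L.dim) ℂ
  | rho1 Y hY => Matrix.diagonal (sub x Y hY)
  | rho2 Y hY => mat2 (sub x Y hY)
  | rho3 Y hY => mat3 (sub x Y hY)
  | rho4 Y hY h _ => mat4 h (sub x Y hY)
  | rho5 Y hY f _ => mat5 f (sub x Y hY)
  | rho6 Y hY s => mat6 (sub x Y hY ∘ Equiv.swap s 4)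

end Label

/-- In a suitable basis of `V` the elements `g₁` and `g₂` act by the matrices listed under the
label `L`. As `g₁`, `g₂` generate `Q_X`, this says that `ρ` is equivalent to that
representation. -/
def Affords {n : ℕ} {x : Fin n → ℂ} {V : Type*} [AddCommGroup V] [Module ℂ V]
    (ρ : Q x →ₐ[ℂ] Module.End ℂ V) (L : Label x) : Prop :=
  ∃ e : V ≃ₗ[ℂ] (Fin L.dim → ℂ), ∀ v : V,
    e (ρ (gen x 0) v) = L.mat_g1.mulVec (e v) ∧ e (ρ (gen x 1) v) = L.mat_g2.mulVec (e v)

end BraidQuotient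

/-!
The element `(g₁ g₂)³ = (g₁ g₂ g₁)²` of `B₃` is central, so on a finite-dimensional simple
`Q_X`-module it acts by a scalar `τ⁶ ≠ 0`. Such a module is then the same as a vector space with
endomorphisms `a = g₁`, `b = g₁ g₂` and `c = b a`, all diagonalizable with prescribed eigenvalues:
the `xᵢ`, the three roots of `t³ = τ⁶`, and the two roots of `t² = τ⁶`. Its type consists of the
multiplicities `m`, `p`, `q` of these eigenvalues. For two such modules `U`, `W` with the same `τ`
the Euler form
`⟨U, W⟩ = ∑ mᵢ mᵢ' + ∑ pⱼ pⱼ' + ∑ qₖ qₖ' - d d'`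
equals `dim Hom(U, W) + dim Hom(W, U) - dim Ext¹(U, W)`; this rigidity statement is obtained from
the trace pairing and is used as three facts: a positive form gives a nonzero homomorphism
(`moduleForm_le`), a nonnegative form and no homomorphisms give splitting
(`exists_section_of_le`), and a negative form gives a non-split extension
(`exists_nonsplit_extension`).

Since `1/5 + 1/3 + 1/2 > 1` and `n ≤ 5`, the quadratic form `⟨U, U⟩` is positive on types, and it
is even. So a simple module has `⟨U, U⟩ = 2`. This forces `d ≤ 6`, and it forces `p` and `q` to be
as equal as possible; with the relation between the determinants of `a`, `b`, `c`, they are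
functions of `τ` and `det a = ∏ xᵢ ^ mᵢ` (`isSimpleType`, `IsBalanced.eq_of_det_eq`).

*Criterion.* Let `U`, `W` be simple, not isomorphic, with the same `τ`. Positivity of
`⟨U ⊕ W, U ⊕ W⟩ = 4 + 2 ⟨U, W⟩` gives `⟨U, W⟩ ≥ -1`. If the value is `-1`, then the sum of the two
types again has norm `2`, so `d + d' ≤ 6`, and in each of the nine possible pairs of dimensions the
equality is the vanishing of one of the nine kinds of quantities of the criterion
(`not_conditions_of_pairing`). Thus under the conditions extensions of simple modules split; since
`Q_X` is finite-dimensional (`finite_of_braid`), it is semisimple. Conversely, the vanishing of a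
quantity produces two of the listed representations with form `-1`, hence a non-split extension,
which is impossible over a semisimple ring (`conditions_of_isSemisimpleRing`).

*Representations.* The matrices satisfy the braid relation, only scalars commute with both of
them, and `(g₁ g₂)³` is the scalar `Label.scalar`. These are identities of rational functions; for
`d ≥ 4` they are verified by clearing denominators and evaluating the resulting polynomial at one
integral point whose coordinates grow fast compared with the coefficients
(`PExpr.eval_eq_zero_of_check`). A semisimple module with scalar endomorphisms is simple. The type
of any simple module is that of a listed representation with the same scalar
(`IsSimpleType.exists_label`); the form of the two is then `2`, so they are isomorphic. Finally the
eigenvalues of `g₁` and the scalar of `(g₁ g₂)³` determine the label.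
-/

namespace BraidQuotient

open Polynomial

/-! ### The quotient algebra: universal property and generators -/

theorem polyP_eval_zero_ne {n : ℕ} {x : Fin n → ℂ} (hx0 : ∀ i, x i ≠ 0) :
    (polyP x).coeff 0 ≠ 0 := by
  rw [coeff_zero_eq_eval_zero, polyP, eval_prod]
  exact Finset.prod_ne_zero_iff.2 fun i _ => by simpa using hx0 i

theorem commute_aeval_self {E : Type*} [Ring E] [Algebra ℂ E] (A : E) (p : ℂ[X]) :
    aeval A p * A = A * aeval A p := by
  have h := congrArg (aeval A) (mul_comm p X)
  rwa [map_mul, map_mul, aeval_X] at h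

/-- An element annihilated by a polynomial with nonzero constant coefficient has an inverse that
is a polynomial in it. -/
theorem exists_aeval_inverse {E : Type*} [Ring E] [Algebra ℂ E] {p : ℂ[X]} (hp : p.coeff 0 ≠ 0)
    {A : E} (hA : aeval A p = 0) :
    ∃ q : ℂ[X], A * aeval A q = 1 ∧ aeval A q * A = 1 := by
  refine ⟨-C (p.coeff 0)⁻¹ * p.divX, ?_⟩
  have h : A * aeval A p.divX = - algebraMap ℂ E (p.coeff 0) := by
    have h1 := congrArg (aeval A) (X_mul_divX_add p)
    rw [hA, map_add, map_mul, aeval_X, aeval_C] at h1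
    exact eq_neg_of_add_eq_zero_left h1
  have h2 : aeval A p.divX * A = A * aeval A p.divX :=
    commute_aeval_self A _
  have h3 : A * aeval A (-C (p.coeff 0)⁻¹ * p.divX) = 1 := by
    rw [map_mul, map_neg, aeval_C, neg_mul, mul_neg, ← mul_assoc, ← Algebra.commutes, mul_assoc, h,
      mul_neg, neg_neg, ← map_mul, inv_mul_cancel₀ hp, map_one]
  exact ⟨h3, by rw [← h3]; exact commute_aeval_self A _⟩

/-- A polynomial relation with nonzero constant coefficient makes an element a unit. -/
theorem exists_unit_of_aeval {E : Type*} [Ring E] [Algebra ℂ E] {p : ℂ[X]} (hp : p.coeff 0 ≠ 0)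
    {A : E} (hA : aeval A p = 0) : ∃ u : Eˣ, (u : E) = A := by
  obtain ⟨q, h1, h2⟩ := exists_aeval_inverse hp hA
  exact ⟨⟨A, aeval A q, h1, h2⟩, rfl⟩

variable {n : ℕ} {x : Fin n → ℂ}

theorem gen_braid : gen x 0 * gen x 1 * gen x 0 = gen x 1 * gen x 0 * gen x 1 := by
  have h : (PresentedGroup.of 0 * PresentedGroup.of 1 * PresentedGroup.of 0 : B3) =
      PresentedGroup.of 1 * PresentedGroup.of 0 * PresentedGroup.of 1 := by
    have h1 := PresentedGroup.one_of_mem (rels := braidRels)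
      (x := FreeGroup.of 0 * FreeGroup.of 1 * FreeGroup.of 0 *
        (FreeGroup.of 1 * FreeGroup.of 0 * FreeGroup.of 1)⁻¹) rfl
    rw [map_mul, map_inv] at h1
    exact mul_inv_eq_one.1 h1
  simp only [gen, elemBraid, ← map_mul]
  rw [h]

theorem gen_poly (s : Fin 2) : aeval (gen x s) (polyP x) = 0 := by
  rw [gen, aeval_algHom_apply, ← map_zero (RingQuot.mkAlgHom ℂ (quotRel x))]
  exact RingQuot.mkAlgHom_rel ℂ ⟨s, rfl, rfl⟩

/-- The universal property of `Q_X`. -/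
theorem exists_lift (hx0 : ∀ i, x i ≠ 0) {E : Type*} [Ring E] [Algebra ℂ E] {A B : E}
    (h : A * B * A = B * A * B) (hA : aeval A (polyP x) = 0) (hB : aeval B (polyP x) = 0) :
    ∃ φ : Q x →ₐ[ℂ] E, φ (gen x 0) = A ∧ φ (gen x 1) = B := by
  obtain ⟨u, rfl⟩ := exists_unit_of_aeval (polyP_eval_zero_ne hx0) hA
  obtain ⟨v, rfl⟩ := exists_unit_of_aeval (polyP_eval_zero_ne hx0) hB
  have huv : u * v * u = v * u * v := Units.ext (by simpa using h)
  let f : Fin 2 → Eˣ := ![u, v]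
  have hf : ∀ r ∈ braidRels, FreeGroup.lift f r = 1 := by
    rintro r rfl
    simp [f, huv]
  let F : B3 →* E := (Units.coeHom E).comp (PresentedGroup.toGroup hf)
  let G : MonoidAlgebra ℂ B3 →ₐ[ℂ] E := MonoidAlgebra.lift ℂ E B3 F
  have hG : ∀ s, G (elemBraid s) = f s := by
    intro s
    simp only [G, elemBraid, MonoidAlgebra.lift_of, F, MonoidHom.comp_apply,
      PresentedGroup.toGroup.of, Units.coeHom_apply]
  have hrel : ∀ ⦃p q⦄, quotRel x p q → G p = G q := by
    rintro p q ⟨s, rfl, rfl⟩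
    rw [map_zero, ← aeval_algHom_apply, hG]
    fin_cases s
    · exact hA
    · exact hB
  refine ⟨RingQuot.liftAlgHom ℂ ⟨G, hrel⟩, ?_, ?_⟩
  · rw [gen, RingQuot.liftAlgHom_mkAlgHom_apply, hG]; rfl
  · rw [gen, RingQuot.liftAlgHom_mkAlgHom_apply, hG]; rfl

theorem adjoin_gen (hx0 : ∀ i, x i ≠ 0) : Algebra.adjoin ℂ {gen x 0, gen x 1} = ⊤ := by
  set S := Algebra.adjoin ℂ {gen x 0, gen x 1}
  have hg : ∀ s, gen x s ∈ S := by
    intro s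
    apply Algebra.subset_adjoin
    fin_cases s <;> simp
  have hgrp : ∀ g : B3, RingQuot.mkAlgHom ℂ (quotRel x) (MonoidAlgebra.of ℂ B3 g) ∈ S ∧
      RingQuot.mkAlgHom ℂ (quotRel x) (MonoidAlgebra.of ℂ B3 g⁻¹) ∈ S := by
    intro g
    have hmem : g ∈ Subgroup.closure (Set.range (PresentedGroup.of (rels := braidRels))) := by
      rw [PresentedGroup.closure_range_of]; trivial
    induction hmem using Subgroup.closure_induction with
    | mem y hy =>
      obtain ⟨s, rfl⟩ := hy
      refine ⟨hg s, ?_⟩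
      -- the inverse of a generator is a polynomial in it
      obtain ⟨q, h1, h2⟩ := exists_aeval_inverse (polyP_eval_zero_ne hx0) (gen_poly (x := x) s)
      have h3 : RingQuot.mkAlgHom ℂ (quotRel x) (MonoidAlgebra.of ℂ B3 (PresentedGroup.of s)⁻¹) *
          gen x s = 1 := by
        rw [gen, elemBraid, ← map_mul, ← map_mul, inv_mul_cancel, map_one, map_one]
      rw [left_inv_eq_right_inv h3 h1]
      exact (Algebra.adjoin_singleton_le (hg s)) (aeval_mem_adjoin_singleton ℂ _)
    | one => rw [inv_one, map_one, map_one]; exact ⟨S.one_mem, S.one_mem⟩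
    | mul y z _ _ h1 h2 =>
      rw [mul_inv_rev, map_mul, map_mul, map_mul, map_mul]
      exact ⟨S.mul_mem h1.1 h2.1, S.mul_mem h2.2 h1.2⟩
    | inv y hy h1 => rw [inv_inv]; exact h1.symm
  rw [eq_top_iff]
  rintro q -
  obtain ⟨r, rfl⟩ := RingQuot.mkAlgHom_surjective ℂ (quotRel x) q
  induction r using MonoidAlgebra.induction_on with
  | of g => exact (hgrp g).1
  | add p q hp hq => rw [map_add]; exact S.add_mem hp hq
  | smul c p hp => rw [map_smul]; exact S.smul_mem hp c

/-! ### The central element -/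

theorem braid_cube {E : Type*} [Ring E] {a b : E} (h : a * b * a = b * a * b) :
    (a * b) ^ 3 = (a * b * a) ^ 2 := by
  rw [pow_succ, pow_two, pow_two]
  calc _ = a * b * a * (b * a * b) := by noncomm_ring
    _ = _ := by rw [← h]

theorem braid_cube_comm {E : Type*} [Ring E] {a b : E} (h : a * b * a = b * a * b) :
    (a * b) ^ 3 * a = a * (a * b) ^ 3 ∧ (a * b) ^ 3 * b = b * (a * b) ^ 3 := by
  rw [braid_cube h]
  have hab : a * b * a * a = b * (a * b * a) := by
    calc a * b * a * a = b * a * b * a := by rw [h]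
      _ = _ := by simp only [mul_assoc]
  have hba : a * b * a * b = a * (a * b * a) := by
    calc a * b * a * b = a * (b * a * b) := by simp only [mul_assoc]
      _ = _ := by rw [h]
  constructor
  · rw [pow_two, mul_assoc, hab, ← mul_assoc, hba, mul_assoc]
  · rw [pow_two, mul_assoc, hba, ← mul_assoc, hab, mul_assoc]

/-- A property of elements of an algebra generated by `a`, `b` that is closed under the algebra
operations holds everywhere if it holds for `a` and `b`. -/
theorem adjoin_pair_induction {E : Type*} [Ring E] [Algebra ℂ E] {a b : E}
    (hab : Algebra.adjoin ℂ {a, b} = ⊤) {S : Subalgebra ℂ E} (ha : a ∈ S) (hb : b ∈ S) (e : E) :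
    e ∈ S := by
  have h : Algebra.adjoin ℂ {a, b} ≤ S :=
    Algebra.adjoin_le (by rintro y (rfl | rfl); exacts [ha, hb])
  rw [hab] at h
  exact h trivial

theorem braid_cube_central {E : Type*} [Ring E] [Algebra ℂ E] {a b : E}
    (hab : Algebra.adjoin ℂ {a, b} = ⊤) (h : a * b * a = b * a * b) (e : E) :
    (a * b) ^ 3 * e = e * (a * b) ^ 3 := by
  have key : ∀ y, (a * b) ^ 3 * y = y * (a * b) ^ 3 → y ∈ Subalgebra.centralizer ℂ {(a * b) ^ 3} := by
    intro y hy
    rw [Subalgebra.mem_centralizer_iff]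
    rintro _ rfl
    exact hy
  have h2 := adjoin_pair_induction hab (key a (braid_cube_comm h).1) (key b (braid_cube_comm h).2) e
  exact (Subalgebra.mem_centralizer_iff ℂ).1 h2 _ rfl

/-! ### `Q_X` is a finite-dimensional algebra -/

section spanning

variable {R E : Type*} [CommRing R] [Ring E] [Algebra R E] {a ai c z : E}

/-- If `a` satisfies a relation of degree five whose extreme coefficients are units, and `z` one of
degree two, then the commutative algebra generated by `a`, `a⁻¹`, `z` is spanned by ten
elements. -/
theorem adjoin_le_span (h1 : a * ai = 1) (h2 : ai * a = 1) (hza : z * a = a * z)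
    (hzai : z * ai = ai * z) {k l k1 k2 k3 k4 t : R} (hkl : k * l = 1)
    (h5 : a * a * a = k • (ai * ai) + k1 • ai + k2 • (1 : E) + k3 • a + k4 • (a * a))
    (hz : z * z = t • z - 1) :
    Subalgebra.toSubmodule (Algebra.adjoin R {a, ai, z}) ≤
      Submodule.span R {q | ∃ g ∈ ({1, z} : Set E), ∃ p ∈ ({ai * ai, ai, 1, a, a * a} : Set E),
        q = g * p} := by
  set T := {q | ∃ g ∈ ({1, z} : Set E), ∃ p ∈ ({ai * ai, ai, 1, a, a * a} : Set E), q = g * p}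
  have hT : ∀ g ∈ ({1, z} : Set E), ∀ p ∈ ({ai * ai, ai, 1, a, a * a} : Set E),
      g * p ∈ Submodule.span R T := fun g hg p hp => Submodule.subset_span ⟨g, hg, p, hp, rfl⟩
  have hga : ∀ g ∈ ({1, z} : Set E), g * a = a * g ∧ g * ai = ai * g := by
    rintro g (rfl | rfl)
    · simp
    · exact ⟨hza, hzai⟩
  have h5' : ai * ai * ai = l • (a * a) - l • (k1 • (ai * ai)) - l • (k2 • ai)
      - l • (k3 • (1 : E)) - l • (k4 • a) := by
    have h : a * a = k • (ai * ai * ai) + k1 • (ai * ai) + k2 • ai + k3 • (1 : E) + k4 • a := by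
      have := congrArg (· * ai) h5
      simpa only [add_mul, smul_mul_assoc, mul_assoc, h1, mul_one, one_mul] using this
    rw [h]
    simp only [smul_add, smul_smul, mul_comm l k, hkl, one_smul]
    abel
  have key : ∀ q ∈ ({a, ai, z} : Set E), ∀ s ∈ Submodule.span R T, q * s ∈ Submodule.span R T := by
    intro q hq s hs
    induction hs using Submodule.span_induction with
    | zero => simp
    | add s t _ _ h h' => rw [mul_add]; exact add_mem h h'
    | smul r s _ h => rw [mul_smul_comm]; exact Submodule.smul_mem _ _ h
    | mem s hs =>
      obtain ⟨g, hg, p, hp, rfl⟩ := hs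
      rcases hq with rfl | rfl | rfl
      · rw [← mul_assoc, ← (hga g hg).1]
        rcases hp with rfl | rfl | rfl | rfl | rfl
        · rw [mul_assoc, ← mul_assoc q, h1, one_mul]; exact hT g hg _ (by simp)
        · rw [mul_assoc, h1]; exact hT g hg _ (by simp)
        · rw [mul_one]; exact hT g hg _ (by simp)
        · rw [mul_assoc]; exact hT g hg _ (by simp)
        · rw [mul_assoc, ← mul_assoc q, h5]
          simp only [mul_add, mul_smul_comm]
          refine add_mem (add_mem (add_mem (add_mem ?_ ?_) ?_) ?_) ?_ <;>
            exact Submodule.smul_mem _ _ (hT g hg _ (by simp))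
      · rw [← mul_assoc, ← (hga g hg).2]
        rcases hp with rfl | rfl | rfl | rfl | rfl
        · rw [mul_assoc, ← mul_assoc q, h5']
          simp only [mul_sub, mul_smul_comm]
          refine sub_mem (sub_mem (sub_mem (sub_mem ?_ ?_) ?_) ?_) ?_ <;>
            refine Submodule.smul_mem _ _ ?_ <;> try refine Submodule.smul_mem _ _ ?_
          all_goals exact hT g hg _ (by simp)
        · rw [mul_assoc]; exact hT g hg _ (by simp)
        · rw [mul_one]; exact hT g hg _ (by simp)
        · rw [mul_assoc, h2]; exact hT g hg _ (by simp)
        · rw [mul_assoc, ← mul_assoc q, h2, one_mul]; exact hT g hg _ (by simp)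
      · rcases hg with rfl | rfl
        · rw [one_mul]; exact hT q (by simp) p hp
        · rw [← mul_assoc, hz, sub_mul, smul_mul_assoc]
          exact sub_mem (Submodule.smul_mem _ _ (hT g (by simp) p hp)) (hT 1 (by simp) p hp)
  have hall : ∀ q ∈ Algebra.adjoin R {a, ai, z},
      ∀ s ∈ Submodule.span R T, q * s ∈ Submodule.span R T := by
    intro q hq
    induction hq using Algebra.adjoin_induction with
    | mem q hq => exact key q hq
    | algebraMap r =>
      intro s hs; rw [← Algebra.smul_def]; exact Submodule.smul_mem _ _ hs
    | add p q _ _ h h' => intro s hs; rw [add_mul]; exact add_mem (h s hs) (h' s hs)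
    | mul p q _ _ h h' => intro s hs; rw [mul_assoc]; exact h _ (h' s hs)
  intro q hq
  have := hall q hq 1 (by simpa using hT 1 (by simp) 1 (by simp))
  rwa [mul_one] at this

/-- The spanning argument: an algebra generated over a commutative ring by `a`, `a⁻¹` and `c`,
where `c² = z` is central, `c a⁻¹ c = a c a`, and `a`, `z` satisfy relations of degree five and two,
is a finite module. With `U` the algebra generated by `a`, `a⁻¹`, `z` it is the sum
`U + U c U + U (c a² c) U + U (c a² c a⁻² c)`, which reflects the decomposition of the twelve
vertices of the icosahedron into the orbits of a rotation of order five. -/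
theorem fg_of_relations (h1 : a * ai = 1) (h2 : ai * a = 1) (hzc : ∀ q, z * q = q * z)
    (hc : c * c = z) (hbr : c * ai * c = a * c * a)
    {k l k1 k2 k3 k4 t : R} (hkl : k * l = 1)
    (h5 : a * a * a = k • (ai * ai) + k1 • ai + k2 • (1 : E) + k3 • a + k4 • (a * a))
    (hz : z * z = t • z - 1) (hgen : Algebra.adjoin R {a, ai, c} = ⊤) : Module.Finite R E := by
  set T := {q | ∃ g ∈ ({1, z} : Set E), ∃ p ∈ ({ai * ai, ai, 1, a, a * a} : Set E), q = g * p}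
    with hT
  set U := Algebra.adjoin R {a, ai, z} with hU
  set 𝒰 := Subalgebra.toSubmodule U with h𝒰
  have hUT : 𝒰 ≤ Submodule.span R T := adjoin_le_span h1 h2 (hzc a) (hzc ai) hkl h5 hz
  have haU : a ∈ U := Algebra.subset_adjoin (by simp)
  have haiU : ai ∈ U := Algebra.subset_adjoin (by simp)
  have hzU : z ∈ U := Algebra.subset_adjoin (by simp)
  have hTU : T ⊆ 𝒰 := by
    rintro q ⟨g, hg, p, hp, rfl⟩
    refine U.mul_mem ?_ ?_
    · rcases hg with rfl | rfl
      exacts [U.one_mem, hzU]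
    · rcases hp with rfl | rfl | rfl | rfl | rfl
      exacts [U.mul_mem haiU haiU, haiU, U.one_mem, haU, U.mul_mem haU haU]
  have hUfg : 𝒰.FG := by
    have : 𝒰 = Submodule.span R T := le_antisymm hUT (Submodule.span_le.2 hTU)
    rw [this]
    refine Submodule.fg_span ?_
    have : T ⊆ Set.image2 (· * ·) ({1, z} : Set E) ({ai * ai, ai, 1, a, a * a} : Set E) := by
      rintro q ⟨g, hg, p, hp, rfl⟩
      exact ⟨g, hg, p, hp, rfl⟩
    exact Set.Finite.subset (Set.Finite.image2 _ (by simp) (by simp)) this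
  have hUU : 𝒰 * 𝒰 = 𝒰 := Subalgebra.isIdempotentElem_toSubmodule U
  -- basic relations
  have hcac : c * a * c = z * (ai * c * ai) := by
    calc c * a * c = ai * (a * c * a) * c := by
          rw [mul_assoc a, ← mul_assoc ai, h2, one_mul]
      _ = ai * (c * ai * c) * c := by rw [hbr]
      _ = ai * c * ai * (c * c) := by simp only [mul_assoc]
      _ = _ := by rw [hc, ← hzc]
  have hd : c * (a * a) * c * z = z * z * (ai * (c * (ai * ai) * c) * ai) := by
    calc c * (a * a) * c * z = c * a * (a * c * z) := by simp only [mul_assoc]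
      _ = c * a * (z * (a * c)) := by rw [hzc]
      _ = c * a * c * (c * a * c) := by rw [← hc]; simp only [mul_assoc]
      _ = z * (ai * c * ai) * (z * (ai * c * ai)) := by rw [hcac]
      _ = z * ((ai * c * ai) * z) * (ai * c * ai) := by simp only [mul_assoc]
      _ = _ := by rw [← hzc (ai * c * ai)]; simp only [mul_assoc]
  -- `z` is invertible
  set zi := t • (1 : E) - z with hzi
  have hziU : zi ∈ U := U.sub_mem (U.smul_mem U.one_mem t) hzU
  have hzzi : z * zi = 1 := by rw [hzi, mul_sub, mul_smul_comm, mul_one, hz]; abel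
  have hziz : zi * z = 1 := by rw [← hzc]; exact hzzi
  have hd' : c * (a * a) * c = z * (ai * (c * (ai * ai) * c) * ai) := by
    have := congrArg (· * zi) hd
    simp only [mul_assoc, hzzi, mul_one] at this
    calc c * (a * a) * c = z * (z * (ai * (c * (ai * (ai * (c * (ai * zi))))))) := by
          simpa only [mul_assoc] using this
      _ = z * ((z * (ai * (c * (ai * ai) * c) * ai)) * zi) := by simp only [mul_assoc]
      _ = z * ((ai * (c * (ai * ai) * c) * ai) * (z * zi)) := by
          rw [hzc (ai * (c * (ai * ai) * c) * ai), mul_assoc _ z zi]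
      _ = _ := by rw [hzzi, mul_one]
  set d := c * (a * a) * c with hdd
  have hd2 : c * (ai * ai) * c = zi * (a * d * a) := by
    rw [hd']
    calc c * (ai * ai) * c = 1 * (c * (ai * ai) * c) := (one_mul _).symm
      _ = zi * z * ((a * ai) * (c * (ai * ai) * c) * (ai * a)) := by rw [hziz, h1, h2]; simp
      _ = zi * (z * a * (ai * (c * (ai * ai) * c) * (ai * a))) := by simp only [mul_assoc]
      _ = _ := by rw [hzc a]; simp only [mul_assoc]
  set W1 := 𝒰 ⊔ 𝒰 * Submodule.span R {c} * 𝒰 ⊔ 𝒰 * Submodule.span R {d} * 𝒰 with hW1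
  have hW1U : W1 * 𝒰 ≤ W1 := by
    simp only [hW1, Submodule.sup_mul, mul_assoc, hUU]; exact le_rfl
  have hUW1 : 𝒰 * W1 ≤ W1 := by
    simp only [hW1, Submodule.mul_sup, ← mul_assoc, hUU]; exact le_rfl
  have hl : ∀ u ∈ U, ∀ w ∈ W1, u * w ∈ W1 := fun u hu w hw => hUW1 (Submodule.mul_mem_mul hu hw)
  have hr : ∀ u ∈ U, ∀ w ∈ W1, w * u ∈ W1 := fun u hu w hw => hW1U (Submodule.mul_mem_mul hw hu)
  have hUin : ∀ u ∈ U, u ∈ W1 := fun u hu => (le_sup_left.trans le_sup_left : 𝒰 ≤ W1) hu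
  have hcin : c ∈ W1 := by
    refine (le_sup_right.trans le_sup_left : 𝒰 * Submodule.span R {c} * 𝒰 ≤ W1) ?_
    have := Submodule.mul_mem_mul (Submodule.mul_mem_mul (show (1 : E) ∈ 𝒰 from U.one_mem)
      (Submodule.mem_span_singleton_self (R := R) c)) (show (1 : E) ∈ 𝒰 from U.one_mem)
    simpa using this
  have hdin : d ∈ W1 := by
    refine (le_sup_right : 𝒰 * Submodule.span R {d} * 𝒰 ≤ W1) ?_
    have := Submodule.mul_mem_mul (Submodule.mul_mem_mul (show (1 : E) ∈ 𝒰 from U.one_mem)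
      (Submodule.mem_span_singleton_self (R := R) d)) (show (1 : E) ∈ 𝒰 from U.one_mem)
    simpa using this
  -- reduction of a statement about `U` to the five powers of `a`
  have hred : ∀ (N : Submodule R E) (p q : E), (∀ w ∈ N, z * w ∈ N) →
      p * (ai * ai) * q ∈ N → p * ai * q ∈ N → p * 1 * q ∈ N → p * a * q ∈ N →
      p * (a * a) * q ∈ N → ∀ u ∈ U, p * u * q ∈ N := by
    intro N p q hN q1 q2 q3 q4 q5 u hu
    have hle : Submodule.span R T ≤ N.comap (LinearMap.mulRight R q ∘ₗ LinearMap.mulLeft R p) := by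
      refine Submodule.span_le.2 ?_
      rintro s ⟨g, hg, r, hr, rfl⟩
      have hp' : p * r * q ∈ N := by
        rcases hr with rfl | rfl | rfl | rfl | rfl <;> assumption
      change p * (g * r) * q ∈ N
      rcases hg with rfl | rfl
      · simpa using hp'
      · rw [← mul_assoc, ← hzc, mul_assoc g, mul_assoc g]; exact hN _ hp'
    exact hle (hUT hu)
  have hzW1 : ∀ q ∈ W1, z * q ∈ W1 := hl z hzU
  have haaa : a * a * a ∈ U := U.mul_mem (U.mul_mem haU haU) haU
  have hcuc : ∀ u ∈ U, c * u * c ∈ W1 := by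
    refine hred W1 c c hzW1 ?_ ?_ ?_ ?_ hdin
    · rw [hd2]; exact hl _ hziU _ (hr _ haU _ (hl _ haU _ hdin))
    · rw [hbr]; exact hr _ haU _ (hl _ haU _ hcin)
    · rw [mul_one, hc]; exact hUin _ hzU
    · rw [hcac]; exact hzW1 _ (hr _ haiU _ (hl _ haiU _ hcin))
  -- the products `d aᵏ c` and `c aᵏ d` for `k = -1, 0, 1, 2`
  have r1 : d * ai * c ∈ W1 := by
    have : d * ai * c = c * (a * a * a) * c * a := by
      calc d * ai * c = c * (a * a) * (c * ai * c) := by simp only [hdd, mul_assoc]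
        _ = _ := by rw [hbr]; simp only [mul_assoc]
    rw [this]; exact hr _ haU _ (hcuc _ haaa)
  have r2 : d * 1 * c ∈ W1 := by
    rw [mul_one, hdd, mul_assoc _ c c, hc, mul_assoc]
    exact hr _ (U.mul_mem (U.mul_mem haU haU) hzU) _ hcin
  have r3 : d * a * c ∈ W1 := by
    have : d * a * c = z * (c * a * c * ai) := by
      calc d * a * c = c * (a * a) * (c * a * c) := by simp only [hdd, mul_assoc]
        _ = c * (a * a) * z * (ai * c * ai) := by rw [hcac]; simp only [mul_assoc]
        _ = z * (c * a * (a * ai) * c * ai) := by rw [← hzc]; simp only [mul_assoc]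
        _ = _ := by rw [h1, mul_one]
    rw [this]; exact hzW1 _ (hr _ haiU _ (hcuc _ haU))
  have r4 : d * (a * a) * c ∈ W1 := by
    have : d * (a * a) * c = z * (z * (ai * (c * (ai * ai * ai) * c) * ai)) := by
      calc d * (a * a) * c = c * a * (a * c * a) * a * c := by simp only [hdd, mul_assoc]
        _ = (c * a * c) * ai * (c * a * c) := by rw [← hbr]; simp only [mul_assoc]
        _ = z * ((ai * c * ai) * ai * z * (ai * c * ai)) := by rw [hcac]; simp only [mul_assoc]
        _ = _ := by rw [← hzc]; simp only [mul_assoc]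
    rw [this]
    exact hzW1 _ (hzW1 _ (hr _ haiU _ (hl _ haiU _
      (hcuc _ (U.mul_mem (U.mul_mem haiU haiU) haiU)))))
  have l1 : c * ai * d ∈ W1 := by
    have : c * ai * d = a * (c * (a * a * a) * c) := by
      calc c * ai * d = (c * ai * c) * (a * a) * c := by simp only [hdd, mul_assoc]
        _ = _ := by rw [hbr]; simp only [mul_assoc]
    rw [this]; exact hl _ haU _ (hcuc _ haaa)
  have l2 : c * 1 * d ∈ W1 := by
    rw [mul_one, hdd, ← mul_assoc, ← mul_assoc, hc]
    exact hl _ (U.mul_mem hzU (U.mul_mem haU haU)) _ hcin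
  have l3 : c * a * d ∈ W1 := by
    have : c * a * d = z * (ai * (c * a * c)) := by
      calc c * a * d = (c * a * c) * (a * a) * c := by simp only [hdd, mul_assoc]
        _ = z * (ai * (c * ((ai * a) * a) * c)) := by rw [hcac]; simp only [mul_assoc]
        _ = _ := by rw [h2, one_mul]
    rw [this]; exact hzW1 _ (hl _ haiU _ (hcuc _ haU))
  have l4 : c * (a * a) * d ∈ W1 := by
    have : c * (a * a) * d = d * (a * a) * c := by simp only [hdd, mul_assoc]
    rw [this]; exact r4
  set w := d * (ai * ai) * c with hw
  set w' := c * (ai * ai) * d with hw'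
  have e1 : d * (a * a * a) * c = z * (ai * w') := by
    calc d * (a * a * a) * c = c * a * (a * c * a) * (a * a) * c := by simp only [hdd, mul_assoc]
      _ = (c * a * c) * ai * c * (a * a) * c := by rw [← hbr]; simp only [mul_assoc]
      _ = _ := by rw [hcac, hw', hdd]; simp only [mul_assoc]
  have e2 : c * (a * a * a) * d = z * (w * ai) := by
    calc c * (a * a * a) * d = c * (a * a) * (a * c * a) * a * c := by simp only [hdd, mul_assoc]
      _ = d * ai * (c * a * c) := by rw [← hbr, hdd]; simp only [mul_assoc]
      _ = d * ai * z * (ai * c * ai) := by rw [hcac]; simp only [mul_assoc]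
      _ = _ := by rw [← hzc, hw]; simp only [mul_assoc]
  have f1 : w - l • (z * (ai * w')) ∈ W1 := by
    have : w - l • (z * (ai * w')) = -(l • (k1 • (d * ai * c) + k2 • (d * 1 * c)
        + k3 • (d * a * c) + k4 • (d * (a * a) * c))) := by
      rw [← e1, h5]
      simp only [mul_add, add_mul, mul_smul_comm, smul_mul_assoc, smul_add, smul_smul, ← hw]
      rw [mul_comm l k, hkl, one_smul]; abel
    rw [this]
    exact neg_mem (W1.smul_mem _ (add_mem (add_mem (add_mem (W1.smul_mem _ r1) (W1.smul_mem _ r2))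
      (W1.smul_mem _ r3)) (W1.smul_mem _ r4)))
  have f2 : w' - l • (z * (w * ai)) ∈ W1 := by
    have : w' - l • (z * (w * ai)) = -(l • (k1 • (c * ai * d) + k2 • (c * 1 * d)
        + k3 • (c * a * d) + k4 • (c * (a * a) * d))) := by
      rw [← e2, h5]
      simp only [mul_add, add_mul, mul_smul_comm, smul_mul_assoc, smul_add, smul_smul, ← hw']
      rw [mul_comm l k, hkl, one_smul]; abel
    rw [this]
    exact neg_mem (W1.smul_mem _ (add_mem (add_mem (add_mem (W1.smul_mem _ l1) (W1.smul_mem _ l2))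
      (W1.smul_mem _ l3)) (W1.smul_mem _ l4)))
  set W := W1 ⊔ 𝒰 * Submodule.span R {w} with hW
  have hW1W : W1 ≤ W := le_sup_left
  have hUw : ∀ u ∈ U, u * w ∈ W := fun u hu =>
    (le_sup_right : 𝒰 * Submodule.span R {w} ≤ W)
      (Submodule.mul_mem_mul hu (Submodule.mem_span_singleton_self w))
  have hUW : 𝒰 * W ≤ W := by
    rw [hW, Submodule.mul_sup, ← mul_assoc, hUU]; exact sup_le_sup_right hUW1 _
  have hlW : ∀ u ∈ U, ∀ q ∈ W, u * q ∈ W := fun u hu q hq => hUW (Submodule.mul_mem_mul hu hq)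
  have hduc : ∀ u ∈ U, d * u * c ∈ W := by
    refine hred W d c (hlW z hzU) ?_ (hW1W r1) (hW1W r2) (hW1W r3) (hW1W r4)
    simpa using hUw 1 U.one_mem
  -- right multiplication by `a`
  have hwa : w * a ∈ W := by
    have : w * a = (w - l • (z * (ai * w'))) * a + l • (z * ai * (w' - l • (z * (w * ai))) * a)
        + (l • l • (z * ai * z)) * w := by
      simp only [sub_mul, mul_sub, smul_mul_assoc, mul_smul_comm, smul_sub, mul_assoc, h2, mul_one]
      abel
    rw [this]
    refine add_mem (add_mem (hW1W (hr _ haU _ f1)) (hW1W (W1.smul_mem _ (hr _ haU _ (hl _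
      (U.mul_mem hzU haiU) _ f2))))) (hUw _ ?_)
    exact U.smul_mem (U.smul_mem (U.mul_mem (U.mul_mem hzU haiU) hzU) _) _
  have hwc : w * c ∈ W := by
    rw [hw, mul_assoc _ c c, hc, mul_assoc]
    exact hW1W (hr _ (U.mul_mem (U.mul_mem haiU haiU) hzU) _ hdin)
  have hWa : ∀ q ∈ W, q * a ∈ W := by
    have : W ≤ W.comap (LinearMap.mulRight R a) := by
      refine sup_le (fun q hq => hW1W (hr a haU q hq)) (Submodule.mul_le.2 ?_)
      rintro u hu q hq
      obtain ⟨r, rfl⟩ := Submodule.mem_span_singleton.1 hq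
      change u * (r • w) * a ∈ W
      rw [mul_smul_comm, smul_mul_assoc, mul_assoc]
      exact W.smul_mem _ (hlW u hu _ hwa)
    exact this
  have hWc : ∀ q ∈ W, q * c ∈ W := by
    have : W ≤ W.comap (LinearMap.mulRight R c) := by
      refine sup_le (sup_le (sup_le ?_ (Submodule.mul_le.2 ?_)) (Submodule.mul_le.2 ?_))
        (Submodule.mul_le.2 ?_)
      · exact fun u hu => hW1W (hl u hu c hcin)
      · intro q hq v hv
        change q * v * c ∈ W
        induction hq using Submodule.mul_induction_on' with
        | mem_mul_mem u hu q hq =>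
          obtain ⟨r, rfl⟩ := Submodule.mem_span_singleton.1 hq
          rw [mul_smul_comm, smul_mul_assoc, smul_mul_assoc, mul_assoc u, mul_assoc u]
          exact W.smul_mem _ (hlW u hu _ (hW1W (hcuc v hv)))
        | add p _ q _ hp hq => rw [add_mul, add_mul]; exact add_mem hp hq
      · intro q hq v hv
        change q * v * c ∈ W
        induction hq using Submodule.mul_induction_on' with
        | mem_mul_mem u hu q hq =>
          obtain ⟨r, rfl⟩ := Submodule.mem_span_singleton.1 hq
          rw [mul_smul_comm, smul_mul_assoc, smul_mul_assoc, mul_assoc u, mul_assoc u]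
          exact W.smul_mem _ (hlW u hu _ (hduc v hv))
        | add p _ q _ hp hq => rw [add_mul, add_mul]; exact add_mem hp hq
      · rintro u hu q hq
        obtain ⟨r, rfl⟩ := Submodule.mem_span_singleton.1 hq
        change u * (r • w) * c ∈ W
        rw [mul_smul_comm, smul_mul_assoc, mul_assoc]
        exact W.smul_mem _ (hlW u hu _ hwc)
    exact this
  have hWai : ∀ q ∈ W, q * ai ∈ W := by
    intro q hq
    have h : ai = l • (a * a * a * a - k1 • (1 : E) - k2 • a - k3 • (a * a)
        - k4 • (a * a * a)) := by
      have : a * a * a * a = k • ai + k1 • (1 : E) + k2 • a + k3 • (a * a) + k4 • (a * a * a) := by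
        have := congrArg (· * a) h5
        simpa only [add_mul, smul_mul_assoc, mul_assoc, h2, mul_one, one_mul] using this
      rw [this, eq_comm]
      simp only [smul_sub, smul_add, smul_smul, mul_comm l k, hkl, one_smul]
      abel
    rw [h]
    simp only [mul_smul_comm, mul_sub, mul_one, ← mul_assoc]
    have m1 := hWa q hq
    have m2 := hWa _ m1
    have m3 := hWa _ m2
    exact W.smul_mem _ (sub_mem (sub_mem (sub_mem (sub_mem (hWa _ m3) (W.smul_mem _ hq))
      (W.smul_mem _ m1)) (W.smul_mem _ m2)) (W.smul_mem _ m3))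
  have hall : ∀ e ∈ Algebra.adjoin R {a, ai, c}, ∀ q ∈ W, q * e ∈ W := by
    intro e he
    induction he using Algebra.adjoin_induction with
    | mem e he =>
      rcases he with rfl | rfl | rfl
      exacts [hWa, hWai, hWc]
    | algebraMap r =>
      intro q hq; rw [← Algebra.commutes, ← Algebra.smul_def]; exact W.smul_mem _ hq
    | add e f _ _ h h' => intro q hq; rw [mul_add]; exact add_mem (h q hq) (h' q hq)
    | mul e f _ _ h h' => intro q hq; rw [← mul_assoc]; exact h' _ (h q hq)
  rw [hgen] at hall
  have htop : W = ⊤ := by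
    rw [eq_top_iff]
    rintro e -
    have := hall e trivial 1 (hW1W (hUin 1 U.one_mem))
    rwa [one_mul] at this
  refine ⟨?_⟩
  rw [← htop]
  exact ((hUfg.sup ((hUfg.mul (Submodule.fg_span_singleton c)).mul hUfg)).sup
    ((hUfg.mul (Submodule.fg_span_singleton d)).mul hUfg)).sup
    (hUfg.mul (Submodule.fg_span_singleton w))

end spanning

/-! ### Diagonalizable endomorphisms and their intertwiners -/

section diagonalizable

variable {U W : Type*} [AddCommGroup U] [Module ℂ U] [AddCommGroup W] [Module ℂ W]

/-- The dimension of the `μ`-eigenspace of `T`. -/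
noncomputable def mult (T : Module.End ℂ U) (μ : ℂ) : ℕ := Module.finrank ℂ (T.eigenspace μ)

theorem finrank_ker_of_basis {J : Type*} [Fintype J] [DecidableEq J] (T : Module.End ℂ U)
    (v : Module.Basis J ℂ U) (l : J → ℂ) (h : ∀ j, T (v j) = l j • v j) :
    Module.finrank ℂ (LinearMap.ker T) = Fintype.card {j // l j = 0} := by
  have hker : LinearMap.ker T = Submodule.span ℂ (Set.range fun j : {j // l j = 0} => v j) := by
    apply le_antisymm
    · intro m hm
      have hm' : T m = 0 := hm
      have h1 : T m = ∑ j, (v.repr m j * l j) • v j := by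
        conv_lhs => rw [← v.sum_repr m, map_sum]
        simp only [map_smul, h, smul_smul]
      rw [hm'] at h1
      have h2 : ∀ j, v.repr m j * l j = 0 :=
        fun j => Fintype.linearIndependent_iff.1 v.linearIndependent _ h1.symm j
      rw [← v.sum_repr m]
      refine Submodule.sum_mem _ fun j _ => ?_
      rcases mul_eq_zero.1 (h2 j) with h3 | h3
      · rw [h3, zero_smul]; exact Submodule.zero_mem _
      · exact Submodule.smul_mem _ _ (Submodule.subset_span ⟨⟨j, h3⟩, rfl⟩)
    · rw [Submodule.span_le]
      rintro _ ⟨⟨j, hj⟩, rfl⟩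
      simp [h, hj]
  rw [hker]
  exact finrank_span_eq_card (v.linearIndependent.comp _ Subtype.val_injective)

theorem mult_eq_of_comm {U W : Type*} [AddCommGroup U] [Module ℂ U] [AddCommGroup W] [Module ℂ W]
    (e : U ≃ₗ[ℂ] W) {S : Module.End ℂ U} {T : Module.End ℂ W} (h : ∀ u, e (S u) = T (e u)) (μ : ℂ) :
    mult S μ = mult T μ := by
  refine LinearEquiv.finrank_eq ((e.submoduleMap _).trans (LinearEquiv.ofEq _ _ ?_))
  ext w
  simp only [Submodule.mem_map, Module.End.mem_eigenspace_iff]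
  constructor
  · rintro ⟨u, hu, rfl⟩
    change T (e u) = μ • e u
    rw [← h, hu]
    exact map_smul e μ u
  · intro hw
    refine ⟨e.symm w, e.injective ?_, e.apply_symm_apply w⟩
    rw [h, map_smul, e.apply_symm_apply, hw]

theorem mult_of_basis {J : Type*} [Fintype J] [DecidableEq J] (T : Module.End ℂ U)
    (v : Module.Basis J ℂ U) (l : J → ℂ) (h : ∀ j, T (v j) = l j • v j) (μ : ℂ) :
    mult T μ = Fintype.card {j // l j = μ} := by
  rw [mult, Module.End.eigenspace_def, finrank_ker_of_basis _ v (fun j => l j - μ)]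
  · simp only [sub_eq_zero]
  · intro j
    simp [h, sub_smul]

variable {ι : Type*} {r : ι → ℂ}

/-- The polynomial with the roots `r i`. -/
noncomputable def rootPoly [Fintype ι] (r : ι → ℂ) : ℂ[X] := ∏ i, (X - C (r i))

theorem ker_prod_le_iSup_eigenspace [DecidableEq ι] (hr : Function.Injective r)
    (T : Module.End ℂ U) (s : Finset ι) :
    LinearMap.ker (aeval T (∏ i ∈ s, (X - C (r i)))) ≤ ⨆ i, T.eigenspace (r i) := by
  induction s using Finset.induction_on with
  | empty => intro v hv; have : v = 0 := by simpa using hv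
             rw [this]; exact Submodule.zero_mem _
  | insert i s hi ih =>
    rw [Finset.prod_insert hi, ← Polynomial.sup_ker_aeval_eq_ker_aeval_mul_of_coprime]
    · refine sup_le (le_trans (le_of_eq ?_) (le_iSup _ i)) ih
      rw [Module.End.eigenspace_def, map_sub, aeval_X, aeval_C]; rfl
    · refine IsCoprime.prod_right fun j hj => ?_
      exact Polynomial.pairwise_coprime_X_sub_C hr (fun h => hi (h ▸ hj))

theorem toMatrix_eigenbasis {J : Type*} [Fintype J] [DecidableEq J] {T : Module.End ℂ U}
    {v : Module.Basis J ℂ U} {l : J → ℂ} (h : ∀ j, T (v j) = l j • v j) :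
    LinearMap.toMatrix v v T = Matrix.diagonal l := by
  ext i j
  rw [LinearMap.toMatrix_apply, h, map_smul, Finsupp.smul_apply, Module.Basis.repr_self,
    Matrix.diagonal_apply, Finsupp.single_apply]
  by_cases hij : i = j
  · simp [hij]
  · simp [hij, Ne.symm hij]

/-- The map `X ↦ S X - X T` on linear maps; its kernel consists of the intertwiners. -/
def ad (S : Module.End ℂ W) (T : Module.End ℂ U) : Module.End ℂ (U →ₗ[ℂ] W) where
  toFun X := S ∘ₗ X - X ∘ₗ T
  map_add' X Y := by rw [LinearMap.comp_add, LinearMap.add_comp]; abel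
  map_smul' c X := by rw [LinearMap.comp_smul, LinearMap.smul_comp, RingHom.id_apply, smul_sub]

@[simp] theorem ad_apply (S : Module.End ℂ W) (T : Module.End ℂ U) (X : U →ₗ[ℂ] W) :
    ad S T X = S ∘ₗ X - X ∘ₗ T := rfl

variable [Fintype ι] [FiniteDimensional ℂ U] [FiniteDimensional ℂ W]

theorem exists_eigenbasis (hr : Function.Injective r) {T : Module.End ℂ U}
    (hT : aeval T (rootPoly r) = 0) :
    ∃ v : Module.Basis (Σ i, Fin (mult T (r i))) ℂ U, ∀ j, T (v j) = r j.1 • v j := by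
  classical
  have hint : DirectSum.IsInternal fun i => T.eigenspace (r i) := by
    rw [DirectSum.isInternal_submodule_iff_iSupIndep_and_iSup_eq_top]
    refine ⟨(Module.End.eigenspaces_iSupIndep T).comp hr, ?_⟩
    rw [eq_top_iff]
    refine le_trans ?_ (ker_prod_le_iSup_eigenspace hr T Finset.univ)
    rw [← rootPoly, hT, LinearMap.ker_zero]
  refine ⟨hint.collectedBasis fun i => Module.finBasis ℂ (T.eigenspace (r i)), fun j => ?_⟩
  exact Module.End.mem_eigenspace_iff.1 (hint.collectedBasis_mem _ j)

theorem sum_mult (hr : Function.Injective r) {T : Module.End ℂ U}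
    (hT : aeval T (rootPoly r) = 0) : ∑ i, mult T (r i) = Module.finrank ℂ U := by
  obtain ⟨v, -⟩ := exists_eigenbasis hr hT
  rw [Module.finrank_eq_card_basis v]; simp

theorem det_eq_prod_mult (hr : Function.Injective r) {T : Module.End ℂ U}
    (hT : aeval T (rootPoly r) = 0) : LinearMap.det T = ∏ i, r i ^ mult T (r i) := by
  classical
  obtain ⟨v, hv⟩ := exists_eigenbasis hr hT
  rw [← LinearMap.det_toMatrix v, toMatrix_eigenbasis hv, Matrix.det_diagonal,
    Fintype.prod_sigma]
  simp

/-- Elementary matrices are eigenvectors of `ad`, so intertwiners of diagonalizable endomorphisms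
are counted by pairs of equal eigenvalues. -/
theorem finrank_ker_ad (hr : Function.Injective r) {S : Module.End ℂ W} {T : Module.End ℂ U}
    (hS : aeval S (rootPoly r) = 0) (hT : aeval T (rootPoly r) = 0) :
    Module.finrank ℂ (LinearMap.ker (ad S T)) = ∑ i, mult T (r i) * mult S (r i) := by
  classical
  obtain ⟨v, hv⟩ := exists_eigenbasis hr hT
  obtain ⟨w, hw⟩ := exists_eigenbasis hr hS
  have hb : ∀ p : (Σ i, Fin (mult S (r i))) × (Σ i, Fin (mult T (r i))),
      ad S T (Module.Basis.linearMap v w p) =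
        (r p.1.1 - r p.2.1) • Module.Basis.linearMap v w p := by
    rintro ⟨k, j⟩
    refine v.ext fun j' => ?_
    rw [ad_apply, LinearMap.sub_apply, LinearMap.comp_apply, LinearMap.comp_apply, hv, map_smul,
      LinearMap.smul_apply, Module.Basis.linearMap_apply_apply]
    by_cases h : j = j'
    · subst h; simp [hw, sub_smul]
    · simp [h]
  rw [finrank_ker_of_basis _ _ _ hb]
  have e : {p : (Σ i, Fin (mult S (r i))) × (Σ i, Fin (mult T (r i))) // r p.1.1 - r p.2.1 = 0} ≃
      Σ i, Fin (mult T (r i)) × Fin (mult S (r i)) :=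
    { toFun := fun p => ⟨p.1.1.1, (Equiv.cast (by rw [hr (sub_eq_zero.1 p.2)]) p.1.2.2 , p.1.1.2)⟩
      invFun := fun q => ⟨(⟨q.1, q.2.2⟩, ⟨q.1, q.2.1⟩), sub_self _⟩
      left_inv := by
        rintro ⟨⟨⟨i, k⟩, ⟨j, l⟩⟩, h⟩
        have hij : i = j := hr (sub_eq_zero.1 h)
        subst hij
        rfl
      right_inv := by rintro ⟨i, k, l⟩; rfl }
  rw [Fintype.card_congr e, Fintype.card_sigma]
  simp

end diagonalizable

section finite

variable {n : ℕ} {x : Fin n → ℂ}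

theorem det_gen_eq (hx0 : ∀ i, x i ≠ 0) {V : Type*} [AddCommGroup V] [Module ℂ V]
    {A B : Module.End ℂ V} (hAB : A * B * A = B * A * B) (hA : aeval A (rootPoly x) = 0)
    (hB : aeval B (rootPoly x) = 0) :
    LinearMap.det A ≠ 0 ∧ LinearMap.det B = LinearMap.det A := by
  have hu : ∀ T : Module.End ℂ V, aeval T (rootPoly x) = 0 → LinearMap.det T ≠ 0 := by
    intro T hT
    obtain ⟨q, h, -⟩ := exists_aeval_inverse (polyP_eval_zero_ne hx0) hT
    have := congrArg LinearMap.det h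
    simp only [map_mul, map_one] at this
    exact left_ne_zero_of_mul_eq_one this
  refine ⟨hu A hA, ?_⟩
  have := congrArg LinearMap.det hAB
  simp only [map_mul] at this
  have h2 : LinearMap.det A * LinearMap.det B * (LinearMap.det B - LinearMap.det A) = 0 := by
    linear_combination -this
  rcases mul_eq_zero.1 h2 with h3 | h3
  · exact absurd h3 (mul_ne_zero (hu A hA) (hu B hB))
  · exact sub_eq_zero.1 h3

/-- The scalar by which the central element acts is bounded in terms of the `xᵢ`, because its
`d`-th power is the sixth power of the determinant of `g₁`. -/
theorem norm_central_le (hx : Function.Injective x) (hx0 : ∀ i, x i ≠ 0) {M : ℝ}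
    (hM : ∀ i, ‖x i‖ ≤ M ∧ ‖(x i)⁻¹‖ ≤ M) {V : Type*} [AddCommGroup V] [Module ℂ V]
    [FiniteDimensional ℂ V] [Nontrivial V] {A B : Module.End ℂ V} (hAB : A * B * A = B * A * B)
    (hA : aeval A (rootPoly x) = 0) (hB : aeval B (rootPoly x) = 0) {ζ : ℂ}
    (hζ : (A * B) ^ 3 = algebraMap ℂ _ ζ) : ζ ≠ 0 ∧ ‖ζ + ζ⁻¹‖ ≤ 2 * M ^ 6 := by
  set d := Module.finrank ℂ V
  have hd : d ≠ 0 := Module.finrank_pos.ne'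
  obtain ⟨h0, h1⟩ := det_gen_eq hx0 hAB hA hB
  have hdet : ζ ^ d = LinearMap.det A ^ 6 := by
    have := congrArg LinearMap.det hζ
    rw [map_pow, map_mul, h1, Algebra.algebraMap_eq_smul_one,
      LinearMap.det_smul, map_one, mul_one] at this
    rw [← this]; ring
  have hsum := sum_mult hx hA
  rw [det_eq_prod_mult hx hA] at hdet h0
  have hζ0 : ζ ≠ 0 := by
    rintro rfl
    rw [zero_pow hd] at hdet
    exact h0 (pow_eq_zero_iff (by norm_num) |>.1 hdet.symm)
  have hM0 : 0 ≤ M := by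
    rcases isEmpty_or_nonempty (Fin n) with h | ⟨⟨i⟩⟩
    · simp only [Finset.univ_eq_empty, Finset.sum_empty] at hsum
      exact absurd hsum.symm hd
    · exact (norm_nonneg _).trans (hM i).1
  have bound : ∀ y : Fin n → ℂ, (∀ i, ‖y i‖ ≤ M) →
      ‖∏ i, y i ^ mult A (x i)‖ ≤ M ^ d := by
    intro y hy
    rw [norm_prod]
    calc ∏ i, ‖y i ^ mult A (x i)‖ ≤ ∏ i, M ^ mult A (x i) := by
          refine Finset.prod_le_prod (fun i _ => norm_nonneg _) fun i _ => ?_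
          rw [norm_pow]
          exact pow_le_pow_left₀ (norm_nonneg _) (hy i) _
      _ = M ^ d := by rw [Finset.prod_pow_eq_pow_sum, hsum]
  refine ⟨hζ0, ?_⟩
  have b1 : ‖ζ‖ ≤ M ^ 6 := by
    refine le_of_pow_le_pow_left₀ hd (pow_nonneg hM0 6) ?_
    rw [← norm_pow, hdet, norm_pow, ← pow_mul, mul_comm, pow_mul]
    exact pow_le_pow_left₀ (norm_nonneg _) (bound x fun i => (hM i).1) 6
  have b2 : ‖ζ⁻¹‖ ≤ M ^ 6 := by
    refine le_of_pow_le_pow_left₀ hd (pow_nonneg hM0 6) ?_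
    rw [← norm_pow, inv_pow, hdet, ← inv_pow, ← Finset.prod_inv_distrib, norm_pow, ← pow_mul,
      mul_comm, pow_mul]
    simp only [← inv_pow]
    exact pow_le_pow_left₀ (norm_nonneg _) (bound (fun i => (x i)⁻¹) fun i => (hM i).2) 6
  calc ‖ζ + ζ⁻¹‖ ≤ ‖ζ‖ + ‖ζ⁻¹‖ := norm_add_le _ _
    _ ≤ _ := by linarith

/-- A finitely generated `ℂ[X]`-module annihilated by a nonzero polynomial is
finite-dimensional. -/
theorem finite_of_smul_eq_zero {V : Type*} [AddCommGroup V] [Module ℂ V] [Module ℂ[X] V]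
    [IsScalarTower ℂ ℂ[X] V] [Module.Finite ℂ[X] V] {p : ℂ[X]} (hp : p ≠ 0)
    (h : ∀ v : V, p • v = 0) : Module.Finite ℂ V := by
  obtain ⟨s, hs⟩ := Module.Finite.fg_top (R := ℂ[X]) (M := V)
  let f : V → ℂ[X] →ₗ[ℂ] V := fun v => (LinearMap.toSpanSingleton ℂ[X] V v).restrictScalars ℂ
  let N : Submodule ℂ V := ⨆ v ∈ s, (degreeLT ℂ p.natDegree).map (f v)
  have hN : ∀ v ∈ s, ∀ q : ℂ[X], q • v ∈ N := by
    intro v hv q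
    have h1 : q • v = f v (q % p) := by
      change q • v = (q % p) • v
      conv_lhs => rw [← EuclideanDomain.mod_add_div q p]
      rw [add_smul, mul_comm, mul_smul, h, smul_zero, add_zero]
    rw [h1]
    refine (le_iSup₂ (f := fun v (_ : v ∈ s) => (degreeLT ℂ p.natDegree).map (f v)) v hv)
      (Submodule.mem_map_of_mem ?_)
    rw [mem_degreeLT, ← degree_eq_natDegree hp]
    exact EuclideanDomain.mod_lt q hp
  have htop : N = ⊤ := by
    rw [eq_top_iff]
    rintro v -
    have hv : v ∈ Submodule.span ℂ[X] (s : Set V) := by rw [hs]; trivial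
    have h2 : ∀ q : ℂ[X], q • v ∈ N := by
      induction hv using Submodule.span_induction with
      | mem v hv => exact hN v hv
      | zero => intro q; rw [smul_zero]; exact N.zero_mem
      | add v w _ _ h1 h2 => intro q; rw [smul_add]; exact add_mem (h1 q) (h2 q)
      | smul r v _ h1 => intro q; rw [smul_smul]; exact h1 _
    simpa using h2 1
  refine ⟨?_⟩
  rw [← htop]
  refine Submodule.fg_biSup s _ fun v _ => Submodule.FG.map _ ?_
  exact Module.Finite.iff_fg.1 (Module.Finite.equiv (degreeLTEquiv ℂ p.natDegree).symm)

/-- A quintic relation for `a`, written so that `a³` is expressed by lower powers. -/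
theorem exists_cubic_relation (hn : n ≤ 5) (hx0 : ∀ i, x i ≠ 0) {E : Type*} [Ring E] [Algebra ℂ E]
    {a ai : E} (ha : aeval a (polyP x) = 0) (h1 : a * ai = 1) :
    ∃ k k1 k2 k3 k4 : ℂ, k ≠ 0 ∧
      a * a * a = k • (ai * ai) + k1 • ai + k2 • (1 : E) + k3 • a + k4 • (a * a) := by
  let p : ℂ[X] := polyP x * (X - C 1) ^ (5 - n)
  have hp0 : p.coeff 0 ≠ 0 := by
    rw [coeff_zero_eq_eval_zero, eval_mul, ← coeff_zero_eq_eval_zero]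
    refine mul_ne_zero (polyP_eval_zero_ne hx0) ?_
    rw [eval_pow]
    exact pow_ne_zero _ (by simp)
  have hmon : (polyP x).Monic := monic_prod_of_monic _ _ fun i _ => monic_X_sub_C (x i)
  have hdeg : p.natDegree = 5 := by
    rw [Monic.natDegree_mul hmon ((monic_X_sub_C 1).pow _), polyP,
      natDegree_prod_of_monic _ _ fun i _ => monic_X_sub_C (x i),
      (monic_X_sub_C (1 : ℂ)).natDegree_pow]
    simp only [natDegree_X_sub_C, Finset.sum_const, Finset.card_univ, Fintype.card_fin]
    simp only [smul_eq_mul, mul_one]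
    omega
  have hlead : p.coeff 5 = 1 := by
    rw [← hdeg]
    exact hmon.mul ((monic_X_sub_C 1).pow _)
  have hpa : aeval a p = 0 := by rw [map_mul, ha, zero_mul]
  rw [p.as_sum_range' 6 (by omega)] at hpa
  simp only [Finset.sum_range_succ, Finset.sum_range_zero, zero_add, map_add, aeval_monomial,
    hlead, map_one, one_mul, pow_zero, mul_one] at hpa
  have h2 := congrArg (· * (ai * ai)) hpa
  have e1 : ∀ y : E, a * (ai * y) = y := fun y => by rw [← mul_assoc, h1, one_mul]
  simp only [add_mul, mul_assoc, pow_succ, pow_zero, one_mul, e1, h1, mul_one, zero_mul,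
    ← Algebra.smul_def] at h2
  refine ⟨-p.coeff 0, -p.coeff 1, -p.coeff 2, -p.coeff 3, -p.coeff 4, neg_ne_zero.2 hp0, ?_⟩
  simp only [neg_smul, mul_assoc]
  simp only [Algebra.smul_def, mul_assoc, h1, e1, mul_one] at h2 ⊢
  rw [← sub_eq_zero, ← h2]
  abel

/-- An algebra generated by elements with the relations of `Q_X` is finite-dimensional. It is a
finite module over `ℂ[X]`, where `X` acts as `y = z + z⁻¹` for the central element `z`. As the
eigenvalues of `y` in finite-dimensional representations are bounded, `y - λ` is invertible for
large `λ`, and the lemma of Nakayama gives a polynomial relation for `y`. -/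
theorem finite_of_braid (hn : n ≤ 5) (hx : Function.Injective x) (hx0 : ∀ i, x i ≠ 0)
    {E : Type*} [Ring E] [Algebra ℂ E] {a b : E} (hbr : a * b * a = b * a * b)
    (hpa : aeval a (rootPoly x) = 0) (hpb : aeval b (rootPoly x) = 0)
    (hab : Algebra.adjoin ℂ {a, b} = ⊤) : Module.Finite ℂ E := by
  obtain ⟨q, h1, h2⟩ := exists_aeval_inverse (polyP_eval_zero_ne hx0) hpa
  obtain ⟨q', h1', h2'⟩ := exists_aeval_inverse (polyP_eval_zero_ne hx0) hpb
  set ai := aeval a q with hai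
  set bi := aeval b q' with hbi
  set z := (a * b) ^ 3 with hz
  have hzc : ∀ e, z * e = e * z := braid_cube_central hab hbr
  set c := a * b * a with hc
  have hcc : c * c = z := by rw [hz, braid_cube hbr, pow_two]
  set ci := ai * bi * ai with hci
  have hcci : c * ci = 1 := by
    rw [hc, hci]
    calc a * b * a * (ai * bi * ai) = a * (b * (a * ai) * bi) * ai := by simp only [mul_assoc]
      _ = 1 := by rw [h1, mul_one, h1', mul_one, h1]
  set zi := ci * ci with hzi
  have hzzi : z * zi = 1 := by
    rw [← hcc, hzi, mul_assoc, ← mul_assoc c ci, hcci, one_mul, hcci]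
  have hzic : ∀ e, zi * e = e * zi := by
    intro e
    have hziz : zi * z = 1 := by rw [← hzc]; exact hzzi
    calc zi * e = zi * (e * z) * zi := by rw [mul_assoc zi, mul_assoc e, hzzi, mul_one]
      _ = zi * z * e * zi := by rw [← hzc, mul_assoc zi z e]
      _ = _ := by rw [hziz, one_mul]
  have hcac : c * ai * c = a * c * a := by
    calc c * ai * c = a * b * (a * ai) * (a * b * a) := by simp only [hc, mul_assoc]
      _ = a * (b * a * b) * a := by rw [h1]; simp only [mul_assoc, one_mul]
      _ = a * c * a := by rw [← hbr]
  let φ : ℂ[X] →ₐ[ℂ] E := aeval (z + zi)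
  have hφ : ∀ (p : ℂ[X]) (e : E), φ p * e = e * φ p := by
    intro p e
    have hy : z + zi ∈ Subalgebra.center ℂ E := by
      rw [Subalgebra.mem_center_iff]
      intro e
      rw [mul_add, add_mul, hzc, hzic]
    have := Algebra.adjoin_singleton_le hy (aeval_mem_adjoin_singleton ℂ (z + zi) (p := p))
    exact (Subalgebra.mem_center_iff.1 this e).symm
  let alg : Algebra ℂ[X] E := φ.toRingHom.toAlgebra' hφ
  have hsm : ∀ (p : ℂ[X]) (e : E), p • e = φ p * e := fun p e => rfl
  have hC : ∀ (r : ℂ) (e : E), (C r) • e = r • e := by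
    intro r e
    rw [hsm, aeval_C, ← Algebra.smul_def]
  have hX : ∀ e : E, (X : ℂ[X]) • e = (z + zi) * e := by
    intro e
    rw [hsm, aeval_X]
  have tower : IsScalarTower ℂ ℂ[X] E := ⟨fun r p e => by
    rw [hsm, map_smul, hsm, smul_mul_assoc]⟩
  have fin1 : Module.Finite ℂ[X] E := by
    obtain ⟨k, k1, k2, k3, k4, hk, h5⟩ := exists_cubic_relation hn hx0 hpa h1
    refine fg_of_relations (R := ℂ[X]) (k := C k) (l := C k⁻¹) (k1 := C k1) (k2 := C k2)
      (k3 := C k3) (k4 := C k4) (t := X) h1 h2 hzc hcc hcac ?_ ?_ ?_ ?_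
    · rw [← C_mul, mul_inv_cancel₀ hk, C_1]
    · simp only [hC]; exact h5
    · rw [hX, add_mul, hzic, hzzi]; abel
    · rw [eq_top_iff]
      rintro e -
      have key : ∀ e, e ∈ (Algebra.adjoin ℂ[X] {a, ai, c}).restrictScalars ℂ := by
        have ha' : a ∈ Algebra.adjoin ℂ[X] {a, ai, c} := Algebra.subset_adjoin (by simp)
        have hai' : ai ∈ Algebra.adjoin ℂ[X] {a, ai, c} := Algebra.subset_adjoin (by simp)
        have hc' : c ∈ Algebra.adjoin ℂ[X] {a, ai, c} := Algebra.subset_adjoin (by simp)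
        refine adjoin_pair_induction hab ha' ?_
        have : b = ai * c * ai := by
          rw [hc]
          calc b = (ai * a) * b * (a * ai) := by rw [h1, h2]; simp
            _ = _ := by simp only [mul_assoc]
        change b ∈ Algebra.adjoin ℂ[X] {a, ai, c}
        rw [this]
        exact mul_mem (mul_mem hai' hc') hai'
      exact key e
  -- a bound for the eigenvalues of `y`
  obtain ⟨M, hM⟩ : ∃ M : ℝ, ∀ i, ‖x i‖ ≤ M ∧ ‖(x i)⁻¹‖ ≤ M := by
    refine ⟨∑ i, (‖x i‖ + ‖(x i)⁻¹‖), fun i => ?_⟩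
    have h := Finset.single_le_sum (f := fun i => ‖x i‖ + ‖(x i)⁻¹‖)
      (fun i _ => add_nonneg (norm_nonneg _) (norm_nonneg _)) (Finset.mem_univ i)
    have h3 := norm_nonneg (x i)
    have h4 := norm_nonneg (x i)⁻¹
    exact ⟨by linarith, by linarith⟩
  set lam : ℂ := ((2 * M ^ 6 + 1 : ℝ) : ℂ) with hlam
  -- the left ideal generated by `y - λ` is everything
  have hideal : Submodule.span E {z + zi - algebraMap ℂ E lam} = ⊤ := by
    by_contra hne
    set J := Submodule.span E {z + zi - algebraMap ℂ E lam} with hJ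
    have nt : Nontrivial (E ⧸ J) := Submodule.Quotient.nontrivial_iff.2 hne
    have hkill : ∀ v : E ⧸ J, (z + zi) • v = lam • v := by
      intro v
      obtain ⟨e, rfl⟩ := Submodule.Quotient.mk_surjective J v
      rw [← Submodule.Quotient.mk_smul, ← Submodule.Quotient.mk_smul, Submodule.Quotient.eq]
      rw [hJ, Submodule.mem_span_singleton]
      refine ⟨e, ?_⟩
      rw [smul_eq_mul, smul_eq_mul, mul_sub, mul_add, add_mul, hzc, hzic, Algebra.smul_def,
        Algebra.commutes]
    have fin2 : Module.Finite ℂ (E ⧸ J) := by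
      refine finite_of_smul_eq_zero (p := X - C lam) (X_sub_C_ne_zero lam) fun v => ?_
      obtain ⟨e, rfl⟩ := Submodule.Quotient.mk_surjective J v
      rw [← Submodule.Quotient.mk_smul, sub_smul, hX, hC, Submodule.Quotient.mk_sub,
        Submodule.Quotient.mk_smul, sub_eq_zero, ← hkill, ← Submodule.Quotient.mk_smul, smul_eq_mul]
    obtain ⟨ζ, hζ⟩ := Module.End.exists_eigenvalue (Algebra.lsmul ℂ ℂ (E ⧸ J) z)
    let K : Submodule E (E ⧸ J) :=
      { carrier := {v | z • v = ζ • v}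
        add_mem' := fun {v w} hv hw => by
          change z • (v + w) = ζ • (v + w)
          rw [smul_add, smul_add, hv, hw]
        zero_mem' := by change z • (0 : E ⧸ J) = ζ • 0; rw [smul_zero, smul_zero]
        smul_mem' := fun e v hv => by
          change z • e • v = ζ • e • v
          rw [smul_smul, hzc, mul_smul, hv, smul_comm] }
    obtain ⟨v, hv⟩ := hζ.exists_hasEigenvector
    have ntK : Nontrivial K :=
      ⟨⟨⟨v, Module.End.mem_eigenspace_iff.1 hv.1⟩, 0, fun h => hv.2 (congrArg Subtype.val h)⟩⟩
    have finK : FiniteDimensional ℂ K :=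
      FiniteDimensional.finiteDimensional_submodule (K.restrictScalars ℂ)
    have hzK : Algebra.lsmul ℂ ℂ K z = algebraMap ℂ _ ζ := by
      ext w
      exact w.2
    obtain ⟨hζ0, hle⟩ := norm_central_le hx hx0 hM (A := Algebra.lsmul ℂ ℂ K a)
      (B := Algebra.lsmul ℂ ℂ K b) (by simp only [← map_mul]; exact congrArg _ hbr)
      (by rw [aeval_algHom_apply, hpa, map_zero]) (by rw [aeval_algHom_apply, hpb, map_zero])
      (by rw [← map_mul, ← map_pow]; exact hzK)
    have hv' : z • v = ζ • v := Module.End.mem_eigenspace_iff.1 hv.1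
    have hzv : zi • v = ζ⁻¹ • v := by
      have h3 : zi • z • v = v := by rw [smul_smul, ← hzc, hzzi, one_smul]
      rw [hv', smul_comm] at h3
      rw [← h3, smul_smul ζ⁻¹, inv_mul_cancel₀ hζ0, one_smul, h3]
    have h4 := hkill v
    rw [add_smul, hv', hzv, ← add_smul] at h4
    have h5 : ζ + ζ⁻¹ = lam := smul_left_injective ℂ hv.2 h4
    rw [h5, hlam, Complex.norm_real] at hle
    have := le_abs_self (2 * M ^ 6 + 1)
    rw [Real.norm_eq_abs] at hle
    linarith
  have hle : (⊤ : Submodule ℂ[X] E) ≤ Ideal.span {X - C lam} • (⊤ : Submodule ℂ[X] E) := by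
    rintro e -
    have he : e ∈ Submodule.span E {z + zi - algebraMap ℂ E lam} := by
      rw [hideal]; trivial
    obtain ⟨f, rfl⟩ := Submodule.mem_span_singleton.1 he
    have : f • (z + zi - algebraMap ℂ E lam) = (X - C lam) • f := by
      rw [sub_smul, hX, hC, smul_eq_mul, mul_sub, mul_add, add_mul, hzc, hzic, Algebra.smul_def,
        Algebra.commutes]
    rw [this]
    exact Submodule.smul_mem_smul (Ideal.mem_span_singleton_self _) trivial
  obtain ⟨r, hr, hr0⟩ := Submodule.exists_sub_one_mem_and_smul_eq_zero_of_fg_of_le_smul _ _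
    fin1.fg_top hle
  refine finite_of_smul_eq_zero (p := r) ?_ fun v => hr0 v trivial
  rintro rfl
  rw [Ideal.mem_span_singleton] at hr
  have := (dvd_iff_isRoot.1 hr)
  simp [IsRoot] at this

end finite

/-! ### Rigidity: counting intertwiners and extensions -/

section rigidity

variable {U W : Type*} [AddCommGroup U] [Module ℂ U] [AddCommGroup W] [Module ℂ W]

/-- The linear maps that intertwine the actions of both `a` and `b`. -/
def intertwiners (aU bU : Module.End ℂ U) (aW bW : Module.End ℂ W) : Submodule ℂ (U →ₗ[ℂ] W) :=
  LinearMap.ker (ad aW aU) ⊓ LinearMap.ker (ad bW bU)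

theorem mem_intertwiners {aU bU : Module.End ℂ U} {aW bW : Module.End ℂ W} {X : U →ₗ[ℂ] W} :
    X ∈ intertwiners aU bU aW bW ↔ aW ∘ₗ X = X ∘ₗ aU ∧ bW ∘ₗ X = X ∘ₗ bU := by
  simp [intertwiners, sub_eq_zero]

/-- For an extension of `U` by `W` on the space `W × U`, in which `a`, `b`, `c` act by block
triangular matrices with off-diagonal blocks `ad a X`, `ad b Y`, `ad c Z`, the value of this map is
the failure of the relation `c = b a`. -/
def defect (aU bU : Module.End ℂ U) (aW bW : Module.End ℂ W) :
    ((U →ₗ[ℂ] W) × (U →ₗ[ℂ] W) × (U →ₗ[ℂ] W)) →ₗ[ℂ] (U →ₗ[ℂ] W) where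
  toFun t := ad (bW * aW) (bU * aU) t.2.2 - (ad bW bU t.2.1 ∘ₗ aU + bW ∘ₗ ad aW aU t.1)
  map_add' s t := by
    simp only [Prod.fst_add, Prod.snd_add, map_add, LinearMap.add_comp, LinearMap.comp_add]; abel
  map_smul' c t := by
    simp only [Prod.smul_fst, Prod.smul_snd, map_smul, LinearMap.smul_comp, LinearMap.comp_smul,
      RingHom.id_apply, smul_sub, smul_add]

theorem defect_diag (aU bU : Module.End ℂ U) (aW bW : Module.End ℂ W) (X : U →ₗ[ℂ] W) :
    defect aU bU aW bW (X, X, X) = 0 := by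
  ext u
  simp [defect]

theorem aeval_comp_of_comp {T : Module.End ℂ W} {S : Module.End ℂ U} {s : U →ₗ[ℂ] W}
    (h : T ∘ₗ s = s ∘ₗ S) (p : ℂ[X]) : aeval T p ∘ₗ s = s ∘ₗ aeval S p := by
  induction p using Polynomial.induction_on' with
  | add p q hp hq => rw [map_add, map_add, LinearMap.add_comp, LinearMap.comp_add, hp, hq]
  | monomial k r =>
    have hk : (T ^ k) ∘ₗ s = s ∘ₗ (S ^ k) := by
      induction k with
      | zero => rfl
      | succ k ih =>
        rw [pow_succ, pow_succ, Module.End.mul_eq_comp, LinearMap.comp_assoc, h,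
          ← LinearMap.comp_assoc, ih]; rfl
    rw [aeval_monomial, aeval_monomial, Algebra.algebraMap_eq_smul_one, smul_mul_assoc, one_mul,
      Algebra.algebraMap_eq_smul_one, smul_mul_assoc, one_mul, LinearMap.smul_comp,
      LinearMap.comp_smul, hk]

/-- The conjugate of `S × T` on `W × U` by the unipotent matrix of `X : U → W`. -/
def blockExt (S : Module.End ℂ W) (T : Module.End ℂ U) (X : U →ₗ[ℂ] W) : Module.End ℂ (W × U) :=
  (S ∘ₗ LinearMap.fst ℂ W U - ad S T X ∘ₗ LinearMap.snd ℂ W U).prod (T ∘ₗ LinearMap.snd ℂ W U)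

theorem blockExt_apply (S : Module.End ℂ W) (T : Module.End ℂ U) (X : U →ₗ[ℂ] W) (w : W) (u : U) :
    blockExt S T X (w, u) = (S w - (S (X u) - X (T u)), T u) := rfl

theorem aeval_blockExt_eq_zero {S : Module.End ℂ W} {T : Module.End ℂ U} (X : U →ₗ[ℂ] W) {p : ℂ[X]}
    (hS : aeval S p = 0) (hT : aeval T p = 0) : aeval (blockExt S T X) p = 0 := by
  have h1 := aeval_comp_of_comp (T := blockExt S T X) (S := S) (s := LinearMap.inl ℂ W U)
    (by ext w <;> simp [blockExt_apply]) p
  have h2 := aeval_comp_of_comp (T := blockExt S T X) (S := T) (s := X.prod LinearMap.id)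
    (by ext u <;> simp [blockExt_apply]) p
  rw [hS, LinearMap.comp_zero] at h1
  rw [hT, LinearMap.comp_zero] at h2
  refine LinearMap.ext fun v => ?_
  have hv : v = LinearMap.inl ℂ W U (v.1 - X v.2) + X.prod LinearMap.id v.2 := by
    ext <;> simp
  rw [hv, map_add, ← LinearMap.comp_apply, ← LinearMap.comp_apply, h1, h2]
  simp

theorem defect_fst (aU bU : Module.End ℂ U) (aW bW : Module.End ℂ W) (X : U →ₗ[ℂ] W) :
    defect aU bU aW bW (X, 0, 0) = (bW ∘ₗ X) ∘ₗ aU - (bW * aW) ∘ₗ X := by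
  ext u
  simp [defect]

theorem defect_snd (aU bU : Module.End ℂ U) (aW bW : Module.End ℂ W) (Y : U →ₗ[ℂ] W) :
    defect aU bU aW bW (0, Y, 0) = Y ∘ₗ (bU * aU) - (bW ∘ₗ Y) ∘ₗ aU := by
  ext u
  simp [defect]

theorem defect_trd (aU bU : Module.End ℂ U) (aW bW : Module.End ℂ W) (Z : U →ₗ[ℂ] W) :
    defect aU bU aW bW (0, 0, Z) = (bW * aW) ∘ₗ Z - Z ∘ₗ (bU * aU) := by
  ext u
  simp [defect]

theorem finrank_submodule_prod [FiniteDimensional ℂ U] [FiniteDimensional ℂ W]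
    (p : Submodule ℂ U) (q : Submodule ℂ W) :
    Module.finrank ℂ (p.prod q) = Module.finrank ℂ p + Module.finrank ℂ q := by
  rw [← Module.finrank_prod]
  exact LinearEquiv.finrank_eq
    { toFun := fun t => (⟨t.1.1, t.2.1⟩, ⟨t.1.2, t.2.2⟩)
      invFun := fun t => ⟨(t.1, t.2), t.1.2, t.2.2⟩
      map_add' := fun _ _ => rfl
      map_smul' := fun _ _ => rfl }

variable [FiniteDimensional ℂ U]

theorem eq_zero_of_trace_comp {Y : W →ₗ[ℂ] U} 
    (h : ∀ X : U →ₗ[ℂ] W, LinearMap.trace ℂ U (Y ∘ₗ X) = 0) :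
    Y = 0 := by
  ext w
  rw [LinearMap.zero_apply, ← Module.forall_dual_apply_eq_zero_iff ℂ]
  intro f
  have := h (f.smulRight w)
  have e : Y ∘ₗ f.smulRight w = f.smulRight (Y w) := by ext; simp
  rwa [e, LinearMap.trace_smulRight] at this

variable [FiniteDimensional ℂ W]

/-- By the trace pairing the cokernel of `defect` embeds into the space of intertwiners in the
opposite direction, by `Y ↦ Y c`. -/
theorem le_finrank_range_defect {aU bU : Module.End ℂ U} {aW bW : Module.End ℂ W}
    (ha : IsUnit aW) (hb : IsUnit bW) :
    Module.finrank ℂ U * Module.finrank ℂ W ≤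
      Module.finrank ℂ (LinearMap.range (defect aU bU aW bW)) +
        Module.finrank ℂ (intertwiners aW bW aU bU) := by
  let Ψ : (W →ₗ[ℂ] U) →ₗ[ℂ] Module.Dual ℂ (U →ₗ[ℂ] W) :=
    LinearMap.mk₂ ℂ (fun Y X => LinearMap.trace ℂ U (Y ∘ₗ X))
      (fun Y Y' X => by rw [LinearMap.add_comp, map_add])
      (fun c Y X => by rw [LinearMap.smul_comp, map_smul])
      (fun Y X X' => by rw [LinearMap.comp_add, map_add])
      (fun c Y X => by rw [LinearMap.comp_smul, map_smul])
  have hΨ : ∀ Y X, Ψ Y X = LinearMap.trace ℂ U (Y ∘ₗ X) := fun Y X => rfl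
  have hinj : Function.Injective Ψ := by
    rw [← LinearMap.ker_eq_bot, LinearMap.ker_eq_bot']
    intro Y hY
    exact eq_zero_of_trace_comp fun X => by rw [← hΨ, hY, LinearMap.zero_apply]
  have hdim : Module.finrank ℂ (W →ₗ[ℂ] U) = Module.finrank ℂ (Module.Dual ℂ (U →ₗ[ℂ] W)) := by
    rw [Subspace.dual_finrank_eq, Module.finrank_linearMap, Module.finrank_linearMap, mul_comm]
  let e := LinearEquiv.ofInjectiveOfFinrankEq Ψ hinj hdim
  have he : ∀ Y X, e Y X = LinearMap.trace ℂ U (Y ∘ₗ X) := fun Y X => rfl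
  set R := LinearMap.range (defect aU bU aW bW) with hR
  have hann := Subspace.finrank_add_finrank_dualAnnihilator_eq R
  rw [Module.finrank_linearMap] at hann
  let K := R.dualAnnihilator.comap (e : (W →ₗ[ℂ] U) →ₗ[ℂ] Module.Dual ℂ (U →ₗ[ℂ] W))
  have hK : Module.finrank ℂ K = Module.finrank ℂ R.dualAnnihilator :=
    LinearEquiv.finrank_eq (e.submoduleMap K |>.trans (LinearEquiv.ofEq _ _ (by
      rw [Submodule.map_comap_eq_of_surjective e.surjective])))
  let cmul : (W →ₗ[ℂ] U) →ₗ[ℂ] (W →ₗ[ℂ] U) := LinearMap.lcomp ℂ U (bW * aW)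
  have hcmul : Function.Injective cmul := by
    obtain ⟨u, hu⟩ := hb.mul ha
    intro Y Y' h
    have h' : Y ∘ₗ (bW * aW) = Y' ∘ₗ (bW * aW) := h
    have hu' : (bW * aW) * (↑u⁻¹ : Module.End ℂ W) = 1 := by rw [← hu, u.mul_inv]
    calc Y = (Y ∘ₗ (bW * aW)) ∘ₗ (↑u⁻¹ : Module.End ℂ W) := by
          rw [LinearMap.comp_assoc, ← Module.End.mul_eq_comp, hu']; rfl
      _ = Y' := by rw [h', LinearMap.comp_assoc, ← Module.End.mul_eq_comp, hu']; rfl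
  have hKle : K.map cmul ≤ intertwiners aW bW aU bU := by
    rintro _ ⟨Y, hY, rfl⟩
    have hY' : ∀ t, LinearMap.trace ℂ U (Y ∘ₗ defect aU bU aW bW t) = 0 := by
      intro t
      have := (Submodule.mem_dualAnnihilator _).1 hY (defect aU bU aW bW t) ⟨t, rfl⟩
      exact this
    -- the three families of test maps give `Y c = c Y`, `a Y b = c Y` and `Y c = a Y b`
    have e1 : Y ∘ₗ (bW * aW) = (bU * aU) ∘ₗ Y := by
      rw [← sub_eq_zero]
      refine eq_zero_of_trace_comp fun Z => ?_
      have h := hY' (0, 0, Z)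
      rw [defect_trd, LinearMap.comp_sub, map_sub] at h
      rw [LinearMap.sub_comp, map_sub, ← h, LinearMap.comp_assoc, LinearMap.comp_assoc,
        LinearMap.trace_comp_comm' _ (bU * aU), LinearMap.comp_assoc]
    have e2 : aU ∘ₗ Y ∘ₗ bW = (bU * aU) ∘ₗ Y := by
      rw [← sub_eq_zero, ← neg_eq_zero, neg_sub]
      refine eq_zero_of_trace_comp fun Z => ?_
      have h := hY' (0, Z, 0)
      rw [defect_snd, LinearMap.comp_sub, map_sub] at h
      rw [LinearMap.sub_comp, map_sub, ← h, LinearMap.comp_assoc, LinearMap.comp_assoc,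
        LinearMap.trace_comp_comm' _ (bU * aU), LinearMap.trace_comp_comm' _ aU]
      rfl
    have e3 : Y ∘ₗ (bW * aW) = aU ∘ₗ Y ∘ₗ bW := by
      rw [← sub_eq_zero, ← neg_eq_zero, neg_sub]
      refine eq_zero_of_trace_comp fun Z => ?_
      have h := hY' (Z, 0, 0)
      rw [defect_fst, LinearMap.comp_sub, map_sub] at h
      rw [LinearMap.sub_comp, map_sub, ← h, LinearMap.comp_assoc, LinearMap.trace_comp_comm' _ aU]
      rfl
    have hc : cmul Y = Y ∘ₗ (bW * aW) := rfl
    rw [mem_intertwiners, hc]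
    constructor
    · conv_rhs => rw [e3]
      rfl
    · calc bU ∘ₗ Y ∘ₗ (bW * aW) = bU ∘ₗ aU ∘ₗ Y ∘ₗ bW := by rw [e3]
        _ = ((bU * aU) ∘ₗ Y) ∘ₗ bW := rfl
        _ = (Y ∘ₗ (bW * aW)) ∘ₗ bW := by rw [e1]
  have h1 : Module.finrank ℂ (K.map cmul) = Module.finrank ℂ K :=
    (Submodule.equivMapOfInjective cmul hcmul K).finrank_eq.symm
  have h2 := Submodule.finrank_mono hKle
  omega

variable {ι₁ ι₂ ι₃ : Type*} [Fintype ι₁] [Fintype ι₂] [Fintype ι₃]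
  {r₁ : ι₁ → ℂ} {r₂ : ι₂ → ℂ} {r₃ : ι₃ → ℂ}

/-- `a`, `b` and `b a` are diagonalizable with eigenvalues among the `r₁ i`, `r₂ i` and `r₃ i`. -/
structure IsTriple {V : Type*} [AddCommGroup V] [Module ℂ V] (r₁ : ι₁ → ℂ) (r₂ : ι₂ → ℂ)
    (r₃ : ι₃ → ℂ) (a b : Module.End ℂ V) : Prop where
  ha : aeval a (rootPoly r₁) = 0
  hb : aeval b (rootPoly r₂) = 0
  hc : aeval (b * a) (rootPoly r₃) = 0

/-- The form `∑ dim Hom_T(U, W) - dim Hom(U, W)`, where `T` runs through `a`, `b`, `c = b a`. It is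
the Euler form of the category of modules with prescribed eigenvalues. -/
noncomputable def eulerForm (r₁ : ι₁ → ℂ) (r₂ : ι₂ → ℂ) (r₃ : ι₃ → ℂ) (aU bU : Module.End ℂ U)
    (aW bW : Module.End ℂ W) : ℤ :=
  ∑ i, (mult aU (r₁ i) * mult aW (r₁ i) : ℤ) + ∑ i, (mult bU (r₂ i) * mult bW (r₂ i) : ℤ)
    + ∑ i, (mult (bU * aU) (r₃ i) * mult (bW * aW) (r₃ i) : ℤ)
    - Module.finrank ℂ U * Module.finrank ℂ W

theorem isUnit_of_rootPoly (h0 : ∀ i, r₁ i ≠ 0) {V : Type*} [AddCommGroup V] [Module ℂ V]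
    {T : Module.End ℂ V} (hT : aeval T (rootPoly r₁) = 0) : IsUnit T := by
  obtain ⟨u, hu⟩ := exists_unit_of_aeval (p := rootPoly r₁) (by
    rw [coeff_zero_eq_eval_zero, rootPoly, eval_prod]
    exact Finset.prod_ne_zero_iff.2 fun i _ => by simpa using h0 i) hT
  exact ⟨u, hu⟩

/-- Infinitesimal data that give split extensions: intertwiners of the three endomorphisms plus a
common linear map. -/
def splitData (aU bU : Module.End ℂ U) (aW bW : Module.End ℂ W) :
    Submodule ℂ ((U →ₗ[ℂ] W) × (U →ₗ[ℂ] W) × (U →ₗ[ℂ] W)) :=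
  ((LinearMap.ker (ad aW aU)).prod
    ((LinearMap.ker (ad bW bU)).prod (LinearMap.ker (ad (bW * aW) (bU * aU))))) ⊔
  LinearMap.range (LinearMap.id.prod (LinearMap.id.prod (LinearMap.id (R := ℂ) (M := U →ₗ[ℂ] W))))

omit [FiniteDimensional ℂ U] [FiniteDimensional ℂ W] in
theorem splitData_le (aU bU : Module.End ℂ U) (aW bW : Module.End ℂ W) :
    splitData aU bU aW bW ≤ LinearMap.ker (defect aU bU aW bW) := by
  refine sup_le ?_ ?_
  · rintro ⟨X, Y, Z⟩ ⟨hX, hY, hZ⟩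
    rw [SetLike.mem_coe, LinearMap.mem_ker] at hX
    have hY' : ad bW bU Y = 0 := hY
    have hZ' : ad (bW * aW) (bU * aU) Z = 0 := hZ
    change ad (bW * aW) (bU * aU) Z - (ad bW bU Y ∘ₗ aU + bW ∘ₗ ad aW aU X) = 0
    rw [hX, hY', hZ']
    simp
  · rintro _ ⟨X, rfl⟩
    exact defect_diag aU bU aW bW X

theorem finrank_splitData (i₁ : Function.Injective r₁) (i₂ : Function.Injective r₂)
    (i₃ : Function.Injective r₃) {aU bU : Module.End ℂ U} {aW bW : Module.End ℂ W}
    (hU : IsTriple r₁ r₂ r₃ aU bU) (hW : IsTriple r₁ r₂ r₃ aW bW) :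
    (Module.finrank ℂ (splitData aU bU aW bW) : ℤ) + Module.finrank ℂ (intertwiners aU bU aW bW) =
      eulerForm r₁ r₂ r₃ aU bU aW bW + 2 * (Module.finrank ℂ U * Module.finrank ℂ W) := by
  set A := (LinearMap.ker (ad aW aU)).prod
    ((LinearMap.ker (ad bW bU)).prod (LinearMap.ker (ad (bW * aW) (bU * aU)))) with hA
  set δ : (U →ₗ[ℂ] W) →ₗ[ℂ] ((U →ₗ[ℂ] W) × (U →ₗ[ℂ] W) × (U →ₗ[ℂ] W)) :=
    LinearMap.id.prod (LinearMap.id.prod LinearMap.id) with hδ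
  have hδi : Function.Injective δ := fun X Y h => congrArg Prod.fst h
  have h1 := Submodule.finrank_sup_add_finrank_inf_eq A (LinearMap.range δ)
  have h2 : A ⊓ LinearMap.range δ = (intertwiners aU bU aW bW).map δ := by
    ext t
    constructor
    · rintro ⟨⟨h₁, h₂, -⟩, X, rfl⟩
      exact ⟨X, ⟨h₁, h₂⟩, rfl⟩
    · rintro ⟨X, hX, rfl⟩
      refine ⟨⟨hX.1, hX.2, ?_⟩, X, rfl⟩
      obtain ⟨h₁, h₂⟩ := mem_intertwiners.1 hX
      change ad (bW * aW) (bU * aU) X = 0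
      rw [ad_apply, sub_eq_zero, Module.End.mul_eq_comp, Module.End.mul_eq_comp,
        LinearMap.comp_assoc, h₁, ← LinearMap.comp_assoc, h₂, LinearMap.comp_assoc]
  have h3 : Module.finrank ℂ A = Module.finrank ℂ (LinearMap.ker (ad aW aU)) +
      (Module.finrank ℂ (LinearMap.ker (ad bW bU)) +
        Module.finrank ℂ (LinearMap.ker (ad (bW * aW) (bU * aU)))) := by
    rw [hA, finrank_submodule_prod, finrank_submodule_prod]
  rw [h2, ← (Submodule.equivMapOfInjective δ hδi _).finrank_eq, LinearMap.finrank_range_of_inj hδi, h3,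
    finrank_ker_ad i₁ hW.ha hU.ha, finrank_ker_ad i₂ hW.hb hU.hb, finrank_ker_ad i₃ hW.hc hU.hc,
    Module.finrank_linearMap] at h1
  have h4 : Module.finrank ℂ (splitData aU bU aW bW) =
    Module.finrank ℂ (A ⊔ LinearMap.range δ : Submodule ℂ _) := rfl
  rw [← h4] at h1
  have h5 := congrArg (Nat.cast : ℕ → ℤ) h1
  push_cast at h5
  rw [h5, eulerForm]
  ring

theorem eulerForm_le (i₁ : Function.Injective r₁) (i₂ : Function.Injective r₂)
    (i₃ : Function.Injective r₃) (n₁ : ∀ i, r₁ i ≠ 0) (n₂ : ∀ i, r₂ i ≠ 0)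
    {aU bU : Module.End ℂ U} {aW bW : Module.End ℂ W}
    (hU : IsTriple r₁ r₂ r₃ aU bU) (hW : IsTriple r₁ r₂ r₃ aW bW) :
    eulerForm r₁ r₂ r₃ aU bU aW bW ≤ Module.finrank ℂ (intertwiners aU bU aW bW) +
      Module.finrank ℂ (intertwiners aW bW aU bU) := by
  have h1 := finrank_splitData i₁ i₂ i₃ hU hW
  have h2 := Submodule.finrank_mono (splitData_le aU bU aW bW)
  have h3 := LinearMap.finrank_range_add_finrank_ker (defect aU bU aW bW)
  have h4 := le_finrank_range_defect (aU := aU) (bU := bU) (isUnit_of_rootPoly n₁ hW.ha)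
    (isUnit_of_rootPoly n₂ hW.hb)
  rw [Module.finrank_prod, Module.finrank_prod, Module.finrank_linearMap] at h3
  zify at h2 h3 h4
  linarith

/-- If the Euler form is large enough, then infinitesimal extension data are all split. -/
theorem ker_defect_eq (i₁ : Function.Injective r₁) (i₂ : Function.Injective r₂)
    (i₃ : Function.Injective r₃) (n₁ : ∀ i, r₁ i ≠ 0) (n₂ : ∀ i, r₂ i ≠ 0)
    {aU bU : Module.End ℂ U} {aW bW : Module.End ℂ W}
    (hU : IsTriple r₁ r₂ r₃ aU bU) (hW : IsTriple r₁ r₂ r₃ aW bW)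
    (h : (Module.finrank ℂ (intertwiners aU bU aW bW) : ℤ) +
      Module.finrank ℂ (intertwiners aW bW aU bU) ≤ eulerForm r₁ r₂ r₃ aU bU aW bW) :
    splitData aU bU aW bW = LinearMap.ker (defect aU bU aW bW) := by
  refine Submodule.eq_of_le_of_finrank_le (splitData_le _ _ _ _) ?_
  have h1 := finrank_splitData i₁ i₂ i₃ hU hW
  have h3 := LinearMap.finrank_range_add_finrank_ker (defect aU bU aW bW)
  have h4 := le_finrank_range_defect (aU := aU) (bU := bU) (isUnit_of_rootPoly n₁ hW.ha)
    (isUnit_of_rootPoly n₂ hW.hb)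
  rw [Module.finrank_prod, Module.finrank_prod, Module.finrank_linearMap] at h3
  zify at h3 h4 ⊢
  linarith

/-- If the Euler form is negative, then there are infinitesimal extension data that do not
split. -/
theorem exists_mem_ker_defect (i₁ : Function.Injective r₁) (i₂ : Function.Injective r₂)
    (i₃ : Function.Injective r₃)
    {aU bU : Module.End ℂ U} {aW bW : Module.End ℂ W}
    (hU : IsTriple r₁ r₂ r₃ aU bU) (hW : IsTriple r₁ r₂ r₃ aW bW)
    (h : eulerForm r₁ r₂ r₃ aU bU aW bW < 0) :
    ∃ t ∈ LinearMap.ker (defect aU bU aW bW), t ∉ splitData aU bU aW bW := by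
  by_contra! hcon
  have h0 := Submodule.finrank_mono (show LinearMap.ker (defect aU bU aW bW) ≤ _ from hcon)
  have h1 := finrank_splitData i₁ i₂ i₃ hU hW
  have h3 := LinearMap.finrank_range_add_finrank_ker (defect aU bU aW bW)
  have h4 := (LinearMap.range (defect aU bU aW bW)).finrank_le
  rw [Module.finrank_prod, Module.finrank_prod, Module.finrank_linearMap] at h3
  rw [Module.finrank_linearMap] at h4
  zify at h0 h3 h4
  linarith

omit [FiniteDimensional ℂ U] in
/-- Every eigenspace decomposition is compatible with quotients: a diagonalizable endomorphism has
an equivariant section of an equivariant surjection. -/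
theorem exists_section (hr : Function.Injective r₁) {V : Type*} [AddCommGroup V] [Module ℂ V]
    [FiniteDimensional ℂ V] {T : Module.End ℂ V} {S : Module.End ℂ U}
    (hT : aeval T (rootPoly r₁) = 0) {π : V →ₗ[ℂ] U} (hπ : Function.Surjective π)
    (h : S ∘ₗ π = π ∘ₗ T) : ∃ s : U →ₗ[ℂ] V, π ∘ₗ s = LinearMap.id ∧ T ∘ₗ s = s ∘ₗ S := by
  have hss : T.IsSemisimple := by
    refine Module.End.isSemisimple_of_squarefree_aeval_eq_zero (p := rootPoly r₁) ?_ hT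
    exact (separable_prod_X_sub_C_iff.2 hr).squarefree
  obtain ⟨q, hq, hc⟩ := Module.End.isSemisimple_iff.1 hss (LinearMap.ker π) (by
    intro v hv
    have : S (π v) = π (T v) := LinearMap.congr_fun h v
    rw [Submodule.mem_comap, LinearMap.mem_ker, ← this, LinearMap.mem_ker.1 hv, map_zero])
  have hbij : Function.Bijective (π.domRestrict q) := by
    constructor
    · rw [← LinearMap.ker_eq_bot, LinearMap.ker_eq_bot']
      rintro ⟨v, hv⟩ hv0
      have := hc.disjoint.le_bot ⟨(show v ∈ LinearMap.ker π from hv0), hv⟩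
      simpa using this
    · intro u
      obtain ⟨v, rfl⟩ := hπ u
      obtain ⟨k, hk, w, hw, rfl⟩ := Submodule.mem_sup.1
        (show v ∈ LinearMap.ker π ⊔ q from hc.codisjoint.eq_top ▸ Submodule.mem_top)
      exact ⟨⟨w, hw⟩, by rw [LinearMap.domRestrict_apply, map_add, LinearMap.mem_ker.1 hk, zero_add]⟩
  let e := LinearEquiv.ofBijective _ hbij
  have he : ∀ u, π (e.symm u : V) = u := fun u => e.apply_symm_apply u
  refine ⟨q.subtype ∘ₗ e.symm, ?_, ?_⟩
  · ext u; exact he u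
  · ext u
    have h1 : (⟨T (e.symm u : V), hq (e.symm u).2⟩ : q) = e.symm (S u) := by
      rw [LinearEquiv.eq_symm_apply]
      have := LinearMap.congr_fun h (e.symm u : V)
      rw [LinearMap.comp_apply, LinearMap.comp_apply, he] at this
      exact this.symm
    exact congrArg Subtype.val h1

/-- Extensions split if the Euler form is large enough. -/
theorem exists_section_of_le (i₁ : Function.Injective r₁) (i₂ : Function.Injective r₂)
    (i₃ : Function.Injective r₃) (n₁ : ∀ i, r₁ i ≠ 0) (n₂ : ∀ i, r₂ i ≠ 0)
    {V : Type*} [AddCommGroup V] [Module ℂ V] [FiniteDimensional ℂ V]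
    {aU bU : Module.End ℂ U} {aW bW : Module.End ℂ W} {aV bV : Module.End ℂ V}
    (hU : IsTriple r₁ r₂ r₃ aU bU) (hW : IsTriple r₁ r₂ r₃ aW bW)
    (hV : IsTriple r₁ r₂ r₃ aV bV)
    (h : (Module.finrank ℂ (intertwiners aU bU aW bW) : ℤ) +
      Module.finrank ℂ (intertwiners aW bW aU bU) ≤ eulerForm r₁ r₂ r₃ aU bU aW bW)
    {ι : W →ₗ[ℂ] V} {π : V →ₗ[ℂ] U} (hι : Function.Injective ι) (hπ : Function.Surjective π)
    (hex : LinearMap.range ι = LinearMap.ker π)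
    (hιa : aV ∘ₗ ι = ι ∘ₗ aW) (hιb : bV ∘ₗ ι = ι ∘ₗ bW)
    (hπa : aU ∘ₗ π = π ∘ₗ aV) (hπb : bU ∘ₗ π = π ∘ₗ bV) :
    ∃ s : U →ₗ[ℂ] V, π ∘ₗ s = LinearMap.id ∧ s ∈ intertwiners aU bU aV bV := by
  have hπc : (bU * aU) ∘ₗ π = π ∘ₗ (bV * aV) := by
    rw [Module.End.mul_eq_comp, LinearMap.comp_assoc, hπa, ← LinearMap.comp_assoc, hπb]; rfl
  obtain ⟨sa, ha, ha'⟩ := exists_section i₁ hV.ha hπ hπa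
  obtain ⟨sb, hb, hb'⟩ := exists_section i₂ hV.hb hπ hπb
  obtain ⟨sc, hc, hc'⟩ := exists_section i₃ hV.hc hπ hπc
  have lift : ∀ s : U →ₗ[ℂ] V, π ∘ₗ s = LinearMap.id → ∃ X : U →ₗ[ℂ] W, s = sc + ι ∘ₗ X := by
    intro s hs
    have hmem : ∀ u, (s - sc) u ∈ LinearMap.range ι := by
      intro u
      rw [hex, LinearMap.mem_ker, LinearMap.sub_apply, map_sub, ← LinearMap.comp_apply,
        ← LinearMap.comp_apply, hs, hc, sub_self]
    refine ⟨(LinearEquiv.ofInjective ι hι).symm ∘ₗ (s - sc).codRestrict _ hmem, ?_⟩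
    ext u
    have : ι ((LinearEquiv.ofInjective ι hι).symm ⟨(s - sc) u, hmem u⟩) = (s - sc) u :=
      congrArg Subtype.val ((LinearEquiv.ofInjective ι hι).apply_symm_apply ⟨(s - sc) u, hmem u⟩)
    change s u = sc u + ι ((LinearEquiv.ofInjective ι hι).symm ⟨(s - sc) u, hmem u⟩)
    rw [this, LinearMap.sub_apply]; abel
  obtain ⟨X, rfl⟩ := lift sa ha
  obtain ⟨Y, rfl⟩ := lift sb hb
  have ha₁ : ∀ u, aV (sc u) + ι (aW (X u)) = sc (aU u) + ι (X (aU u)) := by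
    intro u
    have := LinearMap.congr_fun ha' u
    have h2 : aV (ι (X u)) = ι (aW (X u)) := LinearMap.congr_fun hιa (X u)
    simpa [h2] using this
  have hb₁ : ∀ u, bV (sc u) + ι (bW (Y u)) = sc (bU u) + ι (Y (bU u)) := by
    intro u
    have := LinearMap.congr_fun hb' u
    have h2 : bV (ι (Y u)) = ι (bW (Y u)) := LinearMap.congr_fun hιb (Y u)
    simpa [h2] using this
  have hι₂ : ∀ w, bV (ι w) = ι (bW w) := fun w => LinearMap.congr_fun hιb w
  have hι₁ : ∀ w, aV (ι w) = ι (aW w) := fun w => LinearMap.congr_fun hιa w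
  have hmem : (X, Y, 0) ∈ LinearMap.ker (defect aU bU aW bW) := by
    rw [LinearMap.mem_ker]
    ext u
    apply hι
    have h3 : bV (aV (sc u)) = sc (bU (aU u)) := LinearMap.congr_fun hc' u
    have h4 : aV (sc u) = sc (aU u) + ι (X (aU u)) - ι (aW (X u)) := eq_sub_of_add_eq (ha₁ u)
    have h5 := hb₁ (aU u)
    rw [h4, map_sub, map_add, hι₂, hι₂] at h3
    have h6 : bV (sc (aU u)) = sc (bU (aU u)) + ι (Y (bU (aU u))) - ι (bW (Y (aU u))) :=
      eq_sub_of_add_eq h5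
    rw [h6] at h3
    simp only [defect, ad_apply, LinearMap.coe_mk, AddHom.coe_mk, LinearMap.sub_apply,
      LinearMap.add_apply, LinearMap.comp_apply, LinearMap.zero_apply, map_sub, map_add, map_zero,
      LinearMap.comp_zero, LinearMap.zero_comp]
    refine sub_eq_zero.1 (Eq.trans ?_ (sub_eq_zero.2 h3))
    abel
  rw [← ker_defect_eq i₁ i₂ i₃ n₁ n₂ hU hW h] at hmem
  obtain ⟨⟨X', Y', Z'⟩, ⟨hX', hY', hZ'⟩, _, ⟨T, rfl⟩, hsum⟩ := Submodule.mem_sup.1 hmem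
  obtain ⟨hXT, hYT, -⟩ : X' + T = X ∧ Y' + T = Y ∧ Z' + T = 0 := by
    simpa [Prod.ext_iff] using hsum
  have hX'' : ∀ u, aW (X' u) = X' (aU u) := fun u => by
    have : ad aW aU X' = 0 := hX'
    exact LinearMap.congr_fun (sub_eq_zero.1 this) u
  have hY'' : ∀ u, bW (Y' u) = Y' (bU u) := fun u => by
    have : ad bW bU Y' = 0 := hY'
    exact LinearMap.congr_fun (sub_eq_zero.1 this) u
  have hπι : ∀ w, π (ι w) = 0 := fun w =>
    LinearMap.mem_ker.1 (hex ▸ (⟨w, rfl⟩ : ι w ∈ LinearMap.range ι))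
  refine ⟨sc + ι ∘ₗ T, ?_, mem_intertwiners.2 ⟨?_, ?_⟩⟩
  · rw [LinearMap.comp_add, hc]
    ext u
    simp [hπι]
  · ext u
    have := ha₁ u
    rw [← hXT] at this
    simp only [LinearMap.comp_apply, LinearMap.add_apply, map_add, hι₁, hX''] at this ⊢
    rw [add_left_comm] at this
    rw [add_left_comm (sc _)] at this
    exact add_left_cancel this
  · ext u
    have := hb₁ u
    rw [← hYT] at this
    simp only [LinearMap.comp_apply, LinearMap.add_apply, map_add, hι₂, hY''] at this ⊢
    rw [add_left_comm] at this
    rw [add_left_comm (sc _)] at this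
    exact add_left_cancel this

/-- A negative Euler form gives a non-split extension. -/
theorem exists_nonsplit_extension (i₁ : Function.Injective r₁) (i₂ : Function.Injective r₂)
    (i₃ : Function.Injective r₃)
    {aU bU : Module.End ℂ U} {aW bW : Module.End ℂ W}
    (hU : IsTriple r₁ r₂ r₃ aU bU) (hW : IsTriple r₁ r₂ r₃ aW bW)
    (h : eulerForm r₁ r₂ r₃ aU bU aW bW < 0) :
    ∃ aV bV : Module.End ℂ (W × U), IsTriple r₁ r₂ r₃ aV bV ∧
      (∀ w, aV (w, 0) = (aW w, 0)) ∧ (∀ w, bV (w, 0) = (bW w, 0)) ∧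
      (∀ v, (aV v).2 = aU v.2) ∧ (∀ v, (bV v).2 = bU v.2) ∧
      ∀ s : U →ₗ[ℂ] W × U, LinearMap.snd ℂ W U ∘ₗ s = LinearMap.id →
        s ∉ intertwiners aU bU aV bV := by
  obtain ⟨⟨X, Y, Z⟩, ht, hns⟩ := exists_mem_ker_defect i₁ i₂ i₃ hU hW h
  have hmul : blockExt bW bU Y * blockExt aW aU X = blockExt (bW * aW) (bU * aU) Z := by
    refine LinearMap.ext fun ⟨w, u⟩ => ?_
    have := LinearMap.congr_fun (LinearMap.mem_ker.1 ht) u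
    simp only [defect, ad_apply, LinearMap.coe_mk, AddHom.coe_mk, LinearMap.sub_apply,
      LinearMap.add_apply, LinearMap.comp_apply, LinearMap.zero_apply, map_sub,
      Module.End.mul_apply] at this
    rw [Module.End.mul_apply, blockExt_apply, blockExt_apply, blockExt_apply]
    simp only [map_sub, Module.End.mul_apply]
    refine Prod.ext ?_ rfl
    change bW (aW w) - (bW (aW (X u)) - bW (X (aU u))) - (bW (Y (aU u)) - Y (bU (aU u))) =
      bW (aW w) - (bW (aW (Z u)) - Z (bU (aU u)))
    refine sub_eq_zero.1 (Eq.trans ?_ this)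
    abel
  refine ⟨blockExt aW aU X, blockExt bW bU Y, ⟨aeval_blockExt_eq_zero X hW.ha hU.ha, aeval_blockExt_eq_zero Y hW.hb hU.hb, ?_⟩,
    fun w => by simp [blockExt_apply], fun w => by simp [blockExt_apply], fun v => rfl, fun v => rfl, ?_⟩
  · rw [hmul]; exact aeval_blockExt_eq_zero Z hW.hc hU.hc
  · intro s hs hint
    obtain ⟨hsa, hsb⟩ := mem_intertwiners.1 hint
    apply hns
    have hs2 : ∀ u, (s u).2 = u := fun u => LinearMap.congr_fun hs u
    let R : U →ₗ[ℂ] W := LinearMap.fst ℂ W U ∘ₗ s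
    have hsR : ∀ u, s u = (R u, u) := fun u => Prod.ext rfl (hs2 u)
    have key : ∀ S T X, blockExt S T X ∘ₗ s = s ∘ₗ T → X - R ∈ LinearMap.ker (ad S T) := by
      intro S T X hST
      rw [LinearMap.mem_ker]
      ext u
      have h1 := LinearMap.congr_fun hST u
      rw [LinearMap.comp_apply, LinearMap.comp_apply, hsR, hsR, blockExt_apply] at h1
      have h2 := congrArg Prod.fst h1
      simp only [ad_apply, LinearMap.sub_apply, LinearMap.comp_apply, map_sub,
        LinearMap.zero_apply] at h2 ⊢
      refine sub_eq_zero.1 (Eq.trans ?_ (sub_eq_zero.2 h2.symm))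
      abel
    refine Submodule.mem_sup.2 ⟨(X - R, Y - R, Z - R), ⟨key _ _ _ hsa, key _ _ _ hsb, key _ _ _ ?_⟩,
      (R, R, R), ⟨R, rfl⟩, by simp⟩
    rw [← hmul, Module.End.mul_eq_comp, LinearMap.comp_assoc, hsa, ← LinearMap.comp_assoc, hsb]
    rfl

end rigidity

/-! ### Extensions of simple modules and complete reducibility -/

section lattice

variable {α : Type*} [Lattice α] [BoundedOrder α] [IsModularLattice α] [WellFoundedLT α]
  [WellFoundedGT α]

omit [BoundedOrder α] in
theorem exists_relCompl_of_covBy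
    (h : ∀ a b c : α, a ⋖ b → b ⋖ c → ∃ d, b ⊓ d = a ∧ b ⊔ d = c) {M L : α} (hML : M ⋖ L)
    (N : α) (hN : N ≤ M) : ∃ D, M ⊓ D = N ∧ M ⊔ D = L := by
  induction N using WellFoundedGT.induction with
  | ind N ih =>
  rcases hN.eq_or_lt with rfl | hlt
  · exact ⟨L, inf_eq_left.2 hML.le, sup_eq_right.2 hML.le⟩
  obtain ⟨W, hNW, hWM⟩ := exists_covBy_le_of_lt hlt
  obtain ⟨D, hD1, hD2⟩ := ih W hNW.lt hWM
  have hWD : W ⋖ D := by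
    rw [← hD1]; exact inf_covBy_of_covBy_sup_left (hD2.symm ▸ hML)
  obtain ⟨U, hU1, hU2⟩ := h N W D hNW hWD
  refine ⟨U, ?_, ?_⟩
  · have hUD : U ≤ D := hU2 ▸ le_sup_right
    rw [← inf_eq_right.2 hUD, ← inf_assoc, hD1, hU1]
  · rw [← hD2, ← hU2, ← sup_assoc, sup_eq_left.2 hWM]

/-- A modular lattice of finite length is complemented if its intervals of length two are. -/
theorem complementedLattice_of_covBy
    (h : ∀ a b c : α, a ⋖ b → b ⋖ c → ∃ d, b ⊓ d = a ∧ b ⊔ d = c) : ComplementedLattice α := by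
  have key : ∀ L P : α, P ≤ L → ∃ D, P ⊓ D = ⊥ ∧ P ⊔ D = L := by
    intro L
    induction L using WellFoundedLT.induction with
    | ind L ih =>
    intro P hP
    rcases hP.eq_or_lt with rfl | hlt
    · exact ⟨⊥, inf_bot_eq _, sup_bot_eq _⟩
    obtain ⟨M, hPM, hML⟩ := exists_le_covBy_of_lt hlt
    obtain ⟨D, hD1, hD2⟩ := ih M hML.lt P hPM
    obtain ⟨U, hU1, hU2⟩ := exists_relCompl_of_covBy h hML ⊥ bot_le
    refine ⟨D ⊔ U, ?_, ?_⟩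
    · have hDM : D ≤ M := hD2 ▸ le_sup_right
      rw [← inf_eq_left.2 hPM, inf_assoc, inf_comm M, sup_inf_assoc_of_le _ hDM, inf_comm U, hU1,
        sup_bot_eq, hD1]
    · rw [← sup_assoc, hD2, hU2]
  refine ⟨fun P => ?_⟩
  obtain ⟨D, h1, h2⟩ := key ⊤ P le_top
  exact ⟨D, disjoint_iff.2 h1, codisjoint_iff.2 h2⟩

end lattice

section modules

variable {n : ℕ} {x : Fin n → ℂ} {E : Type*} [Ring E] [Algebra ℂ E] {a b : E}

/-- The action of an element of an algebra on a module, as a linear endomorphism over `ℂ`. -/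
abbrev act (V : Type*) [AddCommGroup V] [Module ℂ V] [Module E V] [IsScalarTower ℂ E V] (e : E) :
    Module.End ℂ V :=
  Algebra.lsmul ℂ ℂ V e

theorem aeval_act {V : Type*} [AddCommGroup V] [Module ℂ V] [Module E V] [IsScalarTower ℂ E V]
    (e : E) {p : ℂ[X]} (h : aeval e p = 0) : aeval (act V e) p = 0 := by
  rw [act, aeval_algHom_apply, h, map_zero]

variable {U V W : Type*} [AddCommGroup U] [Module ℂ U] [Module E U] [IsScalarTower ℂ E U]
  [AddCommGroup W] [Module ℂ W] [Module E W] [IsScalarTower ℂ E W]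
  [AddCommGroup V] [Module ℂ V] [Module E V] [IsScalarTower ℂ E V]

theorem restrictScalars_mem_intertwiners (φ : U →ₗ[E] W) :
    φ.restrictScalars ℂ ∈ intertwiners (act U a) (act U (a * b)) (act W a) (act W (a * b)) :=
  mem_intertwiners.2 ⟨LinearMap.ext fun u => (φ.map_smul a u).symm,
    LinearMap.ext fun u => (φ.map_smul (a * b) u).symm⟩

/-- A linear map that commutes with `a` and `a b` is a homomorphism of modules over the algebra
generated by `a` and `b`. -/
theorem exists_linearMap_of_mem_intertwiners (hab : Algebra.adjoin ℂ {a, b} = ⊤) (hu : IsUnit a)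
    {X : U →ₗ[ℂ] W}
    (hX : X ∈ intertwiners (act U a) (act U (a * b)) (act W a) (act W (a * b))) :
    ∃ φ : U →ₗ[E] W, φ.restrictScalars ℂ = X := by
  obtain ⟨h1, h2⟩ := mem_intertwiners.1 hX
  have h1' : ∀ u, X (a • u) = a • X u := fun u => (LinearMap.congr_fun h1 u).symm
  have h2' : ∀ u, X ((a * b) • u) = (a * b) • X u := fun u => (LinearMap.congr_fun h2 u).symm
  let S : Subalgebra ℂ E :=
    { carrier := {e | ∀ u, X (e • u) = e • X u}
      mul_mem' := fun {e f} he hf u => by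
        change X ((e * f) • u) = (e * f) • X u
        rw [mul_smul, mul_smul, he, hf]
      one_mem' := fun u => by rw [one_smul, one_smul]
      add_mem' := fun {e f} he hf u => by rw [add_smul, map_add, he, hf, add_smul]
      zero_mem' := fun u => by rw [zero_smul, zero_smul, map_zero]
      algebraMap_mem' := fun c u => by rw [algebraMap_smul, algebraMap_smul, map_smul] }
  have hb : b ∈ S := by
    intro u
    obtain ⟨v, rfl⟩ := hu
    have h3 := h2' u
    rw [mul_smul, h1', mul_smul] at h3
    have h4 := congrArg (fun w => (↑v⁻¹ : E) • w) h3
    simpa only [← mul_smul, v.inv_mul, ← mul_assoc, one_mul, one_smul] using h4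
  exact ⟨{ toFun := X, map_add' := map_add X,
           map_smul' := adjoin_pair_induction hab (S := S) h1' hb }, rfl⟩

theorem exists_scalar_of_central [IsSimpleModule E U] [FiniteDimensional ℂ U] {z : E}
    (hz : ∀ e, z * e = e * z) : ∃ ζ : ℂ, ∀ u : U, z • u = ζ • u := by
  let f : Module.End E U :=
    { toFun := fun u => z • u, map_add' := smul_add z,
      map_smul' := fun e u => by rw [RingHom.id_apply, ← mul_smul, hz, mul_smul] }
  obtain ⟨ζ, hζ⟩ := (IsSimpleModule.algebraMap_end_bijective_of_isAlgClosed ℂ).2 f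
  exact ⟨ζ, fun u => (LinearMap.congr_fun hζ u).symm⟩

omit [Algebra ℂ E] [Module ℂ U] [IsScalarTower ℂ E U] [Module ℂ W] [IsScalarTower ℂ E W]
  [Module ℂ V] [IsScalarTower ℂ E V] in
theorem exists_comp_eq_of_ker_le {f : V →ₗ[E] U} (hf : Function.Surjective f) {g : V →ₗ[E] W}
    (h : ∀ v, f v = 0 → g v = 0) : ∃ s : U →ₗ[E] W, ∀ v, s (f v) = g v := by
  refine ⟨(LinearMap.ker f).liftQ g (fun v hv => h v hv) ∘ₗ
    (f.quotKerEquivOfSurjective hf).symm, fun v => ?_⟩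
  have : (f.quotKerEquivOfSurjective hf).symm (f v) = Submodule.Quotient.mk v := by
    rw [LinearEquiv.symm_apply_eq]; rfl
  rw [LinearMap.comp_apply, LinearEquiv.coe_coe, this]
  rfl

/-- Extensions of modules on which a central element acts by different scalars split. -/
theorem exists_section_of_central_ne {z : E} (hz : ∀ e, z * e = e * z) {ζ ζ' : ℂ} (hne : ζ ≠ ζ')
    {ι : W →ₗ[E] V} {π : V →ₗ[E] U} (hπ : Function.Surjective π)
    (hex : LinearMap.range ι = LinearMap.ker π) (hW : ∀ w : W, z • w = ζ • w)
    (hU : ∀ u : U, z • u = ζ' • u) : ∃ s : U →ₗ[E] V, π ∘ₗ s = LinearMap.id := by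
  let g : V →ₗ[E] V :=
    { toFun := fun v => (ζ' - ζ)⁻¹ • (z • v - ζ • v)
      map_add' := fun v w => by simp only [smul_add, smul_sub]; abel
      map_smul' := fun e v => by
        rw [RingHom.id_apply, ← mul_smul, hz, mul_smul, smul_comm ζ e v, ← smul_sub,
          smul_comm _ e] }
  obtain ⟨s, hs⟩ := exists_comp_eq_of_ker_le (g := g) hπ (fun v hv => by
    obtain ⟨w, rfl⟩ : v ∈ LinearMap.range ι := hex ▸ hv
    change (ζ' - ζ)⁻¹ • (z • ι w - ζ • ι w) = 0
    rw [← map_smul, hW, ← algebraMap_smul E ζ w, map_smul, algebraMap_smul, sub_self, smul_zero])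
  refine ⟨s, LinearMap.ext fun u => ?_⟩
  obtain ⟨v, rfl⟩ := hπ u
  rw [LinearMap.comp_apply, hs]
  change π ((ζ' - ζ)⁻¹ • (z • v - ζ • v)) = π v
  rw [← algebraMap_smul E, map_smul, map_sub, map_smul, hU, ← algebraMap_smul E ζ v, map_smul,
    algebraMap_smul, algebraMap_smul, ← sub_smul, smul_smul, inv_mul_cancel₀, one_smul]
  exact sub_ne_zero.2 hne.symm

/-- In an extension of simple modules with the same central character `ζ`, the central element
`z = (a b)³` acts by the scalar `ζ`. Otherwise `z - ζ` would induce an isomorphism `θ` of the two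
modules; if `δ` is the derivation defined by the extension, then `T ↦ tr (T⁻¹ δ(T) θ⁻¹)` is
additive on products and vanishes on the diagonalizable elements `a` and `b`, but not on `z`. -/
theorem central_smul_eq (hx : Function.Injective x) (hx0 : ∀ i, x i ≠ 0)
    (hab : Algebra.adjoin ℂ {a, b} = ⊤) (hbr : a * b * a = b * a * b)
    (hpa : aeval a (rootPoly x) = 0) (hpb : aeval b (rootPoly x) = 0)
    [FiniteDimensional ℂ V] [FiniteDimensional ℂ U] [FiniteDimensional ℂ W]
    [IsSimpleModule E U] [IsSimpleModule E W] {ζ : ℂ}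
    {ι : W →ₗ[E] V} {π : V →ₗ[E] U} (hι : Function.Injective ι) (hπ : Function.Surjective π)
    (hex : LinearMap.range ι = LinearMap.ker π) (hW : ∀ w : W, (a * b) ^ 3 • w = ζ • w)
    (hU : ∀ u : U, (a * b) ^ 3 • u = ζ • u) (v : V) : (a * b) ^ 3 • v = ζ • v := by
  have hz := braid_cube_central hab hbr
  set z := (a * b) ^ 3 with hzdef
  have hπι : ∀ w, π (ι w) = 0 := fun w =>
    LinearMap.mem_ker.1 (hex ▸ (⟨w, rfl⟩ : ι w ∈ LinearMap.range ι))
  -- the induced map `θ`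
  let ιe := LinearEquiv.ofInjective ι hι
  have hιe : ∀ y : LinearMap.range ι, ι (ιe.symm y) = y := fun y =>
    congrArg Subtype.val (ιe.apply_symm_apply y)
  let g : V →ₗ[E] V :=
    { toFun := fun v => z • v - ζ • v
      map_add' := fun v w => by simp only [smul_add]; abel
      map_smul' := fun e v => by
        rw [RingHom.id_apply, ← mul_smul, hz, mul_smul, smul_comm ζ e v, ← smul_sub] }
  have hg : ∀ v, g v = z • v - ζ • v := fun v => rfl
  have hgι : ∀ w, g (ι w) = 0 := fun w => by
    rw [hg, ← map_smul, hW, sub_eq_zero]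
    exact (ι.restrictScalars ℂ).map_smul ζ w
  have hgr : ∀ v, g v ∈ LinearMap.range ι := fun v => by
    rw [hex, LinearMap.mem_ker, hg, map_sub, map_smul, hU, sub_eq_zero]
    exact ((π.restrictScalars ℂ).map_smul ζ v).symm
  obtain ⟨θ, hθ⟩ := exists_comp_eq_of_ker_le
    (g := (ιe.symm : LinearMap.range ι →ₗ[E] W) ∘ₗ g.codRestrict _ hgr) hπ (fun v hv => by
      obtain ⟨w, rfl⟩ : v ∈ LinearMap.range ι := hex ▸ hv
      have : g.codRestrict _ hgr (ι w) = 0 := Subtype.ext (hgι w)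
      rw [LinearMap.comp_apply, this, map_zero])
  have hθ' : ∀ v, ι (θ (π v)) = z • v - ζ • v := fun v => by
    rw [hθ]; exact hιe _
  rcases LinearMap.bijective_or_eq_zero θ with hbij | h0
  swap
  · have := hθ' v
    rw [h0, LinearMap.zero_apply, map_zero] at this
    exact (sub_eq_zero.1 this.symm)
  exfalso
  let θe := LinearEquiv.ofBijective θ hbij
  let ψ : W →ₗ[ℂ] U := (θe.symm : W →ₗ[E] U).restrictScalars ℂ
  have hψE : ∀ (e : E) w, ψ (e • w) = e • ψ w := fun e w => θe.symm.map_smul e w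
  have hψ : ∀ w, θ (ψ w) = w := fun w => θe.apply_symm_apply w
  obtain ⟨s, hs⟩ := (π.restrictScalars ℂ).exists_rightInverse_of_surjective
    (LinearMap.range_eq_top.2 hπ)
  have hs' : ∀ u, π (s u) = u := fun u => LinearMap.congr_fun hs u
  have lift : ∀ f : U →ₗ[ℂ] V, (∀ u, π (f u) = 0) → ∃ X : U →ₗ[ℂ] W, ∀ u, ι (X u) = f u := by
    intro f hf
    have hmem : ∀ u, f u ∈ (LinearMap.range ι).restrictScalars ℂ := fun u =>
      show f u ∈ LinearMap.range ι by rw [hex]; exact hf u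
    exact ⟨((ιe.symm : LinearMap.range ι →ₗ[E] W).restrictScalars ℂ) ∘ₗ f.codRestrict _ hmem,
      fun u => hιe ⟨f u, hmem u⟩⟩
  -- the derivation
  have hδ : ∀ T : E, ∃ X : U →ₗ[ℂ] W, ∀ u, ι (X u) = T • s u - s (T • u) := fun T =>
    lift (act V T ∘ₗ s - s ∘ₗ act U T) (fun u => by
      change π (T • s u - s (T • u)) = 0
      rw [map_sub, map_smul, hs', hs', sub_self])
  choose δ hδ using hδ
  have hδmul : ∀ T T' u, δ (T * T') u = T • δ T' u + δ T (T' • u) := by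
    intro T T' u
    apply hι
    rw [map_add, map_smul, hδ, hδ, hδ, smul_sub, ← mul_smul, ← mul_smul]
    abel
  let lam : Eˣ → ℂ := fun T => LinearMap.trace ℂ W (act W (↑T⁻¹ : E) ∘ₗ δ T ∘ₗ ψ)
  have hlam_mul : ∀ T T', lam (T * T') = lam T + lam T' := by
    intro T T'
    have h1 : act W (↑(T * T')⁻¹ : E) ∘ₗ δ ↑(T * T') ∘ₗ ψ =
        act W (↑T'⁻¹ : E) ∘ₗ (act W (↑T⁻¹ : E) ∘ₗ δ T ∘ₗ ψ) ∘ₗ act W (T' : E) +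
          act W (↑T'⁻¹ : E) ∘ₗ δ T' ∘ₗ ψ := by
      ext w
      simp only [LinearMap.comp_apply, LinearMap.add_apply, Algebra.lsmul_coe, hψE]
      rw [Units.val_mul, hδmul, mul_inv_rev, Units.val_mul, mul_smul, smul_add, smul_add,
        ← mul_smul _ (T : E), T.inv_mul, one_smul, add_comm]
    change LinearMap.trace ℂ W _ = _
    rw [h1, map_add, LinearMap.trace_comp_comm', LinearMap.comp_assoc]
    congr 2
    have : act W (T' : E) ∘ₗ act W (↑T'⁻¹ : E) = LinearMap.id := by
      ext w
      simp only [LinearMap.comp_apply, Algebra.lsmul_coe, ← mul_smul, T'.mul_inv, one_smul,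
        LinearMap.id_apply]
    rw [this, LinearMap.comp_id]
  have hlam_zero : ∀ T : Eˣ, aeval (T : E) (rootPoly x) = 0 → lam T = 0 := by
    intro T hT
    obtain ⟨t, ht1, ht2⟩ := exists_section (U := U) hx (aeval_act (V := V) _ hT)
      (π := π.restrictScalars ℂ) (S := act U (T : E)) hπ
      (LinearMap.ext fun v => (π.map_smul (T : E) v).symm)
    obtain ⟨X, hX⟩ := lift (s - t) (fun u => by
      have h1 : π (t u) = u := LinearMap.congr_fun ht1 u
      rw [LinearMap.sub_apply, map_sub, hs', h1, sub_self])
    have ht2' : ∀ u, (T : E) • t u = t ((T : E) • u) := fun u => LinearMap.congr_fun ht2 u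
    have hδT : ∀ u, δ T u = (T : E) • X u - X ((T : E) • u) := by
      intro u
      apply hι
      rw [hδ, map_sub ι, map_smul ι, hX, hX, LinearMap.sub_apply, LinearMap.sub_apply, smul_sub, ht2']
      abel
    have h1 : act W (↑T⁻¹ : E) ∘ₗ δ T ∘ₗ ψ =
        X ∘ₗ ψ - act W (↑T⁻¹ : E) ∘ₗ (X ∘ₗ ψ) ∘ₗ act W (T : E) := by
      ext w
      simp only [LinearMap.comp_apply, LinearMap.sub_apply, Algebra.lsmul_coe, hψE]
      rw [hδT, smul_sub, ← mul_smul, T.inv_mul, one_smul]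
    change LinearMap.trace ℂ W _ = 0
    rw [h1, map_sub, LinearMap.trace_comp_comm' ((X ∘ₗ ψ) ∘ₗ act W (T : E)), LinearMap.comp_assoc]
    have : act W (T : E) ∘ₗ act W (↑T⁻¹ : E) = LinearMap.id := by
      ext w
      simp only [LinearMap.comp_apply, Algebra.lsmul_coe, ← mul_smul, T.mul_inv, one_smul,
        LinearMap.id_apply]
    rw [this, LinearMap.comp_id, sub_self]
  obtain ⟨ua, hua⟩ := exists_unit_of_aeval (polyP_eval_zero_ne hx0) hpa
  obtain ⟨ub, hub⟩ := exists_unit_of_aeval (polyP_eval_zero_ne hx0) hpb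
  have hl0 : lam ((ua * ub) ^ 3) = 0 := by
    rw [pow_succ, pow_two, hlam_mul, hlam_mul, hlam_mul, hlam_zero ua (hua ▸ hpa),
      hlam_zero ub (hub ▸ hpb)]
    simp
  have hzu : ((((ua * ub) ^ 3 : Eˣ)) : E) = z := by
    rw [Units.val_pow_eq_pow_val, Units.val_mul, hua, hub]
  have hδz : ∀ u, δ z u = θ u := by
    intro u
    apply hι
    have h2 := hθ' (s u)
    rw [hs'] at h2
    rw [hδ, h2, hU, map_smul]
  have hζ : ζ ≠ 0 := by
    rintro rfl
    have : Nontrivial W := IsSimpleModule.nontrivial E W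
    obtain ⟨w, hw⟩ := exists_ne (0 : W)
    have h3 := hW w
    rw [zero_smul, ← hzu] at h3
    exact hw ((smul_eq_zero_iff_eq ((ua * ub) ^ 3)).1 h3)
  have hl1 : lam ((ua * ub) ^ 3) = ζ⁻¹ * Module.finrank ℂ W := by
    have h1 : act W (↑((ua * ub) ^ 3)⁻¹ : E) ∘ₗ δ ↑((ua * ub) ^ 3) ∘ₗ ψ = ζ⁻¹ • LinearMap.id := by
      ext w
      simp only [LinearMap.comp_apply, Algebra.lsmul_coe, LinearMap.smul_apply, LinearMap.id_apply]
      rw [hzu, hδz, hψ]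
      have h3 := hW (ζ⁻¹ • w)
      rw [smul_smul, mul_inv_cancel₀ hζ, one_smul] at h3
      conv_lhs => rw [← h3]
      rw [← hzu, ← mul_smul, Units.inv_mul, one_smul]
    change LinearMap.trace ℂ W _ = _
    rw [h1, map_smul, LinearMap.trace_id, smul_eq_mul]
  have : Nontrivial W := IsSimpleModule.nontrivial E W
  have hW0 : Module.finrank ℂ W ≠ 0 := Module.finrank_pos.ne'
  rw [hl0] at hl1
  exact (mul_ne_zero (inv_ne_zero hζ) (Nat.cast_ne_zero.2 hW0)) hl1.symm

end modules

/-! ### Eigenvalue multiplicities of simple modules -/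

section numerics

theorem mul_pred_nonneg (a t : ℤ) : 0 ≤ (a - t) * (a - t - 1) := by
  rcases le_or_gt a t with h | h
  · nlinarith
  · nlinarith

theorem sum_mul_pred {ι : Type*} [Fintype ι] (f : ι → ℕ) (t : ℤ) :
    ∑ i, ((f i : ℤ) - t) * ((f i : ℤ) - t - 1) =
      ∑ i, (f i : ℤ) ^ 2 - (2 * t + 1) * ∑ i, (f i : ℤ) + Fintype.card ι * (t * (t + 1)) := by
  have : ∀ i, ((f i : ℤ) - t) * ((f i : ℤ) - t - 1) =
      (f i : ℤ) ^ 2 - (2 * t + 1) * f i + t * (t + 1) := fun i => by ring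
  simp only [this, Finset.sum_add_distrib, Finset.sum_sub_distrib, ← Finset.mul_sum,
    Finset.sum_const, Finset.card_univ, nsmul_eq_mul]
  ring

theorem eq_or_eq_of_sum_mul_pred {ι : Type*} [Fintype ι] {f : ι → ℕ} {t : ℤ}
    (h : ∑ i, ((f i : ℤ) - t) * ((f i : ℤ) - t - 1) ≤ 0) (i : ι) : (f i : ℤ) = t ∨ (f i : ℤ) = t + 1 := by
  have h0 := (Finset.sum_eq_zero_iff_of_nonneg fun i _ => mul_pred_nonneg (f i : ℤ) t).1
    (le_antisymm h (Finset.sum_nonneg fun i _ => mul_pred_nonneg (f i : ℤ) t)) i (Finset.mem_univ i)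
  rcases mul_eq_zero.1 h0 with h1 | h1
  · left; linarith
  · right; linarith

variable {n : ℕ}

/-- Multiplicities of at most five, three and two eigenvalues with the same sum `d` have
`∑ m² + ∑ p² + ∑ q² ≥ (1/5 + 1/3 + 1/2) d² > d²`. -/
theorem thirty_mul_le (hn : n ≤ 5) {d : ℕ} {m : Fin n → ℕ} {p : Fin 3 → ℕ} {q : Fin 2 → ℕ}
    (hm : ∑ i, m i = d) (hp : ∑ i, p i = d) (hq : ∑ i, q i = d) :
    31 * d ^ 2 ≤ 30 * (∑ i, m i ^ 2 + ∑ i, p i ^ 2 + ∑ i, q i ^ 2) := by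
  have h1 := sq_sum_le_card_mul_sum_sq (s := Finset.univ) (f := m)
  have h2 := sq_sum_le_card_mul_sum_sq (s := Finset.univ) (f := p)
  have h3 := sq_sum_le_card_mul_sum_sq (s := Finset.univ) (f := q)
  rw [hm, Finset.card_univ, Fintype.card_fin] at h1
  rw [hp, Finset.card_univ, Fintype.card_fin] at h2
  rw [hq, Finset.card_univ, Fintype.card_fin] at h3
  have h4 : n * ∑ i, m i ^ 2 ≤ 5 * ∑ i, m i ^ 2 := Nat.mul_le_mul_right _ hn
  push_cast at *
  omega

/-- If the norm of a dimension vector is two, then the multiplicities are as equal as possible. -/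
theorem shape_of_norm_two (hn : n ≤ 5) {d : ℕ} (hd : 0 < d) {m : Fin n → ℕ} {p : Fin 3 → ℕ}
    {q : Fin 2 → ℕ} (hm : ∑ i, m i = d) (hp : ∑ i, p i = d) (hq : ∑ i, q i = d)
    (h : ∑ i, m i ^ 2 + ∑ i, p i ^ 2 + ∑ i, q i ^ 2 = d ^ 2 + 2) :
    d ≤ 6 ∧ (d ≤ 5 → ∀ i, m i ≤ 1) ∧ (d = 6 → n = 5 ∧ ∀ i, 1 ≤ m i ∧ m i ≤ 2) ∧
      (∀ j, d / 3 ≤ p j ∧ p j ≤ d / 3 + 1) ∧ (∀ j, d / 2 ≤ q j ∧ q j ≤ d / 2 + 1) := by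
  have h1 := thirty_mul_le hn hm hp hq
  rw [h] at h1
  have hd7 : d ≤ 7 := by nlinarith
  zify at hm hp hq h
  have key : ∀ s t u : ℤ,
      ∑ i, ((m i : ℤ) - s) * ((m i : ℤ) - s - 1) + ∑ i, ((p i : ℤ) - t) * ((p i : ℤ) - t - 1) +
        ∑ i, ((q i : ℤ) - u) * ((q i : ℤ) - u - 1) =
      (d : ℤ) ^ 2 + 2 - (2 * s + 2 * t + 2 * u + 3) * d + n * (s * (s + 1)) + 3 * (t * (t + 1)) +
        2 * (u * (u + 1)) := by
    intro s t u
    rw [sum_mul_pred, sum_mul_pred, sum_mul_pred, hm, hp, hq]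
    simp only [Fintype.card_fin]
    push_cast
    linear_combination h
  have nn : ∀ {ι : Type} [Fintype ι] (f : ι → ℕ) (t : ℤ),
      0 ≤ ∑ i, ((f i : ℤ) - t) * ((f i : ℤ) - t - 1) :=
    fun f t => Finset.sum_nonneg fun i _ => mul_pred_nonneg _ _
  have fin : ∀ s t u : ℤ, (d : ℤ) ^ 2 + 2 - (2 * s + 2 * t + 2 * u + 3) * d + n * (s * (s + 1)) +
      3 * (t * (t + 1)) + 2 * (u * (u + 1)) ≤ 0 →
      (∀ i, (m i : ℤ) = s ∨ (m i : ℤ) = s + 1) ∧ (∀ i, (p i : ℤ) = t ∨ (p i : ℤ) = t + 1) ∧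
        (∀ i, (q i : ℤ) = u ∨ (q i : ℤ) = u + 1) := by
    intro s t u hle
    rw [← key] at hle
    have a1 := nn m s
    have a2 := nn p t
    have a3 := nn q u
    exact ⟨eq_or_eq_of_sum_mul_pred (by linarith), eq_or_eq_of_sum_mul_pred (by linarith),
      eq_or_eq_of_sum_mul_pred (by linarith)⟩
  have neg : ∀ s t u : ℤ, 0 ≤ (d : ℤ) ^ 2 + 2 - (2 * s + 2 * t + 2 * u + 3) * d +
      n * (s * (s + 1)) + 3 * (t * (t + 1)) + 2 * (u * (u + 1)) := by
    intro s t u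
    rw [← key]
    linarith [nn m s, nn p t, nn q u]
  interval_cases d
  · obtain ⟨h1, h2, h3⟩ := fin 0 0 0 (by norm_num)
    refine ⟨by norm_num, fun _ i => ?_, by norm_num, fun j => ?_, fun j => ?_⟩
    · have := h1 i; omega
    · have := h2 j; omega
    · have := h3 j; omega
  · obtain ⟨h1, h2, h3⟩ := fin 0 0 1 (by norm_num)
    refine ⟨by norm_num, fun _ i => ?_, by norm_num, fun j => ?_, fun j => ?_⟩
    · have := h1 i; omega
    · have := h2 j; omega
    · have := h3 j; omega
  · obtain ⟨h1, h2, h3⟩ := fin 0 1 1 (by norm_num)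
    refine ⟨by norm_num, fun _ i => ?_, by norm_num, fun j => ?_, fun j => ?_⟩
    · have := h1 i; omega
    · have := h2 j; omega
    · have := h3 j; omega
  · obtain ⟨h1, h2, h3⟩ := fin 0 1 2 (by norm_num)
    refine ⟨by norm_num, fun _ i => ?_, by norm_num, fun j => ?_, fun j => ?_⟩
    · have := h1 i; omega
    · have := h2 j; omega
    · have := h3 j; omega
  · obtain ⟨h1, h2, h3⟩ := fin 0 1 2 (by norm_num)
    refine ⟨by norm_num, fun _ i => ?_, by norm_num, fun j => ?_, fun j => ?_⟩
    · have := h1 i; omega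
    · have := h2 j; omega
    · have := h3 j; omega
  · have hn5 : n = 5 := by
      have := neg 1 2 3
      push_cast at this
      omega
    obtain ⟨h1, h2, h3⟩ := fin 1 2 3 (by rw [hn5]; norm_num)
    refine ⟨by norm_num, by norm_num, fun _ => ⟨hn5, fun i => ?_⟩, fun j => ?_, fun j => ?_⟩
    · have := h1 i; omega
    · have := h2 j; omega
    · have := h3 j; omega
  · exfalso
    have a1 := nn m 1
    have a2 := nn p 2
    have a3 := nn q 3
    have := key 1 2 3
    push_cast at this
    -- here `n ≤ 5` bounds the constant term
    have := neg 1 2 3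
    push_cast at this
    omega

/-- A primitive third root of unity. -/
noncomputable def omega : ℂ := Complex.exp (2 * Real.pi * Complex.I / 3)

theorem omega_isPrimitiveRoot : IsPrimitiveRoot omega 3 := by
  simpa [omega] using Complex.isPrimitiveRoot_exp 3 (by norm_num)

theorem omega_sq_add : omega ^ 2 + omega + 1 = 0 := by
  have h := omega_isPrimitiveRoot.geom_sum_eq_zero (by norm_num)
  simp only [Finset.sum_range_succ, Finset.sum_range_zero, pow_zero, pow_one] at h
  linear_combination h

/-- The multiplicities `p` of the eigenvalues `τ² ω^{2j}` of `a b`, the multiplicities `q` of the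
eigenvalues `±τ³` of `a b a`, and the determinant `e` of `a`, in a `d`-dimensional representation
in which the former are as equal as possible. -/
structure IsBalanced (τ : ℂ) (d : ℕ) (p : Fin 3 → ℕ) (q : Fin 2 → ℕ) (e : ℂ) : Prop where
  sum_p : ∑ j, p j = d
  sum_q : ∑ j, q j = d
  bound_p : ∀ j, d / 3 ≤ p j ∧ p j ≤ d / 3 + 1
  bound_q : ∀ j, d / 2 ≤ q j ∧ q j ≤ d / 2 + 1
  det : e = τ ^ d * (-1) ^ q 1 * omega ^ (p 1 + 2 * p 2)

/-- The part of the Euler form that comes from `a b` and `a b a`. -/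
def pairing (p p' : Fin 3 → ℕ) (q q' : Fin 2 → ℕ) : ℕ := ∑ j, p j * p' j + ∑ j, q j * q' j

variable {τ e e' : ℂ} {p p' : Fin 3 → ℕ} {q q' : Fin 2 → ℕ}

theorem IsBalanced.cases_q {d : ℕ} (h : IsBalanced τ d p q e) :
    (d % 2 = 0 ∧ q = ![d / 2, d / 2]) ∨
      (d % 2 = 1 ∧ (q = ![d / 2, d / 2 + 1] ∨ q = ![d / 2 + 1, d / 2])) := by
  have h1 := h.sum_q
  have h2 := h.bound_q 0
  have h3 := h.bound_q 1
  rw [Fin.sum_univ_two] at h1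
  have : (d % 2 = 0 ∧ q 0 = d / 2 ∧ q 1 = d / 2) ∨ (d % 2 = 1 ∧ ((q 0 = d / 2 ∧ q 1 = d / 2 + 1) ∨
    (q 0 = d / 2 + 1 ∧ q 1 = d / 2))) := by omega
  rcases this with ⟨h0, h4, h5⟩ | ⟨h0, ⟨h4, h5⟩ | ⟨h4, h5⟩⟩
  · left; refine ⟨h0, ?_⟩; ext j; fin_cases j <;> simp [h4, h5]
  · right; refine ⟨h0, Or.inl ?_⟩; ext j; fin_cases j <;> simp [h4, h5]
  · right; refine ⟨h0, Or.inr ?_⟩; ext j; fin_cases j <;> simp [h4, h5]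

theorem IsBalanced.cases_p {d : ℕ} (h : IsBalanced τ d p q e) :
    (d % 3 = 0 ∧ p = ![d / 3, d / 3, d / 3]) ∨
      (d % 3 = 1 ∧ (p = ![d / 3 + 1, d / 3, d / 3] ∨ p = ![d / 3, d / 3 + 1, d / 3] ∨
        p = ![d / 3, d / 3, d / 3 + 1])) ∨
      (d % 3 = 2 ∧ (p = ![d / 3, d / 3 + 1, d / 3 + 1] ∨ p = ![d / 3 + 1, d / 3, d / 3 + 1] ∨
        p = ![d / 3 + 1, d / 3 + 1, d / 3])) := by
  have h1 := h.sum_p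
  have h2 := h.bound_p 0
  have h3 := h.bound_p 1
  have h4 := h.bound_p 2
  rw [Fin.sum_univ_three] at h1
  have key : ∀ {a b c : ℕ}, p 0 = a → p 1 = b → p 2 = c → p = ![a, b, c] := by
    intro a b c ha hb hc
    ext j; fin_cases j <;> simp [ha, hb, hc]
  have h5 : p 0 = d / 3 ∨ p 0 = d / 3 + 1 := by omega
  have h6 : p 1 = d / 3 ∨ p 1 = d / 3 + 1 := by omega
  have h7 : p 2 = d / 3 ∨ p 2 = d / 3 + 1 := by omega
  rcases h5 with h5 | h5 <;> rcases h6 with h6 | h6 <;> rcases h7 with h7 | h7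
  · exact Or.inl ⟨by omega, key h5 h6 h7⟩
  · exact Or.inr (Or.inl ⟨by omega, Or.inr (Or.inr (key h5 h6 h7))⟩)
  · exact Or.inr (Or.inl ⟨by omega, Or.inr (Or.inl (key h5 h6 h7))⟩)
  · exact Or.inr (Or.inr ⟨by omega, Or.inl (key h5 h6 h7)⟩)
  · exact Or.inr (Or.inl ⟨by omega, Or.inl (key h5 h6 h7)⟩)
  · exact Or.inr (Or.inr ⟨by omega, Or.inr (Or.inl (key h5 h6 h7))⟩)
  · exact Or.inr (Or.inr ⟨by omega, Or.inr (Or.inr (key h5 h6 h7))⟩)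
  · omega

theorem IsBalanced.det_ne_zero (hτ : τ ≠ 0) {d : ℕ} (h : IsBalanced τ d p q e) : e ≠ 0 := by
  rw [h.det]
  exact mul_ne_zero (mul_ne_zero (pow_ne_zero _ hτ) (pow_ne_zero _ (by norm_num)))
    (pow_ne_zero _ (omega_isPrimitiveRoot.ne_zero (by norm_num)))

/-- For dimensions with `d + d' ≤ 5`, where `m` and `m'` have disjoint supports, the Euler form is `-1`
if the pairing is `d d' - 1`. For `d + d' = 6` the supports share one element and the critical
value is `d d' - 2`. In each case this amounts to a relation between the two determinants, proved
by going through all possible multiplicities. -/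
theorem pairing_eq_iff_1_1 (hτ : τ ≠ 0) (h : IsBalanced τ 1 p q e)
    (h' : IsBalanced τ 1 p' q' e') : pairing p p' q q' = 0 ↔ e ^ 2 - e * e' + e' ^ 2 = 0 := by
  obtain ⟨t, ht⟩ : ∃ t, τ * t = 1 := ⟨τ⁻¹, mul_inv_cancel₀ hτ⟩
  have hω := omega_sq_add
  have he := h.det
  have he' := h'.det
  rcases h.cases_p with ⟨h1, hp⟩ | ⟨h1, hp | hp | hp⟩ | ⟨h1, hp | hp | hp⟩ <;>
  first
  | (exfalso; omega)
  | (rcases h'.cases_p with ⟨h2, hp'⟩ | ⟨h2, hp' | hp' | hp'⟩ | ⟨h2, hp' | hp' | hp'⟩ <;>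
    first
    | (exfalso; omega)
    | (rcases h.cases_q with ⟨h3, hq⟩ | ⟨h3, hq | hq⟩ <;>
      first
      | (exfalso; omega)
      | (rcases h'.cases_q with ⟨h4, hq'⟩ | ⟨h4, hq' | hq'⟩ <;>
        first
        | (exfalso; omega)
        | (clear h h'; subst hp hp' hq hq'; simp [pairing, Fin.sum_univ_succ] at he he' ⊢; grind))))

theorem pairing_eq_iff_1_2 (hτ : τ ≠ 0) (h : IsBalanced τ 1 p q e)
    (h' : IsBalanced τ 2 p' q' e') : pairing p p' q q' = 1 ↔ e ^ 2 + e' = 0 := by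
  obtain ⟨t, ht⟩ : ∃ t, τ * t = 1 := ⟨τ⁻¹, mul_inv_cancel₀ hτ⟩
  have hω := omega_sq_add
  have he := h.det
  have he' := h'.det
  rcases h.cases_p with ⟨h1, hp⟩ | ⟨h1, hp | hp | hp⟩ | ⟨h1, hp | hp | hp⟩ <;>
  first
  | (exfalso; omega)
  | (rcases h'.cases_p with ⟨h2, hp'⟩ | ⟨h2, hp' | hp' | hp'⟩ | ⟨h2, hp' | hp' | hp'⟩ <;>
    first
    | (exfalso; omega)
    | (rcases h.cases_q with ⟨h3, hq⟩ | ⟨h3, hq | hq⟩ <;>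
      first
      | (exfalso; omega)
      | (rcases h'.cases_q with ⟨h4, hq'⟩ | ⟨h4, hq' | hq'⟩ <;>
        first
        | (exfalso; omega)
        | (clear h h'; subst hp hp' hq hq'; simp [pairing, Fin.sum_univ_succ] at he he' ⊢; grind))))

theorem pairing_eq_iff_1_3 (hτ : τ ≠ 0) (h : IsBalanced τ 1 p q e)
    (h' : IsBalanced τ 3 p' q' e') : pairing p p' q q' = 2 ↔ e' = e ^ 3 := by
  obtain ⟨t, ht⟩ : ∃ t, τ * t = 1 := ⟨τ⁻¹, mul_inv_cancel₀ hτ⟩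
  have hω := omega_sq_add
  have he := h.det
  have he' := h'.det
  rcases h.cases_p with ⟨h1, hp⟩ | ⟨h1, hp | hp | hp⟩ | ⟨h1, hp | hp | hp⟩ <;>
  first
  | (exfalso; omega)
  | (rcases h'.cases_p with ⟨h2, hp'⟩ | ⟨h2, hp' | hp' | hp'⟩ | ⟨h2, hp' | hp' | hp'⟩ <;>
    first
    | (exfalso; omega)
    | (rcases h.cases_q with ⟨h3, hq⟩ | ⟨h3, hq | hq⟩ <;>
      first
      | (exfalso; omega)
      | (rcases h'.cases_q with ⟨h4, hq'⟩ | ⟨h4, hq' | hq'⟩ <;>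
        first
        | (exfalso; omega)
        | (clear h h'; subst hp hp' hq hq'; simp [pairing, Fin.sum_univ_succ] at he he' ⊢; grind))))

theorem pairing_eq_iff_2_2 (hτ : τ ≠ 0) (h : IsBalanced τ 2 p q e)
    (h' : IsBalanced τ 2 p' q' e') : pairing p p' q q' = 3 ↔ e ^ 2 + e * e' + e' ^ 2 = 0 := by
  obtain ⟨t, ht⟩ : ∃ t, τ * t = 1 := ⟨τ⁻¹, mul_inv_cancel₀ hτ⟩
  have hω := omega_sq_add
  have he := h.det
  have he' := h'.det
  rcases h.cases_p with ⟨h1, hp⟩ | ⟨h1, hp | hp | hp⟩ | ⟨h1, hp | hp | hp⟩ <;>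
  first
  | (exfalso; omega)
  | (rcases h'.cases_p with ⟨h2, hp'⟩ | ⟨h2, hp' | hp' | hp'⟩ | ⟨h2, hp' | hp' | hp'⟩ <;>
    first
    | (exfalso; omega)
    | (rcases h.cases_q with ⟨h3, hq⟩ | ⟨h3, hq | hq⟩ <;>
      first
      | (exfalso; omega)
      | (rcases h'.cases_q with ⟨h4, hq'⟩ | ⟨h4, hq' | hq'⟩ <;>
        first
        | (exfalso; omega)
        | (clear h h'; subst hp hp' hq hq'; simp [pairing, Fin.sum_univ_succ] at he he' ⊢; grind))))

theorem pairing_eq_iff_1_4 (hτ : τ ≠ 0) (h : IsBalanced τ 1 p q e)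
    (h' : IsBalanced τ 4 p' q' e') : pairing p p' q q' = 3 ↔ e' ^ 2 + e' * e ^ 4 + e ^ 8 = 0 := by
  obtain ⟨t, ht⟩ : ∃ t, τ * t = 1 := ⟨τ⁻¹, mul_inv_cancel₀ hτ⟩
  have hω := omega_sq_add
  have he := h.det
  have he' := h'.det
  rcases h.cases_p with ⟨h1, hp⟩ | ⟨h1, hp | hp | hp⟩ | ⟨h1, hp | hp | hp⟩ <;>
  first
  | (exfalso; omega)
  | (rcases h'.cases_p with ⟨h2, hp'⟩ | ⟨h2, hp' | hp' | hp'⟩ | ⟨h2, hp' | hp' | hp'⟩ <;>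
    first
    | (exfalso; omega)
    | (rcases h.cases_q with ⟨h3, hq⟩ | ⟨h3, hq | hq⟩ <;>
      first
      | (exfalso; omega)
      | (rcases h'.cases_q with ⟨h4, hq'⟩ | ⟨h4, hq' | hq'⟩ <;>
        first
        | (exfalso; omega)
        | (clear h h'; subst hp hp' hq hq'; simp [pairing, Fin.sum_univ_succ] at he he' ⊢; grind))))

theorem pairing_eq_iff_2_3 (hτ : τ ≠ 0) (h : IsBalanced τ 2 p q e)
    (h' : IsBalanced τ 3 p' q' e') : pairing p p' q q' = 5 ↔ e' ^ 2 + e ^ 3 = 0 := by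
  obtain ⟨t, ht⟩ : ∃ t, τ * t = 1 := ⟨τ⁻¹, mul_inv_cancel₀ hτ⟩
  have hω := omega_sq_add
  have he := h.det
  have he' := h'.det
  rcases h.cases_p with ⟨h1, hp⟩ | ⟨h1, hp | hp | hp⟩ | ⟨h1, hp | hp | hp⟩ <;>
  first
  | (exfalso; omega)
  | (rcases h'.cases_p with ⟨h2, hp'⟩ | ⟨h2, hp' | hp' | hp'⟩ | ⟨h2, hp' | hp' | hp'⟩ <;>
    first
    | (exfalso; omega)
    | (rcases h.cases_q with ⟨h3, hq⟩ | ⟨h3, hq | hq⟩ <;>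
      first
      | (exfalso; omega)
      | (rcases h'.cases_q with ⟨h4, hq'⟩ | ⟨h4, hq' | hq'⟩ <;>
        first
        | (exfalso; omega)
        | (clear h h'; subst hp hp' hq hq'; simp [pairing, Fin.sum_univ_succ] at he he' ⊢; grind))))

theorem pairing_eq_iff_1_5 (hτ : τ ≠ 0) (h : IsBalanced τ 1 p q e)
    (h' : IsBalanced τ 5 p' q' e') : pairing p p' q q' = 3 ↔ e' + e ^ 5 = 0 := by
  obtain ⟨t, ht⟩ : ∃ t, τ * t = 1 := ⟨τ⁻¹, mul_inv_cancel₀ hτ⟩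
  have hω := omega_sq_add
  have he := h.det
  have he' := h'.det
  rcases h.cases_p with ⟨h1, hp⟩ | ⟨h1, hp | hp | hp⟩ | ⟨h1, hp | hp | hp⟩ <;>
  first
  | (exfalso; omega)
  | (rcases h'.cases_p with ⟨h2, hp'⟩ | ⟨h2, hp' | hp' | hp'⟩ | ⟨h2, hp' | hp' | hp'⟩ <;>
    first
    | (exfalso; omega)
    | (rcases h.cases_q with ⟨h3, hq⟩ | ⟨h3, hq | hq⟩ <;>
      first
      | (exfalso; omega)
      | (rcases h'.cases_q with ⟨h4, hq'⟩ | ⟨h4, hq' | hq'⟩ <;>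
        first
        | (exfalso; omega)
        | (clear h h'; subst hp hp' hq hq'; simp [pairing, Fin.sum_univ_succ] at he he' ⊢; grind))))

theorem pairing_eq_iff_2_4 (hτ : τ ≠ 0) (h : IsBalanced τ 2 p q e)
    (h' : IsBalanced τ 4 p' q' e') : pairing p p' q q' = 6 ↔ e ^ 2 = e' := by
  obtain ⟨t, ht⟩ : ∃ t, τ * t = 1 := ⟨τ⁻¹, mul_inv_cancel₀ hτ⟩
  have hω := omega_sq_add
  have he := h.det
  have he' := h'.det
  rcases h.cases_p with ⟨h1, hp⟩ | ⟨h1, hp | hp | hp⟩ | ⟨h1, hp | hp | hp⟩ <;>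
  first
  | (exfalso; omega)
  | (rcases h'.cases_p with ⟨h2, hp'⟩ | ⟨h2, hp' | hp' | hp'⟩ | ⟨h2, hp' | hp' | hp'⟩ <;>
    first
    | (exfalso; omega)
    | (rcases h.cases_q with ⟨h3, hq⟩ | ⟨h3, hq | hq⟩ <;>
      first
      | (exfalso; omega)
      | (rcases h'.cases_q with ⟨h4, hq'⟩ | ⟨h4, hq' | hq'⟩ <;>
        first
        | (exfalso; omega)
        | (clear h h'; subst hp hp' hq hq'; simp [pairing, Fin.sum_univ_succ] at he he' ⊢; grind))))

theorem pairing_eq_iff_3_3 (hτ : τ ≠ 0) (h : IsBalanced τ 3 p q e)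
    (h' : IsBalanced τ 3 p' q' e') : pairing p p' q q' = 7 ↔ e + e' = 0 := by
  obtain ⟨t, ht⟩ : ∃ t, τ * t = 1 := ⟨τ⁻¹, mul_inv_cancel₀ hτ⟩
  have hω := omega_sq_add
  have he := h.det
  have he' := h'.det
  rcases h.cases_p with ⟨h1, hp⟩ | ⟨h1, hp | hp | hp⟩ | ⟨h1, hp | hp | hp⟩ <;>
  first
  | (exfalso; omega)
  | (rcases h'.cases_p with ⟨h2, hp'⟩ | ⟨h2, hp' | hp' | hp'⟩ | ⟨h2, hp' | hp' | hp'⟩ <;>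
    first
    | (exfalso; omega)
    | (rcases h.cases_q with ⟨h3, hq⟩ | ⟨h3, hq | hq⟩ <;>
      first
      | (exfalso; omega)
      | (rcases h'.cases_q with ⟨h4, hq'⟩ | ⟨h4, hq' | hq'⟩ <;>
        first
        | (exfalso; omega)
        | (clear h h'; subst hp hp' hq hq'; simp [pairing, Fin.sum_univ_succ] at he he' ⊢; grind))))

/-- The central character `τ⁶` in terms of the determinant, for each dimension. -/
theorem IsBalanced.pow_det_1 (h : IsBalanced τ 1 p q e) : e ^ 6 = τ ^ 6 := by
  have hω := omega_sq_add
  have he := h.det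
  rcases h.cases_p with ⟨h1, hp⟩ | ⟨h1, hp | hp | hp⟩ | ⟨h1, hp | hp | hp⟩ <;>
  first
  | (exfalso; omega)
  | (rcases h.cases_q with ⟨h3, hq⟩ | ⟨h3, hq | hq⟩ <;>
    first
    | (exfalso; omega)
    | (clear h; subst hp hq; simp at he; grind))

theorem IsBalanced.pow_det_2 (h : IsBalanced τ 2 p q e) : -e ^ 3 = τ ^ 6 := by
  have hω := omega_sq_add
  have he := h.det
  rcases h.cases_p with ⟨h1, hp⟩ | ⟨h1, hp | hp | hp⟩ | ⟨h1, hp | hp | hp⟩ <;>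
  first
  | (exfalso; omega)
  | (rcases h.cases_q with ⟨h3, hq⟩ | ⟨h3, hq | hq⟩ <;>
    first
    | (exfalso; omega)
    | (clear h; subst hp hq; simp at he; grind))

theorem IsBalanced.pow_det_3 (h : IsBalanced τ 3 p q e) : e ^ 2 = τ ^ 6 := by
  have hω := omega_sq_add
  have he := h.det
  rcases h.cases_p with ⟨h1, hp⟩ | ⟨h1, hp | hp | hp⟩ | ⟨h1, hp | hp | hp⟩ <;>
  first
  | (exfalso; omega)
  | (rcases h.cases_q with ⟨h3, hq⟩ | ⟨h3, hq | hq⟩ <;>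
    first
    | (exfalso; omega)
    | (clear h; subst hp hq; simp at he; grind))

theorem IsBalanced.pow_det_4 (h : IsBalanced τ 4 p q e) : e ^ 3 = τ ^ 12 := by
  have hω := omega_sq_add
  have he := h.det
  rcases h.cases_p with ⟨h1, hp⟩ | ⟨h1, hp | hp | hp⟩ | ⟨h1, hp | hp | hp⟩ <;>
  first
  | (exfalso; omega)
  | (rcases h.cases_q with ⟨h3, hq⟩ | ⟨h3, hq | hq⟩ <;>
    first
    | (exfalso; omega)
    | (clear h; subst hp hq; simp at he; grind))

theorem IsBalanced.pow_det_5 (h : IsBalanced τ 5 p q e) : e ^ 6 = τ ^ 30 := by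
  have hω := omega_sq_add
  have he := h.det
  rcases h.cases_p with ⟨h1, hp⟩ | ⟨h1, hp | hp | hp⟩ | ⟨h1, hp | hp | hp⟩ <;>
  first
  | (exfalso; omega)
  | (rcases h.cases_q with ⟨h3, hq⟩ | ⟨h3, hq | hq⟩ <;>
    first
    | (exfalso; omega)
    | (clear h; subst hp hq; simp at he; grind))

/-- The multiplicities are determined by the dimension and the determinant. -/
theorem IsBalanced.eq_of_det_eq (hτ : τ ≠ 0) {d : ℕ} (hd : 0 < d) (hd6 : d ≤ 6)
    (h : IsBalanced τ d p q e) (h' : IsBalanced τ d p' q' e) : p = p' ∧ q = q' := by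
  obtain ⟨t, ht⟩ : ∃ t, τ * t = 1 := ⟨τ⁻¹, mul_inv_cancel₀ hτ⟩
  have hω := omega_sq_add
  have he := h.det
  have he' := h'.det
  interval_cases d <;>
  rcases h.cases_p with ⟨h1, hp⟩ | ⟨h1, hp | hp | hp⟩ | ⟨h1, hp | hp | hp⟩ <;>
  first
  | (exfalso; omega)
  | (rcases h'.cases_p with ⟨h2, hp'⟩ | ⟨h2, hp' | hp' | hp'⟩ | ⟨h2, hp' | hp' | hp'⟩ <;>
    first
    | (exfalso; omega)
    | (rcases h.cases_q with ⟨h3, hq⟩ | ⟨h3, hq | hq⟩ <;>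
      first
      | (exfalso; omega)
      | (rcases h'.cases_q with ⟨h4, hq'⟩ | ⟨h4, hq' | hq'⟩ <;>
        first
        | (exfalso; omega)
        | (clear h h'; subst hp hp' hq hq'; exact ⟨rfl, rfl⟩)
        | (clear h h'; subst hp hp' hq hq'; exfalso; simp at he he'; grind))))

end numerics

section conditions_numerics

variable {n : ℕ} {x : Fin n → ℂ}

/-- Positivity and parity: the norm of a dimension vector is a positive even number. -/
theorem two_le_norm (hn : n ≤ 5) {d : ℕ} (hd : 0 < d) {m : Fin n → ℕ} {p : Fin 3 → ℕ}
    {q : Fin 2 → ℕ} (hm : ∑ i, m i = d) (hp : ∑ i, p i = d) (hq : ∑ i, q i = d) :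
    d ^ 2 + 2 ≤ ∑ i, m i ^ 2 + ∑ i, p i ^ 2 + ∑ i, q i ^ 2 := by
  have h1 := thirty_mul_le hn hm hp hq
  have par : ∀ {ι : Type} [Fintype ι] (f : ι → ℕ), (∑ i, f i ^ 2) % 2 = (∑ i, f i) % 2 := by
    intro ι _ f
    rw [Finset.sum_nat_mod, Finset.sum_nat_mod _ _ f]
    congr 1
    refine Finset.sum_congr rfl fun i _ => ?_
    rcases Nat.mod_two_eq_zero_or_one (f i) with h | h <;> simp [Nat.pow_mod, h]
  have h2 := par m
  have h3 := par p
  have h4 := par q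
  have h5 : d ^ 2 % 2 = d % 2 := by
    rcases Nat.mod_two_eq_zero_or_one d with h | h <;> simp [Nat.pow_mod, h]
  rw [hm] at h2
  rw [hp] at h3
  rw [hq] at h4
  have h6 : 0 < d ^ 2 := by positivity
  omega

/-- The data of a simple module: the multiplicities of the eigenvalues of `a`, `a b`, `a b a`. -/
structure IsSimpleType (x : Fin n → ℂ) (τ : ℂ) (d : ℕ) (m : Fin n → ℕ) (p : Fin 3 → ℕ)
    (q : Fin 2 → ℕ) : Prop where
  pos : 0 < d
  sum_m : ∑ i, m i = d
  norm : ∑ i, m i ^ 2 + ∑ i, p i ^ 2 + ∑ i, q i ^ 2 = d ^ 2 + 2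
  le_six : d ≤ 6
  le_one : d ≤ 5 → ∀ i, m i ≤ 1
  six : d = 6 → n = 5 ∧ ∀ i, 1 ≤ m i ∧ m i ≤ 2
  balanced : IsBalanced τ d p q (∏ i, x i ^ m i)

theorem exists_support {d : ℕ} {m : Fin n → ℕ} (hm : ∀ i, m i ≤ 1) (hs : ∑ i, m i = d) :
    ∃ S : Finset (Fin n), S.card = d ∧ (∀ i, m i = if i ∈ S then 1 else 0) := by
  refine ⟨Finset.univ.filter fun i => m i = 1, ?_, fun i => ?_⟩
  · rw [Finset.card_filter, ← hs]
    refine Finset.sum_congr rfl fun i _ => ?_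
    have := hm i
    split_ifs <;> omega
  · have := hm i
    simp only [Finset.mem_filter, Finset.mem_univ, true_and]
    split_ifs <;> omega

theorem prod_pow_support {m : Fin n → ℕ} {S : Finset (Fin n)}
    (hm : ∀ i, m i = if i ∈ S then 1 else 0) : ∏ i, x i ^ m i = ∏ i ∈ S, x i := by
  simp only [hm, pow_ite, pow_one, pow_zero, Finset.prod_ite_mem, Finset.univ_inter]

variable {τ : ℂ} {d d' : ℕ} {m m' : Fin n → ℕ} {p p' : Fin 3 → ℕ} {q q' : Fin 2 → ℕ}

set_option maxHeartbeats 1600000 in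
/-- Two simple types whose sum has norm two violate one of the conditions. The nine pairs of
dimensions with sum at most six correspond to the nine families of conditions. -/
theorem not_conditions_of_le (hn : n ≤ 5) (hx0 : ∀ i, x i ≠ 0) (hτ : τ ≠ 0) (hdd : d ≤ d')
    (h : IsSimpleType x τ d m p q) (h' : IsSimpleType x τ d' m' p' q')
    (hN : ∑ i, m i * m' i + pairing p p' q q' + 1 = d * d') : ¬ SemisimplicityConditions x := by
  rintro ⟨c2, c3, c4, c5⟩
  have hsum := shape_of_norm_two hn (d := d + d') (m := fun i => m i + m' i)
    (p := fun i => p i + p' i) (q := fun i => q i + q' i) (by have := h.pos; omega)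
    (by rw [Finset.sum_add_distrib, h.sum_m, h'.sum_m])
    (by rw [Finset.sum_add_distrib, h.balanced.sum_p, h'.balanced.sum_p])
    (by rw [Finset.sum_add_distrib, h.balanced.sum_q, h'.balanced.sum_q])
    (by
      have e1 := h.norm
      have e2 := h'.norm
      simp only [pairing] at hN
      have e3 : ∀ {ι : Type} [Fintype ι] (f g : ι → ℕ),
          ∑ i, (f i + g i) ^ 2 = ∑ i, f i ^ 2 + ∑ i, g i ^ 2 + 2 * ∑ i, f i * g i := by
        intro ι _ f g
        rw [Finset.mul_sum, ← Finset.sum_add_distrib, ← Finset.sum_add_distrib]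
        exact Finset.sum_congr rfl fun i _ => by ring
      rw [e3, e3, e3]
      nlinarith)
  obtain ⟨hle6, hle1, h6, -, -⟩ := hsum
  have hd := h.pos
  have hd' := h'.pos
  obtain ⟨S, hS, hmS⟩ := exists_support (h.le_one (by omega)) h.sum_m
  obtain ⟨S', hS', hmS'⟩ := exists_support (h'.le_one (by omega)) h'.sum_m
  have hb := h.balanced
  have hb' := h'.balanced
  rw [prod_pow_support hmS] at hb
  rw [prod_pow_support hmS'] at hb'
  have hmm : ∑ i, m i * m' i = (S ∩ S').card := by
    simp only [hmS, hmS', ← ite_and, mul_ite, mul_one, mul_zero]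
    rw [Finset.card_eq_sum_ones, ← Finset.sum_filter]
    exact Finset.sum_congr (by ext i; simp [and_comm]) fun _ _ => rfl
  have hun : (S ∪ S').card + (S ∩ S').card = d + d' := by
    rw [Finset.card_union_add_card_inter, hS, hS']
  have hdisj : d + d' ≤ 5 → (S ∩ S') = ∅ := by
    intro h5
    ext i
    have := hle1 h5 i
    rw [hmS, hmS'] at this
    simp only [Finset.mem_inter, Finset.notMem_empty, iff_false, not_and]
    intro h1 h2
    simp [h1, h2] at this
  have huniv : d + d' = 6 → n = 5 ∧ S ∪ S' = Finset.univ ∧ (S ∩ S').card = 1 := by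
    intro h7
    obtain ⟨hn5, hi⟩ := h6 h7
    have hU : S ∪ S' = Finset.univ := by
      ext i
      have := (hi i).1
      rw [hmS, hmS'] at this
      simp only [Finset.mem_union, Finset.mem_univ, iff_true]
      by_contra hc
      push Not at hc
      simp [hc.1, hc.2] at this
    refine ⟨hn5, hU, ?_⟩
    rw [hU, Finset.card_univ, Fintype.card_fin] at hun
    omega
  rw [hmm] at hN
  have hd3 : d ≤ 3 := by omega
  have hd5 : d' ≤ 5 := by omega
  have hdj : d + d' ≤ 5 → Disjoint S S' := fun h5 => Finset.disjoint_iff_inter_eq_empty.2 (hdisj h5)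
  have hc0 : d + d' ≤ 5 → (S ∩ S').card = 0 := fun h5 => by rw [hdisj h5]; rfl
  interval_cases d
  · obtain ⟨i, rfl⟩ := Finset.card_eq_one.1 hS
    rw [Finset.prod_singleton] at hb
    interval_cases d'
    · obtain ⟨j, rfl⟩ := Finset.card_eq_one.1 hS'
      rw [Finset.prod_singleton] at hb'
      have hij : i ≠ j := by simpa using hdj (by norm_num)
      rw [hc0 (by norm_num)] at hN
      exact c2 i j (by simpa using hij) ((pairing_eq_iff_1_1 hτ hb hb').1 (by omega))
    · obtain ⟨j, k, hjk, rfl⟩ := Finset.card_eq_two.1 hS'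
      rw [Finset.prod_pair hjk] at hb'
      have hij : i ≠ j ∧ i ≠ k := by simpa using hdj (by norm_num)
      rw [hc0 (by norm_num)] at hN
      exact c3 i j k (by simp [hij, hjk]) ((pairing_eq_iff_1_2 hτ hb hb').1 (by omega))
    · obtain ⟨j, k, l, hjk, hjl, hkl, rfl⟩ := Finset.card_eq_three.1 hS'
      rw [Finset.prod_insert (by simp [hjk, hjl]), Finset.prod_pair hkl] at hb'
      have hij : i ≠ j ∧ i ≠ k ∧ i ≠ l := by simpa using hdj (by norm_num)
      rw [hc0 (by norm_num)] at hN
      have hR := (pairing_eq_iff_1_3 hτ hb hb').1 (by omega)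
      exact (c4 i j k l (by simp [hij, hjk, hjl, hkl]) (x i ^ 2) (by linear_combination -x i * hR)).1
        (sub_self _)
    · have hR := (pairing_eq_iff_1_4 hτ hb hb').1 (by rw [hc0 (by norm_num)] at hN; omega)
      have hcard := (Finset.card_le_univ ({i} ∪ S'))
      rw [Fintype.card_fin] at hcard
      rw [hc0 (by norm_num)] at hun
      have hn5 : n = 5 := by omega
      have hU : {i} ∪ S' = Finset.univ := Finset.eq_univ_of_card _ (by rw [Fintype.card_fin]; omega)
      set e' := ∏ j ∈ S', x j with he'
      have hprod : ∏ j, x j = x i * e' := by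
        rw [← hU, Finset.prod_union (hdj (by norm_num)), Finset.prod_singleton]
      have hxi := hx0 i
      refine ((c5 hn5).1 (e' ^ 2 / x i ^ 7) ?_).1 i ?_
      · rw [hprod, div_pow, div_eq_iff (pow_ne_zero _ (pow_ne_zero _ hxi))]
        have h3 : e' ^ 3 = (x i ^ 4) ^ 3 := by linear_combination (e' - x i ^ 4) * hR
        calc (e' ^ 2) ^ 5 = (e' ^ 3) ^ 3 * e' := by ring
          _ = _ := by rw [h3]; ring
      · rw [I5]
        field_simp
        linear_combination (x i ^ 8 - x i ^ 4 * e' + e' ^ 2) * hR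
    · obtain ⟨hn5, hU, h1⟩ := huniv (by norm_num)
      rw [h1] at hN
      have hR := (pairing_eq_iff_1_5 hτ hb hb').1 (by omega)
      have hS'u : S' = Finset.univ :=
        Finset.eq_univ_of_card _ (by rw [Fintype.card_fin]; omega)
      rw [hS'u] at hR
      exact (c5 hn5).2.1 i hR
  · obtain ⟨i, j, hij, rfl⟩ := Finset.card_eq_two.1 hS
    rw [Finset.prod_pair hij] at hb
    have hd4 : d' ≤ 4 := by omega
    interval_cases d'
    · obtain ⟨k, l, hkl, rfl⟩ := Finset.card_eq_two.1 hS'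
      rw [Finset.prod_pair hkl] at hb'
      have hne : (i ≠ k ∧ i ≠ l) ∧ j ≠ k ∧ j ≠ l := by
        have := hdj (by norm_num)
        simp at this
        tauto
      rw [hc0 (by norm_num)] at hN
      have hR := (pairing_eq_iff_2_2 hτ hb hb').1 (by omega)
      exact (c4 i j k l (by simp [hij, hkl, hne]) (x i * x j + x k * x l)
        (by linear_combination hR)).2 (sub_self _)
    · have hR := (pairing_eq_iff_2_3 hτ hb hb').1 (by rw [hc0 (by norm_num)] at hN; omega)
      have hcard := (Finset.card_le_univ ({i, j} ∪ S'))
      rw [Fintype.card_fin] at hcard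
      rw [hc0 (by norm_num)] at hun
      have hn5 : n = 5 := by omega
      have hU : {i, j} ∪ S' = Finset.univ :=
        Finset.eq_univ_of_card _ (by rw [Fintype.card_fin]; omega)
      set e' := ∏ j ∈ S', x j with he'
      have hprod : ∏ j, x j = x i * x j * e' := by
        rw [← hU, Finset.prod_union (hdj (by norm_num)), Finset.prod_pair hij]
      have hxi := hx0 i
      have hxj := hx0 j
      refine ((c5 hn5).1 (e' / (x i * x j)) ?_).2 i j (by simpa using hij) ?_
      · rw [hprod, div_pow, div_eq_iff (pow_ne_zero _ (mul_ne_zero hxi hxj))]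
        linear_combination e' * (e' ^ 2 - (x i * x j) ^ 3) * hR
      · rw [J5]
        field_simp
        linear_combination hR
    · obtain ⟨hn5, hU, h1⟩ := huniv (by norm_num)
      rw [h1] at hN
      have hR := (pairing_eq_iff_2_4 hτ hb hb').1 (by omega)
      -- `x t` is the common eigenvalue
      have key : ∀ s t : Fin n, s ≠ t → {s, t} = ({i, j} : Finset (Fin n)) → s ∉ S' → False := by
        intro s t hst hset hs
        have hS'e : insert s S' = Finset.univ := by
          refine Finset.eq_univ_of_card _ ?_
          rw [Finset.card_insert_of_notMem hs, Fintype.card_fin]; omega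
        have hprod : ∏ j, x j = x s * ∏ j ∈ S', x j := by
          rw [← hS'e, Finset.prod_insert hs]
        have hx2 : x i * x j = x s * x t := by
          rw [← Finset.prod_pair hij, ← Finset.prod_pair hst, hset]
        refine (c5 hn5).2.2.1 s t (by simpa using hst) ?_
        rw [J6, hprod, ← hR, hx2]
        ring
      obtain ⟨t, ht⟩ := Finset.card_eq_one.1 h1
      have htm : t ∈ ({i, j} : Finset (Fin n)) ∩ S' := by rw [ht]; simp
      rw [Finset.mem_inter, Finset.mem_insert, Finset.mem_singleton] at htm
      rcases htm with ⟨rfl | rfl, htS⟩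
      · refine key j t hij.symm (Finset.pair_comm _ _) fun hj => hij ?_
        have : j ∈ ({t, j} : Finset (Fin n)) ∩ S' := by simp [hj]
        rw [ht, Finset.mem_singleton] at this
        exact this.symm
      · refine key i t hij rfl fun hj => hij ?_
        have : i ∈ ({i, t} : Finset (Fin n)) ∩ S' := by simp [hj]
        rw [ht, Finset.mem_singleton] at this
        exact this
  · have hd' : d' = 3 := by omega
    subst hd'
    obtain ⟨hn5, hU, h1⟩ := huniv (by norm_num)
    rw [h1] at hN
    have hR := (pairing_eq_iff_3_3 hτ hb hb').1 (by omega)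
    obtain ⟨t, ht⟩ := Finset.card_eq_one.1 h1
    have htm : t ∈ S ∩ S' := by rw [ht]; simp
    rw [Finset.mem_inter] at htm
    obtain ⟨j, k, hjk, hjk'⟩ := Finset.card_eq_two.1
      (show (S.erase t).card = 2 by rw [Finset.card_erase_of_mem htm.1, hS])
    obtain ⟨l, r, hlr, hlr'⟩ := Finset.card_eq_two.1
      (show (S'.erase t).card = 2 by rw [Finset.card_erase_of_mem htm.2, hS'])
    rw [← Finset.mul_prod_erase S x htm.1, ← Finset.mul_prod_erase S' x htm.2, hjk', hlr',
      Finset.prod_pair hjk, Finset.prod_pair hlr, ← mul_add] at hR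
    have hdis : ∀ u ∈ S.erase t, u ∉ S'.erase t := by
      intro u hu hu'
      rw [Finset.mem_erase] at hu hu'
      have : u ∈ S ∩ S' := Finset.mem_inter.2 ⟨hu.2, hu'.2⟩
      rw [ht, Finset.mem_singleton] at this
      exact hu.1 this
    have hj := hdis j (by rw [hjk']; simp)
    have hk := hdis k (by rw [hjk']; simp)
    rw [hlr'] at hj hk
    simp only [Finset.mem_insert, Finset.mem_singleton, not_or] at hj hk
    exact (c5 hn5).2.2.2 j k l r (by simp [hjk, hlr, hj, hk])
      ((mul_eq_zero.1 hR).resolve_left (hx0 t))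

theorem not_conditions_of_pairing (hn : n ≤ 5) (hx0 : ∀ i, x i ≠ 0) (hτ : τ ≠ 0)
    (h : IsSimpleType x τ d m p q) (h' : IsSimpleType x τ d' m' p' q')
    (hN : ∑ i, m i * m' i + pairing p p' q q' + 1 = d * d') : ¬ SemisimplicityConditions x := by
  rcases le_total d d' with hle | hle
  · exact not_conditions_of_le hn hx0 hτ hle h h' hN
  · refine not_conditions_of_le hn hx0 hτ hle h' h ?_
    simpa only [pairing, mul_comm] using hN

end conditions_numerics

/-! ### The semisimplicity criterion: sufficiency -/

section types

/-- The eigenvalues of `a b`, if `(a b)³` acts by `τ⁶`. -/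
noncomputable def rootsB (τ : ℂ) : Fin 3 → ℂ := fun j => τ ^ 2 * omega ^ (2 * (j : ℕ))

/-- The eigenvalues of `a b a`, if `(a b a)²` acts by `τ⁶`. -/
noncomputable def rootsC (τ : ℂ) : Fin 2 → ℂ := fun j => (-1) ^ (j : ℕ) * τ ^ 3

variable {τ : ℂ}

theorem rootsB_ne_zero (hτ : τ ≠ 0) (j : Fin 3) : rootsB τ j ≠ 0 :=
  mul_ne_zero (pow_ne_zero _ hτ) (pow_ne_zero _ (omega_isPrimitiveRoot.ne_zero (by norm_num)))

theorem rootsB_injective (hτ : τ ≠ 0) : Function.Injective (rootsB τ) := by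
  intro i j h
  have h1 : omega ^ (2 * (i : ℕ)) = omega ^ (2 * (j : ℕ)) := mul_left_cancel₀ (pow_ne_zero _ hτ) h
  obtain ⟨t, ht⟩ : ∃ t, omega * t = 1 :=
    ⟨omega⁻¹, mul_inv_cancel₀ (omega_isPrimitiveRoot.ne_zero (by norm_num))⟩
  have hω := omega_sq_add
  fin_cases i <;> fin_cases j <;> first | rfl | (exfalso; simp at h1; grind)

theorem rootsC_injective (hτ : τ ≠ 0) : Function.Injective (rootsC τ) := by
  intro i j h
  have h1 := mul_right_cancel₀ (pow_ne_zero 3 hτ) h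
  fin_cases i <;> fin_cases j <;> first | rfl | (exfalso; norm_num at h1)

theorem rootPoly_rootsB (τ : ℂ) : rootPoly (rootsB τ) = X ^ 3 - C (τ ^ 6) := by
  have hω := congrArg (C : ℂ → ℂ[X]) omega_sq_add
  simp only [map_add, map_pow, map_one, map_zero] at hω
  rw [rootPoly, Fin.prod_univ_three]
  simp [rootsB]
  generalize (C omega : ℂ[X]) = w at *
  generalize (C τ : ℂ[X]) = t at *
  grind

theorem rootPoly_rootsC (τ : ℂ) : rootPoly (rootsC τ) = X ^ 2 - C (τ ^ 6) := by
  rw [rootPoly, Fin.prod_univ_two]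
  simp [rootsC]
  ring

end types

/-- `E` is generated by elements `a`, `b` that satisfy the relations of `Q_X`. -/
structure IsBraidAlgebra {n : ℕ} (x : Fin n → ℂ) {E : Type*} [Ring E] [Algebra ℂ E] (a b : E) :
    Prop where
  le_five : n ≤ 5
  inj : Function.Injective x
  ne_zero : ∀ i, x i ≠ 0
  braid : a * b * a = b * a * b
  poly_a : aeval a (rootPoly x) = 0
  poly_b : aeval b (rootPoly x) = 0
  adjoin : Algebra.adjoin ℂ {a, b} = ⊤

section modules

variable {n : ℕ} {x : Fin n → ℂ} {E : Type*} [Ring E] [Algebra ℂ E] {a b : E}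

theorem isUnit_of_rootPoly' (h0 : ∀ i, x i ≠ 0) {T : E} (hT : aeval T (rootPoly x) = 0) :
    IsUnit T := by
  obtain ⟨u, hu⟩ := exists_unit_of_aeval (polyP_eval_zero_ne h0) hT
  exact ⟨u, hu⟩

/-- The multiplicities of the eigenvalues of `a`. -/
noncomputable def typeM (x : Fin n → ℂ) (a : E) (V : Type*) [AddCommGroup V] [Module ℂ V]
    [Module E V] [IsScalarTower ℂ E V] : Fin n → ℕ := fun i => mult (act V a) (x i)

/-- The multiplicities of the eigenvalues of `a b`. -/
noncomputable def typeP (τ : ℂ) (a b : E) (V : Type*) [AddCommGroup V] [Module ℂ V]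
    [Module E V] [IsScalarTower ℂ E V] : Fin 3 → ℕ := fun j => mult (act V (a * b)) (rootsB τ j)

/-- The multiplicities of the eigenvalues of `a b a`. -/
noncomputable def typeQ (τ : ℂ) (a b : E) (V : Type*) [AddCommGroup V] [Module ℂ V]
    [Module E V] [IsScalarTower ℂ E V] : Fin 2 → ℕ :=
  fun j => mult (act V (a * b) * act V a) (rootsC τ j)

variable {U V W : Type*} [AddCommGroup U] [Module ℂ U] [Module E U] [IsScalarTower ℂ E U]
  [AddCommGroup W] [Module ℂ W] [Module E W] [IsScalarTower ℂ E W]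
  [AddCommGroup V] [Module ℂ V] [Module E V] [IsScalarTower ℂ E V] {τ : ℂ}

/-- The Euler form of two modules. -/
noncomputable def moduleForm (x : Fin n → ℂ) (τ : ℂ) (a b : E) (U W : Type*) [AddCommGroup U]
    [Module ℂ U] [Module E U] [IsScalarTower ℂ E U] [AddCommGroup W] [Module ℂ W] [Module E W]
    [IsScalarTower ℂ E W] : ℤ :=
  eulerForm x (rootsB τ) (rootsC τ) (act U a) (act U (a * b)) (act W a) (act W (a * b))

theorem moduleForm_eq : moduleForm x τ a b U W =
    ((∑ i, typeM x a U i * typeM x a W i +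
      pairing (typeP τ a b U) (typeP τ a b W) (typeQ τ a b U) (typeQ τ a b W) : ℕ) : ℤ)
      - Module.finrank ℂ U * Module.finrank ℂ W := by
  rw [moduleForm, eulerForm, pairing]
  push_cast
  simp only [typeM, typeP, typeQ]
  ring

theorem isTriple_act (h : IsBraidAlgebra x a b) (hz : ∀ v : V, (a * b) ^ 3 • v = τ ^ 6 • v) :
    IsTriple x (rootsB τ) (rootsC τ) (act V a) (act V (a * b)) := by
  refine ⟨aeval_act a h.poly_a, ?_, ?_⟩
  · rw [rootPoly_rootsB]
    rw [map_sub, map_pow, aeval_X, aeval_C, act, ← map_pow (Algebra.lsmul ℂ ℂ V), sub_eq_zero]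
    exact LinearMap.ext hz
  · rw [rootPoly_rootsC, act, act, ← map_mul]
    rw [map_sub, map_pow, aeval_X, aeval_C, ← map_pow (Algebra.lsmul ℂ ℂ V),
      ← braid_cube h.braid, sub_eq_zero]
    exact LinearMap.ext hz

variable [FiniteDimensional ℂ U] [FiniteDimensional ℂ V] [FiniteDimensional ℂ W]

theorem sum_typeM (h : IsBraidAlgebra x a b) : ∑ i, typeM x a V i = Module.finrank ℂ V :=
  sum_mult h.inj (aeval_act a h.poly_a)

theorem sum_typeP (h : IsBraidAlgebra x a b) (hτ : τ ≠ 0)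
    (hz : ∀ v : V, (a * b) ^ 3 • v = τ ^ 6 • v) :
    ∑ i, typeP τ a b V i = Module.finrank ℂ V :=
  sum_mult (rootsB_injective hτ) (isTriple_act h hz).hb

theorem sum_typeQ (h : IsBraidAlgebra x a b) (hτ : τ ≠ 0)
    (hz : ∀ v : V, (a * b) ^ 3 • v = τ ^ 6 • v) :
    ∑ i, typeQ τ a b V i = Module.finrank ℂ V :=
  sum_mult (rootsC_injective hτ) (isTriple_act h hz).hc

/-- Evaluating the determinants of `a`, `a b` and `a b a`, where `b` is conjugate to `a`. -/
theorem prod_typeM (h : IsBraidAlgebra x a b) (hτ : τ ≠ 0)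
    (hz : ∀ v : V, (a * b) ^ 3 • v = τ ^ 6 • v) :
    ∏ i, x i ^ typeM x a V i = τ ^ Module.finrank ℂ V * (-1) ^ typeQ τ a b V 1 *
      omega ^ (typeP τ a b V 1 + 2 * typeP τ a b V 2) := by
  have ht := isTriple_act h hz
  have hA : LinearMap.det (act V a) = ∏ i, x i ^ typeM x a V i :=
    det_eq_prod_mult h.inj ht.ha
  have hB := det_eq_prod_mult (rootsB_injective hτ) ht.hb
  have hC := det_eq_prod_mult (rootsC_injective hτ) ht.hc
  have hab := (det_gen_eq h.ne_zero (A := act V a) (B := act V b)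
    (by simp only [act, ← map_mul, h.braid]) ht.ha (aeval_act b h.poly_b)).2
  have hsP := sum_typeP h hτ hz
  have hsQ := sum_typeQ h hτ hz
  have hP : ∀ j, mult (act V (a * b)) (rootsB τ j) = typeP τ a b V j := fun j => rfl
  have hQ : ∀ j, mult (act V (a * b) * act V a) (rootsC τ j) = typeQ τ a b V j := fun j => rfl
  have hab2 : LinearMap.det (act V (a * b)) = LinearMap.det (act V a) ^ 2 := by
    rw [act, map_mul, map_mul, hab, pow_two]
  simp only [hQ] at hC
  simp only [hP] at hB
  rw [map_mul, hab2, hA, Fin.prod_univ_two] at hC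
  rw [hab2, hA, Fin.prod_univ_three] at hB
  rw [Fin.sum_univ_two] at hsQ
  rw [Fin.sum_univ_three] at hsP
  set e := ∏ i, x i ^ typeM x a V i
  have h3 : omega ^ 3 = 1 := omega_isPrimitiveRoot.pow_eq_one
  have hω0 : omega ≠ 0 := omega_isPrimitiveRoot.ne_zero (by norm_num)
  simp only [rootsB, rootsC, Fin.val_zero, Fin.val_one, Fin.val_two, mul_pow] at hB hC
  generalize typeP τ a b V 0 = p0 at *
  generalize typeP τ a b V 1 = p1 at *
  generalize typeP τ a b V 2 = p2 at *
  generalize typeQ τ a b V 0 = q0 at *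
  generalize typeQ τ a b V 1 = q1 at *
  have hB' : e ^ 2 = τ ^ (2 * Module.finrank ℂ V) * omega ^ (2 * (p1 + 2 * p2)) := by
    rw [hB, ← hsP]; ring
  have hC' : e ^ 2 * e = τ ^ (3 * Module.finrank ℂ V) * (-1) ^ q1 := by
    rw [hC, ← hsQ]; ring
  have hne : τ ^ (2 * Module.finrank ℂ V) * omega ^ (2 * (p1 + 2 * p2)) ≠ 0 :=
    mul_ne_zero (pow_ne_zero _ hτ) (pow_ne_zero _ hω0)
  refine mul_left_cancel₀ hne ?_
  rw [← hB', hC', hB']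
  have h4 : omega ^ (2 * (p1 + 2 * p2)) * omega ^ (p1 + 2 * p2) = 1 := by
    rw [← pow_add, show 2 * (p1 + 2 * p2) + (p1 + 2 * p2) = 3 * (p1 + 2 * p2) by ring, pow_mul, h3,
      one_pow]
  calc _ = τ ^ (3 * Module.finrank ℂ V) * (-1) ^ q1 *
        (omega ^ (2 * (p1 + 2 * p2)) * omega ^ (p1 + 2 * p2)) := by rw [h4, mul_one]
    _ = _ := by ring

omit [FiniteDimensional ℂ W] in
theorem finrank_intertwiners_le_one (h : IsBraidAlgebra x a b) [IsSimpleModule E U]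
    [IsSimpleModule E W] :
    Module.finrank ℂ (intertwiners (act U a) (act U (a * b)) (act W a) (act W (a * b))) ≤ 1 := by
  have hu : IsUnit a := isUnit_of_rootPoly' h.ne_zero h.poly_a
  by_cases hiso : ∃ φ : U →ₗ[E] W, φ ≠ 0
  · obtain ⟨φ, hφ⟩ := hiso
    let e := LinearEquiv.ofBijective φ ((LinearMap.bijective_or_eq_zero φ).resolve_right hφ)
    refine finrank_le_one (⟨φ.restrictScalars ℂ, restrictScalars_mem_intertwiners φ⟩ :
      intertwiners (act U a) (act U (a * b)) (act W a) (act W (a * b))) ?_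
    rintro ⟨X, hX⟩
    obtain ⟨ψ, rfl⟩ := exists_linearMap_of_mem_intertwiners h.adjoin hu hX
    obtain ⟨c, hc⟩ := (IsSimpleModule.algebraMap_end_bijective_of_isAlgClosed ℂ).2
      ((e.symm : W →ₗ[E] U) ∘ₗ ψ)
    refine ⟨c, Subtype.ext (LinearMap.ext fun u => ?_)⟩
    have h1 : c • u = e.symm (ψ u) := LinearMap.congr_fun hc u
    change c • φ u = ψ u
    have h2 : φ (c • u) = ψ u := by rw [h1]; exact e.apply_symm_apply _
    rw [← h2]
    exact ((φ.restrictScalars ℂ).map_smul c u).symm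
  · push Not at hiso
    have : intertwiners (act U a) (act U (a * b)) (act W a) (act W (a * b)) = ⊥ := by
      rw [Submodule.eq_bot_iff]
      intro X hX
      obtain ⟨ψ, rfl⟩ := exists_linearMap_of_mem_intertwiners h.adjoin hu hX
      rw [hiso ψ]; rfl
    rw [this, finrank_bot]
    exact Nat.zero_le _

omit [FiniteDimensional ℂ U] [FiniteDimensional ℂ W] in
theorem finrank_intertwiners_eq_zero (h : IsBraidAlgebra x a b) [IsSimpleModule E U]
    [IsSimpleModule E W] (hUW : IsEmpty (U ≃ₗ[E] W)) :
    Module.finrank ℂ (intertwiners (act U a) (act U (a * b)) (act W a) (act W (a * b))) = 0 := by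
  have hu : IsUnit a := isUnit_of_rootPoly' h.ne_zero h.poly_a
  have : intertwiners (act U a) (act U (a * b)) (act W a) (act W (a * b)) = ⊥ := by
    rw [Submodule.eq_bot_iff]
    intro X hX
    obtain ⟨ψ, rfl⟩ := exists_linearMap_of_mem_intertwiners h.adjoin hu hX
    rcases LinearMap.bijective_or_eq_zero ψ with hb | h0
    · exact hUW.elim (LinearEquiv.ofBijective ψ hb)
    · rw [h0]; rfl
  rw [this, finrank_bot]

theorem moduleForm_le (h : IsBraidAlgebra x a b) (hτ : τ ≠ 0)
    (hU : ∀ v : U, (a * b) ^ 3 • v = τ ^ 6 • v) (hW : ∀ v : W, (a * b) ^ 3 • v = τ ^ 6 • v) :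
    moduleForm x τ a b U W ≤
      Module.finrank ℂ (intertwiners (act U a) (act U (a * b)) (act W a) (act W (a * b))) +
      Module.finrank ℂ (intertwiners (act W a) (act W (a * b)) (act U a) (act U (a * b))) :=
  eulerForm_le h.inj (rootsB_injective hτ) (rootsC_injective hτ) h.ne_zero (rootsB_ne_zero hτ)
    (isTriple_act h hU) (isTriple_act h hW)

/-- The type of a simple module: its Euler form with itself is even, positive, and at most
`2 = 2 dim End`. -/
theorem isSimpleType (h : IsBraidAlgebra x a b) (hτ : τ ≠ 0) [IsSimpleModule E V]
    (hz : ∀ v : V, (a * b) ^ 3 • v = τ ^ 6 • v) :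
    IsSimpleType x τ (Module.finrank ℂ V) (typeM x a V) (typeP τ a b V) (typeQ τ a b V) := by
  have : Nontrivial V := IsSimpleModule.nontrivial E V
  have hpos : 0 < Module.finrank ℂ V := Module.finrank_pos
  have hm := sum_typeM (V := V) h
  have hp := sum_typeP h hτ hz
  have hq := sum_typeQ h hτ hz
  have h1 := two_le_norm h.le_five hpos hm hp hq
  have h2 := moduleForm_le h hτ hz hz
  have h3 := finrank_intertwiners_le_one (U := V) (W := V) h
  have hnorm : ∑ i, typeM x a V i ^ 2 + ∑ i, typeP τ a b V i ^ 2 + ∑ i, typeQ τ a b V i ^ 2 =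
      Module.finrank ℂ V ^ 2 + 2 := by
    rw [moduleForm_eq, pairing] at h2
    simp only [← pow_two] at h2
    zify at h1 h3 ⊢
    push_cast at h2
    linarith
  obtain ⟨g1, g2, g3, g4, g5⟩ := shape_of_norm_two h.le_five hpos hm hp hq hnorm
  exact ⟨hpos, hm, hnorm, g1, g2, g3, hp, hq, g4, g5, prod_typeM h hτ hz⟩

omit [FiniteDimensional ℂ U] [FiniteDimensional ℂ W] in
theorem finrank_eq_of_equiv (e : U ≃ₗ[E] W) : Module.finrank ℂ U = Module.finrank ℂ W :=
  (e.restrictScalars ℂ).finrank_eq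

omit [FiniteDimensional ℂ U] [FiniteDimensional ℂ W] in
theorem mult_act_eq_of_equiv (e : U ≃ₗ[E] W) (T : E) (μ : ℂ) :
    mult (act U T) μ = mult (act W T) μ :=
  mult_eq_of_comm (e.restrictScalars ℂ) (fun u => e.map_smul T u) μ

omit [FiniteDimensional ℂ U] [FiniteDimensional ℂ W] in
theorem moduleForm_congr (e : U ≃ₗ[E] W) : moduleForm x τ a b U W = moduleForm x τ a b W W := by
  have h1 : ∀ i, mult (act U (a * b) * act U a) i = mult (act W (a * b) * act W a) i := by
    intro i
    rw [← map_mul, ← map_mul]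
    exact mult_act_eq_of_equiv e _ i
  simp only [moduleForm, eulerForm, mult_act_eq_of_equiv e, h1, finrank_eq_of_equiv e]

/-- Under the conditions, the Euler form of simple modules with the same central character is
nonnegative. -/
theorem moduleForm_nonneg (h : IsBraidAlgebra x a b) (hc : SemisimplicityConditions x)
    (hτ : τ ≠ 0) [IsSimpleModule E U] [IsSimpleModule E W]
    (hU : ∀ v : U, (a * b) ^ 3 • v = τ ^ 6 • v) (hW : ∀ v : W, (a * b) ^ 3 • v = τ ^ 6 • v) :
    0 ≤ moduleForm x τ a b U W := by
  have tU := isSimpleType h hτ hU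
  have tW := isSimpleType h hτ hW
  have hform := moduleForm_eq (x := x) (τ := τ) (a := a) (b := b) (U := U) (W := W)
  -- the norm of the sum of the two types is `4 + 2 N`, and it is at least two
  have h1 := two_le_norm h.le_five (d := Module.finrank ℂ U + Module.finrank ℂ W)
    (m := fun i => typeM x a U i + typeM x a W i) (p := fun i => typeP τ a b U i + typeP τ a b W i)
    (q := fun i => typeQ τ a b U i + typeQ τ a b W i) (by have := tU.pos; omega)
    (by rw [Finset.sum_add_distrib, tU.sum_m, tW.sum_m])
    (by rw [Finset.sum_add_distrib, tU.balanced.sum_p, tW.balanced.sum_p])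
    (by rw [Finset.sum_add_distrib, tU.balanced.sum_q, tW.balanced.sum_q])
  have e3 : ∀ {ι : Type} [Fintype ι] (f g : ι → ℕ),
      ∑ i, (f i + g i) ^ 2 = ∑ i, f i ^ 2 + ∑ i, g i ^ 2 + 2 * ∑ i, f i * g i := by
    intro ι _ f g
    rw [Finset.mul_sum, ← Finset.sum_add_distrib, ← Finset.sum_add_distrib]
    exact Finset.sum_congr rfl fun i _ => by ring
  rw [e3, e3, e3] at h1
  have h2 := tU.norm
  have h3 := tW.norm
  have h4 : -1 ≤ moduleForm x τ a b U W := by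
    rw [hform, pairing]
    zify at h1 h2 h3
    push_cast
    nlinarith
  by_contra hneg
  have h5 : moduleForm x τ a b U W = -1 := by omega
  refine not_conditions_of_pairing h.le_five h.ne_zero hτ tU tW ?_ hc
  rw [hform] at h5
  zify
  push_cast at h5
  linarith

/-- Under the conditions, extensions of simple modules split. -/
theorem exists_section_of_simple (h : IsBraidAlgebra x a b) (hc : SemisimplicityConditions x)
    [IsSimpleModule E U] [IsSimpleModule E W] {ι : W →ₗ[E] V} {π : V →ₗ[E] U}
    (hι : Function.Injective ι) (hπ : Function.Surjective π)
    (hex : LinearMap.range ι = LinearMap.ker π) : ∃ s : U →ₗ[E] V, π ∘ₗ s = LinearMap.id := by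
  have hzc := braid_cube_central h.adjoin h.braid
  obtain ⟨ζ, hW⟩ := exists_scalar_of_central (U := W) hzc
  obtain ⟨ζ', hU⟩ := exists_scalar_of_central (U := U) hzc
  by_cases hne : ζ = ζ'
  swap
  · exact exists_section_of_central_ne hzc hne hπ hex hW hU
  subst hne
  have hV := central_smul_eq h.inj h.ne_zero h.adjoin h.braid h.poly_a h.poly_b hι hπ hex hW hU
  obtain ⟨τ, rfl⟩ := IsAlgClosed.exists_pow_nat_eq ζ (show 0 < 6 by norm_num)
  have hτ : τ ≠ 0 := by
    rintro rfl
    have : Nontrivial W := IsSimpleModule.nontrivial E W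
    obtain ⟨w, hw⟩ := exists_ne (0 : W)
    obtain ⟨ua, hua⟩ := isUnit_of_rootPoly' h.ne_zero h.poly_a
    obtain ⟨ub, hub⟩ := isUnit_of_rootPoly' h.ne_zero h.poly_b
    have h3 := hW w
    rw [← hua, ← hub, ← Units.val_mul, ← Units.val_pow_eq_pow_val, zero_pow (by norm_num),
      zero_smul] at h3
    exact hw ((smul_eq_zero_iff_eq ((ua * ub) ^ 3)).1 h3)
  have hform : (Module.finrank ℂ
        (intertwiners (act U a) (act U (a * b)) (act W a) (act W (a * b))) : ℤ) +
      Module.finrank ℂ (intertwiners (act W a) (act W (a * b)) (act U a) (act U (a * b))) ≤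
      moduleForm x τ a b U W := by
    by_cases hUW : IsEmpty (U ≃ₗ[E] W)
    · have hWU : IsEmpty (W ≃ₗ[E] U) := ⟨fun e => hUW.elim e.symm⟩
      rw [finrank_intertwiners_eq_zero h hUW, finrank_intertwiners_eq_zero h hWU]
      simpa using moduleForm_nonneg h hc hτ hU hW
    · rw [not_isEmpty_iff] at hUW
      obtain ⟨e⟩ := hUW
      have h1 := finrank_intertwiners_le_one (U := U) (W := W) h
      have h2 := finrank_intertwiners_le_one (U := W) (W := U) h
      have h3 := (isSimpleType h hτ hW).norm
      rw [moduleForm_congr e, moduleForm_eq, pairing]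
      simp only [← pow_two]
      zify at h1 h2 h3
      push_cast
      linarith
  obtain ⟨s, hs, hs'⟩ := exists_section_of_le h.inj (rootsB_injective hτ) (rootsC_injective hτ)
    h.ne_zero (rootsB_ne_zero hτ) (isTriple_act h hU) (isTriple_act h hW) (isTriple_act h hV) hform
    (ι := ι.restrictScalars ℂ) (π := π.restrictScalars ℂ) hι hπ
    (by ext v; exact SetLike.ext_iff.1 hex v)
    (LinearMap.ext fun w => (ι.map_smul a w).symm)
    (LinearMap.ext fun w => (ι.map_smul (a * b) w).symm)
    (LinearMap.ext fun w => (π.map_smul a w).symm)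
    (LinearMap.ext fun w => (π.map_smul (a * b) w).symm)
  obtain ⟨φ, rfl⟩ := exists_linearMap_of_mem_intertwiners h.adjoin
    (isUnit_of_rootPoly' h.ne_zero h.poly_a) hs'
  exact ⟨φ, LinearMap.ext fun u => LinearMap.congr_fun hs u⟩

theorem isSemisimpleModule_of_conditions (h : IsBraidAlgebra x a b)
    (hc : SemisimplicityConditions x) : IsSemisimpleModule E V := by
  have : IsNoetherian E V := isNoetherian_of_tower ℂ inferInstance
  have : IsArtinian E V := isArtinian_of_tower ℂ inferInstance
  have hcov : ∀ N M L : Submodule E V, N ⋖ M → M ⋖ L → ∃ D, M ⊓ D = N ∧ M ⊔ D = L := by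
    intro N M L hNM hML
    have s1 := (covBy_iff_quot_is_simple hNM.le).1 hNM
    have s2 := (covBy_iff_quot_is_simple hML.le).1 hML
    have fin : ∀ L : Submodule E V, FiniteDimensional ℂ L := fun L =>
      Module.Finite.of_injective (L.subtype.restrictScalars ℂ) L.injective_subtype
    have finq : ∀ (L : Submodule E V) (P : Submodule E L), FiniteDimensional ℂ (L ⧸ P) := by
      intro L P
      have := fin L
      exact Module.Finite.of_surjective (P.mkQ.restrictScalars ℂ) P.mkQ_surjective
    let N' := N.comap L.subtype
    let M' := M.comap L.subtype
    let i : M →ₗ[E] L := Submodule.inclusion hML.le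
    let ι : (M ⧸ N.comap M.subtype) →ₗ[E] (L ⧸ N') :=
      Submodule.mapQ _ _ i (fun m hm => hm)
    let π : (L ⧸ N') →ₗ[E] (L ⧸ M') := Submodule.mapQ _ _ LinearMap.id (fun l hl => hNM.le hl)
    have hι : Function.Injective ι := by
      rw [← LinearMap.ker_eq_bot, LinearMap.ker_eq_bot']
      intro m hm
      obtain ⟨m, rfl⟩ := Submodule.Quotient.mk_surjective _ m
      have hm' : (Submodule.Quotient.mk (i m) : L ⧸ N') = 0 := hm
      rw [Submodule.Quotient.mk_eq_zero] at hm'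
      replace hm := hm'
      exact (Submodule.Quotient.mk_eq_zero _).2 hm
    have hπ : Function.Surjective π := by
      intro l
      obtain ⟨l, rfl⟩ := Submodule.Quotient.mk_surjective _ l
      exact ⟨Submodule.Quotient.mk l, rfl⟩
    have hex : LinearMap.range ι = LinearMap.ker π := by
      ext l
      obtain ⟨l, rfl⟩ := Submodule.Quotient.mk_surjective _ l
      rw [LinearMap.mem_ker, Submodule.mapQ_apply, Submodule.Quotient.mk_eq_zero]
      constructor
      · rintro ⟨m, hm⟩
        change (l : V) ∈ M
        obtain ⟨m, rfl⟩ := Submodule.Quotient.mk_surjective _ m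
        have h1 : (m : V) - l ∈ N := (Submodule.Quotient.eq N' (x := i m) (y := l)).1 hm
        have h2 : (l : V) = m - (m - l) := by abel
        rw [h2]
        exact M.sub_mem m.2 (hNM.le h1)
      · intro hl
        exact ⟨Submodule.Quotient.mk ⟨l, hl⟩, rfl⟩
    have f1 := finq L N'
    have f2 := finq L M'
    have f3 := finq M (N.comap M.subtype)
    obtain ⟨s, hs⟩ := exists_section_of_simple h hc hι hπ hex
    have hs' : ∀ u, π (s u) = u := fun u => LinearMap.congr_fun hs u
    let D := ((LinearMap.range s).comap N'.mkQ).map L.subtype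
    have hND : N ≤ D := by
      intro v hv
      refine ⟨⟨v, hML.le (hNM.le hv)⟩, ?_, rfl⟩
      have : N'.mkQ ⟨v, hML.le (hNM.le hv)⟩ = 0 := (Submodule.Quotient.mk_eq_zero _).2 hv
      change N'.mkQ _ ∈ LinearMap.range s
      rw [this]
      exact Submodule.zero_mem _
    refine ⟨D, le_antisymm ?_ (le_inf hNM.le hND), le_antisymm ?_ ?_⟩
    · rintro v ⟨hvM, l, ⟨u, hu⟩, rfl⟩
      have h1 : π (N'.mkQ l) = 0 := by
        rw [Submodule.mkQ_apply, Submodule.mapQ_apply, Submodule.Quotient.mk_eq_zero]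
        exact hvM
      rw [← hu, hs'] at h1
      rw [h1, map_zero] at hu
      exact (Submodule.Quotient.mk_eq_zero N').1 hu.symm
    · refine sup_le hML.le ?_
      rintro _ ⟨l, -, rfl⟩
      exact l.2
    · intro v hv
      obtain ⟨l, hl⟩ := Submodule.Quotient.mk_surjective _ (s (π (N'.mkQ ⟨v, hv⟩)))
      have h1 : π (N'.mkQ (⟨v, hv⟩ - l)) = 0 := by
        rw [map_sub, map_sub, Submodule.mkQ_apply _ l, hl, hs', sub_self]
      rw [Submodule.mkQ_apply, Submodule.mapQ_apply, Submodule.Quotient.mk_eq_zero] at h1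
      have h2 : v - (l : V) ∈ M := h1
      have h3 : (l : V) ∈ D := ⟨l, ⟨_, hl.symm⟩, rfl⟩
      exact Submodule.mem_sup.2 ⟨_, h2, _, h3, sub_add_cancel _ _⟩
  have := complementedLattice_of_covBy hcov
  exact ⟨⟩

end modules

theorem isBraidAlgebra_gen {n : ℕ} (hn : n ≤ 5) {x : Fin n → ℂ} (hx : Function.Injective x)
    (hx0 : ∀ i, x i ≠ 0) : IsBraidAlgebra x (gen x 0) (gen x 1) :=
  ⟨hn, hx, hx0, gen_braid, gen_poly 0, gen_poly 1, adjoin_gen hx0⟩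

/-! ### Polynomial identities by evaluation at one integral point -/

/-- Polynomial expressions with integral coefficients. -/
inductive PExpr : Type
  | var (i : ℕ)
  | const (c : ℤ)
  | add (a b : PExpr)
  | sub (a b : PExpr)
  | mul (a b : PExpr)

namespace PExpr

instance : Add PExpr := ⟨add⟩
instance : Sub PExpr := ⟨sub⟩
instance : Mul PExpr := ⟨mul⟩

/-- The value of an expression in a commutative ring. -/
def eval {R : Type*} [CommRing R] (v : ℕ → R) : PExpr → R
  | var i => v i
  | const c => c
  | add a b => a.eval v + b.eval v
  | sub a b => a.eval v - b.eval v
  | mul a b => a.eval v * b.eval v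

/-- The value of an expression at an integral point. -/
def evalInt (v : ℕ → ℤ) : PExpr → ℤ
  | var i => v i
  | const c => c
  | add a b => Int.add (a.evalInt v) (b.evalInt v)
  | sub a b => Int.sub (a.evalInt v) (b.evalInt v)
  | mul a b => Int.mul (a.evalInt v) (b.evalInt v)

theorem evalInt_eq (v : ℕ → ℤ) (e : PExpr) : e.evalInt v = e.eval v := by
  induction e with
  | var i => rfl
  | const c => simp [eval, evalInt]
  | add a b ha hb => rw [eval, evalInt, ha, hb]; rfl
  | sub a b ha hb => rw [eval, evalInt, ha, hb]; rfl
  | mul a b ha hb => rw [eval, evalInt, ha, hb]; rfl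

/-- A bound for the absolute value of an expression when the absolute values of the variables are
bounded by `w`. -/
def bound (w : ℕ → ℕ) : PExpr → ℕ
  | var i => w i
  | const c => c.natAbs
  | add a b => Nat.add (a.bound w) (b.bound w)
  | sub a b => Nat.add (a.bound w) (b.bound w)
  | mul a b => Nat.mul (a.bound w) (b.bound w)

/-- Substitution of expressions for the variables. -/
def subst (s : ℕ → PExpr) : PExpr → PExpr
  | var i => s i
  | const c => const c
  | add a b => add (a.subst s) (b.subst s)
  | sub a b => sub (a.subst s) (b.subst s)
  | mul a b => mul (a.subst s) (b.subst s)

theorem eval_subst {R : Type*} [CommRing R] (v : ℕ → R) (s : ℕ → PExpr) (e : PExpr) :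
    (e.subst s).eval v = e.eval fun i => (s i).eval v := by
  induction e with
  | var i => rfl
  | const c => rfl
  | add a b ha hb => rw [subst, eval, eval, ha, hb]
  | sub a b ha hb => rw [subst, eval, eval, ha, hb]
  | mul a b ha hb => rw [subst, eval, eval, ha, hb]

theorem map_eval {R S : Type*} [CommRing R] [CommRing S] (f : R →+* S) (v : ℕ → R) (e : PExpr) :
    f (e.eval v) = e.eval fun i => f (v i) := by
  induction e with
  | var i => rfl
  | const c => simp [eval]
  | add a b ha hb => rw [eval, map_add, ha, hb, eval]
  | sub a b ha hb => rw [eval, map_sub, ha, hb, eval]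
  | mul a b ha hb => rw [eval, map_mul, ha, hb, eval]

/-- A submultiplicative size on a commutative ring for which an element smaller than `B` that is
divisible by `B` vanishes. -/
class SizedRing (R : Type*) [CommRing R] where
  size : R → ℕ
  size_int (c : ℤ) : size c ≤ c.natAbs
  size_add (a b : R) : size (a + b) ≤ size a + size b
  size_neg (a : R) : size (-a) = size a
  size_mul (a b : R) : size (a * b) ≤ size a * size b
  eq_zero (B : ℕ) (a : R) : size ((B : R) * a) < B → (B : R) * a = 0
  mul_cancel (B : ℕ) (a : R) : B ≠ 0 → (B : R) * a = 0 → a = 0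

open SizedRing

theorem size_eval_le {R : Type*} [CommRing R] [SizedRing R] {v : ℕ → R} {w : ℕ → ℕ}
    (h : ∀ i, size (v i) ≤ w i) (e : PExpr) : size (e.eval v) ≤ e.bound w := by
  induction e with
  | var i => exact h i
  | const c => exact size_int c
  | add a b ha hb => exact (size_add _ _).trans (Nat.add_le_add ha hb)
  | sub a b ha hb =>
    rw [eval, sub_eq_add_neg]
    refine (size_add _ _).trans (Nat.add_le_add ha ?_)
    rw [size_neg]; exact hb
  | mul a b ha hb => exact (size_mul _ _).trans (Nat.mul_le_mul ha hb)

instance : SizedRing ℤ where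
  size := Int.natAbs
  size_int c := le_rfl
  size_add a b := Int.natAbs_add_le a b
  size_neg a := Int.natAbs_neg a
  size_mul a b := (Int.natAbs_mul a b).le
  eq_zero B a h := by
    rw [Int.natAbs_mul, Int.natAbs_natCast] at h
    have : a.natAbs = 0 := by
      by_contra h0
      have := Nat.le_mul_of_pos_right B (Nat.pos_of_ne_zero h0)
      omega
    rw [Int.natAbs_eq_zero.1 this, mul_zero]
  mul_cancel B a hB h := (mul_eq_zero.1 h).resolve_left (by exact_mod_cast hB)

section poly

variable {R : Type*} [CommRing R] [SizedRing R]

theorem size_zero : size (0 : R) = 0 := by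
  have := size_int (R := R) 0
  simpa using this

/-- The sum of the sizes of the coefficients. -/
def polySize (p : R[X]) : ℕ := ∑ i ∈ p.support, size (p.coeff i)

theorem polySize_eq {p : R[X]} {k : ℕ} (h : p.natDegree < k) :
    polySize p = ∑ i ∈ Finset.range k, size (p.coeff i) := by
  refine Finset.sum_subset (fun i hi => ?_) (fun i _ hi => ?_)
  · exact Finset.mem_range.2 ((le_natDegree_of_mem_supp i hi).trans_lt h)
  · rw [notMem_support_iff.1 hi, size_zero]

theorem polySize_add_le (p q : R[X]) : polySize (p + q) ≤ polySize p + polySize q := by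
  have h1 : p.natDegree < p.natDegree + q.natDegree + 1 := by omega
  have h2 : q.natDegree < p.natDegree + q.natDegree + 1 := by omega
  rw [polySize_eq h1, polySize_eq h2, polySize_eq (k := p.natDegree + q.natDegree + 1)
    (lt_of_le_of_lt (natDegree_add_le p q) (by omega)), ← Finset.sum_add_distrib]
  exact Finset.sum_le_sum fun i _ => by rw [coeff_add]; exact size_add _ _

theorem polySize_sum_le {ι : Type*} (s : Finset ι) (f : ι → R[X]) :
    polySize (∑ i ∈ s, f i) ≤ ∑ i ∈ s, polySize (f i) := by
  classical
  induction s using Finset.induction_on with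
  | empty => simp [polySize]
  | insert i s hi ih =>
    rw [Finset.sum_insert hi, Finset.sum_insert hi]
    exact (polySize_add_le _ _).trans (Nat.add_le_add_left ih _)

theorem polySize_monomial_le (k : ℕ) (a : R) : polySize (monomial k a) ≤ size a := by
  rw [polySize_eq (k := k + 1) (Nat.lt_succ_of_le (natDegree_monomial_le a)),
    Finset.sum_eq_single k]
  · rw [coeff_monomial_same]
  · intro i _ hi
    rw [coeff_monomial, if_neg (Ne.symm hi), size_zero]
  · intro h; exact absurd (Finset.mem_range.2 (Nat.lt_succ_self k)) h

theorem polySize_mul_le (p q : R[X]) : polySize (p * q) ≤ polySize p * polySize q := by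
  rw [mul_eq_sum_sum]
  simp only [Polynomial.sum]
  refine (polySize_sum_le _ _).trans ?_
  rw [polySize, polySize, Finset.sum_mul_sum]
  refine Finset.sum_le_sum fun i _ => (polySize_sum_le _ _).trans ?_
  exact Finset.sum_le_sum fun j _ => (polySize_monomial_le _ _).trans (size_mul _ _)

theorem size_coeff_le (p : R[X]) (i : ℕ) : size (p.coeff i) ≤ polySize p := by
  rw [polySize_eq (k := max (p.natDegree + 1) (i + 1)) (by omega)]
  exact Finset.single_le_sum (f := fun i => size (p.coeff i)) (fun _ _ => Nat.zero_le _)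
    (Finset.mem_range.2 (by omega))

instance : SizedRing R[X] where
  size := polySize
  size_int c := by
    have : ((c : ℤ) : R[X]) = monomial 0 (c : R) := by simp
    rw [this]
    exact (polySize_monomial_le _ _).trans (size_int c)
  size_add := polySize_add_le
  size_neg p := by simp only [polySize, support_neg, coeff_neg, size_neg]
  size_mul := polySize_mul_le
  eq_zero B p h := by
    ext i
    have h1 := (size_coeff_le ((B : R[X]) * p) i).trans_lt h
    rw [← C_eq_natCast, coeff_C_mul] at h1 ⊢
    rw [eq_zero B _ h1, coeff_zero]
  mul_cancel B p hB h := by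
    ext i
    have h1 := congrArg (fun p => coeff p i) h
    simp only [← C_eq_natCast, coeff_C_mul, coeff_zero] at h1
    exact mul_cancel B _ hB h1

theorem coeff_zero_of_eval_eq_zero {B : ℕ} {p : R[X]} (hp : polySize p < B)
    (h : p.eval (B : R) = 0) : p.coeff 0 = 0 ∧ p.divX.eval (B : R) = 0 := by
  have h1 : (p.divX).eval (B : R) * B + p.coeff 0 = 0 := by
    rw [← divX_mul_X_add p] at h
    simpa using h
  have h2 : (B : R) * (-(p.divX).eval (B : R)) = p.coeff 0 := by linear_combination -h1
  have h3 : p.coeff 0 = 0 := by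
    rw [← h2]
    refine eq_zero B _ ?_
    rw [h2]
    exact (size_coeff_le p 0).trans_lt hp
  refine ⟨h3, mul_cancel B _ (by omega) ?_⟩
  rw [h3] at h1
  linear_combination h1

/-- A polynomial whose coefficients are small compared with `B` vanishes if it vanishes at `B`. -/
theorem eq_zero_of_eval_eq_zero {B : ℕ} (k : ℕ) {p : R[X]} (hk : p.natDegree ≤ k)
    (hp : polySize p < B) (h : p.eval (B : R) = 0) : p = 0 := by
  induction k generalizing p with
  | zero =>
    rw [eq_C_of_natDegree_le_zero hk, (coeff_zero_of_eval_eq_zero hp h).1, C_0]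
  | succ k ih =>
    obtain ⟨h0, hQ⟩ := coeff_zero_of_eval_eq_zero hp h
    have hQk : p.divX.natDegree ≤ k := by
      rw [natDegree_divX_eq_natDegree_tsub_one]; omega
    have hQs : polySize p.divX < B := by
      refine lt_of_le_of_lt ?_ hp
      rw [polySize_eq (k := k + 1) (by omega), polySize_eq (k := k + 2) (p := p) (by omega),
        Finset.sum_range_succ' _ (k + 1)]
      simp only [coeff_divX]
      omega
    rw [← divX_mul_X_add p, ih hQk hQs hQ, h0, C_0, zero_mul, zero_add]

/-- One step of the substitution of large integers for the variables. -/
theorem eval_update_X {v : ℕ → R} {w : ℕ → ℕ} (h : ∀ i, size (v i) ≤ w i) (k : ℕ) {B : ℕ}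
    {e : PExpr} (he : e.eval (Function.update v k (B : R)) = 0)
    (hB : e.bound (Function.update w k 1) < B) :
    e.eval (Function.update (fun i => C (v i)) k X) = 0 := by
  refine eq_zero_of_eval_eq_zero _ le_rfl (B := B) (lt_of_le_of_lt ?_ hB) ?_
  · refine size_eval_le (R := R[X]) (fun i => ?_) e
    by_cases hi : i = k
    · subst hi
      rw [Function.update_self, Function.update_self, ← monomial_one_one_eq_X]
      exact (polySize_monomial_le _ _).trans (by simpa using size_int (R := R) 1)
    · rw [Function.update_of_ne hi, Function.update_of_ne hi]
      exact (polySize_monomial_le 0 _).trans (h i)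
  · have := map_eval (evalRingHom (B : R)) (Function.update (fun i => C (v i)) k X) e
    rw [coe_evalRingHom] at this
    rw [this, ← he]
    congr 1
    ext i
    by_cases hi : i = k
    · subst hi; simp
    · simp [Function.update_of_ne hi]

end poly

/-- The point with the given four coordinates. -/
def point {R : Type*} [Zero R] (a₀ a₁ a₂ a₃ : R) : ℕ → R
  | 0 => a₀
  | 1 => a₁
  | 2 => a₂
  | 3 => a₃
  | _ => 0

/-- Evaluation at an integral point whose coordinates grow so fast that only the zero polynomial
vanishes there. -/
def check (e : PExpr) : Bool :=
  let b₀ := (e.bound (point 1 1 1 1)).succ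
  let b₁ := (e.bound (point b₀ 1 1 1)).succ
  let b₂ := (e.bound (point b₀ b₁ 1 1)).succ
  let b₃ := (e.bound (point b₀ b₁ b₂ 1)).succ
  decide (e.evalInt (point (Int.ofNat b₀) (Int.ofNat b₁) (Int.ofNat b₂) (Int.ofNat b₃)) = 0)

set_option maxHeartbeats 1000000 in
theorem eval_eq_zero_of_check {e : PExpr} (h : e.check = true) {A : Type*} [CommRing A]
    {v : ℕ → A} (hv : ∀ i, 4 ≤ i → v i = 0) : e.eval v = 0 := by
  simp only [check, decide_eq_true_eq] at h
  set b₀ := (e.bound (point 1 1 1 1)).succ with hb₀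
  set b₁ := (e.bound (point b₀ 1 1 1)).succ with hb₁
  set b₂ := (e.bound (point b₀ b₁ 1 1)).succ with hb₂
  set b₃ := (e.bound (point b₀ b₁ b₂ 1)).succ with hb₃
  rw [evalInt_eq] at h
  have size_point : ∀ {R : Type} [CommRing R] [SizedRing R] {a₀ a₁ a₂ a₃ : R}
      {c₀ c₁ c₂ c₃ : ℕ}, size a₀ ≤ c₀ → size a₁ ≤ c₁ → size a₂ ≤ c₂ → size a₃ ≤ c₃ →
      ∀ i, size (point a₀ a₁ a₂ a₃ i) ≤ point c₀ c₁ c₂ c₃ i := by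
    intro R _ _ a₀ a₁ a₂ a₃ c₀ c₁ c₂ c₃ h₀ h₁ h₂ h₃ i
    match i with
    | 0 => exact h₀
    | 1 => exact h₁
    | 2 => exact h₂
    | 3 => exact h₃
    | _ + 4 => exact size_zero.le
  have size_nat : ∀ {R : Type} [CommRing R] [SizedRing R] (b : ℕ), size (b : R) ≤ b := by
    intro R _ _ b
    simpa using size_int (R := R) b
  have size_X : ∀ {R : Type} [CommRing R] [SizedRing R], size (X : R[X]) ≤ 1 := by
    intro R _ _
    rw [← monomial_one_one_eq_X]
    exact (polySize_monomial_le _ _).trans (by simpa using size_int (R := R) 1)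
  have size_C : ∀ {R : Type} [CommRing R] [SizedRing R] {a : R} {c : ℕ}, size a ≤ c →
      size (C a) ≤ c := fun h => (polySize_monomial_le 0 _).trans h
  have upd : ∀ {R : Type} [Zero R] (a₀ a₁ a₂ a₃ b : R),
      Function.update (point a₀ a₁ a₂ a₃) 0 b = point b a₁ a₂ a₃ ∧
      Function.update (point a₀ a₁ a₂ a₃) 1 b = point a₀ b a₂ a₃ ∧
      Function.update (point a₀ a₁ a₂ a₃) 2 b = point a₀ a₁ b a₃ ∧
      Function.update (point a₀ a₁ a₂ a₃) 3 b = point a₀ a₁ a₂ b := by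
    intro R _ a₀ a₁ a₂ a₃ b
    refine ⟨?_, ?_, ?_, ?_⟩ <;> ext i <;> match i with
      | 0 => rfl
      | 1 => rfl
      | 2 => rfl
      | 3 => rfl
      | _ + 4 => rfl
  have C_point : ∀ {R : Type} [CommRing R] (a₀ a₁ a₂ a₃ : R),
      (fun i => C (point a₀ a₁ a₂ a₃ i)) = point (C a₀) (C a₁) (C a₂) (C a₃) := by
    intro R _ a₀ a₁ a₂ a₃
    ext1 i
    match i with
      | 0 => rfl
      | 1 => rfl
      | 2 => rfl
      | 3 => rfl
      | _ + 4 => exact C_0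
  have s3 := eval_update_X (R := ℤ) (v := point (b₀ : ℤ) b₁ b₂ 0) (w := point b₀ b₁ b₂ 1)
    (size_point (size_nat _) (size_nat _) (size_nat _) (by simp [size_zero])) 3
    (B := b₃) (e := e) (by rw [(upd _ _ _ _ _).2.2.2]; exact h)
    (by rw [(upd _ _ _ _ _).2.2.2]; exact Nat.lt_succ_self _)
  rw [C_point, (upd _ _ _ _ _).2.2.2] at s3
  have s2 := eval_update_X (R := ℤ[X]) (v := point (b₀ : ℤ[X]) b₁ 0 X) (w := point b₀ b₁ 1 1)
    (size_point (size_nat _) (size_nat _) (by simp [size_zero]) size_X) 2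
    (B := b₂) (e := e) (by rw [(upd _ _ _ _ _).2.2.1]; simpa using s3)
    (by rw [(upd _ _ _ _ _).2.2.1]; exact Nat.lt_succ_self _)
  rw [C_point, (upd _ _ _ _ _).2.2.1] at s2
  have s1 := eval_update_X (R := ℤ[X][X]) (v := point (b₀ : ℤ[X][X]) 0 X (C X))
    (w := point b₀ 1 1 1)
    (size_point (size_nat _) (by simp [size_zero]) size_X (size_C size_X)) 1
    (B := b₁) (e := e) (by rw [(upd _ _ _ _ _).2.1]; simpa using s2)
    (by rw [(upd _ _ _ _ _).2.1]; exact Nat.lt_succ_self _)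
  rw [C_point, (upd _ _ _ _ _).2.1] at s1
  have s0 := eval_update_X (R := ℤ[X][X][X]) (v := point (0 : ℤ[X][X][X]) X (C X) (C (C X)))
    (w := point 1 1 1 1)
    (size_point (by simp [size_zero]) size_X (size_C size_X) (size_C (size_C size_X))) 0
    (B := b₀) (e := e) (by rw [(upd _ _ _ _ _).1]; simpa using s1)
    (by rw [(upd _ _ _ _ _).1]; exact Nat.lt_succ_self _)
  rw [C_point, (upd _ _ _ _ _).1] at s0
  let _ : CommRing ℤ[X][X][X][X] := Polynomial.commRing (R := ℤ[X][X][X])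
  let φ : ℤ[X][X][X][X] →+* A :=
    eval₂RingHom (eval₂RingHom (eval₂RingHom (eval₂RingHom (Int.castRingHom A)
      (v 3)) (v 2)) (v 1)) (v 0)
  have hφ := map_eval (R := ℤ[X][X][X][X]) φ (point X (C X) (C (C X)) (C (C (C X)))) e
  rw [s0, map_zero] at hφ
  rw [hφ]
  congr 1
  ext1 i
  match i with
  | 0 => simp [φ, point]
  | 1 => simp [φ, point]
  | 2 => simp [φ, point]
  | 3 => simp [φ, point]
  | k + 4 => rw [hv (k + 4) (by omega)]; simp [point]

/-- The degree of an expression that is visibly homogeneous. -/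
def degree : PExpr → Option ℕ
  | var _ => some 1
  | const _ => some 0
  | add a b => if a.degree = b.degree then a.degree else none
  | sub a b => if a.degree = b.degree then a.degree else none
  | mul a b => match a.degree, b.degree with
    | some k, some l => some (k + l)
    | _, _ => none

theorem eval_smul {A : Type*} [CommRing A] (c : A) (v : ℕ → A) {e : PExpr} {k : ℕ}
    (h : e.degree = some k) : e.eval (fun i => c * v i) = c ^ k * e.eval v := by
  induction e generalizing k with
  | var i => cases h; simp [eval]
  | const z => cases h; simp [eval]
  | add a b ha hb =>
    rw [degree] at h
    split_ifs at h with hab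
    rw [eval, eval, ha h, hb (hab ▸ h), mul_add]
  | sub a b ha hb =>
    rw [degree] at h
    split_ifs at h with hab
    rw [eval, eval, ha h, hb (hab ▸ h), mul_sub]
  | mul a b ha hb =>
    rw [degree] at h
    rcases hak : a.degree with _ | k₁
    · simp [hak] at h
    rcases hbk : b.degree with _ | k₂
    · simp [hbk] at h
    rw [hak, hbk] at h
    cases h
    rw [eval, eval, ha hak, hb hbk, pow_add]
    ring

end PExpr

/-! ### The braid relation in dimension six -/

section six

instance : Zero PExpr := ⟨PExpr.const 0⟩

variable {R : Type*} [Add R] [Sub R] [Mul R] [Zero R]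

/-- The polynomial `p_i`. -/
def numP (x : Fin 5 → R) (i : Fin 5) : R :=
  x 0 * x 1 * x 2 * x 3 * x 4 - x i * x i * x i * (x 4 * x 4)

/-- The numerator of `w6`. -/
def numW (x₀ x₁ x₂ x₃ x₄ : R) : R :=
  (x₀ * x₁ * x₂ * x₃ * x₄ - x₀ * x₀ * x₀ * (x₄ * x₄)) *
    (x₀ * x₁ * x₂ * x₃ * (x₀ * x₂ + x₄ * (x₁ + x₃)) -
      x₄ * x₄ * x₄ * (x₀ * x₂ * (x₁ + x₃) + x₄ * x₁ * x₃))

/-- The numerator of `z6`; `a` is the variable of the row and `b` the double eigenvalue. -/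
def numZ (a x₁ x₂ x₃ b : R) : R :=
  let e₁ := x₁ + x₂ + x₃
  let e₂ := x₁ * x₂ + x₁ * x₃ + x₂ * x₃
  let e₃ := x₁ * x₂ * x₃
  (e₁ * e₃ - a * a * e₂) * (a * e₁ * e₃ - e₂ * (b * b * b)) * a * b +
    e₃ * (a - b) * (a * a * (e₁ - a) * (e₃ * (a - b) - e₁ * (b * b * b)) +
      (a * e₂ - e₃) * (a * e₂ + (a - b) * (b * b)) * b)

/-- The numerator of `u6`. -/
def numU (x₀ x₁ x₂ x₃ x₄ : R) : R :=
  x₀ * x₁ * (x₂ + x₃) * (x₂ * x₃ - x₀ * x₄) + x₂ * x₃ * (x₁ - x₀) * (x₀ * x₀ + x₁ * x₄)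

/-- The numerator of a diagonal entry; `a` is its variable and `b` the double eigenvalue. -/
def numG (a x₁ x₂ x₃ b : R) : R :=
  x₁ * x₂ * x₃ * b * (x₁ + x₂ + x₃ + b) -
    a * b * (x₁ * x₂ * x₃ + x₁ * x₂ * b + x₁ * x₃ * b + x₂ * x₃ * b)

/-- The numerators of the entries of `mat6`, for the denominators `ρᵢ κⱼ`. -/
def num6 (x : Fin 5 → R) : Matrix (Fin 6) (Fin 6) R :=
  let q₂ := x 0 * x 1 + x 2 * x 3
  let q₃ := x 0 * x 2 + x 1 * x 3
  let q₄ := x 0 * x 3 + x 1 * x 2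
  !![x 0 * x 0 * numG (x 0) (x 1) (x 2) (x 3) (x 4),
     numP x 1 * q₃ * q₄,
     numP x 2 * q₂ * q₄,
     numP x 3 * q₂ * q₃,
     numZ (x 0) (x 1) (x 2) (x 3) (x 4) * x 0 * x 4,
     q₃ * q₄ * numW (x 1) (x 2) (x 0) (x 3) (x 4);
     numP x 0,
     x 1 * x 1 * numG (x 1) (x 0) (x 2) (x 3) (x 4),
     q₂ * numP x 2,
     q₂ * numP x 3,
     numW (x 0) (x 2) (x 1) (x 3) (x 4),
     numZ (x 1) (x 0) (x 2) (x 3) (x 4) * x 1 * x 4;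
     numP x 0,
     q₃ * numP x 1,
     x 2 * x 2 * numG (x 2) (x 0) (x 1) (x 3) (x 4),
     q₃ * numP x 3,
     numW (x 0) (x 1) (x 2) (x 3) (x 4),
     q₃ * numW (x 1) (x 0) (x 2) (x 3) (x 4);
     numP x 0,
     q₄ * numP x 1,
     q₄ * numP x 2,
     x 3 * x 3 * numG (x 3) (x 0) (x 1) (x 2) (x 4),
     numW (x 0) (x 1) (x 3) (x 2) (x 4),
     q₄ * numW (x 1) (x 0) (x 3) (x 2) (x 4);
     x 0 * (x 1 - x 0),
     -- the factor gives this entry the degree that homogeneity asks for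
     0 * (x 0 * x 0 * (x 0 * x 0)),
     q₄ * x 2 * (x 1 - x 2),
     q₃ * x 3 * (x 1 - x 3),
     numU (x 0) (x 1) (x 2) (x 3) (x 4) * x 0 * x 4 * (x 1 - x 4),
     q₃ * q₄ * numP x 1 * (x 1 - x 4);
     0,
     x 1 * (x 0 - x 1),
     x 2 * (x 0 - x 2),
     x 3 * (x 0 - x 3),
     numP x 0 * (x 0 - x 4),
     numU (x 1) (x 0) (x 2) (x 3) (x 4) * x 1 * x 4 * (x 0 - x 4)]

/-- The product of the differences of four variables. -/
def vand (a b c d : R) : R := (b - a) * (c - a) * (d - a) * (c - b) * (d - b) * (d - c)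

/-- The eigenvalues of `g₁`, multiplied by a common multiple of the denominators and divided by
`κₖ ρₖ`. -/
def cofac6 (x : Fin 5 → R) : Fin 6 → R :=
  ![x 1 * x 2 * x 3 * x 4 * vand (x 1) (x 2) (x 3) (x 4),
    x 0 * x 2 * x 3 * x 4 * vand (x 2) (x 0) (x 3) (x 4),
    x 0 * x 1 * x 3 * x 4 * vand (x 0) (x 1) (x 3) (x 4),
    x 0 * x 1 * x 2 * x 4 * vand (x 1) (x 0) (x 2) (x 4),
    x 1 * x 2 * x 3 * x 4 *
      ((x 2 - x 0) * (x 3 - x 0) * (x 2 - x 1) * (x 3 - x 1) * (x 3 - x 2)),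
    x 0 * x 2 * x 3 * x 4 *
      ((x 0 - x 2) * (x 3 - x 0) * (x 2 - x 1) * (x 3 - x 1) * (x 3 - x 2))]

/-- The eigenvalues of `g₁`. -/
def eig6 (x : Fin 5 → R) : Fin 6 → R := ![x 0, x 1, x 2, x 3, x 4, x 4]

/-- A common multiple of the denominators. -/
def lcm6 (x : Fin 5 → R) : R :=
  x 0 * x 1 * x 2 * x 3 * x 4 * ((x 1 - x 0) * (x 2 - x 0) * (x 3 - x 0) * (x 4 - x 0) *
    ((x 2 - x 1) * (x 3 - x 1) * (x 4 - x 1)) * ((x 3 - x 2) * (x 4 - x 2) * (x 4 - x 3)))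

/-- The difference of the two sides of the braid relation, with the denominators removed. -/
def braid6 (x : Fin 5 → R) (i j : Fin 6) : R :=
  num6 x i 0 * num6 x 0 j * cofac6 x 0 + num6 x i 1 * num6 x 1 j * cofac6 x 1 +
  num6 x i 2 * num6 x 2 j * cofac6 x 2 + num6 x i 3 * num6 x 3 j * cofac6 x 3 +
  num6 x i 4 * num6 x 4 j * cofac6 x 4 + num6 x i 5 * num6 x 5 j * cofac6 x 5 -
  eig6 x i * eig6 x j * num6 x i j * lcm6 x

/-- Replaces all but the first four variables by one. -/
def dehom : ℕ → PExpr
  | 0 => PExpr.var 0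
  | 1 => PExpr.var 1
  | 2 => PExpr.var 2
  | 3 => PExpr.var 3
  | _ => PExpr.const 1

end six

/-- The first five variables. -/
def vars5 (i : Fin 5) : PExpr := PExpr.var i

/-- The braid relation in dimension six as a polynomial identity, checked with `x₅ = 1`: it is
homogeneous. -/
theorem braid6_check : ∀ i j : Fin 6, (((braid6 vars5 i j).subst dehom).check &&
    (braid6 vars5 i j).degree.isSome) = true := by
  decide +kernel

section eval

variable (v : ℕ → ℂ)

theorem eval_num6 (i j : Fin 6) :
    (num6 vars5 i j).eval v = num6 (fun i => v i) i j := by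
  have h0 : (0 : PExpr).eval v = 0 := by
    show ((0 : ℤ) : ℂ) = 0
    simp
  have h1 : (num6 vars5 4 1).eval v = num6 (fun i => v i) 4 1 := congrArg (· * _) h0
  fin_cases i <;> fin_cases j <;> first | rfl | exact h0 | exact h1

theorem eval_cofac6 (k : Fin 6) : (cofac6 vars5 k).eval v = cofac6 (fun i => v i) k := by
  fin_cases k <;> rfl

theorem eval_lcm6 : (lcm6 vars5).eval v = lcm6 fun i => v i := rfl

theorem eval_braid6 (i j : Fin 6) :
    (braid6 vars5 i j).eval v = braid6 (fun i => v i) i j := by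
  have h2 : ∀ k, (eig6 vars5 k).eval v = eig6 (fun i => v i) k := by
    intro k
    fin_cases k <;> rfl
  rw [braid6, braid6, ← eval_lcm6]
  simp only [← eval_num6, ← eval_cofac6, ← h2]
  rfl

end eval

/-- The point with the given five coordinates and all further coordinates equal to `f`. -/
def vals5 (x : Fin 5 → ℂ) (f : ℂ) : ℕ → ℂ
  | 0 => x 0
  | 1 => x 1
  | 2 => x 2
  | 3 => x 3
  | 4 => x 4
  | _ => f

theorem vals5_comp_val (x : Fin 5 → ℂ) (f : ℂ) : (fun i : Fin 5 => vals5 x f i) = x := by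
  ext i
  fin_cases i <;> rfl

/-- A homogeneous polynomial in five variables vanishes where the last variable is nonzero, if it
vanishes after setting this variable to one. -/
theorem eval_eq_zero_of_check_dehom {e : PExpr}
    (h : ((e.subst dehom).check && e.degree.isSome) = true) (x : Fin 5 → ℂ) (h4 : x 4 ≠ 0) :
    e.eval (vals5 x (x 4)) = 0 := by
  rw [Bool.and_eq_true, Option.isSome_iff_exists] at h
  obtain ⟨h1, k, h2⟩ := h
  let y : ℕ → ℂ := PExpr.point (x 0 / x 4) (x 1 / x 4) (x 2 / x 4) (x 3 / x 4)
  have h3 := PExpr.eval_eq_zero_of_check h1 (v := y) fun i hi => by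
    match i, hi with
    | k + 4, _ => rfl
  rw [PExpr.eval_subst] at h3
  have h5 := PExpr.eval_smul (x 4) (fun i => (dehom i).eval y) h2
  rw [h3, mul_zero] at h5
  rw [← h5]
  refine congrArg (fun v => e.eval v) (funext fun i => ?_)
  match i with
  | 0 | 1 | 2 | 3 => simp only [dehom, PExpr.eval, y, PExpr.point, vals5]; field_simp
  | 4 => simp [dehom, PExpr.eval, vals5]
  | k + 5 => simp [dehom, PExpr.eval, vals5]

theorem braid6_eq_zero (x : Fin 5 → ℂ) (h4 : x 4 ≠ 0) (i j : Fin 6) : braid6 x i j = 0 := by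
  have h := eval_eq_zero_of_check_dehom (braid6_check i j) x h4
  rwa [eval_braid6, vals5_comp_val] at h

theorem esym_of_val_four {d : ℕ} (x : Fin d → ℂ) {S : Finset (Fin d)} {a b c e : Fin d}
    (h : S.val = a ::ₘ b ::ₘ c ::ₘ e ::ₘ 0) :
    esym x S 1 = x a + x b + x c + x e ∧
    esym x S 3 = x a * x b * x c + x a * x b * x e + x a * x c * x e + x b * x c * x e ∧
    esym x S 4 = x a * x b * x c * x e := by
  simp only [esym, h, Multiset.map_cons, Multiset.map_zero, Multiset.esymm]
  refine ⟨?_, ?_, ?_⟩ <;>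
    simp [Multiset.powersetCard_cons, Multiset.powersetCard_one] <;> ring

theorem esym_of_val_three {d : ℕ} (x : Fin d → ℂ) {S : Finset (Fin d)} {a b c : Fin d}
    (h : S.val = a ::ₘ b ::ₘ c ::ₘ 0) :
    esym x S 1 = x a + x b + x c ∧
    esym x S 2 = x a * x b + x a * x c + x b * x c ∧
    esym x S 3 = x a * x b * x c := by
  simp only [esym, h, Multiset.map_cons, Multiset.map_zero, Multiset.esymm]
  refine ⟨?_, ?_, ?_⟩ <;>
    simp [Multiset.powersetCard_cons, Multiset.powersetCard_one] <;> ring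

theorem Delta_of_val_three {d : ℕ} (x : Fin d → ℂ) {S : Finset (Fin d)} {i a b c : Fin d}
    (h : (S.erase i).val = a ::ₘ b ::ₘ c ::ₘ 0) :
    Delta x S i = (x a - x i) * (x b - x i) * (x c - x i) := by
  rw [Delta, Finset.prod, h]
  simp
  ring

theorem Delta_of_val_four {d : ℕ} (x : Fin d → ℂ) {S : Finset (Fin d)} {i a b c e : Fin d}
    (h : (S.erase i).val = a ::ₘ b ::ₘ c ::ₘ e ::ₘ 0) :
    Delta x S i = (x a - x i) * (x b - x i) * (x c - x i) * (x e - x i) := by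
  rw [Delta, Finset.prod, h]
  simp
  ring

section six

variable (x : Fin 5 → ℂ)

theorem p6_eq (i : Fin 5) : p6 i x = numP x i := by
  rw [p6, Fin.prod_univ_five, numP]
  ring

theorem w6_eq : w6 x = numW (x 0) (x 1) (x 2) (x 3) (x 4) := by
  rw [w6, p6_eq, numP, numW]
  ring

theorem z6_eq : z6 x = numZ (x 0) (x 1) (x 2) (x 3) (x 4) := by
  obtain ⟨h1, h2, h3⟩ := esym_of_val_three x (S := {1, 2, 3}) (a := 1) (b := 2) (c := 3)
    (by decide)
  simp only [z6, h1, h2, h3, numZ]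
  ring

theorem u6_eq : u6 x = numU (x 0) (x 1) (x 2) (x 3) (x 4) /
    ((x 1 - x 0) * ((x 0 - x 4) * (x 2 - x 4) * (x 3 - x 4))) := by
  rw [u6, Delta_of_val_three x (a := 0) (b := 2) (c := 3) (by decide)]
  simp only [numU, pow_two]

theorem v6_eq : v6 x = numP x 1 /
    (x 0 * x 4 * (x 1 - x 0) * ((x 0 - x 4) * (x 2 - x 4) * (x 3 - x 4))) := by
  rw [v6, Delta_of_val_three x (a := 0) (b := 2) (c := 3) (by decide), p6_eq]

theorem r6_eq : r6 x = x 2 /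
    (x 0 * (x 1 - x 0) * ((x 0 - x 2) * (x 3 - x 2) * (x 4 - x 2))) := by
  rw [r6, Delta_of_val_three x (a := 0) (b := 3) (c := 4) (by decide)]

theorem diag6_eq {i a b c : Fin 5} (h : (Finset.univ.erase i).val = a ::ₘ b ::ₘ c ::ₘ 4 ::ₘ 0) :
    (esym x (Finset.univ.erase i) 4 * esym x (Finset.univ.erase i) 1
      - x i * x 4 * esym x (Finset.univ.erase i) 3) = numG (x i) (x a) (x b) (x c) (x 4) := by
  obtain ⟨h1, h3, h4⟩ := esym_of_val_four x h
  simp only [h1, h3, h4, numG]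

theorem swap01_apply : Equiv.swap (0 : Fin 5) 1 0 = 1 ∧ Equiv.swap (0 : Fin 5) 1 1 = 0 ∧
    Equiv.swap (0 : Fin 5) 1 2 = 2 ∧ Equiv.swap (0 : Fin 5) 1 3 = 3 ∧
    Equiv.swap (0 : Fin 5) 1 4 = 4 := by decide

theorem swap12_apply : Equiv.swap (1 : Fin 5) 2 0 = 0 ∧ Equiv.swap (1 : Fin 5) 2 1 = 2 ∧
    Equiv.swap (1 : Fin 5) 2 2 = 1 ∧ Equiv.swap (1 : Fin 5) 2 3 = 3 ∧
    Equiv.swap (1 : Fin 5) 2 4 = 4 := by decide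

theorem swap23_apply : Equiv.swap (2 : Fin 5) 3 0 = 0 ∧ Equiv.swap (2 : Fin 5) 3 1 = 1 ∧
    Equiv.swap (2 : Fin 5) 3 2 = 3 ∧ Equiv.swap (2 : Fin 5) 3 3 = 2 ∧
    Equiv.swap (2 : Fin 5) 3 4 = 4 := by decide

theorem numP_swap : numP (x ∘ Equiv.swap 0 1) 1 = numP x 0 := by
  simp only [numP, Function.comp_apply, swap01_apply]
  ring

/-- The row parts of the denominators of the entries of `mat6`. -/
def rowDen6 (x : Fin 5 → ℂ) : Fin 6 → ℂ :=
  ![x 0 ^ 2, x 1 ^ 2, x 2 ^ 2, x 3 ^ 2, x 0 * (x 1 - x 0), x 1 * (x 0 - x 1)]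

/-- The column parts of the denominators of the entries of `mat6`. -/
noncomputable def colDen6 (x : Fin 5 → ℂ) : Fin 6 → ℂ :=
  ![(x 1 - x 0) * (x 2 - x 0) * (x 3 - x 0) * (x 4 - x 0),
    (x 0 - x 1) * (x 2 - x 1) * (x 3 - x 1) * (x 4 - x 1),
    (x 0 - x 2) * (x 1 - x 2) * (x 3 - x 2) * (x 4 - x 2),
    (x 0 - x 3) * (x 1 - x 3) * (x 2 - x 3) * (x 4 - x 3),
    x 4 * ((x 0 - x 4) * (x 1 - x 4) * (x 2 - x 4) * (x 3 - x 4)),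
    x 4 * ((x 0 - x 4) * (x 1 - x 4) * (x 2 - x 4) * (x 3 - x 4))]

variable {x}

set_option maxHeartbeats 4000000 in
theorem mat6_apply (hx : Function.Injective x) (hx0 : ∀ i, x i ≠ 0) (i j : Fin 6) :
    mat6 x i j = num6 x i j / (rowDen6 x i * colDen6 x j) := by
  have d : ∀ i j : Fin 5, i ≠ j → x i - x j ≠ 0 := fun i j h => sub_ne_zero.2 (hx.ne h)
  have h0 := hx0 0
  have h1 := hx0 1
  have h2 := hx0 2
  have h3 := hx0 3
  have h4 := hx0 4
  have d01 := d 0 1 (by decide)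
  have d02 := d 0 2 (by decide)
  have d03 := d 0 3 (by decide)
  have d04 := d 0 4 (by decide)
  have d10 := d 1 0 (by decide)
  have d12 := d 1 2 (by decide)
  have d13 := d 1 3 (by decide)
  have d14 := d 1 4 (by decide)
  have d20 := d 2 0 (by decide)
  have d21 := d 2 1 (by decide)
  have d23 := d 2 3 (by decide)
  have d24 := d 2 4 (by decide)
  have d30 := d 3 0 (by decide)
  have d31 := d 3 1 (by decide)
  have d32 := d 3 2 (by decide)
  have d34 := d 3 4 (by decide)
  have d40 := d 4 0 (by decide)
  have d41 := d 4 1 (by decide)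
  have d42 := d 4 2 (by decide)
  have d43 := d 4 3 (by decide)
  clear d
  rw [mat6]
  simp only [diag6_eq x (i := 0) (a := 1) (b := 2) (c := 3) (by decide),
    diag6_eq x (i := 1) (a := 0) (b := 2) (c := 3) (by decide),
    diag6_eq x (i := 2) (a := 0) (b := 1) (c := 3) (by decide),
    diag6_eq x (i := 3) (a := 0) (b := 1) (c := 2) (by decide),
    Delta_of_val_four x (a := 1) (b := 2) (c := 3) (e := 4) (i := 0) (S := Finset.univ) (by decide),
    Delta_of_val_four x (a := 0) (b := 2) (c := 3) (e := 4) (i := 1)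
      (S := Finset.univ) (by decide),
    Delta_of_val_four x (a := 0) (b := 1) (c := 3) (e := 4) (i := 2)
      (S := Finset.univ) (by decide),
    Delta_of_val_four x (a := 0) (b := 1) (c := 2) (e := 4) (i := 3)
      (S := Finset.univ) (by decide),
    Delta_of_val_four x (a := 0) (b := 1) (c := 2) (e := 3) (i := 4)
      (S := Finset.univ) (by decide),
    sigma, w6_eq, z6_eq, u6_eq, v6_eq, r6_eq, p6_eq, numP_swap, Function.comp_apply, swap01_apply,
    swap12_apply, swap23_apply]
  fin_cases i <;> fin_cases j <;>
    simp only [num6, rowDen6, colDen6, Fin.zero_eta, Fin.mk_one, Fin.reduceFinMk, Fin.isValue,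
      Matrix.of_apply, Matrix.cons_val, Matrix.cons_val_zero, Matrix.cons_val_one] <;>
    field_simp <;> try ring1

/-- The relation that brings the sum over `k` in the matrix product `g₂ g₁ g₂` to a common
denominator. -/
theorem cofac6_mul (k : Fin 6) :
    cofac6 x k * (rowDen6 x k * colDen6 x k) = eig6 x k * lcm6 x := by
  fin_cases k <;>
    simp only [cofac6, rowDen6, colDen6, eig6, lcm6, vand, Fin.zero_eta, Fin.mk_one,
      Fin.reduceFinMk, Fin.isValue, Matrix.cons_val, Matrix.cons_val_zero,
      Matrix.cons_val_one] <;> ring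

theorem rowDen6_mul_colDen6_ne_zero (hx : Function.Injective x) (hx0 : ∀ i, x i ≠ 0)
    (i j : Fin 6) : rowDen6 x i * colDen6 x j ≠ 0 := by
  have d : ∀ i j : Fin 5, i ≠ j → x i - x j ≠ 0 := fun i j h => sub_ne_zero.2 (hx.ne h)
  refine mul_ne_zero ?_ ?_
  · fin_cases i <;> simp [rowDen6, hx0, d]
  · fin_cases j <;> simp [colDen6, hx0, d]

theorem lcm6_ne_zero (hx : Function.Injective x) (hx0 : ∀ i, x i ≠ 0) : lcm6 x ≠ 0 := by
  have d : ∀ i j : Fin 5, i ≠ j → x i - x j ≠ 0 := fun i j h => sub_ne_zero.2 (hx.ne h)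
  simp [lcm6, hx0, d]

theorem mat6_braid (hx : Function.Injective x) (hx0 : ∀ i, x i ≠ 0) :
    mat6 x * Matrix.diagonal (eig6 x) * mat6 x =
      Matrix.diagonal (eig6 x) * mat6 x * Matrix.diagonal (eig6 x) := by
  ext i j
  have hL := lcm6_ne_zero hx hx0
  have hk : ∀ k, mat6 x i k * eig6 x k * mat6 x k j =
      num6 x i k * num6 x k j * cofac6 x k / (rowDen6 x i * colDen6 x j * lcm6 x) := by
    intro k
    have h1 := rowDen6_mul_colDen6_ne_zero hx hx0 i j
    have h2 := rowDen6_mul_colDen6_ne_zero hx hx0 k k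
    have h3 := rowDen6_mul_colDen6_ne_zero hx hx0 i k
    have h4 := rowDen6_mul_colDen6_ne_zero hx hx0 k j
    rw [mat6_apply hx hx0, mat6_apply hx hx0, eq_div_iff (mul_ne_zero h1 hL), div_mul_eq_mul_div,
      div_mul_div_comm, div_mul_eq_mul_div, div_eq_iff (mul_ne_zero h3 h4)]
    linear_combination -(num6 x i k * num6 x k j * rowDen6 x i * colDen6 x j) * cofac6_mul k
  rw [Matrix.mul_apply, Matrix.mul_diagonal, Matrix.diagonal_mul]
  simp only [Matrix.mul_diagonal, hk]
  rw [← Finset.sum_div, mat6_apply hx hx0 i j, div_eq_iff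
    (mul_ne_zero (rowDen6_mul_colDen6_ne_zero hx hx0 i j) hL), Fin.sum_univ_six]
  have h1 := rowDen6_mul_colDen6_ne_zero hx hx0 i j
  have h2 : eig6 x i * (num6 x i j / (rowDen6 x i * colDen6 x j)) * eig6 x j *
      (rowDen6 x i * colDen6 x j * lcm6 x) = eig6 x i * eig6 x j * num6 x i j * lcm6 x := by
    rw [mul_div_assoc', div_mul_eq_mul_div, div_mul_eq_mul_div, div_eq_iff h1]
    ring
  rw [h2]
  have h3 := braid6_eq_zero x (hx0 4) i j
  rw [braid6] at h3
  linear_combination h3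

end six

/-! ### The braid relation in dimensions four and five -/

namespace PExpr

/-- A bound for the degree in the variable `4`. -/
def degreeFour : PExpr → ℕ
  | var i => if i = 4 then 1 else 0
  | const _ => 0
  | add a b => max a.degreeFour b.degreeFour
  | sub a b => max a.degreeFour b.degreeFour
  | mul a b => a.degreeFour + b.degreeFour

/-- Powers. -/
def pow (q : PExpr) : ℕ → PExpr
  | 0 => const 1
  | k + 1 => mul (q.pow k) q

/-- The substitution of `p / q` for the variable `4`, multiplied by a power of `q` that clears the
denominators. -/
def clear (p q : PExpr) : PExpr → PExpr
  | var i => if i = 4 then p else var i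
  | const c => const c
  | add a b => add (mul (q.pow (b.degreeFour - a.degreeFour)) (clear p q a))
      (mul (q.pow (a.degreeFour - b.degreeFour)) (clear p q b))
  | sub a b => sub (mul (q.pow (b.degreeFour - a.degreeFour)) (clear p q a))
      (mul (q.pow (a.degreeFour - b.degreeFour)) (clear p q b))
  | mul a b => mul (clear p q a) (clear p q b)

theorem eval_pow {R : Type*} [CommRing R] (v : ℕ → R) (q : PExpr) (k : ℕ) :
    (q.pow k).eval v = q.eval v ^ k := by
  induction k with
  | zero => simp [pow, eval]
  | succ k ih => rw [pow, eval, ih, pow_succ]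

theorem eval_clear {R : Type*} [CommRing R] {v w : ℕ → R} {p q : PExpr}
    (hw : ∀ i, i ≠ 4 → w i = v i) (hpq : p.eval w = q.eval w * v 4) (e : PExpr) :
    (clear p q e).eval w = q.eval w ^ e.degreeFour * e.eval v := by
  have key (k l : ℕ) : q.eval w ^ max k l = q.eval w ^ (l - k) * q.eval w ^ k ∧
      q.eval w ^ max k l = q.eval w ^ (k - l) * q.eval w ^ l := by
    rw [← pow_add, ← pow_add]
    constructor <;> congr 1 <;> omega
  induction e with
  | var i =>
    by_cases hi : i = 4
    · subst hi
      simp [clear, degreeFour, eval, hpq]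
    · simp [clear, degreeFour, eval, hi, hw i hi]
  | const c => simp [clear, degreeFour, eval]
  | add a b ha hb =>
    obtain ⟨h1, h2⟩ := key a.degreeFour b.degreeFour
    simp only [clear, eval, eval_pow, ha, hb, degreeFour]
    linear_combination -a.eval v * h1 - b.eval v * h2
  | sub a b ha hb =>
    obtain ⟨h1, h2⟩ := key a.degreeFour b.degreeFour
    simp only [clear, eval, eval_pow, ha, hb, degreeFour]
    linear_combination -a.eval v * h1 + b.eval v * h2
  | mul a b ha hb =>
    rw [clear, eval, ha, hb, degreeFour, eval, pow_add]
    ring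

/-- An identity between rational functions of four variables, one more variable being `p / q`. -/
theorem eval_eq_zero_of_check_clear {A : Type*} [CommRing A] [IsDomain A] {e p q : PExpr}
    (h : (clear p q e).check = true) {v w : ℕ → A} (hv : ∀ i, 4 ≤ i → w i = 0)
    (hw : ∀ i, i ≠ 4 → w i = v i) (hpq : p.eval w = q.eval w * v 4) (hq : q.eval w ≠ 0) :
    e.eval v = 0 := by
  have h1 := eval_clear hw hpq e
  rw [eval_eq_zero_of_check h hv] at h1
  exact (mul_eq_zero.1 h1.symm).resolve_left (pow_ne_zero _ hq)

end PExpr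

section four

variable {R : Type*} [Add R] [Sub R] [Mul R]

/-- The numerator of a diagonal entry; `a` is its variable. -/
def numA (h a b c d : R) : R :=
  a * a * (b * c * d * (b + c + d) - h * (b * c + b * d + c * d))

/-- The numerators of the entries of `mat4`, for the denominators `x_i²Δ_i`. -/
def num4 (h : R) (x : Fin 4 → R) : Matrix (Fin 4) (Fin 4) R :=
  let e := x 0 * x 1 * x 2 * x 3
  let γ₂ := x 0 * x 1 + x 2 * x 3 - h
  let γ₃ := x 0 * x 2 + x 1 * x 3 - h
  let γ₄ := x 0 * x 3 + x 1 * x 2 - h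
  !![numA h (x 0) (x 1) (x 2) (x 3), (e - h * x 0 * x 0) * γ₃ * γ₄,
      (e - h * x 0 * x 0) * γ₂ * γ₄, (e - h * x 0 * x 0) * γ₂ * γ₃;
     e - h * x 1 * x 1, numA h (x 1) (x 0) (x 2) (x 3), (e - h * x 1 * x 1) * γ₂,
      (e - h * x 1 * x 1) * γ₂;
     e - h * x 2 * x 2, (e - h * x 2 * x 2) * γ₃, numA h (x 2) (x 0) (x 1) (x 3),
      (e - h * x 2 * x 2) * γ₃;
     e - h * x 3 * x 3, (e - h * x 3 * x 3) * γ₄, (e - h * x 3 * x 3) * γ₄,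
      numA h (x 3) (x 0) (x 1) (x 2)]

/-- A common multiple of the denominators. -/
def lcm4 (x : Fin 4 → R) : R :=
  x 0 * x 1 * x 2 * x 3 * vand (x 0) (x 1) (x 2) (x 3)

/-- The product of the differences of three variables. -/
def vand3 (a b c : R) : R := (b - a) * (c - a) * (c - b)

/-- The quotients of `lcm4` by `x_kΔ_k`. -/
def cofac4 (x : Fin 4 → R) : Fin 4 → R :=
  ![x 1 * x 2 * x 3 * vand3 (x 1) (x 2) (x 3), x 0 * x 2 * x 3 * vand3 (x 2) (x 0) (x 3),
    x 0 * x 1 * x 3 * vand3 (x 0) (x 1) (x 3), x 0 * x 1 * x 2 * vand3 (x 1) (x 0) (x 2)]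

/-- The difference of the two sides of the braid relation, with the denominators removed. -/
def braid4 (h : R) (x : Fin 4 → R) (i j : Fin 4) : R :=
  num4 h x i 0 * num4 h x 0 j * cofac4 x 0 + num4 h x i 1 * num4 h x 1 j * cofac4 x 1 +
  num4 h x i 2 * num4 h x 2 j * cofac4 x 2 + num4 h x i 3 * num4 h x 3 j * cofac4 x 3 -
  x i * x j * num4 h x i j * lcm4 x

end four

/-- The variables of the identity in dimension four. The variable `3` stands for `h`. -/
def vars4 : Fin 4 → PExpr :=
  ![PExpr.var 0, PExpr.var 1, PExpr.var 2, PExpr.var 4]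

/-- The braid relation in dimension four as a polynomial identity in `x₁, x₂, x₃, h`, after the
substitution `x₄ = h² / (x₁ x₂ x₃)`. -/
theorem braid4_check : ∀ i j : Fin 4, (PExpr.clear (PExpr.var 3 * PExpr.var 3)
    (PExpr.var 0 * PExpr.var 1 * PExpr.var 2) (braid4 (PExpr.var 3) vars4 i j)).check = true := by
  decide +kernel

section five

variable {R : Type*} [Add R] [Sub R] [Mul R]

/-- The numerator of a diagonal entry; `a` is its variable. -/
def numM (f a b c d e : R) : R :=
  f * a * a * (b * c * d * e * (b + c + d + e) +
    f * a * (b * c * d + b * c * e + b * d * e + c * d * e) +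
    f * ((f + b) * (f + c) * (f + d) * (f + e)))

/-- The numerator of an entry outside the diagonal; `a` is the variable of its row. -/
def numO (f a b c d : R) : R :=
  (a * a + f * a + f * f) * ((f * f + a * b) * (f * f + a * c) * (f * f + a * d))

/-- The numerators of the entries of `mat5`, for the denominators `fx_ix_jΔ_i`. -/
def num5 (f : R) (x : Fin 5 → R) : Matrix (Fin 5) (Fin 5) R :=
  !![numM f (x 0) (x 1) (x 2) (x 3) (x 4), numO f (x 0) (x 2) (x 3) (x 4),
      numO f (x 0) (x 1) (x 3) (x 4), numO f (x 0) (x 1) (x 2) (x 4),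
      numO f (x 0) (x 1) (x 2) (x 3);
     numO f (x 1) (x 2) (x 3) (x 4), numM f (x 1) (x 0) (x 2) (x 3) (x 4),
      numO f (x 1) (x 0) (x 3) (x 4), numO f (x 1) (x 0) (x 2) (x 4),
      numO f (x 1) (x 0) (x 2) (x 3);
     numO f (x 2) (x 1) (x 3) (x 4), numO f (x 2) (x 0) (x 3) (x 4),
      numM f (x 2) (x 0) (x 1) (x 3) (x 4), numO f (x 2) (x 0) (x 1) (x 4),
      numO f (x 2) (x 0) (x 1) (x 3);
     numO f (x 3) (x 1) (x 2) (x 4), numO f (x 3) (x 0) (x 2) (x 4),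
      numO f (x 3) (x 0) (x 1) (x 4), numM f (x 3) (x 0) (x 1) (x 2) (x 4),
      numO f (x 3) (x 0) (x 1) (x 2);
     numO f (x 4) (x 1) (x 2) (x 3), numO f (x 4) (x 0) (x 2) (x 3),
      numO f (x 4) (x 0) (x 1) (x 3), numO f (x 4) (x 0) (x 1) (x 2),
      numM f (x 4) (x 0) (x 1) (x 2) (x 3)]

/-- A common multiple of the denominators. -/
def lcm5 (x : Fin 5 → R) : R :=
  x 0 * x 1 * x 2 * x 3 * x 4 * (vand (x 0) (x 1) (x 2) (x 3) *
    ((x 4 - x 0) * (x 4 - x 1) * (x 4 - x 2) * (x 4 - x 3)))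

/-- The quotients of `lcm5` by `x_kΔ_k`. -/
def cofac5 (x : Fin 5 → R) : Fin 5 → R :=
  ![x 1 * x 2 * x 3 * x 4 * vand (x 1) (x 2) (x 3) (x 4),
    x 0 * x 2 * x 3 * x 4 * vand (x 2) (x 0) (x 3) (x 4),
    x 0 * x 1 * x 3 * x 4 * vand (x 0) (x 1) (x 3) (x 4),
    x 0 * x 1 * x 2 * x 4 * vand (x 1) (x 0) (x 2) (x 4),
    x 0 * x 1 * x 2 * x 3 * vand (x 0) (x 1) (x 2) (x 3)]

/-- The difference of the two sides of the braid relation, with the denominators removed. -/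
def braid5 (f : R) (x : Fin 5 → R) (i j : Fin 5) : R :=
  num5 f x i 0 * num5 f x 0 j * cofac5 x 0 + num5 f x i 1 * num5 f x 1 j * cofac5 x 1 +
  num5 f x i 2 * num5 f x 2 j * cofac5 x 2 + num5 f x i 3 * num5 f x 3 j * cofac5 x 3 +
  num5 f x i 4 * num5 f x 4 j * cofac5 x 4 - f * (x i * x j * num5 f x i j * lcm5 x)

end five

/-- Replaces all but the first five variables by one. -/
def dehomFive : ℕ → PExpr
  | 0 => PExpr.var 0
  | 1 => PExpr.var 1
  | 2 => PExpr.var 2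
  | 3 => PExpr.var 3
  | 4 => PExpr.var 4
  | _ => PExpr.const 1

/-- The braid relation in dimension five as a polynomial identity, with `f = 1` by homogeneity and
`x₅ = 1 / (x₁ x₂ x₃ x₄)`. -/
theorem braid5_check : ∀ i j : Fin 5, ((PExpr.clear (PExpr.const 1)
    (PExpr.var 0 * PExpr.var 1 * PExpr.var 2 * PExpr.var 3)
    ((braid5 (PExpr.var 5) vars5 i j).subst dehomFive)).check &&
    (braid5 (PExpr.var 5) vars5 i j).degree.isSome) = true := by
  decide +kernel

section eval

variable (v : ℕ → ℂ)

theorem eval_braid4 (i j : Fin 4) : (braid4 (PExpr.var 3) vars4 i j).eval v =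
    braid4 (v 3) ![v 0, v 1, v 2, v 4] i j := by
  have h0 : ∀ i j, (num4 (PExpr.var 3) vars4 i j).eval v =
      num4 (v 3) ![v 0, v 1, v 2, v 4] i j := by
    intro i j
    fin_cases i <;> fin_cases j <;> rfl
  have h1 : ∀ k, (cofac4 vars4 k).eval v = cofac4 ![v 0, v 1, v 2, v 4] k := by
    intro k
    fin_cases k <;> rfl
  have h2 : ∀ k, (vars4 k).eval v = ![v 0, v 1, v 2, v 4] k := by
    intro k
    fin_cases k <;> rfl
  have h3 : (lcm4 vars4).eval v = lcm4 ![v 0, v 1, v 2, v 4] := rfl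
  rw [braid4, braid4, ← h3]
  simp only [← h0, ← h1, ← h2]
  rfl

theorem eval_num5 (i j : Fin 5) :
    (num5 (PExpr.var 5) vars5 i j).eval v = num5 (v 5) (fun i => v i) i j := by
  fin_cases i <;> fin_cases j <;> rfl

theorem eval_cofac5 (k : Fin 5) : (cofac5 vars5 k).eval v = cofac5 (fun i => v i) k := by
  fin_cases k <;> rfl

theorem eval_lcm5 : (lcm5 vars5).eval v = lcm5 fun i => v i := rfl

theorem eval_braid5 (i j : Fin 5) : (braid5 (PExpr.var 5) vars5 i j).eval v =
    braid5 (v 5) (fun i => v i) i j := by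
  rw [braid5, braid5, ← eval_lcm5]
  simp only [← eval_num5, ← eval_cofac5]
  rfl

end eval

/-- The point with the coordinates `x 0`, `x 1`, `x 2`, `h`, `x 3`. -/
def vals4 (x : Fin 4 → ℂ) (h : ℂ) : ℕ → ℂ :=
  fun k => if k = 4 then x 3 else PExpr.point (x 0) (x 1) (x 2) h k

theorem vals4_vec (x : Fin 4 → ℂ) (h : ℂ) :
    ![vals4 x h 0, vals4 x h 1, vals4 x h 2, vals4 x h 4] = x := by
  ext i
  fin_cases i <;> rfl

/-- An identity that is checked after the substitution `x₄ = h² / (x₁ x₂ x₃)` holds if `h²` is the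
product of the four variables. -/
theorem eval_eq_zero_of_check_four {e : PExpr} (he : (PExpr.clear (PExpr.var 3 * PExpr.var 3)
    (PExpr.var 0 * PExpr.var 1 * PExpr.var 2) e).check = true) {h : ℂ} {x : Fin 4 → ℂ}
    (hx0 : ∀ i, x i ≠ 0) (hh : h ^ 2 = ∏ i, x i) : e.eval (vals4 x h) = 0 := by
  rw [Fin.prod_univ_four] at hh
  exact PExpr.eval_eq_zero_of_check_clear he (v := vals4 x h)
    (w := PExpr.point (x 0) (x 1) (x 2) h)
    (fun i hi => by
      match i, hi with
      | k + 4, _ => rfl)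
    (fun i hi => by simp [vals4, hi])
    (show h * h = x 0 * x 1 * x 2 * x 3 by rw [← hh]; ring)
    (show x 0 * x 1 * x 2 ≠ 0 from mul_ne_zero (mul_ne_zero (hx0 0) (hx0 1)) (hx0 2))

theorem braid4_eq_zero {h : ℂ} {x : Fin 4 → ℂ} (hx0 : ∀ i, x i ≠ 0) (hh : h ^ 2 = ∏ i, x i)
    (i j : Fin 4) : braid4 h x i j = 0 := by
  have h1 := eval_eq_zero_of_check_four (braid4_check i j) hx0 hh
  rw [eval_braid4, vals4_vec] at h1
  exact h1

theorem ne_zero_of_pow_five_eq {f : ℂ} {x : Fin 5 → ℂ} (hx0 : ∀ i, x i ≠ 0)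
    (hf : f ^ 5 = ∏ i, x i) : f ≠ 0 := by
  rintro rfl
  rw [zero_pow (by norm_num)] at hf
  exact Finset.prod_ne_zero_iff.2 (fun i _ => hx0 i) hf.symm

/-- An identity that is homogeneous and checked for `f = 1`, `x₅ = 1 / (x₁ x₂ x₃ x₄)` holds if `f⁵` is
the product of the five variables. -/
theorem eval_eq_zero_of_check_five {e : PExpr} (he : ((PExpr.clear (PExpr.const 1)
    (PExpr.var 0 * PExpr.var 1 * PExpr.var 2 * PExpr.var 3) (e.subst dehomFive)).check &&
    e.degree.isSome) = true) {f : ℂ} {x : Fin 5 → ℂ} (hx0 : ∀ i, x i ≠ 0)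
    (hf : f ^ 5 = ∏ i, x i) : e.eval (vals5 x f) = 0 := by
  have hf0 : f ≠ 0 := ne_zero_of_pow_five_eq hx0 hf
  rw [Fin.prod_univ_five] at hf
  obtain ⟨w, hw⟩ : ∃ w, w = PExpr.point (x 0 / f) (x 1 / f) (x 2 / f) (x 3 / f) := ⟨_, rfl⟩
  have hw4 : ∀ i, 4 ≤ i → w i = 0 := by
    intro i hi
    rw [hw]
    match i, hi with
    | k + 4, _ => rfl
  have hpq : ((1 : ℤ) : ℂ) = w 0 * w 1 * w 2 * w 3 * (x 4 / f) := by
    rw [hw]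
    simp only [PExpr.point]
    field_simp
    rw [← hf]
    simp
  have hq : w 0 * w 1 * w 2 * w 3 ≠ 0 := by
    rw [hw]
    simp [PExpr.point, hx0, hf0]
  rw [Bool.and_eq_true, Option.isSome_iff_exists] at he
  obtain ⟨h1, k, h2⟩ := he
  have h3 := PExpr.eval_eq_zero_of_check_clear h1
    (v := fun k => if k = 4 then x 4 / f else w k) (w := w) hw4
    (fun i hi => by simp only [if_neg hi]) hpq hq
  rw [PExpr.eval_subst] at h3
  have h5 := PExpr.eval_smul f (fun i => (dehomFive i).eval
    fun k => if k = 4 then x 4 / f else w k) h2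
  rw [h3, mul_zero] at h5
  rw [← h5]
  refine congrArg (fun v => e.eval v) (funext fun i => ?_)
  match i with
  | 0 | 1 | 2 | 3 | 4 =>
    simp [dehomFive, PExpr.eval, hw, PExpr.point, vals5]
    field_simp
  | k + 5 => simp [dehomFive, PExpr.eval, vals5]

theorem braid5_eq_zero {f : ℂ} {x : Fin 5 → ℂ} (hx0 : ∀ i, x i ≠ 0) (hf : f ^ 5 = ∏ i, x i)
    (i j : Fin 5) : braid5 f x i j = 0 := by
  have h := eval_eq_zero_of_check_five (braid5_check i j) hx0 hf
  rwa [eval_braid5, vals5_comp_val] at h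

theorem prod_of_val_three {d : ℕ} (y : Fin d → ℂ) {S : Finset (Fin d)} {a b c : Fin d}
    (h : S.val = a ::ₘ b ::ₘ c ::ₘ 0) : ∏ i ∈ S, y i = y a * y b * y c := by
  rw [Finset.prod, h]
  simp
  ring

theorem prod_of_val_four {d : ℕ} (y : Fin d → ℂ) {S : Finset (Fin d)} {a b c e : Fin d}
    (h : S.val = a ::ₘ b ::ₘ c ::ₘ e ::ₘ 0) : ∏ i ∈ S, y i = y a * y b * y c * y e := by
  rw [Finset.prod, h]
  simp
  ring

section four

variable {h : ℂ} {x : Fin 4 → ℂ}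

/-- The products `Δ_i` of four variables. -/
noncomputable def den4 (x : Fin 4 → ℂ) : Fin 4 → ℂ :=
  ![(x 1 - x 0) * (x 2 - x 0) * (x 3 - x 0), (x 0 - x 1) * (x 2 - x 1) * (x 3 - x 1),
    (x 0 - x 2) * (x 1 - x 2) * (x 3 - x 2), (x 0 - x 3) * (x 1 - x 3) * (x 2 - x 3)]

theorem den4_ne_zero (hx : Function.Injective x) (i : Fin 4) : den4 x i ≠ 0 := by
  have d : ∀ i j : Fin 4, i ≠ j → x i - x j ≠ 0 := fun i j h => sub_ne_zero.2 (hx.ne h)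
  fin_cases i <;> simp [den4, d]

set_option maxHeartbeats 1000000 in
theorem mat4_apply (hx : Function.Injective x) (hx0 : ∀ i, x i ≠ 0) (i j : Fin 4) :
    mat4 h x i j = num4 h x i j / (x i ^ 2 * den4 x i) := by
  have h0 := hx0 0
  have h1 := hx0 1
  have h2 := hx0 2
  have h3 := hx0 3
  have d := den4_ne_zero hx
  have e0 := esym_of_val_three x (S := Finset.univ.erase 0) (a := 1) (b := 2) (c := 3) (by decide)
  have e1 := esym_of_val_three x (S := Finset.univ.erase 1) (a := 0) (b := 2) (c := 3) (by decide)
  have e2 := esym_of_val_three x (S := Finset.univ.erase 2) (a := 0) (b := 1) (c := 3) (by decide)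
  have e3 := esym_of_val_three x (S := Finset.univ.erase 3) (a := 0) (b := 1) (c := 2) (by decide)
  rw [mat4]
  simp only [Fin.prod_univ_four, e0, e1, e2, e3]
  rw [show Delta x Finset.univ 0 = den4 x 0 from Delta_of_val_three x (by decide),
    show Delta x Finset.univ 1 = den4 x 1 from Delta_of_val_three x (by decide),
    show Delta x Finset.univ 2 = den4 x 2 from Delta_of_val_three x (by decide),
    show Delta x Finset.univ 3 = den4 x 3 from Delta_of_val_three x (by decide)]
  have d0 := d 0
  have d1 := d 1
  have d2 := d 2
  have d3 := d 3
  clear d hx0 hx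
  fin_cases i <;> fin_cases j <;>
    simp only [num4, numA, Fin.zero_eta, Fin.mk_one, Fin.reduceFinMk, Fin.isValue,
      Matrix.of_apply, Matrix.cons_val, Matrix.cons_val_zero, Matrix.cons_val_one] <;>
    field_simp

theorem cofac4_mul (k : Fin 4) : cofac4 x k * (x k * den4 x k) = lcm4 x := by
  fin_cases k <;>
    simp only [cofac4, den4, lcm4, vand, vand3, Fin.zero_eta, Fin.mk_one,
      Fin.reduceFinMk, Fin.isValue, Matrix.cons_val, Matrix.cons_val_zero,
      Matrix.cons_val_one] <;> ring

theorem mat4_braid (hx : Function.Injective x) (hx0 : ∀ i, x i ≠ 0) (hh : h ^ 2 = ∏ i, x i) :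
    mat4 h x * Matrix.diagonal x * mat4 h x =
      Matrix.diagonal x * mat4 h x * Matrix.diagonal x := by
  ext i j
  have hd := den4_ne_zero hx
  have hL : lcm4 x ≠ 0 := by
    rw [← cofac4_mul 0]
    have d : ∀ i j : Fin 4, i ≠ j → x i - x j ≠ 0 := fun i j h => sub_ne_zero.2 (hx.ne h)
    simp [cofac4, vand3, hx0, d, den4]
  have hk : ∀ k, mat4 h x i k * x k * mat4 h x k j =
      num4 h x i k * num4 h x k j * cofac4 x k / (x i ^ 2 * den4 x i * lcm4 x) := by
    intro k
    rw [mat4_apply hx hx0, mat4_apply hx hx0, ← cofac4_mul k]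
    have h1 := hx0 k
    have h2 := hx0 i
    have h3 := hd k
    have h4 := hd i
    have h5 : cofac4 x k ≠ 0 := by
      intro h0
      rw [← cofac4_mul k, h0, zero_mul] at hL
      exact hL rfl
    field_simp
  rw [Matrix.mul_apply, Matrix.mul_diagonal, Matrix.diagonal_mul]
  simp only [Matrix.mul_diagonal, hk]
  have h2 := hx0 i
  have h4 := hd i
  rw [← Finset.sum_div, mat4_apply hx hx0 i j, div_eq_iff
    (mul_ne_zero (mul_ne_zero (pow_ne_zero 2 h2) h4) hL), Fin.sum_univ_four]
  have h3 := braid4_eq_zero hx0 hh i j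
  rw [braid4] at h3
  field_simp
  linear_combination h3

end four

section five

variable {f : ℂ} {x : Fin 5 → ℂ}

/-- The products `Δ_i` of five variables. -/
noncomputable def den5 (x : Fin 5 → ℂ) : Fin 5 → ℂ :=
  ![(x 1 - x 0) * (x 2 - x 0) * (x 3 - x 0) * (x 4 - x 0),
    (x 0 - x 1) * (x 2 - x 1) * (x 3 - x 1) * (x 4 - x 1),
    (x 0 - x 2) * (x 1 - x 2) * (x 3 - x 2) * (x 4 - x 2),
    (x 0 - x 3) * (x 1 - x 3) * (x 2 - x 3) * (x 4 - x 3),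
    (x 0 - x 4) * (x 1 - x 4) * (x 2 - x 4) * (x 3 - x 4)]

theorem den5_ne_zero (hx : Function.Injective x) (i : Fin 5) : den5 x i ≠ 0 := by
  have d : ∀ i j : Fin 5, i ≠ j → x i - x j ≠ 0 := fun i j h => sub_ne_zero.2 (hx.ne h)
  fin_cases i <;> simp [den5, d]

theorem mat5_apply_ne {i j a b c : Fin 5} (hij : i ≠ j)
    (h : ((Finset.univ.erase i).erase j).val = a ::ₘ b ::ₘ c ::ₘ 0) :
    mat5 f x i j = numO f (x i) (x a) (x b) (x c) / (f * x i * x j * Delta x Finset.univ i) := by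
  rw [mat5, Matrix.of_apply, if_neg hij, prod_of_val_three _ h, numO]
  ring

theorem mat5_apply_self (hf : f ≠ 0) {i a b c e : Fin 5} (hi : x i ≠ 0)
    (h : (Finset.univ.erase i).val = a ::ₘ b ::ₘ c ::ₘ e ::ₘ 0) :
    mat5 f x i i = numM f (x i) (x a) (x b) (x c) (x e) /
      (f * x i * x i * Delta x Finset.univ i) := by
  obtain ⟨h1, h3, h4⟩ := esym_of_val_four x h
  rw [mat5, Matrix.of_apply, if_pos rfl, h1, h3, h4, prod_of_val_four _ h, numM,
    mul_div_mul_left _ _ (mul_ne_zero (mul_ne_zero hf hi) hi)]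

theorem Delta_eq_den5 (i : Fin 5) : Delta x Finset.univ i = den5 x i := by
  fin_cases i <;> exact Delta_of_val_four x (by decide)

theorem mat5_apply (hf : f ≠ 0) (hx0 : ∀ i, x i ≠ 0) (i j : Fin 5) :
    mat5 f x i j = num5 f x i j / (f * x i * x j * den5 x i) := by
  rw [← Delta_eq_den5]
  fin_cases i <;> fin_cases j <;> first
    | exact mat5_apply_ne (by decide) (by decide)
    | exact mat5_apply_self hf (hx0 _) (by decide)

theorem cofac5_mul (k : Fin 5) : cofac5 x k * (x k * den5 x k) = lcm5 x := by
  fin_cases k <;>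
    simp only [cofac5, den5, lcm5, vand, Fin.zero_eta, Fin.mk_one,
      Fin.reduceFinMk, Fin.isValue, Matrix.cons_val, Matrix.cons_val_zero,
      Matrix.cons_val_one] <;> ring

theorem mat5_braid (hx : Function.Injective x) (hx0 : ∀ i, x i ≠ 0) (hf : f ^ 5 = ∏ i, x i) :
    mat5 f x * Matrix.diagonal x * mat5 f x =
      Matrix.diagonal x * mat5 f x * Matrix.diagonal x := by
  ext i j
  have hd := den5_ne_zero hx
  have hf0 := ne_zero_of_pow_five_eq hx0 hf
  have hL : lcm5 x ≠ 0 := by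
    rw [← cofac5_mul 0]
    have d : ∀ i j : Fin 5, i ≠ j → x i - x j ≠ 0 := fun i j h => sub_ne_zero.2 (hx.ne h)
    simp [cofac5, vand, hx0, d, den5]
  have hk : ∀ k, mat5 f x i k * x k * mat5 f x k j =
      num5 f x i k * num5 f x k j * cofac5 x k /
        (f * x i * x j * den5 x i * (f * lcm5 x)) := by
    intro k
    rw [mat5_apply hf0 hx0, mat5_apply hf0 hx0, ← cofac5_mul k]
    have h1 := hx0 k
    have h2 := hx0 i
    have h3 := hd k
    have h4 := hd i
    have h6 := hx0 j
    have h5 : cofac5 x k ≠ 0 := by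
      intro h0
      rw [← cofac5_mul k, h0, zero_mul] at hL
      exact hL rfl
    field_simp
  rw [Matrix.mul_apply, Matrix.mul_diagonal, Matrix.diagonal_mul]
  simp only [Matrix.mul_diagonal, hk]
  have h2 := hx0 i
  have h4 := hd i
  have h6 := hx0 j
  rw [← Finset.sum_div, mat5_apply hf0 hx0 i j, div_eq_iff
    (mul_ne_zero (mul_ne_zero (mul_ne_zero (mul_ne_zero hf0 h2) h6) h4) (mul_ne_zero hf0 hL)),
    Fin.sum_univ_five]
  have h3 := braid5_eq_zero hx0 hf i j
  rw [braid5] at h3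
  field_simp
  linear_combination h3

end five

theorem mat3_braid {x : Fin 3 → ℂ} (hx : Function.Injective x) :
    mat3 x * Matrix.diagonal x * mat3 x =
      Matrix.diagonal x * mat3 x * Matrix.diagonal x := by
  have d : ∀ i j : Fin 3, i ≠ j → x i - x j ≠ 0 := fun i j h => sub_ne_zero.2 (hx.ne h)
  have d01 := d 0 1 (by decide)
  have d02 := d 0 2 (by decide)
  have d10 := d 1 0 (by decide)
  have d12 := d 1 2 (by decide)
  have d20 := d 2 0 (by decide)
  have d21 := d 2 1 (by decide)
  have D0 : Delta x Finset.univ 0 = (x 1 - x 0) * (x 2 - x 0) := by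
    rw [Delta, show Finset.univ.erase (0 : Fin 3) = {1, 2} by decide]
    simp
  have D1 : Delta x Finset.univ 1 = (x 0 - x 1) * (x 2 - x 1) := by
    rw [Delta, show Finset.univ.erase (1 : Fin 3) = {0, 2} by decide]
    simp
  have D2 : Delta x Finset.univ 2 = (x 0 - x 2) * (x 1 - x 2) := by
    rw [Delta, show Finset.univ.erase (2 : Fin 3) = {0, 1} by decide]
    simp
  ext i j
  rw [Matrix.mul_apply, Matrix.mul_diagonal, Matrix.diagonal_mul]
  simp only [Matrix.mul_diagonal, Fin.sum_univ_three]
  rw [mat3, D0, D1, D2]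
  fin_cases i <;> fin_cases j <;>
    simp only [Fin.zero_eta, Fin.mk_one, Fin.reduceFinMk, Fin.isValue,
      Matrix.of_apply, Matrix.cons_val, Matrix.cons_val_zero, Matrix.cons_val_one] <;>
    field_simp <;> ring1

theorem mat2_braid {x : Fin 2 → ℂ} (hx : Function.Injective x) :
    mat2 x * Matrix.diagonal x * mat2 x =
      Matrix.diagonal x * mat2 x * Matrix.diagonal x := by
  have d01 : x 0 - x 1 ≠ 0 := sub_ne_zero.2 (hx.ne (by decide))
  ext i j
  rw [Matrix.mul_apply, Matrix.mul_diagonal, Matrix.diagonal_mul]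
  simp only [Matrix.mul_diagonal, Fin.sum_univ_two]
  rw [mat2]
  fin_cases i <;> fin_cases j <;>
    simp only [Fin.zero_eta, Fin.mk_one, Fin.isValue, Matrix.smul_apply,
      Matrix.of_apply, Matrix.cons_val_zero, Matrix.cons_val_one, smul_eq_mul] <;>
    field_simp <;> ring1

/-! ### One entry of the central element -/

section expressions

variable {R : Type*} [Add R] [Sub R] [Mul R] [Zero R]

/-- The entry `(0, 0)` of the square of `g₁ g₂ g₁`, in dimension four, with the denominators
removed, minus its expected value. -/
def central4 (h : R) (x : Fin 4 → R) : R :=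
  num4 h x 0 0 * num4 h x 0 0 * (x 0 * cofac4 x 0) +
  num4 h x 0 1 * num4 h x 1 0 * (x 1 * cofac4 x 1) +
  num4 h x 0 2 * num4 h x 2 0 * (x 2 * cofac4 x 2) +
  num4 h x 0 3 * num4 h x 3 0 * (x 3 * cofac4 x 3) -
  h * h * h * ((x 1 - x 0) * (x 2 - x 0) * (x 3 - x 0) * lcm4 x)

/-- The analogue of `central4` in dimension five. -/
def central5 (f : R) (x : Fin 5 → R) : R :=
  num5 f x 0 0 * num5 f x 0 0 * (x 0 * cofac5 x 0) +
  num5 f x 0 1 * num5 f x 1 0 * (x 1 * cofac5 x 1) +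
  num5 f x 0 2 * num5 f x 2 0 * (x 2 * cofac5 x 2) +
  num5 f x 0 3 * num5 f x 3 0 * (x 3 * cofac5 x 3) +
  num5 f x 0 4 * num5 f x 4 0 * (x 4 * cofac5 x 4) -
  f * f * f * f * (f * f * f * f) *
    ((x 1 - x 0) * (x 2 - x 0) * (x 3 - x 0) * (x 4 - x 0) * lcm5 x)

/-- The analogue of `central4` in dimension six. -/
def central6 (x : Fin 5 → R) : R :=
  num6 x 0 0 * num6 x 0 0 * (x 0 * cofac6 x 0) +
  num6 x 0 1 * num6 x 1 0 * (x 1 * cofac6 x 1) +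
  num6 x 0 2 * num6 x 2 0 * (x 2 * cofac6 x 2) +
  num6 x 0 3 * num6 x 3 0 * (x 3 * cofac6 x 3) +
  num6 x 0 4 * num6 x 4 0 * (x 4 * cofac6 x 4) +
  num6 x 0 5 * num6 x 5 0 * (x 4 * cofac6 x 5) +
  x 0 * x 1 * x 2 * x 3 * x 4 * x 4 *
    ((x 1 - x 0) * (x 2 - x 0) * (x 3 - x 0) * (x 4 - x 0) * lcm6 x)

end expressions

theorem central4_check : (PExpr.clear (PExpr.var 3 * PExpr.var 3)
    (PExpr.var 0 * PExpr.var 1 * PExpr.var 2) (central4 (PExpr.var 3) vars4)).check = true := by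
  decide +kernel

theorem central5_check : ((PExpr.clear (PExpr.const 1)
    (PExpr.var 0 * PExpr.var 1 * PExpr.var 2 * PExpr.var 3)
    ((central5 (PExpr.var 5) vars5).subst dehomFive)).check &&
    (central5 (PExpr.var 5) vars5).degree.isSome) = true := by
  decide +kernel

theorem central6_check : (((central6 vars5).subst dehom).check &&
    (central6 vars5).degree.isSome) = true := by
  decide +kernel

theorem central4_eq_zero {h : ℂ} {x : Fin 4 → ℂ} (hx0 : ∀ i, x i ≠ 0) (hh : h ^ 2 = ∏ i, x i) :
    central4 h x = 0 := by
  have h1 := eval_eq_zero_of_check_four central4_check hx0 hh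
  have h2 : (central4 (PExpr.var 3) vars4).eval (vals4 x h) = central4 h
    ![vals4 x h 0, vals4 x h 1, vals4 x h 2, vals4 x h 4] := rfl
  rwa [h2, vals4_vec] at h1

theorem eval_central5 (v : ℕ → ℂ) :
    (central5 (PExpr.var 5) vars5).eval v = central5 (v 5) (fun i => v i) := by
  rw [central5, central5, ← eval_lcm5]
  simp only [← eval_num5, ← eval_cofac5]
  rfl

theorem eval_central6 (v : ℕ → ℂ) : (central6 vars5).eval v = central6 (fun i => v i) := by
  rw [central6, central6, ← eval_lcm6]
  simp only [← eval_num6, ← eval_cofac6]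
  rfl

theorem central5_eq_zero {f : ℂ} {x : Fin 5 → ℂ} (hx0 : ∀ i, x i ≠ 0) (hf : f ^ 5 = ∏ i, x i) :
    central5 f x = 0 := by
  have h1 := eval_eq_zero_of_check_five central5_check hx0 hf
  rw [eval_central5, vals5_comp_val] at h1
  exact h1

theorem central6_eq_zero {x : Fin 5 → ℂ} (h4 : x 4 ≠ 0) : central6 x = 0 := by
  have h1 := eval_eq_zero_of_check_dehom central6_check x h4
  rwa [eval_central6, vals5_comp_val] at h1

/-! ### The listed pairs of matrices -/

/-- The matrices `A`, `B` satisfy the braid relation, have only scalar matrices in their common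
commutant, and `(A B)³` is the scalar `ζ`. -/
structure IsScalarPair {d : ℕ} (A B : Matrix (Fin d) (Fin d) ℂ) (ζ : ℂ) : Prop where
  braid : A * B * A = B * A * B
  comm : ∀ Z, Z * A = A * Z → Z * B = B * Z → ∃ c : ℂ, Z = c • 1
  cube : (A * B) ^ 3 = ζ • 1

/-- The central element `(A B)³ = (A B A)²` commutes with `A` and `B`, hence is a scalar, which can be
read off from one entry. -/
theorem IsScalarPair.of_entry {d : ℕ} {y : Fin (d + 1) → ℂ}
    {g : Matrix (Fin (d + 1)) (Fin (d + 1)) ℂ} {ζ : ℂ}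
    (hbr : g * Matrix.diagonal y * g = Matrix.diagonal y * g * Matrix.diagonal y)
    (hc : ∀ Z, Z * Matrix.diagonal y = Matrix.diagonal y * Z → Z * g = g * Z →
      ∃ c : ℂ, Z = c • 1)
    (h0 : y 0 * y 0 * ∑ k, g 0 k * (y k * y k) * g k 0 = ζ) :
    IsScalarPair (Matrix.diagonal y) g ζ := by
  refine ⟨hbr.symm, hc, ?_⟩
  obtain ⟨h1, h2⟩ := braid_cube_comm hbr.symm
  obtain ⟨c, h3⟩ := hc _ h1 h2
  rw [h3]
  congr 1
  rw [braid_cube hbr.symm] at h3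
  have h4 := congrFun (congrFun h3 0) 0
  rw [pow_two, Matrix.mul_apply, Matrix.smul_apply, Matrix.one_apply_eq, smul_eq_mul,
    mul_one] at h4
  rw [← h4, ← h0, Finset.mul_sum]
  refine Finset.sum_congr rfl fun k _ => ?_
  rw [Matrix.mul_diagonal, Matrix.diagonal_mul, Matrix.mul_diagonal, Matrix.diagonal_mul]
  ring

/-- A matrix that commutes with a diagonal matrix with distinct eigenvalues is diagonal, and if it
commutes with a matrix whose first column has no zero, its diagonal is constant. -/
theorem exists_smul_one_of_commute {d : ℕ} {y : Fin (d + 1) → ℂ} (hy : Function.Injective y)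
    {g : Matrix (Fin (d + 1)) (Fin (d + 1)) ℂ} (hg : ∀ a ≠ 0, g a 0 ≠ 0)
    {Z : Matrix (Fin (d + 1)) (Fin (d + 1)) ℂ}
    (h1 : Z * Matrix.diagonal y = Matrix.diagonal y * Z) (h2 : Z * g = g * Z) :
    ∃ c : ℂ, Z = c • 1 := by
  have hoff : ∀ i j, i ≠ j → Z i j = 0 := by
    intro i j hij
    have h3 := congrFun (congrFun h1 i) j
    rw [Matrix.mul_diagonal, Matrix.diagonal_mul] at h3
    have h4 : (y j - y i) * Z i j = 0 := by linear_combination h3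
    exact (mul_eq_zero.1 h4).resolve_left (sub_ne_zero.2 (hy.ne hij.symm))
  refine ⟨Z 0 0, ?_⟩
  ext i j
  rw [Matrix.smul_apply, Matrix.one_apply, smul_eq_mul]
  split_ifs with hij
  · subst hij
    by_cases hi : i = 0
    · rw [hi, mul_one]
    · have h3 := congrFun (congrFun h2 i) 0
      rw [Matrix.mul_apply, Matrix.mul_apply, Finset.sum_eq_single i, Finset.sum_eq_single 0] at h3
      · rw [mul_comm] at h3
        rw [mul_one]
        exact mul_left_cancel₀ (hg i hi) h3
      · intro k _ hk
        rw [hoff k 0 hk, mul_zero]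
      · simp
      · intro k _ hk
        rw [hoff i k hk.symm, zero_mul]
      · simp
  · rw [hoff i j hij, mul_zero]

theorem isScalarPair_one {y : Fin 1 → ℂ} (hy : Function.Injective y) :
    IsScalarPair (Matrix.diagonal y) (Matrix.diagonal y) (y 0 ^ 6) := by
  refine IsScalarPair.of_entry rfl (fun Z h1 h2 => exists_smul_one_of_commute hy ?_ h1 h2) ?_
  · intro a ha
    exact absurd (Fin.fin_one_eq_zero a) ha
  · simp
    ring

theorem isScalarPair_two {y : Fin 2 → ℂ} (hy : Function.Injective y)
    (h : y 0 ^ 2 - y 0 * y 1 + y 1 ^ 2 ≠ 0) :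
    IsScalarPair (Matrix.diagonal y) (mat2 y) (-(y 0 * y 1) ^ 3) := by
  have d01 : y 0 - y 1 ≠ 0 := sub_ne_zero.2 (hy.ne (by decide))
  refine IsScalarPair.of_entry (mat2_braid hy)
    (fun Z h1 h2 => exists_smul_one_of_commute hy ?_ h1 h2) ?_
  · intro a ha
    fin_cases a
    · exact absurd rfl ha
    · simp [mat2, h, d01]
  · rw [Fin.sum_univ_two, mat2]
    simp only [Fin.isValue, Matrix.smul_apply, Matrix.of_apply,
      Matrix.cons_val_zero, Matrix.cons_val_one, smul_eq_mul]
    field_simp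
    ring

theorem isScalarPair_three {y : Fin 3 → ℂ} (hy : Function.Injective y) (hy0 : ∀ i, y i ≠ 0)
    (h1 : y 1 ^ 2 + y 0 * y 2 ≠ 0) (h2 : y 2 ^ 2 + y 0 * y 1 ≠ 0) :
    IsScalarPair (Matrix.diagonal y) (mat3 y) ((y 0 * y 1 * y 2) ^ 2) := by
  have d : ∀ i j : Fin 3, i ≠ j → y i - y j ≠ 0 := fun i j h => sub_ne_zero.2 (hy.ne h)
  have d01 := d 0 1 (by decide)
  have d02 := d 0 2 (by decide)
  have d10 := d 1 0 (by decide)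
  have d12 := d 1 2 (by decide)
  have d20 := d 2 0 (by decide)
  have d21 := d 2 1 (by decide)
  have D0 : Delta y Finset.univ 0 = (y 1 - y 0) * (y 2 - y 0) := by
    rw [Delta, show Finset.univ.erase (0 : Fin 3) = {1, 2} by decide]
    simp
  have D1 : Delta y Finset.univ 1 = (y 0 - y 1) * (y 2 - y 1) := by
    rw [Delta, show Finset.univ.erase (1 : Fin 3) = {0, 2} by decide]
    simp
  have D2 : Delta y Finset.univ 2 = (y 0 - y 2) * (y 1 - y 2) := by
    rw [Delta, show Finset.univ.erase (2 : Fin 3) = {0, 1} by decide]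
    simp
  refine IsScalarPair.of_entry (mat3_braid hy)
    (fun Z e1 e2 => exists_smul_one_of_commute hy ?_ e1 e2) ?_
  · intro a ha
    fin_cases a
    · exact absurd rfl ha
    · simp [mat3, h1, D1, hy0, d]
    · simp [mat3, h2, D2, hy0, d]
  · rw [Fin.sum_univ_three, mat3, D0, D1, D2]
    simp only [Fin.isValue, Matrix.of_apply, Matrix.cons_val, Matrix.cons_val_zero,
      Matrix.cons_val_one]
    field_simp
    ring

theorem isScalarPair_four {y : Fin 4 → ℂ} (hy : Function.Injective y) (hy0 : ∀ i, y i ≠ 0)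
    {h : ℂ} (hh : h ^ 2 = ∏ i, y i) (hI : ∀ i, y i ^ 2 - h ≠ 0) :
    IsScalarPair (Matrix.diagonal y) (mat4 h y) (h ^ 3) := by
  have hd := den4_ne_zero hy
  have hL : lcm4 y ≠ 0 := by
    rw [← cofac4_mul 0]
    have d : ∀ i j : Fin 4, i ≠ j → y i - y j ≠ 0 := fun i j h => sub_ne_zero.2 (hy.ne h)
    simp [cofac4, vand3, hy0, d, den4]
  refine IsScalarPair.of_entry (mat4_braid hy hy0 hh)
    (fun Z h1 h2 => exists_smul_one_of_commute hy ?_ h1 h2) ?_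
  · intro a ha
    have hn : num4 h y a 0 = -h * (y a ^ 2 - h) := by
      rw [Fin.prod_univ_four] at hh
      fin_cases a
      · exact absurd rfl ha
      all_goals
        simp only [num4, Fin.mk_one, Fin.reduceFinMk, Fin.isValue,
          Matrix.of_apply, Matrix.cons_val, Matrix.cons_val_zero, Matrix.cons_val_one]
        rw [← hh]
        ring
    have hh0 : h ≠ 0 := by
      rintro rfl
      rw [zero_pow two_ne_zero] at hh
      exact Finset.prod_ne_zero_iff.2 (fun i _ => hy0 i) hh.symm
    rw [mat4_apply hy hy0, hn]
    exact div_ne_zero (mul_ne_zero (neg_ne_zero.2 hh0) (hI a))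
      (mul_ne_zero (pow_ne_zero _ (hy0 a)) (hd a))
  · have hk : ∀ k, mat4 h y 0 k * (y k * y k) * mat4 h y k 0 =
        num4 h y 0 k * num4 h y k 0 * (y k * cofac4 y k) / (y 0 ^ 2 * den4 y 0 * lcm4 y) := by
      intro k
      rw [mat4_apply hy hy0, mat4_apply hy hy0, ← cofac4_mul k]
      have h1 := hy0 k
      have h2 := hy0 0
      have h3 := hd k
      have h4 := hd 0
      have h5 : cofac4 y k ≠ 0 := by
        intro h0
        rw [← cofac4_mul k, h0, zero_mul] at hL
        exact hL rfl
      field_simp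
    simp only [hk]
    have h2 := hy0 0
    have h4 := hd 0
    have hc := central4_eq_zero hy0 hh
    rw [central4, show (y 1 - y 0) * (y 2 - y 0) * (y 3 - y 0) = den4 y 0 from rfl] at hc
    rw [← Finset.sum_div, Fin.sum_univ_four]
    field_simp
    linear_combination hc

theorem isScalarPair_five {y : Fin 5 → ℂ} (hy : Function.Injective y) (hy0 : ∀ i, y i ≠ 0)
    {f : ℂ} (hf : f ^ 5 = ∏ i, y i) (hI : ∀ i, y i ^ 2 + y i * f + f ^ 2 ≠ 0)
    (hJ : ∀ i j, i ≠ j → y i * y j + f ^ 2 ≠ 0) :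
    IsScalarPair (Matrix.diagonal y) (mat5 f y) (f ^ 6) := by
  have hd := den5_ne_zero hy
  have hf0 := ne_zero_of_pow_five_eq hy0 hf
  have hL : lcm5 y ≠ 0 := by
    rw [← cofac5_mul 0]
    have d : ∀ i j : Fin 5, i ≠ j → y i - y j ≠ 0 := fun i j h => sub_ne_zero.2 (hy.ne h)
    simp [cofac5, vand, hy0, d, den5]
  refine IsScalarPair.of_entry (mat5_braid hy hy0 hf)
    (fun Z h1 h2 => exists_smul_one_of_commute hy ?_ h1 h2) ?_
  · intro a ha
    have hd' := hd a
    rw [← Delta_eq_den5] at hd'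
    rw [mat5, Matrix.of_apply, if_neg ha]
    refine div_ne_zero (mul_ne_zero ?_ (Finset.prod_ne_zero_iff.2 fun k hk => ?_))
      (mul_ne_zero (mul_ne_zero (mul_ne_zero hf0 (hy0 a)) (hy0 0)) hd')
    · rw [mul_comm f]
      exact hI a
    · rw [add_comm]
      exact hJ a k (Finset.ne_of_mem_erase (Finset.mem_of_mem_erase hk)).symm
  · have hk : ∀ k, mat5 f y 0 k * (y k * y k) * mat5 f y k 0 =
        num5 f y 0 k * num5 f y k 0 * (y k * cofac5 y k) /
          (f ^ 2 * y 0 ^ 2 * den5 y 0 * lcm5 y) := by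
      intro k
      rw [mat5_apply hf0 hy0, mat5_apply hf0 hy0, ← cofac5_mul k]
      have h1 := hy0 k
      have h2 := hy0 0
      have h3 := hd k
      have h4 := hd 0
      have h5 : cofac5 y k ≠ 0 := by
        intro h0
        rw [← cofac5_mul k, h0, zero_mul] at hL
        exact hL rfl
      field_simp
    simp only [hk]
    have h2 := hy0 0
    have h4 := hd 0
    have hc := central5_eq_zero hy0 hf
    rw [central5,
      show (y 1 - y 0) * (y 2 - y 0) * (y 3 - y 0) * (y 4 - y 0) = den5 y 0 from rfl] at hc
    rw [← Finset.sum_div, Fin.sum_univ_five]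
    field_simp
    linear_combination hc

/-- In dimension six the commutant of `g₁` contains the matrices in the double eigenspace. They
are excluded by the first two columns of `g₂`. -/
theorem exists_smul_one_of_commute_six {y : Fin 5 → ℂ} (hy : Function.Injective y)
    {g : Matrix (Fin 6) (Fin 6) ℂ} (h1 : g 1 0 ≠ 0) (h2 : g 2 0 ≠ 0) (h3 : g 3 0 ≠ 0)
    (h40 : g 4 0 ≠ 0) (h41 : g 4 1 = 0) (h50 : g 5 0 = 0) (h51 : g 5 1 ≠ 0)
    {Z : Matrix (Fin 6) (Fin 6) ℂ}
    (hZ1 : Z * Matrix.diagonal (eig6 y) = Matrix.diagonal (eig6 y) * Z) (hZ2 : Z * g = g * Z) :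
    ∃ c : ℂ, Z = c • 1 := by
  have hoff : ∀ i j, eig6 y j - eig6 y i ≠ 0 → Z i j = 0 := by
    intro i j hij
    have h3 := congrFun (congrFun hZ1 i) j
    rw [Matrix.mul_diagonal, Matrix.diagonal_mul] at h3
    have h4 : (eig6 y j - eig6 y i) * Z i j = 0 := by linear_combination h3
    exact (mul_eq_zero.1 h4).resolve_left hij
  have d : ∀ i j : Fin 5, i ≠ j → y i - y j ≠ 0 := fun i j h => sub_ne_zero.2 (hy.ne h)
  have hz : ∀ i j : Fin 6, i ≠ j → ¬ (i = 4 ∧ j = 5) → ¬ (i = 5 ∧ j = 4) → Z i j = 0 := by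
    intro i j hij h45 h54
    apply hoff
    fin_cases i <;> fin_cases j <;> first
      | exact absurd rfl hij
      | exact absurd ⟨rfl, rfl⟩ h45
      | exact absurd ⟨rfl, rfl⟩ h54
      | exact d _ _ (by decide)
  have e : ∀ i j, ∑ k, Z i k * g k j = ∑ k, g i k * Z k j := by
    intro i j
    have := congrFun (congrFun hZ2 i) j
    rwa [Matrix.mul_apply, Matrix.mul_apply] at this
  simp only [Fin.sum_univ_six] at e
  have e10 := e 1 0
  have e20 := e 2 0
  have e30 := e 3 0
  have e40 := e 4 0
  have e41 := e 4 1
  have e50 := e 5 0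
  have e51 := e 5 1
  have z01 := hz 0 1 (by decide) (by decide) (by decide)
  have z10 := hz 1 0 (by decide) (by decide) (by decide)
  have z12 := hz 1 2 (by decide) (by decide) (by decide)
  have z13 := hz 1 3 (by decide) (by decide) (by decide)
  have z14 := hz 1 4 (by decide) (by decide) (by decide)
  have z15 := hz 1 5 (by decide) (by decide) (by decide)
  have z20 := hz 2 0 (by decide) (by decide) (by decide)
  have z21 := hz 2 1 (by decide) (by decide) (by decide)
  have z23 := hz 2 3 (by decide) (by decide) (by decide)
  have z24 := hz 2 4 (by decide) (by decide) (by decide)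
  have z25 := hz 2 5 (by decide) (by decide) (by decide)
  have z30 := hz 3 0 (by decide) (by decide) (by decide)
  have z31 := hz 3 1 (by decide) (by decide) (by decide)
  have z32 := hz 3 2 (by decide) (by decide) (by decide)
  have z34 := hz 3 4 (by decide) (by decide) (by decide)
  have z35 := hz 3 5 (by decide) (by decide) (by decide)
  have z40 := hz 4 0 (by decide) (by decide) (by decide)
  have z41 := hz 4 1 (by decide) (by decide) (by decide)
  have z42 := hz 4 2 (by decide) (by decide) (by decide)
  have z43 := hz 4 3 (by decide) (by decide) (by decide)
  have z50 := hz 5 0 (by decide) (by decide) (by decide)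
  have z51 := hz 5 1 (by decide) (by decide) (by decide)
  have z52 := hz 5 2 (by decide) (by decide) (by decide)
  have z53 := hz 5 3 (by decide) (by decide) (by decide)
  simp only [z01, z10, z12, z13, z14, z15, z20, z21, z23, z24, z25, z30, z31,
    z32, z34, z35, z40, z41, z42, z43, z50, z51, z52, z53, h41, h50, zero_mul, mul_zero, add_zero,
    zero_add] at e10 e20 e30 e40 e41 e50 e51
  have r1 : Z 1 1 = Z 0 0 := mul_left_cancel₀ h1 (by linear_combination e10)
  have r2 : Z 2 2 = Z 0 0 := mul_left_cancel₀ h2 (by linear_combination e20)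
  have r3 : Z 3 3 = Z 0 0 := mul_left_cancel₀ h3 (by linear_combination e30)
  have r4 : Z 4 4 = Z 0 0 := mul_left_cancel₀ h40 (by linear_combination e40)
  have r45 : Z 4 5 = 0 := (mul_eq_zero.1 e41).resolve_right h51
  have r54 : Z 5 4 = 0 := (mul_eq_zero.1 e50).resolve_right h40
  have r5 : Z 5 5 = Z 0 0 := by
    rw [← r1]
    exact mul_left_cancel₀ h51 (by linear_combination e51)
  refine ⟨Z 0 0, ?_⟩
  ext i j
  rw [Matrix.smul_apply, Matrix.one_apply, smul_eq_mul]
  split_ifs with hij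
  · subst hij
    rw [mul_one]
    fin_cases i <;> first | rfl | assumption
  · rw [mul_zero]
    by_cases h45 : i = 4 ∧ j = 5
    · rw [h45.1, h45.2, r45]
    by_cases h54 : i = 5 ∧ j = 4
    · rw [h54.1, h54.2, r54]
    exact hz i j hij h45 h54

theorem isScalarPair_six {y : Fin 5 → ℂ} (hy : Function.Injective y) (hy0 : ∀ i, y i ≠ 0)
    (hJ : (∏ m, y m) - y 0 ^ 3 * y 4 ^ 2 ≠ 0) :
    IsScalarPair (Matrix.diagonal (eig6 y)) (mat6 y) (-((∏ m, y m) * y 4)) := by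
  have hden := rowDen6_mul_colDen6_ne_zero hy hy0
  have hL := lcm6_ne_zero hy hy0
  have d : ∀ i j : Fin 5, i ≠ j → y i - y j ≠ 0 := fun i j h => sub_ne_zero.2 (hy.ne h)
  have hp : numP y 0 ≠ 0 := by
    rw [← p6_eq]
    exact hJ
  have hne : ∀ i j, num6 y i j ≠ 0 → mat6 y i j ≠ 0 := by
    intro i j h
    rw [mat6_apply hy hy0]
    exact div_ne_zero h (hden i j)
  refine IsScalarPair.of_entry (mat6_braid hy hy0)
    (fun Z h1 h2 => exists_smul_one_of_commute_six hy (hne 1 0 hp) (hne 2 0 hp) (hne 3 0 hp)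
      (hne 4 0 (mul_ne_zero (hy0 0) (d 1 0 (by decide)))) ?_ ?_
      (hne 5 1 (mul_ne_zero (hy0 1) (d 0 1 (by decide)))) h1 h2) ?_
  · exact rfl
  · exact rfl
  · have hk : ∀ k, mat6 y 0 k * (eig6 y k * eig6 y k) * mat6 y k 0 =
        num6 y 0 k * num6 y k 0 * (eig6 y k * cofac6 y k) /
          (rowDen6 y 0 * colDen6 y 0 * lcm6 y) := by
      intro k
      rw [mat6_apply hy hy0, mat6_apply hy hy0, eq_div_iff (mul_ne_zero (hden 0 0) hL),
        div_mul_eq_mul_div, div_mul_div_comm, div_mul_eq_mul_div,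
        div_eq_iff (mul_ne_zero (hden 0 k) (hden k 0))]
      linear_combination
        -(num6 y 0 k * num6 y k 0 * eig6 y k * rowDen6 y 0 * colDen6 y 0) * cofac6_mul k
    simp only [hk]
    have hc := central6_eq_zero (hy0 4)
    rw [central6, show (y 1 - y 0) * (y 2 - y 0) * (y 3 - y 0) * (y 4 - y 0) = colDen6 y 0
      from rfl] at hc
    rw [← Finset.sum_div, Fin.sum_univ_six, mul_div_assoc', div_eq_iff (mul_ne_zero (hden 0 0) hL),
      Fin.prod_univ_five, show rowDen6 y 0 = y 0 ^ 2 from rfl]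
    simp only [eig6, Fin.isValue, Matrix.cons_val, Matrix.cons_val_zero, Matrix.cons_val_one]
    linear_combination y 0 ^ 2 * hc

/-! ### Representations as modules -/

section rep

variable {E : Type*} [Ring E] [Algebra ℂ E] {V : Type*} [AddCommGroup V] [Module ℂ V]

/-- The space of a representation of `E`, as a module over `E`. -/
def RepSpace (_ρ : E →ₐ[ℂ] Module.End ℂ V) : Type _ := V

variable (ρ : E →ₐ[ℂ] Module.End ℂ V)

instance : AddCommGroup (RepSpace ρ) := inferInstanceAs (AddCommGroup V)

instance : Module ℂ (RepSpace ρ) := inferInstanceAs (Module ℂ V)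

instance : Module E (RepSpace ρ) := Module.compHom V ρ.toRingHom

theorem RepSpace.smul_def (e : E) (v : RepSpace ρ) : e • v = (ρ e v : V) := rfl

instance : IsScalarTower ℂ E (RepSpace ρ) :=
  ⟨fun c e v => by rw [RepSpace.smul_def, map_smul]; rfl⟩

theorem act_repSpace (e : E) : act (RepSpace ρ) e = ρ e := rfl

theorem isIrreducible_iff_isSimpleModule : IsIrreducible ρ ↔ IsSimpleModule E (RepSpace ρ) := by
  rw [isSimpleModule_iff, isSimpleOrder_iff]
  constructor
  · rintro ⟨h1, h2⟩
    have : Nontrivial (RepSpace ρ) := h1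
    refine ⟨inferInstance, fun N => ?_⟩
    have h3 := h2 (N.restrictScalars ℂ) fun e v hv => N.smul_mem e hv
    refine h3.imp (fun h => ?_) fun h => ?_
    · ext v
      exact Submodule.ext_iff.1 h v
    · ext v
      exact Submodule.ext_iff.1 h v
  · rintro ⟨h1, h2⟩
    have h3 : Nontrivial (RepSpace ρ) := (Submodule.nontrivial_iff E).1 h1
    refine ⟨h3, fun W hW => ?_⟩
    let N : Submodule E (RepSpace ρ) :=
      { carrier := (W : Set V)
        add_mem' := W.add_mem
        zero_mem' := W.zero_mem
        smul_mem' := fun e v hv => hW e v hv }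
    refine (h2 N).imp (fun h => ?_) fun h => ?_
    · ext v
      exact Submodule.ext_iff.1 h v
    · ext v
      exact Submodule.ext_iff.1 h v

omit [Algebra ℂ E] in
/-- A semisimple module with no endomorphisms other than scalars is simple. -/
theorem isSimpleModule_of_endomorphisms {M : Type*} [AddCommGroup M] [Module ℂ M] [Module E M]
    [Nontrivial M] [IsSemisimpleModule E M]
    (h : ∀ φ : M →ₗ[E] M, ∃ c : ℂ, ∀ v, φ v = c • v) : IsSimpleModule E M := by
  rw [isSimpleModule_iff, isSimpleOrder_iff]
  refine ⟨inferInstance, fun N => ?_⟩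
  obtain ⟨N', hN⟩ := exists_isCompl N
  obtain ⟨c, hc⟩ := h (N.projection N' hN)
  by_cases h0 : c = 0
  · left
    rw [Submodule.eq_bot_iff]
    intro v hv
    have h1 := hc v
    rw [h0, zero_smul, Submodule.projection_apply_of_mem_left hN hv] at h1
    exact h1
  · right
    rw [eq_top_iff]
    intro v _
    have h1 := hc (c⁻¹ • v)
    rw [smul_inv_smul₀ h0] at h1
    rw [← h1]
    exact Submodule.projection_apply_mem hN _

end rep

section pair

variable {n : ℕ} {x : Fin n → ℂ}

/-- If `b³` and `(b u)²` are the same nonzero scalar, `u` and `u⁻¹ b` satisfy the braid relation. -/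
theorem braid_of_cube_eq_sq {E : Type*} [Ring E] [Algebra ℂ E] {u : Eˣ} {b : E} {z : ℂ}
    (hz : z ≠ 0) (h3 : b ^ 3 = algebraMap ℂ E z) (h2 : (b * u) ^ 2 = algebraMap ℂ E z) :
    (u : E) * (↑u⁻¹ * b) * u = ↑u⁻¹ * b * u * (↑u⁻¹ * b) := by
  have hb : IsUnit b := by
    have h5 : IsUnit (b ^ 3) := by
      rw [h3]
      exact (isUnit_iff_ne_zero.2 hz).map _
    exact (isUnit_pow_iff three_ne_zero).1 h5
  have h4 : (u : E) * b * u = b * b := by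
    refine hb.mul_left_cancel ?_
    rw [← mul_assoc, ← mul_assoc, ← mul_assoc]
    rw [pow_two] at h2
    rw [pow_succ, pow_two] at h3
    rw [mul_assoc (b * u), h2, h3]
  rw [Units.mul_inv_cancel_left]
  rw [mul_assoc (↑u⁻¹ * b), Units.mul_inv_cancel_left, mul_assoc, ← h4]
  simp [mul_assoc]

/-- Over a semisimple algebra `Q_X` there are no non-split extensions, so the form is nonnegative. -/
theorem moduleForm_nonneg_of_isSemisimpleRing (hn : n ≤ 5) (hx : Function.Injective x)
    (hx0 : ∀ i, x i ≠ 0) [IsSemisimpleRing (Q x)] {τ : ℂ} (hτ : τ ≠ 0)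
    {U W : Type*} [AddCommGroup U] [Module ℂ U] [Module (Q x) U] [IsScalarTower ℂ (Q x) U]
    [AddCommGroup W] [Module ℂ W] [Module (Q x) W] [IsScalarTower ℂ (Q x) W]
    [FiniteDimensional ℂ U] [FiniteDimensional ℂ W]
    (hU : ∀ v : U, (gen x 0 * gen x 1) ^ 3 • v = τ ^ 6 • v)
    (hW : ∀ v : W, (gen x 0 * gen x 1) ^ 3 • v = τ ^ 6 • v) :
    0 ≤ moduleForm x τ (gen x 0) (gen x 1) U W := by
  by_contra hneg
  rw [not_le] at hneg
  have h := isBraidAlgebra_gen hn hx hx0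
  obtain ⟨A, B, ht, hA1, hB1, hA2, hB2, hns⟩ := exists_nonsplit_extension hx
    (rootsB_injective hτ) (rootsC_injective hτ) (isTriple_act h hU) (isTriple_act h hW) hneg
  obtain ⟨u, hu⟩ := isUnit_of_rootPoly' hx0 ht.ha
  have h3 : B ^ 3 = algebraMap ℂ _ (τ ^ 6) := by
    have := ht.hb
    rw [rootPoly_rootsB] at this
    simpa [sub_eq_zero] using this
  have h2 : (B * u) ^ 2 = algebraMap ℂ _ (τ ^ 6) := by
    have := ht.hc
    rw [rootPoly_rootsC] at this
    rw [hu]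
    simpa [sub_eq_zero] using this
  have hbr := braid_of_cube_eq_sq (pow_ne_zero 6 hτ) h3 h2
  set C := (↑u⁻¹ * B : Module.End ℂ (W × U)) with hC
  have huC : (u : Module.End ℂ (W × U)) * C = B := by rw [hC, Units.mul_inv_cancel_left]
  have hCp : aeval C (rootPoly x) = 0 := by
    have h4 : C ∘ₗ (B * (u : Module.End ℂ (W × U))) =
        (B * (u : Module.End ℂ (W × U))) ∘ₗ (u : Module.End ℂ (W × U)) := by
      have h5 : C * (B * u) = B * u * u := by
        rw [← huC, ← mul_assoc C, ← mul_assoc C, ← hbr]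
      exact h5
    have h5 := aeval_comp_of_comp h4 (rootPoly x)
    rw [hu, ht.ha, LinearMap.comp_zero] at h5
    have h6 : IsUnit (B * A) := by
      rw [← hu]
      refine IsUnit.of_mul_eq_one (b := (τ ^ 6)⁻¹ • (B * u)) ?_
      rw [mul_smul_comm, ← pow_two, h2, Algebra.smul_def, ← map_mul,
        inv_mul_cancel₀ (pow_ne_zero 6 hτ), map_one]
    exact h6.mul_right_cancel (h5.trans (zero_mul _).symm)
  obtain ⟨ρ, hρ0, hρ1⟩ := exists_lift hx0 hbr (hu ▸ ht.ha) hCp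
  have hρb : ρ (gen x 0 * gen x 1) = B := by rw [map_mul, hρ0, hρ1, huC]
  let p : RepSpace ρ →ₗ[ℂ] U := LinearMap.snd ℂ W U
  have hsnd : p ∈ intertwiners (act (RepSpace ρ) (gen x 0))
      (act (RepSpace ρ) (gen x 0 * gen x 1)) (act U (gen x 0)) (act U (gen x 0 * gen x 1)) := by
    rw [mem_intertwiners, act_repSpace, act_repSpace, hρb, hρ0, hu]
    exact ⟨LinearMap.ext fun v => (hA2 v).symm, LinearMap.ext fun v => (hB2 v).symm⟩
  obtain ⟨π, hπ⟩ := exists_linearMap_of_mem_intertwiners h.adjoin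
    (isUnit_of_rootPoly' hx0 h.poly_a) hsnd
  have hπs : Function.Surjective π := by
    intro v
    exact ⟨((0, v) : W × U), LinearMap.congr_fun hπ ((0, v) : W × U)⟩
  have hproj : Module.Projective (Q x) U := Module.projective_of_isSemisimpleRing _ _
  obtain ⟨s, hs⟩ := Module.projective_lifting_property π LinearMap.id hπs
  refine hns (s.restrictScalars ℂ) ?_ ?_
  · ext v
    have h5 := LinearMap.congr_fun hπ (s v)
    exact h5.symm.trans (LinearMap.congr_fun hs v)
  · have h6 := restrictScalars_mem_intertwiners (a := gen x 0) (b := gen x 1) s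
    rw [act_repSpace, act_repSpace, hρb, hρ0, hu] at h6
    exact h6

end pair

section pairs

variable {n : ℕ} {x : Fin n → ℂ} {d : ℕ} {A B : Matrix (Fin d) (Fin d) ℂ} {ζ : ℂ}

theorem mult_diagonal {J : Type*} [Fintype J] [DecidableEq J] (y : J → ℂ) (μ : ℂ) :
    mult (Matrix.toLin' (Matrix.diagonal y)) μ = Fintype.card {j // y j = μ} := by
  refine mult_of_basis _ (Pi.basisFun ℂ J) y (fun j => ?_) μ
  ext k
  simp [Pi.single_apply]

theorem aeval_diagonal_polyP {y : Fin d → ℂ} (h : ∀ j, ∃ i, x i = y j) :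
    aeval (Matrix.toLin' (Matrix.diagonal y)) (polyP x) = 0 := by
  refine (Pi.basisFun ℂ (Fin d)).ext fun j => ?_
  have h1 : Module.End.HasEigenvector (Matrix.toLin' (Matrix.diagonal y)) (y j)
      (Pi.basisFun ℂ (Fin d) j) := by
    refine ⟨?_, (Pi.basisFun ℂ (Fin d)).ne_zero j⟩
    rw [Module.End.mem_eigenspace_iff]
    ext k
    simp [Pi.single_apply]
  rw [Module.End.aeval_apply_of_hasEigenvector h1]
  obtain ⟨i, hi⟩ := h j
  rw [polyP, eval_prod, Finset.prod_eq_zero (Finset.mem_univ i) (by simp [hi]), zero_smul]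
  rfl

/-- A pair of matrices with the braid relation in which `A` has its eigenvalues in `X` is a
representation of `Q_X`. -/
theorem IsScalarPair.exists_rep (hp : IsScalarPair A B ζ) (hζ : ζ ≠ 0) (hx0 : ∀ i, x i ≠ 0)
    (hA : aeval (Matrix.toLin' A) (polyP x) = 0) :
    ∃ ρ : Q x →ₐ[ℂ] Module.End ℂ (Fin d → ℂ),
      ρ (gen x 0) = Matrix.toLin' A ∧ ρ (gen x 1) = Matrix.toLin' B := by
  have hbr := congrArg Matrix.toLin' hp.braid
  simp only [Matrix.toLin'_mul] at hbr
  have hbr' : Matrix.toLin' A * Matrix.toLin' B * Matrix.toLin' A =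
      Matrix.toLin' B * Matrix.toLin' A * Matrix.toLin' B := hbr
  have hcube : (Matrix.toLin' A * Matrix.toLin' B) ^ 3 = algebraMap ℂ _ ζ := by
    have h1 := congrArg Matrix.toLinAlgEquiv' hp.cube
    rw [map_pow, map_mul, map_smul, map_one] at h1
    rw [Algebra.algebraMap_eq_smul_one]
    exact h1
  refine exists_lift hx0 hbr' hA ?_
  set a := Matrix.toLin' A
  set b := Matrix.toLin' B
  have h4 : b ∘ₗ (a * b * a) = (a * b * a) ∘ₗ a := by
    have h5 : b * (a * b * a) = a * b * a * a := by
      rw [← mul_assoc, ← mul_assoc, ← hbr']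
    exact h5
  have h5 := aeval_comp_of_comp h4 (polyP x)
  rw [hA, LinearMap.comp_zero] at h5
  have h6 : IsUnit (a * b * a) := by
    rw [braid_cube hbr'] at hcube
    refine (isUnit_pow_iff two_ne_zero).1 ?_
    rw [hcube]
    exact (isUnit_iff_ne_zero.2 hζ).map _
  exact h6.mul_right_cancel (h5.trans (zero_mul _).symm)

theorem IsScalarPair.cube_smul (hp : IsScalarPair A B ζ)
    {ρ : Q x →ₐ[ℂ] Module.End ℂ (Fin d → ℂ)} (h0 : ρ (gen x 0) = Matrix.toLin' A)
    (h1 : ρ (gen x 1) = Matrix.toLin' B) (v : RepSpace ρ) :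
    (gen x 0 * gen x 1) ^ 3 • v = ζ • v := by
  have h2 : ρ ((gen x 0 * gen x 1) ^ 3) = ζ • 1 := by
    have h3 := congrArg Matrix.toLinAlgEquiv' hp.cube
    rw [map_pow, map_mul, map_smul, map_one] at h3
    rw [map_pow, map_mul, h0, h1]
    exact h3
  exact LinearMap.congr_fun h2 v

theorem IsScalarPair.isSimpleModule [IsSemisimpleRing (Q x)] (hd : 0 < d)
    (hp : IsScalarPair A B ζ) {ρ : Q x →ₐ[ℂ] Module.End ℂ (Fin d → ℂ)}
    (h0 : ρ (gen x 0) = Matrix.toLin' A) (h1 : ρ (gen x 1) = Matrix.toLin' B) :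
    IsSimpleModule (Q x) (RepSpace ρ) := by
  have : Nontrivial (RepSpace ρ) := by
    have : Nonempty (Fin d) := ⟨⟨0, hd⟩⟩
    exact inferInstanceAs (Nontrivial (Fin d → ℂ))
  refine isSimpleModule_of_endomorphisms fun φ => ?_
  let f : Module.End ℂ (Fin d → ℂ) := φ.restrictScalars ℂ
  have hf : ∀ s, f * ρ (gen x s) = ρ (gen x s) * f := fun s =>
    LinearMap.ext fun v => φ.map_smul (gen x s) v
  have hf0 := congrArg LinearMap.toMatrix' (hf 0)
  have hf1 := congrArg LinearMap.toMatrix' (hf 1)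
  rw [h0, LinearMap.toMatrix'_mul, LinearMap.toMatrix'_mul, LinearMap.toMatrix'_toLin'] at hf0
  rw [h1, LinearMap.toMatrix'_mul, LinearMap.toMatrix'_mul, LinearMap.toMatrix'_toLin'] at hf1
  obtain ⟨c, hc⟩ := hp.comm _ hf0 hf1
  refine ⟨c, fun v => ?_⟩
  have h3 := congrArg Matrix.toLin' hc
  rw [Matrix.toLin'_toMatrix', map_smul, Matrix.toLin'_one] at h3
  exact LinearMap.congr_fun h3 v

end pairs

/-! ### The semisimplicity criterion: necessity -/

section necessity

variable {n : ℕ} {x : Fin n → ℂ}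

/-- There is a simple module of dimension `d` on which `g₁` has the eigenvalues with indices in `S`
and `(g₁ g₂)³` acts by `ζ`. -/
def HasSimple (x : Fin n → ℂ) (d : ℕ) (S : Finset (Fin n)) (ζ : ℂ) : Prop :=
  ζ ≠ 0 ∧ ∃ ρ : Q x →ₐ[ℂ] Module.End ℂ (Fin d → ℂ), IsSimpleModule (Q x) (RepSpace ρ) ∧
    (∀ v : RepSpace ρ, (gen x 0 * gen x 1) ^ 3 • v = ζ • v) ∧
    ∀ i, typeM x (gen x 0) (RepSpace ρ) i = if i ∈ S then 1 else 0

theorem card_fiber_comp (hx : Function.Injective x) {d : ℕ} {s : Fin d → Fin n}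
    (hs : Function.Injective s) (i : Fin n) :
    Fintype.card {j // (x ∘ s) j = x i} = if i ∈ Finset.univ.image s then 1 else 0 := by
  rw [Fintype.card_subtype]
  have h1 : (Finset.univ.filter fun j => (x ∘ s) j = x i) =
      Finset.univ.filter fun j => s j = i := by
    ext j
    simp [hx.eq_iff]
  rw [h1]
  split_ifs with hi
  · obtain ⟨j, -, rfl⟩ := Finset.mem_image.1 hi
    rw [Finset.card_eq_one]
    refine ⟨j, ?_⟩
    ext k
    simp [hs.eq_iff]
  · rw [Finset.card_eq_zero, Finset.filter_eq_empty_iff]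
    intro j _ hj
    exact hi (Finset.mem_image.2 ⟨j, Finset.mem_univ _, hj⟩)

theorem IsScalarPair.hasSimple [IsSemisimpleRing (Q x)] (hx : Function.Injective x)
    (hx0 : ∀ i, x i ≠ 0) {d : ℕ} (hd : 0 < d) {s : Fin d → Fin n} (hs : Function.Injective s)
    {B : Matrix (Fin d) (Fin d) ℂ} {ζ : ℂ} (hζ : ζ ≠ 0)
    (hp : IsScalarPair (Matrix.diagonal (x ∘ s)) B ζ) :
    HasSimple x d (Finset.univ.image s) ζ := by
  obtain ⟨ρ, h0, h1⟩ := hp.exists_rep hζ hx0 (aeval_diagonal_polyP fun j => ⟨s j, rfl⟩)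
  refine ⟨hζ, ρ, hp.isSimpleModule hd h0 h1, hp.cube_smul h0 h1, fun i => ?_⟩
  rw [← card_fiber_comp hx hs i, ← mult_diagonal, ← h0]
  rfl

/-- Two simple modules with the same central character have a nonnegative form. -/
theorem exists_le_of_hasSimple (hn : n ≤ 5) (hx : Function.Injective x)
    (hx0 : ∀ i, x i ≠ 0) [IsSemisimpleRing (Q x)] {d d' : ℕ} {S S' : Finset (Fin n)} {ζ : ℂ}
    (h : HasSimple x d S ζ) (h' : HasSimple x d' S' ζ) :
    ∃ τ p q p' q', τ ≠ 0 ∧ IsBalanced τ d p q (∏ i ∈ S, x i) ∧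
      IsBalanced τ d' p' q' (∏ i ∈ S', x i) ∧
      d * d' ≤ (S ∩ S').card + pairing p p' q q' := by
  obtain ⟨hζ, ρ, hs, hz, hm⟩ := h
  obtain ⟨-, ρ', hs', hz', hm'⟩ := h'
  obtain ⟨τ, hτ⟩ := IsAlgClosed.exists_pow_nat_eq ζ (n := 6) (by norm_num)
  rw [← hτ] at hz hz'
  have hτ0 : τ ≠ 0 := by
    rintro rfl
    exact hζ (by rw [← hτ, zero_pow (by norm_num)])
  have hb := isBraidAlgebra_gen hn hx hx0
  have f1 : FiniteDimensional ℂ (RepSpace ρ) := inferInstanceAs (FiniteDimensional ℂ (Fin d → ℂ))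
  have f2 : FiniteDimensional ℂ (RepSpace ρ') :=
    inferInstanceAs (FiniteDimensional ℂ (Fin d' → ℂ))
  have r1 : Module.finrank ℂ (RepSpace ρ) = d := (Module.finrank_fintype_fun_eq_card ℂ).trans
    (Fintype.card_fin d)
  have r2 : Module.finrank ℂ (RepSpace ρ') = d' := (Module.finrank_fintype_fun_eq_card ℂ).trans
    (Fintype.card_fin d')
  have t1 := (isSimpleType hb hτ0 hz).balanced
  have t2 := (isSimpleType hb hτ0 hz').balanced
  have hnn := moduleForm_nonneg_of_isSemisimpleRing hn hx hx0 hτ0 hz hz'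
  rw [moduleForm_eq, r1, r2] at hnn
  rw [prod_pow_support hm, r1] at t1
  rw [prod_pow_support hm', r2] at t2
  refine ⟨τ, _, _, _, _, hτ0, t1, t2, ?_⟩
  have h1 : ∑ i, typeM x (gen x 0) (RepSpace ρ) i * typeM x (gen x 0) (RepSpace ρ') i =
      (S ∩ S').card := by
    simp only [hm, hm', mul_ite, mul_one, mul_zero, ← ite_and, Finset.card_eq_sum_ones,
      Finset.sum_ite, Finset.sum_const_zero, add_zero]
    congr 1
    ext i
    simp [and_comm]
  rw [h1] at hnn
  have h2 : ((d * d' : ℕ) : ℤ) ≤ ((S ∩ S').card + pairing (typeP τ (gen x 0) (gen x 1) (RepSpace ρ))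
      (typeP τ (gen x 0) (gen x 1) (RepSpace ρ')) (typeQ τ (gen x 0) (gen x 1) (RepSpace ρ))
      (typeQ τ (gen x 0) (gen x 1) (RepSpace ρ')) : ℕ) := by
    push_cast at hnn ⊢
    linarith
  exact_mod_cast h2

end necessity

section conditions

variable {n : ℕ} {x : Fin n → ℂ} [IsSemisimpleRing (Q x)]

theorem hasSimple_one (hx : Function.Injective x) (hx0 : ∀ i, x i ≠ 0) (i : Fin n) :
    HasSimple x 1 {i} (x i ^ 6) := by
  have h := (isScalarPair_one (y := x ∘ ![i])
    (hx.comp (Function.injective_of_subsingleton _))).hasSimple hx hx0 one_pos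
    (Function.injective_of_subsingleton _) (pow_ne_zero 6 (hx0 i))
  simpa using h

theorem hasSimple_two (hx : Function.Injective x) (hx0 : ∀ i, x i ≠ 0) {i j : Fin n}
    (hij : [i, j].Nodup) (hI : I2 x i j ≠ 0) : HasSimple x 2 {i, j} (-(x i * x j) ^ 3) := by
  have hs : Function.Injective ![i, j] := List.nodup_ofFn.1 (by simpa using hij)
  have h := (isScalarPair_two (y := x ∘ ![i, j]) (hx.comp hs) hI).hasSimple hx hx0 two_pos hs
    (neg_ne_zero.2 (pow_ne_zero 3 (mul_ne_zero (hx0 i) (hx0 j))))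
  convert h using 1
  ext k
  simp [eq_comm]

theorem hasSimple_three (hx : Function.Injective x) (hx0 : ∀ i, x i ≠ 0) {i j k : Fin n}
    (hijk : [i, j, k].Nodup) (hI : ∀ i j k : Fin n, [i, j, k].Nodup → I3 x i j k ≠ 0) :
    HasSimple x 3 {i, j, k} ((x i * x j * x k) ^ 2) := by
  have hs : Function.Injective ![i, j, k] := List.nodup_ofFn.1 (by simpa using hijk)
  have h := (isScalarPair_three (y := x ∘ ![i, j, k]) (hx.comp hs) (fun _ => hx0 _)
    (hI j i k (by simp at hijk ⊢; grind)) (hI k i j (by simp at hijk ⊢; grind))).hasSimple hx hx0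
    three_pos hs (pow_ne_zero 2 (mul_ne_zero (mul_ne_zero (hx0 i) (hx0 j)) (hx0 k)))
  convert h using 1
  ext t
  simp only [Finset.mem_image, Finset.mem_univ, true_and, Finset.mem_insert, Finset.mem_singleton]
  constructor
  · rintro (rfl | rfl | rfl)
    exacts [⟨0, rfl⟩, ⟨1, rfl⟩, ⟨2, rfl⟩]
  · rintro ⟨a, rfl⟩
    fin_cases a <;> simp

theorem hasSimple_four (hx : Function.Injective x) (hx0 : ∀ i, x i ≠ 0) {i j k l : Fin n}
    (hijkl : [i, j, k, l].Nodup) {h : ℂ} (hh : h ^ 2 = x i * x j * x k * x l)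
    (hI : ∀ i j k l : Fin n, [i, j, k, l].Nodup → ∀ h : ℂ, h ^ 2 = x i * x j * x k * x l →
      I4 x h i ≠ 0) : HasSimple x 4 {i, j, k, l} (h ^ 3) := by
  have hs : Function.Injective ![i, j, k, l] := List.nodup_ofFn.1 (by simpa using hijkl)
  have hh0 : h ≠ 0 := by
    rintro rfl
    rw [zero_pow two_ne_zero] at hh
    exact mul_ne_zero (mul_ne_zero (mul_ne_zero (hx0 i) (hx0 j)) (hx0 k)) (hx0 l) hh.symm
  have hI' : ∀ a, (x ∘ ![i, j, k, l]) a ^ 2 - h ≠ 0 := by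
    intro a
    fin_cases a
    · exact hI i j k l hijkl h hh
    · exact hI j i k l (by simp at hijkl ⊢; grind) h (by rw [hh]; ring)
    · exact hI k i j l (by simp at hijkl ⊢; grind) h (by rw [hh]; ring)
    · exact hI l i j k (by simp at hijkl ⊢; grind) h (by rw [hh]; ring)
  have h := (isScalarPair_four (y := x ∘ ![i, j, k, l]) (hx.comp hs) (fun _ => hx0 _)
    (by rw [hh, Fin.prod_univ_four]; rfl) hI').hasSimple hx hx0 four_pos hs (pow_ne_zero 3 hh0)
  convert h using 1
  ext t
  simp only [Finset.mem_image, Finset.mem_univ, true_and, Finset.mem_insert, Finset.mem_singleton]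
  constructor
  · rintro (rfl | rfl | rfl | rfl)
    exacts [⟨0, rfl⟩, ⟨1, rfl⟩, ⟨2, rfl⟩, ⟨3, rfl⟩]
  · rintro ⟨a, rfl⟩
    fin_cases a <;> simp

theorem hasSimple_five {x : Fin 5 → ℂ} [IsSemisimpleRing (Q x)] (hx : Function.Injective x)
    (hx0 : ∀ i, x i ≠ 0) {f : ℂ} (hf : f ^ 5 = ∏ m, x m) (hI : ∀ i, I5 x f i ≠ 0)
    (hJ : ∀ i j, [i, j].Nodup → J5 x f i j ≠ 0) : HasSimple x 5 Finset.univ (f ^ 6) := by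
  have h := (isScalarPair_five hx hx0 hf hI fun i j hij => hJ i j (by simpa using hij)).hasSimple
    (x := x) (s := id) hx hx0 (by norm_num) Function.injective_id
    (pow_ne_zero 6 (ne_zero_of_pow_five_eq hx0 hf))
  simpa using h

variable (hn : n ≤ 5) (hx : Function.Injective x) (hx0 : ∀ i, x i ≠ 0)
include hn hx hx0

theorem I2_ne_zero {i j : Fin n} (hij : [i, j].Nodup) : I2 x i j ≠ 0 := by
  intro h0
  have h1 : x j ^ 6 = x i ^ 6 := by
    rw [I2] at h0
    linear_combination (x j ^ 3 - x i ^ 3) * (x j + x i) * h0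
  obtain ⟨τ, p, q, p', q', hτ, hb, hb', hle⟩ := exists_le_of_hasSimple hn hx hx0
    (hasSimple_one hx hx0 i) (h1 ▸ hasSimple_one hx hx0 j)
  rw [Finset.prod_singleton] at hb hb'
  rw [(pairing_eq_iff_1_1 hτ hb hb').2 h0] at hle
  have : ({i} ∩ {j} : Finset (Fin n)).card = 0 := by
    simp at hij
    simp [hij]
  omega

theorem I3_ne_zero {i j k : Fin n} (hijk : [i, j, k].Nodup) : I3 x i j k ≠ 0 := by
  intro h0
  have hjk : [j, k].Nodup := by simp at hijk ⊢; grind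
  have h1 : -(x j * x k) ^ 3 = x i ^ 6 := by
    rw [I3] at h0
    rw [show x j * x k = -x i ^ 2 by linear_combination h0]
    ring
  obtain ⟨τ, p, q, p', q', hτ, hb, hb', hle⟩ := exists_le_of_hasSimple hn hx hx0
    (hasSimple_one hx hx0 i) (h1 ▸ hasSimple_two hx hx0 hjk (I2_ne_zero hn hx hx0 hjk))
  simp at hijk
  rw [Finset.prod_singleton] at hb
  rw [Finset.prod_pair hijk.2] at hb'
  rw [(pairing_eq_iff_1_2 hτ hb hb').2 h0] at hle
  have : ({i} ∩ {j, k} : Finset (Fin n)).card = 0 := by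
    simp [hijk]
  omega

theorem I4_ne_zero {i j k l : Fin n} (hijkl : [i, j, k, l].Nodup) {h : ℂ}
    (hh : h ^ 2 = x i * x j * x k * x l) : I4 x h i ≠ 0 := by
  intro h0
  have hjkl : [j, k, l].Nodup := by simp at hijkl ⊢; grind
  have he : x j * x k * x l = x i ^ 3 := by
    rw [I4] at h0
    refine mul_left_cancel₀ (hx0 i) ?_
    linear_combination -hh - (h + x i ^ 2) * h0
  obtain ⟨τ, p, q, p', q', hτ, hb, hb', hle⟩ := exists_le_of_hasSimple hn hx hx0
    (hasSimple_one hx hx0 i) (show HasSimple x 3 {j, k, l} (x i ^ 6) by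
      have := hasSimple_three hx hx0 hjkl fun i j k h => I3_ne_zero hn hx hx0 h
      rw [he] at this
      convert this using 1
      ring)
  simp at hijkl
  rw [Finset.prod_singleton] at hb
  rw [Finset.prod_insert (by simp; tauto), Finset.prod_pair (by tauto), ← mul_assoc] at hb'
  rw [(pairing_eq_iff_1_3 hτ hb hb').2 he] at hle
  have : ({i} ∩ {j, k, l} : Finset (Fin n)).card = 0 := by
    simp [hijkl]
  omega

theorem J4_ne_zero {i j k l : Fin n} (hijkl : [i, j, k, l].Nodup) {h : ℂ}
    (hh : h ^ 2 = x i * x j * x k * x l) : J4 x h i j k l ≠ 0 := by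
  intro h0
  have hij : [i, j].Nodup := by simp at hijkl ⊢; grind
  have hkl : [k, l].Nodup := by simp at hijkl ⊢; grind
  have he : (x i * x j) ^ 2 + x i * x j * (x k * x l) + (x k * x l) ^ 2 = 0 := by
    rw [J4] at h0
    linear_combination (x i * x j + x k * x l + h) * h0 + hh
  obtain ⟨τ, p, q, p', q', hτ, hb, hb', hle⟩ := exists_le_of_hasSimple hn hx hx0
    (hasSimple_two hx hx0 hij (I2_ne_zero hn hx hx0 hij))
    (show HasSimple x 2 {k, l} (-(x i * x j) ^ 3) by
      have := hasSimple_two hx hx0 hkl (I2_ne_zero hn hx hx0 hkl)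
      convert this using 1
      linear_combination (x k * x l - x i * x j) * he)
  simp at hijkl
  rw [Finset.prod_pair (by tauto)] at hb hb'
  rw [(pairing_eq_iff_2_2 hτ hb hb').2 he] at hle
  have : ({i, j} ∩ {k, l} : Finset (Fin n)).card = 0 := by
    rw [Finset.card_eq_zero]
    ext t
    simp
    grind
  omega

end conditions

section conditions_five

variable {x : Fin 5 → ℂ}

theorem prod_of_nodup_five {i j k l m : Fin 5} (h : [i, j, k, l, m].Nodup) :
    ∏ t, x t = x i * x j * x k * x l * x m := by
  have hs : Function.Injective ![i, j, k, l, m] := List.nodup_ofFn.1 (by simpa using h)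
  rw [← Function.Bijective.prod_comp (Finite.injective_iff_bijective.1 hs) x, Fin.prod_univ_five]
  rfl

theorem exists_nodup_one : ∀ i : Fin 5, ∃ j k l m : Fin 5, [i, j, k, l, m].Nodup := by decide

theorem exists_nodup_two : ∀ i j : Fin 5, [i, j].Nodup → ∃ k l m : Fin 5,
    [i, j, k, l, m].Nodup := by decide

theorem exists_nodup_four : ∀ j k l m : Fin 5, [j, k, l, m].Nodup → ∃ i : Fin 5,
    [i, j, k, l, m].Nodup := by
  intro j k l m h
  have h1 : ({j, k, l, m} : Finset (Fin 5)).card < Fintype.card (Fin 5) :=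
    lt_of_le_of_lt Finset.card_le_four (by decide)
  obtain ⟨i, hi⟩ := Finset.exists_mem_notMem_of_card_lt_card
    (s := {j, k, l, m}) (t := Finset.univ) (by simpa using h1)
  refine ⟨i, ?_⟩
  simp at h hi ⊢
  tauto

variable [IsSemisimpleRing (Q x)] (hx : Function.Injective x) (hx0 : ∀ i, x i ≠ 0)
include hx hx0

theorem I5_ne_zero {f : ℂ} (hf : f ^ 5 = ∏ m, x m) (i : Fin 5) : I5 x f i ≠ 0 := by
  intro h0
  obtain ⟨j, k, l, m, hnd⟩ := exists_nodup_one i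
  have hjklm : [j, k, l, m].Nodup := (List.nodup_cons.1 hnd).2
  rw [prod_of_nodup_five hnd] at hf
  rw [I5] at h0
  have hE : (x i * f) ^ 2 = x j * x k * x l * x m := by
    refine mul_left_cancel₀ (hx0 i) ?_
    linear_combination hf - f ^ 2 * (f - x i) * h0
  obtain ⟨τ, p, q, p', q', hτ, hb, hb', hle⟩ := exists_le_of_hasSimple le_rfl hx hx0
    (hasSimple_one hx hx0 i) (show HasSimple x 4 {j, k, l, m} (x i ^ 6) by
      have := hasSimple_four hx hx0 hjklm hE fun i j k l h1 h h2 =>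
        I4_ne_zero le_rfl hx hx0 h1 h2
      convert this using 1
      linear_combination -x i ^ 3 * (f - x i) * h0)
  simp at hnd
  rw [Finset.prod_singleton] at hb
  rw [Finset.prod_insert (by simp; tauto), Finset.prod_insert (by simp; tauto),
    Finset.prod_pair (by tauto), ← mul_assoc, ← mul_assoc, ← hE] at hb'
  rw [(pairing_eq_iff_1_4 hτ hb hb').2
    (by linear_combination x i ^ 4 * (f ^ 2 - x i * f + x i ^ 2) * h0)] at hle
  have : ({i} ∩ {j, k, l, m} : Finset (Fin 5)).card = 0 := by
    simp [hnd]
  omega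

theorem J5_ne_zero {f : ℂ} (hf : f ^ 5 = ∏ m, x m) {i j : Fin 5} (hij : [i, j].Nodup) :
    J5 x f i j ≠ 0 := by
  intro h0
  obtain ⟨k, l, m, hnd⟩ := exists_nodup_two i j hij
  have hklm : [k, l, m].Nodup := (List.nodup_cons.1 (List.nodup_cons.1 hnd).2).2
  have hf0 := ne_zero_of_pow_five_eq hx0 hf
  rw [prod_of_nodup_five hnd] at hf
  rw [J5] at h0
  have hE : x k * x l * x m = -f ^ 3 := by
    refine mul_left_cancel₀ (pow_ne_zero 2 hf0) ?_
    linear_combination x k * x l * x m * h0 + hf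
  obtain ⟨τ, p, q, p', q', hτ, hb, hb', hle⟩ := exists_le_of_hasSimple le_rfl hx hx0
    (hasSimple_two hx hx0 hij (I2_ne_zero le_rfl hx hx0 hij))
    (show HasSimple x 3 {k, l, m} (-(x i * x j) ^ 3) by
      have := hasSimple_three hx hx0 hklm fun i j k h => I3_ne_zero le_rfl hx hx0 h
      rw [hE] at this
      convert this using 1
      rw [show x i * x j = -f ^ 2 by linear_combination h0]
      ring)
  simp at hnd
  rw [Finset.prod_pair (by tauto)] at hb
  rw [Finset.prod_insert (by simp; tauto), Finset.prod_pair (by tauto), ← mul_assoc] at hb'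
  rw [(pairing_eq_iff_2_3 hτ hb hb').2 (by
    rw [hE, show x i * x j = -f ^ 2 by linear_combination h0]
    ring)] at hle
  have : ({i, j} ∩ {k, l, m} : Finset (Fin 5)).card = 0 := by
    rw [Finset.card_eq_zero]
    ext t
    simp
    grind
  omega

theorem I6_ne_zero (i : Fin 5) : I6 x i ≠ 0 := by
  intro h0
  rw [I6] at h0
  have hf : (-x i) ^ 5 = ∏ m, x m := by linear_combination -h0
  obtain ⟨τ, p, q, p', q', hτ, hb, hb', hle⟩ := exists_le_of_hasSimple le_rfl hx hx0
    (hasSimple_one hx hx0 i) (show HasSimple x 5 Finset.univ (x i ^ 6) by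
      have := hasSimple_five hx hx0 hf (I5_ne_zero hx hx0 hf) fun i j => J5_ne_zero hx hx0 hf
      convert this using 1
      ring)
  rw [Finset.prod_singleton] at hb
  rw [(pairing_eq_iff_1_5 hτ hb hb').2 h0] at hle
  simp at hle

theorem J6_ne_zero {i j : Fin 5} (hij : [i, j].Nodup) : J6 x i j ≠ 0 := by
  intro h0
  obtain ⟨k, l, m, hnd⟩ := exists_nodup_two i j hij
  rw [J6, prod_of_nodup_five hnd] at h0
  have hjklm : [j, k, l, m].Nodup := (List.nodup_cons.1 hnd).2
  have hE : (-(x i * x j)) ^ 2 = x j * x k * x l * x m := by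
    refine mul_left_cancel₀ (hx0 i) ?_
    linear_combination -h0
  obtain ⟨τ, p, q, p', q', hτ, hb, hb', hle⟩ := exists_le_of_hasSimple le_rfl hx hx0
    (hasSimple_two hx hx0 hij (I2_ne_zero le_rfl hx hx0 hij))
    (show HasSimple x 4 {j, k, l, m} (-(x i * x j) ^ 3) by
      have := hasSimple_four hx hx0 hjklm hE fun i j k l h1 h h2 =>
        I4_ne_zero le_rfl hx hx0 h1 h2
      convert this using 1
      ring)
  simp at hnd
  rw [Finset.prod_pair (by tauto)] at hb
  rw [Finset.prod_insert (by simp; tauto), Finset.prod_insert (by simp; tauto),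
    Finset.prod_pair (by tauto), ← mul_assoc, ← mul_assoc, ← hE] at hb'
  rw [(pairing_eq_iff_2_4 hτ hb hb').2 (by ring)] at hle
  have : ({i, j} ∩ {j, k, l, m} : Finset (Fin 5)) = {j} := by
    ext t
    simp
    grind
  rw [this, Finset.card_singleton] at hle
  omega

theorem K6_ne_zero {j k l m : Fin 5} (hjklm : [j, k, l, m].Nodup) : K6 x j k l m ≠ 0 := by
  intro h0
  obtain ⟨i, hnd⟩ := exists_nodup_four j k l m hjklm
  rw [K6] at h0
  have hE : x i * x l * x m = -(x i * x j * x k) := by linear_combination x i * h0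
  have h3 : ∀ i j k : Fin 5, [i, j, k].Nodup → I3 x i j k ≠ 0 :=
    fun i j k h => I3_ne_zero le_rfl hx hx0 h
  obtain ⟨τ, p, q, p', q', hτ, hb, hb', hle⟩ := exists_le_of_hasSimple le_rfl hx hx0
    (hasSimple_three hx hx0 (show [i, j, k].Nodup by simp at hnd ⊢; tauto) h3)
    (show HasSimple x 3 {i, l, m} ((x i * x j * x k) ^ 2) by
      have := hasSimple_three hx hx0 (show [i, l, m].Nodup by simp at hnd ⊢; tauto) h3
      rw [hE] at this
      convert this using 1
      ring)
  simp at hnd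
  rw [Finset.prod_insert (by simp; tauto), Finset.prod_pair (by tauto), ← mul_assoc] at hb hb'
  rw [(pairing_eq_iff_3_3 hτ hb hb').2 (by rw [hE]; ring)] at hle
  have : ({i, j, k} ∩ {i, l, m} : Finset (Fin 5)) = {i} := by
    ext t
    simp
    grind
  rw [this, Finset.card_singleton] at hle
  omega

end conditions_five

/-- If `Q_X` is semisimple, its simple modules with the same central character have a nonnegative Euler
form. The vanishing of one of the quantities would give two modules with form `-1`. -/
theorem conditions_of_isSemisimpleRing {n : ℕ} (hn : n ≤ 5) {x : Fin n → ℂ}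
    (hx : Function.Injective x) (hx0 : ∀ i, x i ≠ 0) [IsSemisimpleRing (Q x)] :
    SemisimplicityConditions x := by
  refine ⟨fun i j h => I2_ne_zero hn hx hx0 h, fun i j k h => I3_ne_zero hn hx hx0 h,
    fun i j k l hd h hh => ⟨I4_ne_zero hn hx hx0 hd hh, J4_ne_zero hn hx hx0 hd hh⟩, ?_⟩
  rintro rfl
  exact ⟨fun f hf => ⟨I5_ne_zero hx hx0 hf, fun i j h => J5_ne_zero hx hx0 hf h⟩,
    I6_ne_zero hx hx0, fun i j h => J6_ne_zero hx hx0 h,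
    fun j k l m h => K6_ne_zero hx hx0 h⟩

/-! ### The listed representations -/

section sub

variable {n d : ℕ} {x : Fin n → ℂ} {Y : Finset (Fin n)} (hY : Y.card = d)

theorem sub_injective (hx : Function.Injective x) : Function.Injective (sub x Y hY) :=
  hx.comp (Y.orderEmbOfFin hY).injective

theorem prod_sub : ∏ j, sub x Y hY j = ∏ i ∈ Y, x i := by
  conv_rhs => rw [← Finset.map_orderEmbOfFin_univ Y hY, Finset.prod_map]
  rfl

theorem card_fiber_sub (hx : Function.Injective x) (i : Fin n) :
    Fintype.card {j // sub x Y hY j = x i} = if i ∈ Y then 1 else 0 := by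
  have h := card_fiber_comp hx (Y.orderEmbOfFin hY).injective i
  rw [Finset.image_orderEmbOfFin_univ] at h
  exact h

theorem card_fiber_eig6 {Y : Finset (Fin n)} (hY : Y.card = 5) (hx : Function.Injective x)
    (s : Fin 5) (i : Fin n) :
    Fintype.card {j // eig6 (sub x Y hY ∘ Equiv.swap s 4) j = x i} =
      (if i ∈ Y then 1 else 0) + if i = Y.orderEmbOfFin hY s then 1 else 0 := by
  rw [← card_fiber_sub hY hx i, Fintype.card_subtype, Fintype.card_subtype, Finset.card_filter,
    Finset.card_filter, Fin.sum_univ_six]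
  have hsum := Equiv.sum_comp (Equiv.swap s 4) fun j => if sub x Y hY j = x i then 1 else 0
  rw [Fin.sum_univ_five] at hsum
  have h : (if i = Y.orderEmbOfFin hY s then 1 else 0) =
      if sub x Y hY (Equiv.swap s 4 4) = x i then 1 else 0 := by
    rw [Equiv.swap_apply_right]
    simp only [sub, hx.eq_iff, eq_comm]
  rw [← hsum, h]
  rfl

end sub

namespace Label

variable {n : ℕ} {x : Fin n → ℂ}

/-- The scalar by which `(g₁ g₂)³` acts in the representation. -/
noncomputable def scalar : Label x → ℂ
  | rho1 Y _ => (∏ i ∈ Y, x i) ^ 6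
  | rho2 Y _ => -(∏ i ∈ Y, x i) ^ 3
  | rho3 Y _ => (∏ i ∈ Y, x i) ^ 2
  | rho4 _ _ h _ => h ^ 3
  | rho5 _ _ f _ => f ^ 6
  | rho6 Y hY s => -((∏ i ∈ Y, x i) * x (Y.orderEmbOfFin hY s))

/-- The multiplicity of the eigenvalue `x i` of `g₁` in the representation. -/
def multiplicity : Label x → Fin n → ℕ
  | rho1 Y _, i | rho2 Y _, i | rho3 Y _, i | rho4 Y _ _ _, i | rho5 Y _ _ _, i =>
      if i ∈ Y then 1 else 0
  | rho6 Y hY s, i => (if i ∈ Y then 1 else 0) + if i = Y.orderEmbOfFin hY s then 1 else 0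

theorem dim_pos (L : Label x) : 0 < L.dim := by
  cases L <;> simp [dim]

theorem sum_multiplicity (L : Label x) : ∑ i, L.multiplicity i = L.dim := by
  cases L <;> simp [dim, multiplicity, Finset.sum_add_distrib, *]

theorem mult_mat_g1 (hx : Function.Injective x) (L : Label x) (i : Fin n) :
    mult (Matrix.toLin' L.mat_g1) (x i) = L.multiplicity i := by
  cases L with
  | rho1 Y hY => exact (mult_diagonal _ _).trans (card_fiber_sub hY hx i)
  | rho2 Y hY => exact (mult_diagonal _ _).trans (card_fiber_sub hY hx i)
  | rho3 Y hY => exact (mult_diagonal _ _).trans (card_fiber_sub hY hx i)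
  | rho4 Y hY => exact (mult_diagonal _ _).trans (card_fiber_sub hY hx i)
  | rho5 Y hY => exact (mult_diagonal _ _).trans (card_fiber_sub hY hx i)
  | rho6 Y hY s => exact (mult_diagonal _ _).trans (card_fiber_eig6 hY hx s i)

theorem aeval_mat_g1 (L : Label x) : aeval (Matrix.toLin' L.mat_g1) (polyP x) = 0 := by
  cases L with
  | rho6 Y hY s =>
    refine aeval_diagonal_polyP fun j => ?_
    have h : ∀ k, ∃ i, x i = (sub x Y hY ∘ Equiv.swap s 4) k := fun k => ⟨_, rfl⟩
    fin_cases j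
    exacts [h 0, h 1, h 2, h 3, h 4, h 4]
  | _ => exact aeval_diagonal_polyP fun j => ⟨_, rfl⟩

theorem scalar_ne_zero (hx0 : ∀ i, x i ≠ 0) (L : Label x) : L.scalar ≠ 0 := by
  have hp : ∀ Y : Finset (Fin n), ∏ i ∈ Y, x i ≠ 0 := fun Y =>
    Finset.prod_ne_zero_iff.2 fun i _ => hx0 i
  cases L with
  | rho1 Y hY => exact pow_ne_zero _ (hp Y)
  | rho2 Y hY => exact neg_ne_zero.2 (pow_ne_zero _ (hp Y))
  | rho3 Y hY => exact pow_ne_zero _ (hp Y)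
  | rho4 Y hY h hh =>
    refine pow_ne_zero _ ?_
    rintro rfl
    exact hp Y (by rw [← hh, zero_pow two_ne_zero])
  | rho5 Y hY f hf =>
    refine pow_ne_zero _ ?_
    rintro rfl
    exact hp Y (by rw [← hf, zero_pow (by norm_num)])
  | rho6 Y hY s => exact neg_ne_zero.2 (mul_ne_zero (hp Y) (hx0 _))

/-- Under the conditions the listed matrices satisfy the braid relation and commute with scalars
only. -/
theorem isScalarPair (hn : n ≤ 5) (hx : Function.Injective x) (hx0 : ∀ i, x i ≠ 0)
    (hc : SemisimplicityConditions x) (L : Label x) :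
    IsScalarPair L.mat_g1 L.mat_g2 L.scalar := by
  obtain ⟨c2, c3, c4, c5⟩ := hc
  have hY5 : ∀ Y : Finset (Fin n), Y.card = 5 → n = 5 ∧ Y = Finset.univ := by
    intro Y hY
    have h1 := Finset.card_le_univ Y
    rw [hY, Fintype.card_fin] at h1
    have h2 : n = 5 := le_antisymm hn h1
    exact ⟨h2, Finset.eq_univ_of_card _ (by rw [hY, Fintype.card_fin, h2])⟩
  cases L with
  | rho1 Y hY =>
    have h := isScalarPair_one (sub_injective hY hx)
    rw [scalar, ← prod_sub hY, Fin.prod_univ_one]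
    exact h
  | rho2 Y hY =>
    have hσ := (Y.orderEmbOfFin hY).injective
    have h := isScalarPair_two (sub_injective hY hx)
      (c2 (Y.orderEmbOfFin hY 0) (Y.orderEmbOfFin hY 1) (by simp [hσ.eq_iff]))
    rw [scalar, ← prod_sub hY, Fin.prod_univ_two]
    exact h
  | rho3 Y hY =>
    have hσ := (Y.orderEmbOfFin hY).injective
    have h := isScalarPair_three (sub_injective hY hx) (fun _ => hx0 _)
      (c3 (Y.orderEmbOfFin hY 1) (Y.orderEmbOfFin hY 0) (Y.orderEmbOfFin hY 2)
        (by simp [hσ.eq_iff]))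
      (c3 (Y.orderEmbOfFin hY 2) (Y.orderEmbOfFin hY 0) (Y.orderEmbOfFin hY 1)
        (by simp [hσ.eq_iff]))
    rw [scalar, ← prod_sub hY, Fin.prod_univ_three]
    exact h
  | rho4 Y hY h hh =>
    have hσ := (Y.orderEmbOfFin hY).injective
    rw [← prod_sub hY] at hh
    refine isScalarPair_four (sub_injective hY hx) (fun _ => hx0 _) hh fun a => ?_
    rw [Fin.prod_univ_four] at hh
    have key : ∀ a b c e : Fin 4, [a, b, c, e].Nodup →
        h ^ 2 = sub x Y hY a * sub x Y hY b * sub x Y hY c * sub x Y hY e →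
        sub x Y hY a ^ 2 - h ≠ 0 := fun a b c e hd hp =>
      (c4 _ _ _ _ (hd.map hσ) h hp).1
    fin_cases a
    · exact key 0 1 2 3 (by decide) hh
    · exact key 1 0 2 3 (by decide) (by rw [hh]; ring)
    · exact key 2 0 1 3 (by decide) (by rw [hh]; ring)
    · exact key 3 0 1 2 (by decide) (by rw [hh]; ring)
  | rho5 Y hY f hf =>
    have hσ := (Y.orderEmbOfFin hY).injective
    obtain ⟨h5, hU⟩ := hY5 Y hY
    have hf' : f ^ 5 = ∏ m, x m := by rw [hf, hU]
    rw [← prod_sub hY] at hf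
    exact isScalarPair_five (sub_injective hY hx) (fun _ => hx0 _) hf
      (fun a => ((c5 h5).1 f hf').1 _)
      (fun a b hab => ((c5 h5).1 f hf').2 _ _ (by simpa [hσ.eq_iff] using hab))
  | rho6 Y hY s =>
    have hσ := (Y.orderEmbOfFin hY).injective
    obtain ⟨h5, hU⟩ := hY5 Y hY
    have hp : ∏ m, (sub x Y hY ∘ Equiv.swap s 4) m = ∏ i ∈ Y, x i :=
      (Equiv.prod_comp (Equiv.swap s 4) (sub x Y hY)).trans (prod_sub hY)
    have hp' : ∏ m, (sub x Y hY ∘ Equiv.swap s 4) m = ∏ i, x i := hp.trans (by rw [hU])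
    have h := isScalarPair_six (y := sub x Y hY ∘ Equiv.swap s 4)
      ((sub_injective hY hx).comp (Equiv.injective _)) (fun _ => hx0 _) (by
        rw [hp']
        exact (c5 h5).2.2.1 _ _ ((show [(0 : Fin 5), 4].Nodup by decide).map
          (hσ.comp (Equiv.swap s 4).injective)))
    rw [hp, Function.comp_apply, Equiv.swap_apply_right] at h
    exact h

/-- A label is determined by the eigenvalues of `g₁` and by the scalar of `(g₁ g₂)³`. -/
theorem eq_of_multiplicity_eq (hx0 : ∀ i, x i ≠ 0) {L L' : Label x}
    (hm : ∀ i, L.multiplicity i = L'.multiplicity i) (hs : L.scalar = L'.scalar) : L = L' := by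
  have hdim : L.dim = L'.dim := by
    rw [← sum_multiplicity, ← sum_multiplicity]
    exact Finset.sum_congr rfl fun i _ => hm i
  have hYY : ∀ Y Y' : Finset (Fin n),
      (∀ i, (if i ∈ Y then 1 else 0) = if i ∈ Y' then 1 else 0) → Y = Y' := by
    intro Y Y' h
    ext i
    have := h i
    split_ifs at this <;> simp_all
  have hp : ∀ Y : Finset (Fin n), ∏ i ∈ Y, x i ≠ 0 := fun Y =>
    Finset.prod_ne_zero_iff.2 fun i _ => hx0 i
  cases L <;> cases L' <;> first | (exfalso; simp [dim] at hdim; done) | skip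
  case rho1.rho1 Y hY Y' hY' =>
    obtain rfl := hYY _ _ hm
    rfl
  case rho2.rho2 Y hY Y' hY' =>
    obtain rfl := hYY _ _ hm
    rfl
  case rho3.rho3 Y hY Y' hY' =>
    obtain rfl := hYY _ _ hm
    rfl
  case rho4.rho4 Y hY h hh Y' hY' h' hh' =>
    obtain rfl := hYY _ _ hm
    have hs' : h ^ 3 = h' ^ 3 := hs
    obtain rfl : h = h' := by
      refine mul_left_cancel₀ (hp Y) ?_
      rw [← hh]
      linear_combination hs' + h' * (hh' - hh)
    rfl
  case rho5.rho5 Y hY f hf Y' hY' f' hf' =>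
    obtain rfl := hYY _ _ hm
    have hs' : f ^ 6 = f' ^ 6 := hs
    obtain rfl : f = f' := by
      refine mul_left_cancel₀ (hp Y) ?_
      rw [← hf]
      linear_combination hs' + f' * (hf' - hf)
    rfl
  case rho6.rho6 Y hY s Y' hY' s' =>
    simp only [multiplicity] at hm
    obtain rfl : Y = Y' := by
      ext i
      have h1 := Finset.orderEmbOfFin_mem Y hY s
      have h2 := Finset.orderEmbOfFin_mem Y' hY' s'
      have := hm i
      constructor <;> intro hi <;> by_contra hi' <;> rw [if_pos hi, if_neg hi'] at this
      · rw [if_neg (show i ≠ Y'.orderEmbOfFin hY' s' from fun h => hi' (h ▸ h2))] at this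
        omega
      · rw [if_neg (show i ≠ Y.orderEmbOfFin hY s from fun h => hi' (h ▸ h1))] at this
        omega
    have h1 := hm (Y.orderEmbOfFin hY s)
    rw [if_pos rfl, if_pos (Finset.orderEmbOfFin_mem Y hY s)] at h1
    obtain rfl : s = s' := by
      by_contra hne
      rw [if_neg fun h => hne ((Y.orderEmbOfFin hY).injective h)] at h1
      omega
    rfl

end Label

theorem IsBalanced.det_6 {τ e : ℂ} {p : Fin 3 → ℕ} {q : Fin 2 → ℕ} (h : IsBalanced τ 6 p q e) :
    -e = τ ^ 6 := by
  have hω := omega_sq_add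
  have he := h.det
  rcases h.cases_p with ⟨h1, hp⟩ | ⟨h1, hp | hp | hp⟩ | ⟨h1, hp | hp | hp⟩ <;>
  first
  | (exfalso; omega)
  | (rcases h.cases_q with ⟨h3, hq⟩ | ⟨h3, hq | hq⟩ <;>
    first
    | (exfalso; omega)
    | (clear h; subst hp hq; simp at he; grind))

/-- The type of every simple module is that of a listed representation. -/
theorem IsSimpleType.exists_label {n : ℕ} {x : Fin n → ℂ} (hx0 : ∀ i, x i ≠ 0) {τ : ℂ}
    (hτ : τ ≠ 0) {d : ℕ} {m : Fin n → ℕ} {p : Fin 3 → ℕ} {q : Fin 2 → ℕ}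
    (h : IsSimpleType x τ d m p q) :
    ∃ L : Label x, L.dim = d ∧ (∀ i, L.multiplicity i = m i) ∧ L.scalar = τ ^ 6 := by
  have hb := h.balanced
  have hd := h.pos
  have h6 := h.le_six
  have he := hb.det_ne_zero hτ
  by_cases h5 : d ≤ 5
  · obtain ⟨S, hS, hmS⟩ := exists_support (h.le_one h5) h.sum_m
    rw [prod_pow_support hmS] at hb he
    set e := ∏ i ∈ S, x i with hedef
    interval_cases d
    · exact ⟨.rho1 S hS, rfl, fun i => (hmS i).symm, hb.pow_det_1⟩
    · exact ⟨.rho2 S hS, rfl, fun i => (hmS i).symm, hb.pow_det_2⟩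
    · exact ⟨.rho3 S hS, rfl, fun i => (hmS i).symm, hb.pow_det_3⟩
    · have h4 := hb.pow_det_4
      refine ⟨.rho4 S hS (τ ^ 6 / e) ?_, rfl, fun i => (hmS i).symm, ?_⟩
      · rw [← hedef, div_pow, div_eq_iff (pow_ne_zero _ he)]
        linear_combination -h4
      · rw [Label.scalar, div_pow, div_eq_iff (pow_ne_zero _ he), h4]
        ring
    · have h5 := hb.pow_det_5
      refine ⟨.rho5 S hS (τ ^ 6 / e) ?_, rfl, fun i => (hmS i).symm, ?_⟩
      · rw [← hedef, div_pow, div_eq_iff (pow_ne_zero _ he)]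
        linear_combination -h5
      · rw [Label.scalar, div_pow, div_eq_iff (pow_ne_zero _ he), h5]
        ring
  · obtain rfl : d = 6 := by omega
    obtain ⟨rfl, hi⟩ := h.six rfl
    -- five multiplicities that are one or two and have the sum six: exactly one is two
    obtain ⟨S, hS, hmS⟩ := exists_support (m := fun i => m i - 1) (d := 1)
      (fun i => by have := hi i; omega) (by
        have h1 : ∑ i, (m i - 1 + 1) = ∑ i, m i :=
          Finset.sum_congr rfl fun i _ => Nat.sub_add_cancel (hi i).1
        rw [Finset.sum_add_distrib, h.sum_m] at h1
        simpa using h1)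
    obtain ⟨t, rfl⟩ := Finset.card_eq_one.1 hS
    have hm : ∀ i, m i = 1 + if i = t then 1 else 0 := by
      intro i
      have h1 := hmS i
      have h2 := (hi i).1
      simp only [Finset.mem_singleton] at h1
      omega
    have hY : (Finset.univ : Finset (Fin 5)).card = 5 := rfl
    obtain ⟨s, hs⟩ : ∃ s, Finset.univ.orderEmbOfFin hY s = t := by
      have h1 : t ∈ Set.range (Finset.univ.orderEmbOfFin hY) := by
        rw [Finset.range_orderEmbOfFin]
        simp
      exact h1
    refine ⟨.rho6 Finset.univ hY s, rfl, fun i => ?_, ?_⟩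
    · rw [hm, Label.multiplicity, if_pos (Finset.mem_univ i), hs]
    · rw [← hb.det_6, Label.scalar, hs]
      simp only [hm, pow_add, pow_one, Finset.prod_mul_distrib, pow_ite, pow_zero,
        Finset.prod_ite_eq', Finset.mem_univ, if_true]

/-! ### The classification of the irreducible representations -/

section classification

variable {n : ℕ} {x : Fin n → ℂ}

theorem finite_Q (hn : n ≤ 5) (hx : Function.Injective x) (hx0 : ∀ i, x i ≠ 0) :
    Module.Finite ℂ (Q x) :=
  finite_of_braid hn hx hx0 gen_braid (gen_poly 0) (gen_poly 1) (adjoin_gen hx0)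

theorem isSemisimpleRing_of_conditions (hn : n ≤ 5) (hx : Function.Injective x)
    (hx0 : ∀ i, x i ≠ 0) (hc : SemisimplicityConditions x) : IsSemisimpleRing (Q x) := by
  have := finite_Q hn hx hx0
  exact isSemisimpleModule_of_conditions (V := Q x) (isBraidAlgebra_gen hn hx hx0) hc

theorem exists_rep_label (hn : n ≤ 5) (hx : Function.Injective x) (hx0 : ∀ i, x i ≠ 0)
    (hc : SemisimplicityConditions x) (L : Label x) :
    ∃ ρ : Q x →ₐ[ℂ] Module.End ℂ (Fin L.dim → ℂ),
      ρ (gen x 0) = Matrix.toLin' L.mat_g1 ∧ ρ (gen x 1) = Matrix.toLin' L.mat_g2 :=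
  (L.isScalarPair hn hx hx0 hc).exists_rep (L.scalar_ne_zero hx0) hx0 L.aeval_mat_g1

/-- Two simple modules with the same central character and the same eigenvalues of `g₁` are
isomorphic: their Euler form is that of a simple module with itself, which is `2`. -/
theorem nonempty_equiv_of_typeM_eq {E : Type*} [Ring E] [Algebra ℂ E] {a b : E}
    (h : IsBraidAlgebra x a b) {U W : Type*} [AddCommGroup U] [Module ℂ U] [Module E U]
    [IsScalarTower ℂ E U] [AddCommGroup W] [Module ℂ W] [Module E W] [IsScalarTower ℂ E W]
    [FiniteDimensional ℂ U] [FiniteDimensional ℂ W] [IsSimpleModule E U] [IsSimpleModule E W]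
    {τ : ℂ} (hτ : τ ≠ 0) (hU : ∀ v : U, (a * b) ^ 3 • v = τ ^ 6 • v)
    (hW : ∀ v : W, (a * b) ^ 3 • v = τ ^ 6 • v)
    (hm : ∀ i, typeM x a U i = typeM x a W i) : Nonempty (U ≃ₗ[E] W) := by
  by_contra hne
  rw [not_nonempty_iff] at hne
  have hne' : IsEmpty (W ≃ₗ[E] U) := ⟨fun e => hne.elim e.symm⟩
  have hle := moduleForm_le h hτ hU hW
  rw [finrank_intertwiners_eq_zero h hne, finrank_intertwiners_eq_zero h hne', moduleForm_eq] at hle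
  have tU := isSimpleType h hτ hU
  have tW := isSimpleType h hτ hW
  have hd : Module.finrank ℂ U = Module.finrank ℂ W := by
    rw [← tU.sum_m, ← tW.sum_m]
    exact Finset.sum_congr rfl fun i _ => hm i
  have hbU := tU.balanced
  simp only [hm, hd] at hbU
  obtain ⟨hp, hq⟩ := hbU.eq_of_det_eq hτ tW.pos tW.le_six tW.balanced
  have hnorm := tW.norm
  simp only [hm, hd, hp, hq, pairing, ← pow_two] at hle
  push_cast at hle
  zify at hnorm
  linarith

variable {V : Type*} [AddCommGroup V] [Module ℂ V] {ρ : Q x →ₐ[ℂ] Module.End ℂ V}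

/-- The eigenvalues of `g₁` and the scalar of `(g₁ g₂)³` are invariants of a representation. -/
theorem Affords.invariants (hn : n ≤ 5) (hx : Function.Injective x) (hx0 : ∀ i, x i ≠ 0)
    (hc : SemisimplicityConditions x) {L : Label x} (h : Affords ρ L) :
    (∀ i, mult (ρ (gen x 0)) (x i) = L.multiplicity i) ∧
      ∀ v, ρ ((gen x 0 * gen x 1) ^ 3) v = L.scalar • v := by
  obtain ⟨e, he⟩ := h
  refine ⟨fun i => ?_, fun v => e.injective ?_⟩
  · rw [← L.mult_mat_g1 hx]
    exact mult_eq_of_comm e (fun v => (he v).1) _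
  · have h2 : ∀ v, e (ρ (gen x 0 * gen x 1) v) = (L.mat_g1 * L.mat_g2).mulVec (e v) := by
      intro v
      rw [map_mul, Module.End.mul_apply, (he _).1, (he _).2, Matrix.mulVec_mulVec]
    have h3 : e (ρ ((gen x 0 * gen x 1) ^ 3) v) = ((L.mat_g1 * L.mat_g2) ^ 3).mulVec (e v) := by
      rw [map_pow, pow_succ, pow_two, Module.End.mul_apply, Module.End.mul_apply, h2, h2, h2,
        Matrix.mulVec_mulVec, Matrix.mulVec_mulVec, pow_succ, pow_two, mul_assoc]
    rw [h3, (L.isScalarPair hn hx hx0 hc).cube, Matrix.smul_mulVec, Matrix.one_mulVec, map_smul]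

theorem Affords.unique (hn : n ≤ 5) (hx : Function.Injective x) (hx0 : ∀ i, x i ≠ 0)
    (hc : SemisimplicityConditions x) [Nontrivial V] {L L' : Label x} (h : Affords ρ L)
    (h' : Affords ρ L') : L = L' := by
  obtain ⟨h1, h2⟩ := h.invariants hn hx hx0 hc
  obtain ⟨h1', h2'⟩ := h'.invariants hn hx hx0 hc
  obtain ⟨v, hv⟩ := exists_ne (0 : V)
  exact Label.eq_of_multiplicity_eq hx0 (fun i => (h1 i).symm.trans (h1' i))
    (smul_left_injective ℂ hv ((h2 v).symm.trans (h2' v)))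

theorem IsIrreducible.exists_affords (hn : n ≤ 5) (hx : Function.Injective x)
    (hx0 : ∀ i, x i ≠ 0) [IsSemisimpleRing (Q x)] (hρ : IsIrreducible ρ) :
    ∃ L : Label x, Affords ρ L := by
  have hc := conditions_of_isSemisimpleRing hn hx hx0
  have h := isBraidAlgebra_gen hn hx hx0
  have hs := (isIrreducible_iff_isSimpleModule ρ).1 hρ
  have : Nontrivial (RepSpace ρ) := hρ.1
  have := finite_Q hn hx hx0
  have : FiniteDimensional ℂ (RepSpace ρ) := Module.Finite.trans (Q x) _
  obtain ⟨ζ, hζ⟩ := exists_scalar_of_central (U := RepSpace ρ)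
    (braid_cube_central h.adjoin h.braid)
  obtain ⟨τ, rfl⟩ := IsAlgClosed.exists_pow_nat_eq ζ (n := 6) (by norm_num)
  have hτ : τ ≠ 0 := by
    rintro rfl
    obtain ⟨v, hv⟩ := exists_ne (0 : RepSpace ρ)
    have hu : IsUnit ((gen x 0 * gen x 1) ^ 3) :=
      ((isUnit_of_rootPoly' hx0 (gen_poly 0)).mul (isUnit_of_rootPoly' hx0 (gen_poly 1))).pow 3
    refine hv (hu.smul_eq_zero.1 ?_)
    rw [hζ, zero_pow (by norm_num), zero_smul]
  obtain ⟨L, hd, hm, hL⟩ := (isSimpleType h hτ hζ).exists_label hx0 hτ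
  obtain ⟨σ, h0, h1⟩ := exists_rep_label hn hx hx0 hc L
  have hp := L.isScalarPair hn hx hx0 hc
  have s' := hp.isSimpleModule L.dim_pos h0 h1
  have f' : FiniteDimensional ℂ (RepSpace σ) :=
    inferInstanceAs (FiniteDimensional ℂ (Fin L.dim → ℂ))
  obtain ⟨e⟩ := nonempty_equiv_of_typeM_eq h hτ hζ (W := RepSpace σ)
    (fun v => by rw [hp.cube_smul h0 h1 v, hL]) (fun i => by
      rw [← hm, ← L.mult_mat_g1 hx, ← h0]
      rfl)
  refine ⟨L, e.restrictScalars ℂ, fun v => ⟨?_, ?_⟩⟩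
  · refine (e.map_smul (gen x 0) v).trans ?_
    rw [RepSpace.smul_def, h0]
    rfl
  · refine (e.map_smul (gen x 1) v).trans ?_
    rw [RepSpace.smul_def, h1]
    rfl

end classification
end BraidQuotient

theorem theorem1 {n : ℕ} (hn : n ≤ 5) (x : Fin n → ℂ) (hx : Function.Injective x)
    (hx0 : ∀ i, x i ≠ 0) :
    (IsSemisimpleRing (BraidQuotient.Q x) ↔ BraidQuotient.SemisimplicityConditions x) ∧
    (IsSemisimpleRing (BraidQuotient.Q x) →
      (∀ L : BraidQuotient.Label x,
        ∃ ρ : BraidQuotient.Q x →ₐ[ℂ] Module.End ℂ (Fin L.dim → ℂ),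
          ρ (BraidQuotient.gen x 0) = Matrix.toLin' L.mat_g1 ∧
          ρ (BraidQuotient.gen x 1) = Matrix.toLin' L.mat_g2 ∧
          BraidQuotient.IsIrreducible ρ) ∧
      (∀ (V : Type*) [AddCommGroup V] [Module ℂ V]
        (ρ : BraidQuotient.Q x →ₐ[ℂ] Module.End ℂ V), BraidQuotient.IsIrreducible ρ →
          ∃! L : BraidQuotient.Label x, BraidQuotient.Affords ρ L)) := by
  refine ⟨⟨fun _ => BraidQuotient.conditions_of_isSemisimpleRing hn hx hx0,
    BraidQuotient.isSemisimpleRing_of_conditions hn hx hx0⟩, fun _ => ⟨fun L => ?_, ?_⟩⟩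
  · have hc := BraidQuotient.conditions_of_isSemisimpleRing hn hx hx0
    obtain ⟨ρ, h0, h1⟩ := BraidQuotient.exists_rep_label hn hx hx0 hc L
    exact ⟨ρ, h0, h1, (BraidQuotient.isIrreducible_iff_isSimpleModule ρ).2
      ((L.isScalarPair hn hx hx0 hc).isSimpleModule L.dim_pos h0 h1)⟩
  · intro V _ _ ρ hρ
    have hc := BraidQuotient.conditions_of_isSemisimpleRing hn hx hx0
    have := hρ.1
    obtain ⟨L, hL⟩ := hρ.exists_affords hn hx hx0
    exact ⟨L, hL, fun L' hL' => BraidQuotient.Affords.unique hn hx hx0 hc hL' hL⟩
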